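/- Let $(M,\omega)$ be a closed symplectic manifold and let $\Sigma=\mathbb{CP}^1\setminus\{p_1,p_2,p_3\}$ carry disjoint holomorphic cylindrical ends around its punctures, $\Sigma_1,\Sigma_2\cong(-\infty,0)\times S^1$ and $\Sigma_3\cong(0,\infty)\times S^1$ with coordinates $\tau+it$, $S^1=\mathbb R/\mathbb Z$ (for example the half cylinders of the minimal area metric). Let $\rho_i$ be smooth cut-off functions of $\tau$ with values in $[0,1]$, monotone in $|\tau|$, with $\rho_i=0$ for $|\tau|\le R_{i,1}$ and $\rho_i=1$ for $|\tau|\ge R_{i,2}$, where $0<R_{i,1}<R_{i,2}$. Let $H_1,H_2,H_3$ be smooth $1$-periodic Hamiltonians on $M$, with $X_{H}$ defined by $\omega(X_{H},\cdot)=dH_t$; let $J_0$ be an $\omega$-compatible almost complex structure (that is, $\omega(\cdot,J_0\cdot)$ is a Riemannian metric), and for $i=1,2,3$ let $J^{i,s}_t$, $s\in[0,1]$, $t\in S^1$, be a smooth family of $\omega$-compatible almost complex structures with $J^{i,0}_t=J_0$. Let $\widetilde J$ be the almost complex structure on $P=\Sigma\times M$ which over $\Sigma_i$ is $$\widetilde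 J(\alpha,\beta,\xi)=\bigl(-\beta,\ \alpha,\ J^{i,\rho_i(\tau)}_t(\xi-\beta\rho_i(\tau)X_{H_i})+\alpha\rho_i(\tau)X_{H_i}\bigr)$$ and which is $j\oplus J_0$ over the rest of $\Sigma$. For $i=1,2,3$ let $z_i$ be a $1$-periodic orbit of $X_{H_i}$ and $w_i:D^2\to M$ a smooth disc with $w_i(e^{2\pi it})=z_i(t)$. Suppose that there is a smooth $\widetilde J$-holomorphic section $v=(\mathrm{id},u)$ of $P\to\Sigma$ with finite energy $$\int_{\Sigma_i}|\partial_\tau u|^2\,d\tau\,dt<\infty\qquad(i=1,2,3),$$ where on $\Sigma_i$ the norm is taken with respect to $\omega(\cdot,J^{i,\rho_i(\tau)}_t\,\cdot)$, such that $u(\tau,\cdot)\to z_i$ uniformly as $\tau\to-\infty$ on $\Sigma_i$ for $i=1,2$, and as $\tau\to+\infty$ on $\Sigma_3$ for $i=3$, and such that the closed surface obtained by capping off $u$ with $w_1,w_2$ (same orientation) and $w_3$ (opposite orientation) represents zero in $H_2(M;\mathbb Z)$ modulo torsion. Write $$\mathcal A_H([z,w])=-\int_{D^2} w^*\omega-\int_0^1H(t,z(t))\,dt,\qquad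 E^+(H)=\int_0^1\max_M H_t\,dt,\qquad E^-(H)=\int_0^1-\min_M H_t\,dt .$$ If $c\in\mathbb R$ and $\mathcal A_{H_3}([z_3,w_3])\ge c$, then $$\mathcal A_{H_1}([z_1,w_1])+\mathcal A_{H_2}([z_2,w_2])\ \ge\ c-\bigl(E^+(H_1)+E^+(H_2)\bigr)-E^-(H_3).$$ -/

import Mathlib

open Set Filter Topology MeasureTheory Manifold ContDiff

noncomputable section

namespace PantsFloer

variable {E : Type*} [NormedAddCommGroup E] [NormedSpace ℝ E]
variable {M : Type} [TopologicalSpace M] [ChartedSpace E M]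

/-! ### Symplectic forms, Hamiltonians, almost complex structures -/

/-- A field of bilinear forms on the tangent spaces of `M`, read in the chart around `x₀`:
the pullback of the form under the inverse chart, at the point `y` of the chart's target. -/
def formInChart (β : ∀ x : M, TangentSpace 𝓘(ℝ, E) x →L[ℝ] TangentSpace 𝓘(ℝ, E) x →L[ℝ] ℝ)
    (x₀ : M) (y : E) : E →L[ℝ] E →L[ℝ] ℝ :=
  let D : E →L[ℝ] E :=
    mfderiv 𝓘(ℝ, E) 𝓘(ℝ, E) (chartAt E x₀).symm y
  let B : E →L[ℝ] E →L[ℝ] ℝ := β ((chartAt E x₀).symm y)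
  B.bilinearComp D D

/-- A field of endomorphisms of the tangent spaces of `M`, read in the chart around `x₀`. -/
def endoInChart (J : ∀ x : M, TangentSpace 𝓘(ℝ, E) x →L[ℝ] TangentSpace 𝓘(ℝ, E) x)
    (x₀ : M) (y : E) : E →L[ℝ] E :=
  let x : M := (chartAt E x₀).symm y
  let D : E →L[ℝ] TangentSpace 𝓘(ℝ, E) x := mfderiv 𝓘(ℝ, E) 𝓘(ℝ, E) (chartAt E x₀).symm y
  let D' : TangentSpace 𝓘(ℝ, E) x →L[ℝ] E := mfderiv 𝓘(ℝ, E) 𝓘(ℝ, E) (chartAt E x₀) x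
  D'.comp ((J x).comp D)

variable (E M) in
/-- A symplectic form on `M`: a smooth, closed, nondegenerate, alternating 2-form. -/
structure SymplecticForm where
  form : ∀ x : M, TangentSpace 𝓘(ℝ, E) x →L[ℝ] TangentSpace 𝓘(ℝ, E) x →L[ℝ] ℝ
  alternating : ∀ x v, form x v v = 0
  nondegenerate : ∀ x v, (∀ v', form x v v' = 0) → v = 0
  smooth : ∀ x₀ : M, ContDiffOn ℝ ∞ (formInChart form x₀) (chartAt E x₀).target
  /-- `dΩ = 0`, evaluated on constant vector fields of a chart. -/
  closed : ∀ x₀ : M, ∀ y ∈ (chartAt E x₀).target, ∀ a b c : E,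
    fderiv ℝ (formInChart form x₀) y a b c + fderiv ℝ (formInChart form x₀) y b c a
      + fderiv ℝ (formInChart form x₀) y c a b = 0

/-- A smooth Hamiltonian, depending 1-periodically on time. -/
structure IsPeriodicHamiltonian (E : Type*) [NormedAddCommGroup E] [NormedSpace ℝ E]
    {M : Type} [TopologicalSpace M] [ChartedSpace E M] (H : ℝ → M → ℝ) : Prop where
  smooth : ContMDiff (𝓘(ℝ, ℝ).prod 𝓘(ℝ, E)) 𝓘(ℝ, ℝ) ∞ (fun p : ℝ × M => H p.1 p.2)
  periodic : ∀ t x, H (t + 1) x = H t x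

/-- The Hamiltonian vector field `X_H` of `H`: the solution of `Ω(X_H, ·) = dH_t`. -/
def hamVF (Ω : SymplecticForm E M) (H : ℝ → M → ℝ) (t : ℝ) (x : M) : TangentSpace 𝓘(ℝ, E) x :=
  Function.invFun
    (fun v : TangentSpace 𝓘(ℝ, E) x => (Ω.form x v : TangentSpace 𝓘(ℝ, E) x →L[ℝ] ℝ))
    (mfderiv 𝓘(ℝ, E) 𝓘(ℝ, ℝ) (H t) x)

theorem hamVF_spec [FiniteDimensional ℝ E] (Ω : SymplecticForm E M) (H : ℝ → M → ℝ) (t : ℝ)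
    (x : M) (v : TangentSpace 𝓘(ℝ, E) x) :
    Ω.form x (hamVF Ω H t x) v = mfderiv 𝓘(ℝ, E) 𝓘(ℝ, ℝ) (H t) x v := by
  let L : E →L[ℝ] E →L[ℝ] ℝ := Ω.form x
  have hinj : Function.Injective (L : E →ₗ[ℝ] (E →L[ℝ] ℝ)) := by
    rw [← LinearMap.ker_eq_bot, LinearMap.ker_eq_bot']
    intro m hm
    refine Ω.nondegenerate x m fun v' => ?_
    exact congrArg (fun f : E →L[ℝ] ℝ => f v') hm
  have hdim : Module.finrank ℝ E = Module.finrank ℝ (E →L[ℝ] ℝ) := by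
    rw [← (LinearMap.toContinuousLinearMap (𝕜 := ℝ) (E := E) (F' := ℝ)).finrank_eq]
    exact (Subspace.dual_finrank_eq (K := ℝ) (V := E)).symm
  have hsurj := (LinearMap.injective_iff_surjective_of_finrank_eq_finrank hdim).1 hinj
  exact congrArg (fun f : E →L[ℝ] ℝ => f v)
    (Function.invFun_eq (hsurj (mfderiv 𝓘(ℝ, E) 𝓘(ℝ, ℝ) (H t) x)))

/-- `J` is, at every point, a complex structure on the tangent space compatible with `Ω`, that is,
`Ω(·, J ·)` is a positive definite inner product. -/
structure IsCompatible (Ω : SymplecticForm E M)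
    (J : ∀ x : M, TangentSpace 𝓘(ℝ, E) x →L[ℝ] TangentSpace 𝓘(ℝ, E) x) : Prop where
  sq : ∀ x v, J x (J x v) = -v
  symm : ∀ x v v', Ω.form x v (J x v') = Ω.form x v' (J x v)
  pos : ∀ x v, v ≠ 0 → 0 < Ω.form x v (J x v)

/-- An `Ω`-compatible (smooth) almost complex structure. -/
structure IsCompatibleACS (Ω : SymplecticForm E M)
    (J : ∀ x : M, TangentSpace 𝓘(ℝ, E) x →L[ℝ] TangentSpace 𝓘(ℝ, E) x) : Prop
    extends IsCompatible Ω J where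
  smooth : ∀ x₀ : M, ContDiffOn ℝ ∞ (endoInChart J x₀) (chartAt E x₀).target

/-- A smooth family `J s t`, `s ∈ [0,1]`, `t ∈ ℝ/ℤ`, of `Ω`-compatible almost complex structures
with `J 0 t = J₀` for all `t`; in other words a path, in the space of loops of compatible almost
complex structures, that starts at the constant loop `J₀`. -/
structure IsACSPath (Ω : SymplecticForm E M)
    (J₀ : ∀ x : M, TangentSpace 𝓘(ℝ, E) x →L[ℝ] TangentSpace 𝓘(ℝ, E) x)
    (J : ℝ → ℝ → ∀ x : M, TangentSpace 𝓘(ℝ, E) x →L[ℝ] TangentSpace 𝓘(ℝ, E) x) : Prop where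
  compatible : ∀ s ∈ Icc (0 : ℝ) 1, ∀ t, IsCompatible Ω (J s t)
  smooth : ∀ x₀ : M, ContDiffOn ℝ ∞ (fun p : ℝ × ℝ × E => endoInChart (J p.1 p.2.1) x₀ p.2.2)
    (Icc (0 : ℝ) 1 ×ˢ (univ ×ˢ (chartAt E x₀).target))
  periodic : ∀ s ∈ Icc (0 : ℝ) 1, ∀ t x, J s (t + 1) x = J s t x
  start : ∀ t x, J 0 t x = J₀ x

/-! ### Hofer-type quantities, capped orbits, and the action functional -/

/-- `E⁺(H) = ∫₀¹ max_M H_t dt`. -/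
def EPlus {M : Type} (H : ℝ → M → ℝ) : ℝ := ∫ t in (0 : ℝ)..1, ⨆ x, H t x

/-- `E⁻(H) = ∫₀¹ -min_M H_t dt`. -/
def EMinus {M : Type} (H : ℝ → M → ℝ) : ℝ := ∫ t in (0 : ℝ)..1, -(⨅ x, H t x)

/-- `z` is a smooth 1-periodic orbit of `X_H` and `w` is a smooth disc in `M` bounding it.
Only the values of `w` on the closed unit disc matter. -/
structure IsCappedOrbit (Ω : SymplecticForm E M) (H : ℝ → M → ℝ) (z : ℝ → M) (w : ℂ → M) :
    Prop where
  smooth_orbit : ContMDiff 𝓘(ℝ, ℝ) 𝓘(ℝ, E) ∞ z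
  periodic : ∀ t, z (t + 1) = z t
  orbit : ∀ t, mfderiv 𝓘(ℝ, ℝ) 𝓘(ℝ, E) z t (1 : ℝ) = hamVF Ω H t (z t)
  smooth_disc : ContMDiffOn 𝓘(ℝ, ℂ) 𝓘(ℝ, E) ∞ w (Metric.closedBall 0 1)
  boundary : ∀ t : ℝ, w (Complex.exp (2 * Real.pi * t * Complex.I)) = z t

/-- The symplectic area `∫_D w^*Ω` of a disc. -/
def discArea (Ω : SymplecticForm E M) (w : ℂ → M) : ℝ :=
  ∫ q in Metric.ball (0 : ℂ) 1,
    Ω.form (w q) (mfderiv 𝓘(ℝ, ℂ) 𝓘(ℝ, E) w q (1 : ℂ))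
      (mfderiv 𝓘(ℝ, ℂ) 𝓘(ℝ, E) w q Complex.I)

/-- The action functional `𝒜_H([z,w]) = -∫ w^*Ω - ∫₀¹ H(t, z(t)) dt`. -/
def action (Ω : SymplecticForm E M) (H : ℝ → M → ℝ) (z : ℝ → M) (w : ℂ → M) : ℝ :=
  -discArea Ω w - ∫ t in (0 : ℝ)..1, H t (z t)

/-! ### The pair of pants with its cylindrical ends -/

/-- The thrice punctured sphere `ℂP¹ ∖ {0, 1, ∞}`, as an open subset of `ℂ`. -/
def pants : Set ℂ := {0, 1}ᶜ

/-- The three punctures. -/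
def puncture : Fin 3 → OnePoint ℂ := ![((0 : ℂ) : OnePoint ℂ), ((1 : ℂ) : OnePoint ℂ), OnePoint.infty]

/-- The first two ends are modelled on `τ < 0`, the third one on `τ > 0`. -/
def endSign : Fin 3 → ℝ := ![1, 1, -1]

/-- For a point `τ + it` of the `i`-th half cylinder, the distance `|τ|` from its boundary;
it is `-τ` for the first two ends and `τ` for the third. -/
def depth (i : Fin 3) (w : ℂ) : ℝ := -(endSign i * w.re)

/-- Disjoint holomorphic half cylinders in the pair of pants, one around each puncture. The
half cylinder `{τ + it}` is `(-∞,0) × ℝ/ℤ` for the first two ends and `(0,∞) × ℝ/ℤ` for the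
third one, and `chart i` is its holomorphic embedding, as a function of `τ + it`. (The half
cylinders of the minimal area metric are an example.) -/
structure CylindricalEnds where
  chart : Fin 3 → ℂ → ℂ
  holomorphic : ∀ i, DifferentiableOn ℂ (chart i) {w | 0 < depth i w}
  mem_pants : ∀ i w, 0 < depth i w → chart i w ∈ pants
  eq_iff : ∀ i w w', 0 < depth i w → 0 < depth i w' →
    (chart i w = chart i w' ↔ ∃ n : ℤ, w' = w + n * Complex.I)
  disjoint : ∀ i j, i ≠ j → ∀ w w', 0 < depth i w → 0 < depth j w' → chart i w ≠ chart j w'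
  tendsto_puncture : ∀ i, Tendsto (fun w => (chart i w : OnePoint ℂ)) (comap (depth i) atTop)
    (𝓝 (puncture i))

/-- The point of the `i`-th end with distance `s` from the boundary and angle `t`. -/
def CylindricalEnds.point (C : CylindricalEnds) (i : Fin 3) (s t : ℝ) : ℂ :=
  C.chart i (((-(endSign i * s) : ℝ) : ℂ) + t * Complex.I)

/-- A smooth monotone cut-off function of the distance `s = |τ|` from the boundary of a half
cylinder: it is `0` for `s ≤ R₁` and `1` for `s ≥ R₂`, where `0 < R₁ < R₂`. -/
structure IsCutOff (R₁ R₂ : ℝ) (ρ : ℝ → ℝ) : Prop where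
  pos : 0 < R₁
  lt : R₁ < R₂
  smooth : ContDiff ℝ ∞ ρ
  monotone : Monotone ρ
  eq_zero : ∀ s ≤ R₁, ρ s = 0
  eq_one : ∀ s, R₂ ≤ s → ρ s = 1

/-! ### The almost complex structure on the trivial bundle, and its holomorphic sections -/

/-- `Jt` is the `H`-compatible almost complex structure on the trivial bundle `P = Σ × M`
determined by the cut-off functions `ρ i`, the Hamiltonians `H i`, the family `J i` on the `i`-th
end and `J₀`. In the cylindrical coordinates of the `i`-th end, and with `ρ = ρ i (|τ|)`,
`Jt (α, β, ξ) = (-β, α, J^{i,ρ}_t (ξ - β ρ X_{H_i}) + α ρ X_{H_i})`; off the ends (more precisely,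
off the parts of the ends where `|τ| > R₁ i`) it is `j ⊕ J₀`. -/
structure IsHCompatible (Ω : SymplecticForm E M) (C : CylindricalEnds) (R₁ : Fin 3 → ℝ)
    (ρ : Fin 3 → ℝ → ℝ) (H : Fin 3 → ℝ → M → ℝ)
    (J₀ : ∀ x : M, TangentSpace 𝓘(ℝ, E) x →L[ℝ] TangentSpace 𝓘(ℝ, E) x)
    (J : Fin 3 → ℝ → ℝ → ∀ x : M, TangentSpace 𝓘(ℝ, E) x →L[ℝ] TangentSpace 𝓘(ℝ, E) x)
    (Jt : ℂ → ∀ x : M, (ℂ × TangentSpace 𝓘(ℝ, E) x) →L[ℝ] (ℂ × TangentSpace 𝓘(ℝ, E) x)) :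
    Prop where
  on_end : ∀ i w, 0 < depth i w → ∀ (x : M) (α β : ℝ) (ξ : TangentSpace 𝓘(ℝ, E) x),
    Jt (C.chart i w) x (deriv (C.chart i) w * (α + β * Complex.I), ξ) =
      (deriv (C.chart i) w * (-β + α * Complex.I),
        J i (ρ i (depth i w)) w.im x (ξ - (β * ρ i (depth i w)) • hamVF Ω (H i) w.im x)
          + (α * ρ i (depth i w)) • hamVF Ω (H i) w.im x)
  on_center : ∀ z ∈ pants, (∀ i w, R₁ i < depth i w → C.chart i w ≠ z) →
    ∀ (x : M) (a : ℂ) (ξ : TangentSpace 𝓘(ℝ, E) x), Jt z x (a, ξ) = (Complex.I * a, J₀ x ξ)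

/-- The section `z ↦ (z, u z)` of `Σ × M` is smooth and `Jt`-holomorphic: its differential
intertwines the complex structure of `Σ` with `Jt`. -/
structure IsHolomorphicSection
    (Jt : ℂ → ∀ x : M, (ℂ × TangentSpace 𝓘(ℝ, E) x) →L[ℝ] (ℂ × TangentSpace 𝓘(ℝ, E) x))
    (u : ℂ → M) : Prop where
  smooth : ContMDiffOn 𝓘(ℝ, ℂ) 𝓘(ℝ, E) ∞ u pants
  holomorphic : ∀ z ∈ pants, ∀ a : ℂ,
    Jt z (u z) (a, mfderiv 𝓘(ℝ, ℂ) 𝓘(ℝ, E) u z a) =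
      (Complex.I * a, mfderiv 𝓘(ℝ, ℂ) 𝓘(ℝ, E) u z (Complex.I * a))

/-- The energy density `|∂u/∂τ|²` of the section on the `i`-th end, with respect to the metric
`Ω(·, J^{i,ρ}_t ·)`, at distance `s` from the boundary and angle `t`. It is the density of half
the squared norm of the vertical part of the differential of the section. -/
def energyDensity (Ω : SymplecticForm E M) (C : CylindricalEnds) (ρ : Fin 3 → ℝ → ℝ)
    (J : Fin 3 → ℝ → ℝ → ∀ x : M, TangentSpace 𝓘(ℝ, E) x →L[ℝ] TangentSpace 𝓘(ℝ, E) x)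
    (u : ℂ → M) (i : Fin 3) (s t : ℝ) : ℝ :=
  let a : ℂ := deriv (C.chart i) (((-(endSign i * s) : ℝ) : ℂ) + t * Complex.I)
  let ξ : TangentSpace 𝓘(ℝ, E) (u (C.point i s t)) :=
    mfderiv 𝓘(ℝ, ℂ) 𝓘(ℝ, E) u (C.point i s t) a
  Ω.form (u (C.point i s t)) ξ (J i (ρ i s) t (u (C.point i s t)) ξ)

/-- The section has finite (vertical) energy. The complement of the ends is relatively compact
in the pair of pants and always contributes a finite amount. -/
def HasFiniteEnergy (Ω : SymplecticForm E M) (C : CylindricalEnds) (ρ : Fin 3 → ℝ → ℝ)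
    (J : Fin 3 → ℝ → ℝ → ∀ x : M, TangentSpace 𝓘(ℝ, E) x →L[ℝ] TangentSpace 𝓘(ℝ, E) x)
    (u : ℂ → M) : Prop :=
  ∀ i, IntegrableOn (fun p : ℝ × ℝ => energyDensity Ω C ρ J u i p.1 p.2)
    (Ioi (0 : ℝ) ×ˢ Ioc (0 : ℝ) 1)

/-- `u` converges on the `i`-th end to the loop `z i`, uniformly in `t`. (Uniform convergence to
a continuous loop is spelled out as continuous convergence, so that no metric is needed.) -/
def IsAsymptotic (C : CylindricalEnds) (z : Fin 3 → ℝ → M) (u : ℂ → M) : Prop :=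
  ∀ i, ∀ t₀ : ℝ, Tendsto (fun p : ℝ × ℝ => u (C.point i p.1 p.2)) (atTop ×ˢ 𝓝 t₀) (𝓝 (z i t₀))

/-- `S` is the closed surface `u # (w₀ ∪ w₁ ∪ w₂)`, parametrized by the Riemann sphere: the half
cylinder `1 ≤ s < ∞` of the `i`-th end is compressed to `1 ≤ s < 2`, and the disc `w i` is put on
`2 ≤ s ≤ ∞`. As the angle `t` turns positively around the first two punctures and negatively
around the third, `w 0` and `w 1` are attached with the same orientation, and `w 2` with the
opposite one. -/
structure IsCapping (C : CylindricalEnds) (w : Fin 3 → ℂ → M) (u : ℂ → M) (S : OnePoint ℂ → M) :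
    Prop where
  center : ∀ q ∈ pants, (∀ i p, 1 < depth i p → C.chart i p ≠ q) → S q = u q
  neck : ∀ i (s t : ℝ), 1 ≤ s → s < 2 → S (C.point i s t) = u (C.point i (1 / (2 - s)) t)
  cap : ∀ i (s t : ℝ), 2 ≤ s →
    S (C.point i s t) = w i (2 / s * Complex.exp (2 * Real.pi * t * Complex.I))
  pole : ∀ i, S (puncture i) = w i 0

/-- The spherical class represented by `S : S² → M` is zero in `H₂(M; ℤ)` modulo torsion:
the map induced by `S` sends `H₂(S²; ℤ)` to torsion elements of `H₂(M; ℤ)`. -/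
def IsZeroModTorsion {M : Type} [TopologicalSpace M] (S : C(OnePoint ℂ, M)) : Prop :=
  ∀ a : ((AlgebraicTopology.singularHomologyFunctor (ModuleCat.{0} ℤ) 2).obj
      (ModuleCat.of ℤ ℤ)).obj (TopCat.of (OnePoint ℂ)),
    IsOfFinAddOrder ((((AlgebraicTopology.singularHomologyFunctor (ModuleCat.{0} ℤ) 2).obj
      (ModuleCat.of ℤ ℤ)).map (TopCat.ofHom S)).hom a)

/-- The moduli space `ℳ(H, Jt; ẑ)`, `ẑ i = [z i, w i]`: smooth finite energy `Jt`-holomorphic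
sections, asymptotic to `z i` on the `i`-th end, such that the closed surface obtained by capping
off with the discs `w i` represents zero in `H₂(M; ℤ)` modulo torsion. -/
structure IsPantsSection (Ω : SymplecticForm E M) (C : CylindricalEnds) (ρ : Fin 3 → ℝ → ℝ)
    (J : Fin 3 → ℝ → ℝ → ∀ x : M, TangentSpace 𝓘(ℝ, E) x →L[ℝ] TangentSpace 𝓘(ℝ, E) x)
    (Jt : ℂ → ∀ x : M, (ℂ × TangentSpace 𝓘(ℝ, E) x) →L[ℝ] (ℂ × TangentSpace 𝓘(ℝ, E) x))
    (z : Fin 3 → ℝ → M) (w : Fin 3 → ℂ → M) (u : ℂ → M) : Prop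
    extends IsHolomorphicSection Jt u where
  finite_energy : HasFiniteEnergy Ω C ρ J u
  asymptotic : IsAsymptotic C z u
  null : ∃ S : C(OnePoint ℂ, M), IsCapping C w u S ∧ IsZeroModTorsion S

end PantsFloer

end

/-! On an end the holomorphic equation reads `∂_t u = J ∂_τ u + ρ X_H`, so the pullback of the
symplectic form has density `|∂_τ u|² - ρ dH(∂_τ u)`. Off the ends the density is a squared norm.
Discard the energies and integrate the Hamiltonian term by parts along each ray: the derivative of
the cut-off is nonnegative with total mass one, so it averages `H` and is controlled by its maximum
or minimum. This bounds the area of `u` over the pair of pants, truncated at depth `L`, from below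
by `∫H 0 + ∫H 1 - ∫H 2` over the boundary loops, minus `E⁺(H 0) + E⁺(H 1) + E⁻(H 2)`
(`IsHolomorphicSection.energy_inequality`). As `L` grows, the loop integrals converge to those of
the orbits. A closed form integrates to zero over a torsion class, so the area tends to `∫(w 2)^*Ω -
∫(w 0)^*Ω - ∫(w 1)^*Ω`. Together these give the action inequality.

Three points need care.

The capping sphere is merely continuous, so the symplectic form cannot be integrated over it
directly. It is replaced by a cochain that depends only on the vertices of small simplices: with
local potentials `lam v`, there are functions `I v` of two points, morally the integral of `lam v`
minus a reference potential chosen at the initial point, whose coboundary `f` does not depend on `v`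
(`exists_localPotentials`). Barycentric subdivision shows that `f` vanishes on cycles of small
simplices that bound up to torsion (`IsLocalCoboundary.eq_zero_of_smul_eq_boundary`). On smooth
rectangles `f` is the area up to edge terms (`LocalPotentials.rectValue_eq`). On a neck it is
combined with the edge terms of the adjacent annulus and disc, and what remains is line integrals
along the two sides and terms at the two ends (`LocalPotentials.pathDefect_sub_add_neck`).

Uniform convergence of the loops does not control their derivatives. Finite energy provides
arbitrarily deep loops that have energy at most one on all three ends at once
(`HasFiniteEnergy.frequently`). Their lengths are bounded in charts, and line integrals along
uniformly convergent paths of bounded length converge (`tendsto_integral_clm`), so the two sides of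
a neck cancel in the limit.

The pair of pants is swept out by four linear homotopies, called sectors. Two of them join circles
of radius `1/2` around `0` and `1` to deep loops at these punctures. The other two join the figure
eight formed by the same circles to a deep loop at infinity. These homotopies need not be injective,
but Green's theorem compares their signed areas with honest integrals over the plane
(`CylindricalEnds.IsDeep.sum_endArea_le`). -/

set_option maxSynthPendingDepth 3

noncomputable section

namespace PantsFloer
/-! ### Singular chains -/

section SingularChains

open CategoryTheory Opposite Simplicial

/-- The singular chain complex of a space with integral coefficients. -/
abbrev singChains (X : Type) [TopologicalSpace X] : ChainComplex (ModuleCat.{0} ℤ) ℕ :=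
  ((AlgebraicTopology.singularChainComplexFunctor (ModuleCat.{0} ℤ)).obj (ModuleCat.of ℤ ℤ)).obj
    (TopCat.of X)

variable {X Y : Type} [TopologicalSpace X] [TopologicalSpace Y]

/-- The chain given by one singular simplex. -/
def singSimplex {n : ℕ} (σ : C(stdSimplex ℝ (Fin (n + 1)), X)) : (singChains X).X n :=
  ((TopCat.toSSet.obj (TopCat.of X)).ιChainComplex (R := ModuleCat.of ℤ ℤ)
    ((TopCat.toSSetObjEquiv (TopCat.of X) (op ⦋n⦌)).symm σ)).hom (1 : ℤ)

/-- The map on singular chains induced by a continuous map. -/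
abbrev singMap (f : C(X, Y)) : singChains X ⟶ singChains Y :=
  ((AlgebraicTopology.singularChainComplexFunctor (ModuleCat.{0} ℤ)).obj (ModuleCat.of ℤ ℤ)).map
    (TopCat.ofHom f)

/-- The inclusion of the `i`-th face of the standard simplex. -/
def faceMap {n : ℕ} (i : Fin (n + 2)) : C(stdSimplex ℝ (Fin (n + 1)), stdSimplex ℝ (Fin (n + 2))) :=
  ⟨stdSimplex.map i.succAbove, stdSimplex.continuous_map _⟩

theorem singChains_d_singSimplex {n : ℕ} (σ : C(stdSimplex ℝ (Fin (n + 2)), X)) :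
    ((singChains X).d (n + 1) n).hom (singSimplex σ) =
      ∑ i : Fin (n + 2), (-1 : ℤ) ^ (i : ℕ) • singSimplex (σ.comp (faceMap i)) := by
  have h := SSet.ιChainComplex_d (TopCat.toSSet.obj (TopCat.of X)) (R := ModuleCat.of ℤ ℤ)
    ((TopCat.toSSetObjEquiv (TopCat.of X) (op ⦋n + 1⦌)).symm σ)
  have h2 := congrArg (fun g => g.hom (1 : ℤ)) h
  refine h2.trans ?_
  simp only [ModuleCat.hom_sum, LinearMap.sum_apply]
  refine Finset.sum_congr rfl fun i _ => ?_
  rfl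

theorem singMap_singSimplex {n : ℕ} (f : C(X, Y)) (σ : C(stdSimplex ℝ (Fin (n + 1)), X)) :
    ((singMap f).f n).hom (singSimplex σ) = singSimplex (f.comp σ) := by
  have h := SSet.ι_chainComplexMap_f (f := TopCat.toSSet.map (TopCat.ofHom f)) (R := ModuleCat.of ℤ ℤ)
    (x := (TopCat.toSSetObjEquiv (TopCat.of X) (op ⦋n⦌)).symm σ)
  exact congrArg (fun g => g.hom (1 : ℤ)) h

theorem singChains_hom_ext {n : ℕ} {A : Type} [AddCommGroup A] [Module ℤ A]
    {f g : (singChains X).X n →ₗ[ℤ] A} (h : ∀ σ, f (singSimplex σ) = g (singSimplex σ)) : f = g := by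
  have : ModuleCat.ofHom f = ModuleCat.ofHom g := by
    refine SSet.chainComplex_hom_ext (X := TopCat.toSSet.obj (TopCat.of X))
      (R := ModuleCat.of ℤ ℤ) (T := ModuleCat.of ℤ A) fun x => ?_
    ext
    have := h (TopCat.toSSetObjEquiv (TopCat.of X) (op ⦋n⦌) x)
    simp only [singSimplex, Equiv.symm_apply_apply] at this
    exact this
  exact congrArg ModuleCat.Hom.hom this

/-- The cochain with given values on singular simplices. -/
theorem exists_cochain {n : ℕ} {A : Type} [AddCommGroup A]
    (φ : C(stdSimplex ℝ (Fin (n + 1)), X) → A) :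
    ∃ L : (singChains X).X n →ₗ[ℤ] A, ∀ σ, L (singSimplex σ) = φ σ := by
  let D : (singChains X).X n ⟶ ModuleCat.of ℤ A :=
    Limits.Sigma.desc (f := fun _ : (TopCat.toSSet.obj (TopCat.of X)) _⦋n⦌ => ModuleCat.of ℤ ℤ)
      fun x => ModuleCat.ofHom (LinearMap.toSpanSingleton ℤ A
        (φ (TopCat.toSSetObjEquiv (TopCat.of X) (op ⦋n⦌) x)))
  refine ⟨D.hom, fun σ => ?_⟩
  have h := Limits.Sigma.ι_desc (f := fun _ : (TopCat.toSSet.obj (TopCat.of X)) _⦋n⦌ =>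
    ModuleCat.of ℤ ℤ) (fun x => ModuleCat.ofHom (LinearMap.toSpanSingleton ℤ A
        (φ (TopCat.toSSetObjEquiv (TopCat.of X) (op ⦋n⦌) x))))
    ((TopCat.toSSetObjEquiv (TopCat.of X) (op ⦋n⦌)).symm σ)
  have h2 := congrArg (fun g => g.hom (1 : ℤ)) h
  refine h2.trans ?_
  simp

/-- The projection to the quotient by `P` kills all generators, hence is zero. This serves for
properties that hold eventually in a parameter, where the threshold depends on the chain. -/
theorem singChains_induction {n : ℕ} (P : AddSubgroup ((singChains X).X n))
    (h : ∀ σ, singSimplex σ ∈ P) (c : (singChains X).X n) : c ∈ P := by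
  let N : Submodule ℤ ((singChains X).X n) :=
    { P with
      smul_mem' := by
        intro k x hx
        have h := P.zsmul_mem hx k
        rwa [← int_smul_eq_zsmul inferInstance k x] at h }
  have : N.mkQ = 0 := by
    refine @singChains_hom_ext X _ n (_ ⧸ N) _ (Submodule.Quotient.module N) N.mkQ 0 fun σ => ?_
    have : singSimplex σ ∈ N := h σ
    simpa using this
  have h2 : N.mkQ c = 0 := by rw [this]; rfl
  have h3 : c ∈ N := by simpa using h2
  exact h3

/-- Torsion in homology is turned into an equation between chains: a multiple of the image of the
cycle has zero class, and exactness at the cycles produces a chain that it bounds. -/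
theorem exists_boundary_of_isOfFinAddOrder {K L : ChainComplex (ModuleCat.{0} ℤ) ℕ} (f : K ⟶ L)
    (n : ℕ) (a : K.X (n + 1)) (ha : (K.d (n + 1) n).hom a = 0)
    (h : ∀ x : K.homology (n + 1),
      IsOfFinAddOrder ((HomologicalComplex.homologyMap f (n + 1)).hom x)) :
    ∃ k : ℕ, 0 < k ∧ ∃ c : L.X (n + 2), (L.d (n + 2) (n + 1)).hom c = k • (f.f (n + 1)).hom a := by
  -- An element is the same as a morphism out of `ℤ`; in this form the cycle can be lifted to the
  -- object of cycles.
  let α : ModuleCat.of ℤ ℤ ⟶ K.X (n + 1) := ModuleCat.ofHom (LinearMap.toSpanSingleton ℤ _ a)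
  have hα1 : α.hom (1 : ℤ) = a := by
    simp only [α, ModuleCat.hom_ofHom, LinearMap.toSpanSingleton_apply]
    exact (int_smul_eq_zsmul (K.X (n + 1)).isModule 1 a).trans (one_zsmul a)
  have hα : α ≫ K.d (n + 1) n = 0 := by
    ext
    refine (congrArg (K.d (n + 1) n).hom hα1).trans ha
  let z := K.liftCycles α n (by simp) hα
  obtain ⟨k, hk, hk'⟩ := isOfFinAddOrder_iff_nsmul_eq_zero.1
    (h ((K.homologyπ (n + 1)).hom (z.hom (1 : ℤ))))
  refine ⟨k, hk, ?_⟩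
  let y : L.cycles (n + 1) := (HomologicalComplex.cyclesMap f (n + 1)).hom (z.hom (1 : ℤ))
  have hy : (L.homologyπ (n + 1)).hom (k • y) = 0 := by
    rw [map_nsmul, ← hk']
    congr 1
    have := congrArg (fun g => g.hom (z.hom (1 : ℤ)))
      (HomologicalComplex.homologyπ_naturality f (n + 1))
    exact this.symm
  -- Homology is the cokernel of the map from chains to cycles, so a cycle with zero class comes
  -- from a chain.
  have hex := (ShortComplex.exact_of_g_is_cokernel
    (ShortComplex.mk (L.toCycles (n + 2) (n + 1)) (L.homologyπ (n + 1)) (by simp))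
      (L.homologyIsCokernel (n + 2) (n + 1) (by simp)))
  obtain ⟨c, hc⟩ := (ShortComplex.moduleCat_exact_iff _).1 hex (k • y) hy
  refine ⟨c, ?_⟩
  have h1 : (L.iCycles (n + 1)).hom ((L.toCycles (n + 2) (n + 1)).hom c) =
      (L.d (n + 2) (n + 1)).hom c :=
    congrArg (fun g => g.hom c) (L.toCycles_i (n + 2) (n + 1))
  rw [← h1]
  refine (congrArg (L.iCycles (n + 1)).hom hc).trans ?_
  rw [map_nsmul]
  congr 1
  have h2 := congrArg (fun g => g.hom (z.hom (1 : ℤ))) (HomologicalComplex.cyclesMap_i f (n + 1))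
  refine h2.trans ?_
  have h3 := congrArg (fun g => g.hom (1 : ℤ)) (K.liftCycles_i α n (by simp) hα)
  refine (congrArg (f.f (n + 1)).hom h3).trans ?_
  exact congrArg (f.f (n + 1)).hom hα1

theorem IsZeroModTorsion.exists_boundary {S : C(OnePoint ℂ, X)} (hS : IsZeroModTorsion S)
    (a : (singChains (OnePoint ℂ)).X 2) (ha : ((singChains (OnePoint ℂ)).d 2 1).hom a = 0) :
    ∃ k : ℕ, 0 < k ∧ ∃ c : (singChains X).X 3,
      ((singChains X).d 3 2).hom c = k • ((singMap S).f 2).hom a :=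
  exists_boundary_of_isOfFinAddOrder (singMap S) 1 a ha hS

end SingularChains

/-! ### Barycentric subdivision of affine chains -/

section AffineChains

/-- Formal integral combinations of lists of points, thought of as affine simplices. -/
abbrev AffChain (V : Type*) := List V →₀ ℤ

variable {V W : Type*}

/-- The cone over an affine chain. -/
def affCone (b : V) : AffChain V →ₗ[ℤ] AffChain V := Finsupp.lmapDomain ℤ ℤ (List.cons b)

/-- The boundary of an affine simplex (augmented in dimension `0`). -/
def affBdList : List V → AffChain V
  | [] => 0
  | v :: l => Finsupp.single l 1 - affCone v (affBdList l)

/-- The boundary of affine chains. -/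
def affBd : AffChain V →ₗ[ℤ] AffChain V := Finsupp.linearCombination ℤ affBdList

@[simp] theorem affCone_single (b : V) (l : List V) (k : ℤ) :
    affCone b (Finsupp.single l k) = Finsupp.single (b :: l) k := by
  simp [affCone]

@[simp] theorem affBd_single (l : List V) : affBd (Finsupp.single l 1) = affBdList l := by
  simp [affBd]

theorem affChain_hom_ext {A : Type*} [AddCommGroup A] {f g : AffChain V →ₗ[ℤ] A}
    (h : ∀ l, f (Finsupp.single l 1) = g (Finsupp.single l 1)) : f = g := by
  ext l
  simpa using h l

/-- The boundary of a cone is its base minus the cone over the boundary of the base. As the empty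
list counts as a simplex of dimension `-1`, points are no exception. -/
theorem affBd_affCone (b : V) (c : AffChain V) :
    affBd (affCone b c) = c - affCone b (affBd c) := by
  have : affBd ∘ₗ affCone b = LinearMap.id - affCone b ∘ₗ affBd :=
    affChain_hom_ext fun l => by simp [affBdList]
  exact congrArg (fun f => f c) this

theorem affBd_affBdList (l : List V) : affBd (affBdList l) = 0 := by
  induction l with
  | nil => simp [affBdList]
  | cons v l ih => simp [affBdList, affBd_affCone, ih]

/-- The map induced by a map of point sets. -/
def affPush (g : V → W) : AffChain V →ₗ[ℤ] AffChain W := Finsupp.lmapDomain ℤ ℤ (List.map g)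

@[simp] theorem affPush_single (g : V → W) (l : List V) (k : ℤ) :
    affPush g (Finsupp.single l k) = Finsupp.single (l.map g) k := by
  simp [affPush]

theorem affPush_affCone (g : V → W) (b : V) (c : AffChain V) :
    affPush g (affCone b c) = affCone (g b) (affPush g c) := by
  have : affPush g ∘ₗ affCone b = affCone (g b) ∘ₗ affPush g :=
    affChain_hom_ext fun l => by simp
  exact congrArg (fun f => f c) this

theorem affPush_affBdList (g : V → W) (l : List V) :
    affPush g (affBdList l) = affBdList (l.map g) := by
  induction l with
  | nil => simp [affBdList]
  | cons v l ih => simp [affBdList, affPush_affCone, ih]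

theorem affPush_affBd (g : V → W) (c : AffChain V) :
    affPush g (affBd c) = affBd (affPush g c) := by
  have : affPush g ∘ₗ affBd = affBd ∘ₗ affPush g :=
    affChain_hom_ext fun l => by simp [affPush_affBdList]
  exact congrArg (fun f => f c) this

/-- The barycenter of a list of points. -/
def affBary [AddCommGroup V] [Module ℝ V] (l : List V) : V := (l.length : ℝ)⁻¹ • l.sum

/-- Barycentric subdivision of simplices with `m` vertices. -/
def affSd [AddCommGroup V] [Module ℝ V] : ℕ → AffChain V →ₗ[ℤ] AffChain V
  | 0 => LinearMap.id
  | m + 1 => Finsupp.linearCombination ℤ fun l => affCone (affBary l) (affSd m (affBdList l))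

/-! ### Barycentric subdivision as a natural chain map. -/

section Module

variable [AddCommGroup V] [Module ℝ V] [AddCommGroup W] [Module ℝ W]

@[simp] theorem affSd_succ_single (m : ℕ) (l : List V) :
    affSd (m + 1) (Finsupp.single l 1) = affCone (affBary l) (affSd m (affBdList l)) := by
  simp [affSd]

/-- Subdivision is indexed by the number of vertices, hence the shift of the index. The induction is
the cone formula: the boundary of the cone over the subdivided boundary is that subdivided boundary
minus the cone over its boundary, which vanishes since `∂∂ = 0`. -/
theorem affBd_affSd (m : ℕ) (c : AffChain V) : affBd (affSd (m + 1) c) = affSd m (affBd c) := by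
  suffices affBd ∘ₗ affSd (m + 1) = (affSd m ∘ₗ affBd : AffChain V →ₗ[ℤ] AffChain V) from
    congrArg (fun f => f c) this
  induction m with
  | zero => exact affChain_hom_ext fun l => by simp [affSd, affBd_affCone, affBd_affBdList]
  | succ m ih =>
    refine affChain_hom_ext fun l => ?_
    have := congrArg (fun f => f (affBdList l)) ih
    simp only [LinearMap.comp_apply] at this
    rw [LinearMap.comp_apply, LinearMap.comp_apply, affSd_succ_single, affBd_affCone, this,
      affBd_affBdList, affBd_single]
    simp

theorem affBd_affSd_iterate (m n : ℕ) (c : AffChain V) :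
    affBd ((affSd (m + 1))^[n] c) = (affSd m)^[n] (affBd c) := by
  induction n generalizing c with
  | zero => rfl
  | succ n ih => rw [Function.iterate_succ_apply, Function.iterate_succ_apply, ih, affBd_affSd]

theorem affBary_map (g : V →ₗ[ℝ] W) (l : List V) : affBary (l.map g) = g (affBary l) := by
  simp [affBary, map_list_sum]

theorem affPush_affSd (g : V →ₗ[ℝ] W) (m : ℕ) (c : AffChain V) :
    affPush g (affSd m c) = affSd m (affPush g c) := by
  suffices affPush g ∘ₗ affSd m = affSd m ∘ₗ affPush g from congrArg (fun f => f c) this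
  induction m with
  | zero => rfl
  | succ m ih =>
    refine affChain_hom_ext fun l => ?_
    have := congrArg (fun f => f (affBdList l)) ih
    simp only [LinearMap.comp_apply] at this
    simp [affPush_affCone, this, affBary_map, affPush_affBdList]

theorem affPush_affSd_iterate (g : V →ₗ[ℝ] W) (m n : ℕ) (c : AffChain V) :
    affPush g ((affSd m)^[n] c) = (affSd m)^[n] (affPush g c) := by
  induction n generalizing c with
  | zero => rfl
  | succ n ih => rw [Function.iterate_succ_apply, Function.iterate_succ_apply, ih, affPush_affSd]

end Module

/-- Lists of `m` points of `K` with mutual distances at most `r`. -/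
def smallLists [PseudoMetricSpace V] (m : ℕ) (K : Set V) (r : ℝ) : Set (List V) :=
  {l | l.length = m ∧ (∀ x ∈ l, x ∈ K) ∧ ∀ x ∈ l, ∀ y ∈ l, dist x y ≤ r}

theorem affPush_congr {g g' : V → W} {s : Set (List V)} (h : ∀ l ∈ s, ∀ x ∈ l, g x = g' x)
    {c : AffChain V} (hc : c ∈ Finsupp.supported ℤ ℤ s) : affPush g c = affPush g' c := by
  rw [Finsupp.supported_eq_span_single] at hc
  refine LinearMap.eqOn_span (s := (fun i => Finsupp.single i (1 : ℤ)) '' s) ?_ hc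
  rintro _ ⟨l, hl, rfl⟩
  simp only [affPush_single]
  rw [List.map_congr_left (h l hl)]

theorem affPush_mem_supported (g : V → W) {s : Set (List V)} {t : Set (List W)}
    (h : ∀ l ∈ s, l.map g ∈ t) {c : AffChain V} (hc : c ∈ Finsupp.supported ℤ ℤ s) :
    affPush g c ∈ Finsupp.supported ℤ ℤ t := by
  rw [Finsupp.supported_eq_span_single] at hc
  refine (Submodule.span_le (p := (Finsupp.supported ℤ ℤ t).comap (affPush g))).2 ?_ hc
  rintro _ ⟨l, hl, rfl⟩
  simpa using Finsupp.single_mem_supported ℤ 1 (h l hl)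

theorem affCone_mem_supported (b : V) {s t : Set (List V)}
    (h : ∀ l ∈ s, b :: l ∈ t) {c : AffChain V} (hc : c ∈ Finsupp.supported ℤ ℤ s) :
    affCone b c ∈ Finsupp.supported ℤ ℤ t := by
  rw [Finsupp.supported_eq_span_single] at hc
  refine (Submodule.span_le (p := (Finsupp.supported ℤ ℤ t).comap (affCone b))).2 ?_ hc
  rintro _ ⟨l, hl, rfl⟩
  simpa using Finsupp.single_mem_supported ℤ 1 (h l hl)

theorem affBdList_mem_supported (l : List V) :
    affBdList l ∈ Finsupp.supported ℤ ℤ {l' | l'.length + 1 = l.length ∧ l' ⊆ l} := by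
  induction l with
  | nil => simp [affBdList]
  | cons v l ih =>
    refine Submodule.sub_mem _ (Finsupp.single_mem_supported ℤ 1 (by simp)) ?_
    refine affCone_mem_supported v (fun l' hl' => ?_) ih
    refine ⟨by simpa using hl'.1, ?_⟩
    exact List.cons_subset_cons v hl'.2

variable [NormedAddCommGroup V] [NormedSpace ℝ V]

theorem affBary_mem_convexHull {l : List V} (hl : l ≠ []) :
    affBary l ∈ convexHull ℝ {x | x ∈ l} := by
  have hpos : (0 : ℝ) < l.length := by
    exact_mod_cast List.length_pos_iff.2 hl
  have hsum : l.sum = ∑ i : Fin l.length, l.get i := by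
    rw [← List.sum_ofFn]; simp
  rw [affBary, hsum, Finset.smul_sum]
  refine (convex_convexHull ℝ _).sum_mem (fun _ _ => by positivity) ?_ ?_
  · simp [hpos.ne']
  · intro i _
    exact subset_convexHull ℝ _ (List.get_mem l i)

/-- The distance to the barycenter is convex, so its maximum is at a vertex. The difference of a
vertex and the barycenter is the mean of the differences of vertices, one of which is zero; this
gives the factor `1 - 1/n`. -/
theorem dist_affBary_le {l : List V} {r : ℝ} (h : ∀ x ∈ l, ∀ y ∈ l, dist x y ≤ r) {x : V}
    (hx : x ∈ convexHull ℝ {x | x ∈ l}) :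
    dist x (affBary l) ≤ (1 - (l.length : ℝ)⁻¹) * r := by
  have hne : l ≠ [] := by
    rintro rfl
    simp at hx
  have hpos : (0 : ℝ) < l.length := by
    exact_mod_cast List.length_pos_iff.2 hne
  obtain ⟨y, hy, hxy⟩ := (convexOn_dist (affBary l) (convex_convexHull ℝ {x | x ∈ l})).exists_ge_of_mem_convexHull
    (subset_convexHull ℝ _) hx
  refine hxy.trans ?_
  have hsum : l.sum = ∑ i : Fin l.length, l.get i := by
    rw [← List.sum_ofFn]; simp
  obtain ⟨i, hi⟩ := List.get_of_mem hy
  -- The omitted index is that of `y` itself, whose difference vanishes.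
  have : y - affBary l = (l.length : ℝ)⁻¹ • ∑ j ∈ Finset.univ.erase i, (y - l.get j) := by
    rw [affBary, hsum]
    have h1 : ∑ j ∈ Finset.univ.erase i, (y - l.get j) = ∑ j, (y - l.get j) := by
      rw [← Finset.add_sum_erase _ _ (Finset.mem_univ i), hi]
      simp
    rw [h1, Finset.sum_sub_distrib, smul_sub]
    simp [← Nat.cast_smul_eq_nsmul ℝ, smul_smul, inv_mul_cancel₀ hpos.ne']
  rw [dist_eq_norm, this, norm_smul, norm_inv, Real.norm_natCast]
  have h2 : ‖∑ j ∈ Finset.univ.erase i, (y - l.get j)‖ ≤ (l.length - 1) * r := by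
    refine (norm_sum_le_of_le _ (f := fun j => y - l.get j) (n := fun _ => r) fun j _ => ?_).trans ?_
    · rw [← dist_eq_norm]
      exact h _ hy _ (List.get_mem l j)
    · simp [Finset.card_erase_of_mem, Nat.cast_sub (List.length_pos_iff.2 hne)]
  calc (l.length : ℝ)⁻¹ * ‖_‖ ≤ (l.length : ℝ)⁻¹ * ((l.length - 1) * r) := by gcongr
    _ = _ := by field_simp

/-- An edge of the subdivision either lies in a subdivided face, where induction applies, or joins
the barycenter to a point of the hull. The bound `D` on the number of vertices makes the contraction
factor the same in all dimensions of the induction. -/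
theorem affSd_single_mem_supported {D m : ℕ} (hm : m ≤ D) {r : ℝ} (hr : 0 ≤ r) {l : List V}
    (hl : l.length = m) (h : ∀ x ∈ l, ∀ y ∈ l, dist x y ≤ r) :
    affSd m (Finsupp.single l 1) ∈ Finsupp.supported ℤ ℤ
      (smallLists m (convexHull ℝ {x | x ∈ l}) ((1 - (D : ℝ)⁻¹) * r)) := by
  induction m generalizing l with
  | zero =>
    refine Finsupp.single_mem_supported ℤ 1 ⟨hl, ?_⟩
    obtain rfl := List.length_eq_zero_iff.1 hl
    simp
  | succ m ih =>
    rw [affSd_succ_single]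
    have hne : l ≠ [] := by rintro rfl; simp at hl
    have h1 : affSd m (affBdList l) ∈ Finsupp.supported ℤ ℤ
        (smallLists m (convexHull ℝ {x | x ∈ l}) ((1 - (D : ℝ)⁻¹) * r)) := by
      have h2 := affBdList_mem_supported l
      rw [Finsupp.supported_eq_span_single] at h2
      refine (Submodule.span_le (p := (Finsupp.supported ℤ ℤ
        (smallLists m (convexHull ℝ {x | x ∈ l}) ((1 - (D : ℝ)⁻¹) * r))).comap (affSd m))).2 ?_ h2
      rintro _ ⟨l', ⟨hl', hsub⟩, rfl⟩
      refine Finsupp.supported_mono ?_ (ih (by omega) (l := l') (by omega)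
        fun x hx y hy => h x (hsub hx) y (hsub hy))
      rintro l'' ⟨h1, h2, h3⟩
      exact ⟨h1, fun x hx => convexHull_mono (fun y hy => hsub hy) (h2 x hx), h3⟩
    refine affCone_mem_supported _ ?_ h1
    rintro l' ⟨hl', hK, hd⟩
    have hD : (1 - (l.length : ℝ)⁻¹) * r ≤ (1 - (D : ℝ)⁻¹) * r := by
      have : (l.length : ℝ) ≤ D := by rw [hl]; exact_mod_cast hm
      have h0 : (0 : ℝ) < l.length := by exact_mod_cast List.length_pos_iff.2 hne
      gcongr
    have hb := affBary_mem_convexHull hne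
    have hbx : ∀ x ∈ l', dist x (affBary l) ≤ (1 - (D : ℝ)⁻¹) * r := fun x hx =>
      (dist_affBary_le h (hK x hx)).trans hD
    have h0 : 0 ≤ (1 - (D : ℝ)⁻¹) * r := by
      refine mul_nonneg ?_ hr
      have : (1 : ℝ) ≤ D := by exact_mod_cast (by omega : 1 ≤ D)
      linarith [inv_le_one_of_one_le₀ this]
    refine ⟨by simp [hl'], ?_, ?_⟩
    · intro x hx
      rcases List.mem_cons.1 hx with rfl | hx
      exacts [hb, hK x hx]
    · intro x hx y hy
      rcases List.mem_cons.1 hx with rfl | hx <;> rcases List.mem_cons.1 hy with rfl | hy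
      · simpa using h0
      · rw [dist_comm]; exact hbx y hy
      · exact hbx x hx
      · exact hd x hx y hy

/-- Each subdivision shrinks the mesh by a fixed factor. With `m + 1` as the bound on the number of
vertices the factor lies in `[0, 1)` also for `m = 0`, where division by zero would otherwise give
`1`. -/
theorem affSd_iterate_mem_supported {m : ℕ} {K : Set V} (hK : Convex ℝ K) {r : ℝ}
    (hr : 0 ≤ r) (n : ℕ) {c : AffChain V} (hc : c ∈ Finsupp.supported ℤ ℤ (smallLists m K r)) :
    (affSd m)^[n] c ∈ Finsupp.supported ℤ ℤ (smallLists m K ((1 - ((m + 1 : ℕ) : ℝ)⁻¹) ^ n * r)) := by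
  induction n generalizing c r with
  | zero => simpa using hc
  | succ n ih =>
    have h0 : 0 ≤ (1 - ((m + 1 : ℕ) : ℝ)⁻¹) := by
      have : (1 : ℝ) ≤ (m + 1 : ℕ) := by exact_mod_cast (by omega : 1 ≤ m + 1)
      linarith [inv_le_one_of_one_le₀ this]
    rw [Function.iterate_succ_apply, pow_succ, mul_assoc]
    refine ih (mul_nonneg h0 hr) ?_
    rw [Finsupp.supported_eq_span_single] at hc
    refine (Submodule.span_le (p := (Finsupp.supported ℤ ℤ
        (smallLists m K ((1 - ((m + 1 : ℕ) : ℝ)⁻¹) * r))).comap (affSd m))).2 ?_ hc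
    rintro _ ⟨l, ⟨h1, h2, h3⟩, rfl⟩
    refine Finsupp.supported_mono ?_ (affSd_single_mem_supported (D := m + 1) (by omega) hr h1 h3)
    rintro l' ⟨h4, h5, h6⟩
    exact ⟨h4, fun x hx => convexHull_min (fun y hy => h2 y hy) hK (h5 x hx), h6⟩

theorem affSd_iterate_mem_supported_self {m : ℕ} {K : Set V} (hK : Convex ℝ K) (n : ℕ)
    {l : List V} (hlen : l.length = m) (hl : ∀ x ∈ l, x ∈ K) :
    (affSd m)^[n] (Finsupp.single l 1) ∈ Finsupp.supported ℤ ℤ {l | l.length = m ∧ ∀ x ∈ l, x ∈ K} := by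
  obtain ⟨r, hr⟩ := l.finite_toSet.isBounded.exists_norm_le
  have hr' : ∀ x ∈ l, ‖x‖ ≤ |r| := fun x hx => (hr x hx).trans (le_abs_self r)
  -- Any upper bound for the diameter will do, since only membership in `K` is retained.
  refine Finsupp.supported_mono ?_ (affSd_iterate_mem_supported hK (r := 2 * |r|)
    (by positivity) n (Finsupp.single_mem_supported ℤ 1 ⟨hlen, hl, fun x hx y hy => ?_⟩))
  · rintro l' ⟨h1, h2, -⟩
    exact ⟨h1, h2⟩
  · rw [dist_eq_norm]
    linarith [norm_sub_le x y, hr' x hx, hr' y hy]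

end AffineChains

/-! ### Locally trivial cochains evaluated on singular cycles -/

section LocalCochains

variable {X : Type}

/-- A function of pairs of points, as a cochain on affine chains. -/
def pairCochain (I : X → X → ℝ) : AffChain X →ₗ[ℤ] ℝ :=
  Finsupp.linearCombination ℤ fun l => match l with
    | [a, b] => I a b
    | _ => 0

/-- A function of triples of points, as a cochain on affine chains. -/
def tripleCochain (f : X → X → X → ℝ) : AffChain X →ₗ[ℤ] ℝ :=
  Finsupp.linearCombination ℤ fun l => match l with
    | [a, b, c] => f a b c
    | _ => 0

@[simp] theorem pairCochain_single (I : X → X → ℝ) (a b : X) :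
    pairCochain I (Finsupp.single [a, b] 1) = I a b := by simp [pairCochain]

@[simp] theorem tripleCochain_single (f : X → X → X → ℝ) (a b c : X) :
    tripleCochain f (Finsupp.single [a, b, c] 1) = f a b c := by simp [tripleCochain]

theorem affBdList_pair (a b : X) :
    affBdList [a, b] = Finsupp.single [b] 1 - Finsupp.single [a] 1 := by
  simp [affBdList]

theorem affBdList_triple (a b c : X) : affBdList [a, b, c] =
    Finsupp.single [b, c] 1 - Finsupp.single [a, c] 1 + Finsupp.single [a, b] 1 := by
  simp [affBdList]; abel

theorem affBdList_quadruple (a b c d : X) : affBdList [a, b, c, d] =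
    Finsupp.single [b, c, d] 1 - Finsupp.single [a, c, d] 1 + Finsupp.single [a, b, d] 1
      - Finsupp.single [a, b, c] 1 := by
  simp [affBdList]; abel

theorem affChain_eqOn_supported {V A : Type*} [AddCommGroup A] {s : Set (List V)}
    {f g : AffChain V →ₗ[ℤ] A} (h : ∀ l ∈ s, f (Finsupp.single l 1) = g (Finsupp.single l 1))
    {c : AffChain V} (hc : c ∈ Finsupp.supported ℤ ℤ s) : f c = g c := by
  rw [Finsupp.supported_eq_span_single] at hc
  refine LinearMap.eqOn_span (s := (fun i => Finsupp.single i (1 : ℤ)) '' s) ?_ hc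
  rintro _ ⟨l, hl, rfl⟩
  exact h l hl

theorem tripleCochain_eq_pairCochain_affBd {f : X → X → X → ℝ} {I : X → X → ℝ} {U : Set X}
    (h : ∀ x ∈ U, ∀ y ∈ U, ∀ z ∈ U, f x y z = I x y + I y z - I x z) {c : AffChain X}
    (hc : c ∈ Finsupp.supported ℤ ℤ {l | l.length = 3 ∧ ∀ x ∈ l, x ∈ U}) :
    tripleCochain f c = pairCochain I (affBd c) := by
  refine affChain_eqOn_supported (g := pairCochain I ∘ₗ affBd) ?_ hc
  rintro l ⟨hl, hU⟩
  obtain ⟨a, b, c, rfl⟩ := List.length_eq_three.1 hl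
  simp only [LinearMap.comp_apply, affBd_single, affBdList_triple, map_add, map_sub,
    pairCochain_single, tripleCochain_single]
  rw [h a (hU a (by simp)) b (hU b (by simp)) c (hU c (by simp))]
  ring

/-- Inside `U` the function `f` is the coboundary of `I`, and the eight-term check below is the
identity that coboundaries vanish on boundaries. -/
theorem tripleCochain_affBd_eq_zero {f : X → X → X → ℝ} {I : X → X → ℝ} {U : Set X}
    (h : ∀ x ∈ U, ∀ y ∈ U, ∀ z ∈ U, f x y z = I x y + I y z - I x z) {c : AffChain X}
    (hc : c ∈ Finsupp.supported ℤ ℤ {l | l.length = 4 ∧ ∀ x ∈ l, x ∈ U}) :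
    tripleCochain f (affBd c) = 0 := by
  refine affChain_eqOn_supported (f := tripleCochain f ∘ₗ affBd) (g := 0) ?_ hc
  rintro l ⟨hl, hU⟩
  obtain ⟨a, l, rfl⟩ := List.exists_cons_of_length_eq_add_one hl
  obtain ⟨b, c, d, rfl⟩ := List.length_eq_three.1 (by simpa using hl)
  have ha := hU a (by simp)
  have hb := hU b (by simp)
  have hc := hU c (by simp)
  have hd := hU d (by simp)
  simp only [LinearMap.comp_apply, affBd_single, affBdList_quadruple, map_add, map_sub,
    tripleCochain_single, LinearMap.zero_apply]
  rw [h b hb c hc d hd, h a ha c hc d hd, h a ha b hb d hd, h a ha b hb c hc]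
  ring

variable [TopologicalSpace X]

/-- The list of vertices of the standard simplex. -/
def stdVertices (n : ℕ) : List (Fin (n + 1) → ℝ) := List.ofFn fun i => Pi.single i 1

/-- A singular simplex, as a function on the ambient space of the standard simplex. -/
def simplexExt {n : ℕ} (σ : C(stdSimplex ℝ (Fin (n + 1)), X)) (x : Fin (n + 1) → ℝ) : X :=
  open Classical in
  if h : x ∈ stdSimplex ℝ (Fin (n + 1)) then σ ⟨x, h⟩ else σ (stdSimplex.vertex 0)

theorem simplexExt_of_mem {n : ℕ} (σ : C(stdSimplex ℝ (Fin (n + 1)), X)) {x : Fin (n + 1) → ℝ}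
    (h : x ∈ stdSimplex ℝ (Fin (n + 1))) : simplexExt σ x = σ ⟨x, h⟩ := dif_pos h

theorem simplexExt_single {n : ℕ} (σ : C(stdSimplex ℝ (Fin (n + 1)), X)) (i : Fin (n + 1)) :
    simplexExt σ (Pi.single i 1) = σ (stdSimplex.vertex i) :=
  simplexExt_of_mem σ (single_mem_stdSimplex ℝ i)

/-- The linear extension of the face inclusion. -/
def faceLin {n : ℕ} (i : Fin (n + 2)) : (Fin (n + 1) → ℝ) →ₗ[ℝ] (Fin (n + 2) → ℝ) :=
  FunOnFinite.linearMap ℝ ℝ i.succAbove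

theorem faceLin_single {n : ℕ} (i : Fin (n + 2)) (j : Fin (n + 1)) :
    faceLin i (Pi.single j 1) = Pi.single (i.succAbove j) 1 := by
  simp [faceLin]

theorem simplexExt_face {n : ℕ} (σ : C(stdSimplex ℝ (Fin (n + 2)), X)) (i : Fin (n + 2))
    {x : Fin (n + 1) → ℝ} (h : x ∈ stdSimplex ℝ (Fin (n + 1))) :
    simplexExt (σ.comp (faceMap i)) x = simplexExt σ (faceLin i x) := by
  have h2 : faceLin i x ∈ stdSimplex ℝ (Fin (n + 2)) :=
    (stdSimplex.map i.succAbove (⟨x, h⟩ : stdSimplex ℝ (Fin (n + 1)))).2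
  rw [simplexExt_of_mem _ h, simplexExt_of_mem _ h2]
  rfl

theorem stdVertices_mem {n : ℕ} : ∀ x ∈ stdVertices n, x ∈ stdSimplex ℝ (Fin (n + 1)) := by
  intro x hx
  obtain ⟨i, rfl⟩ := (List.mem_ofFn' _ _).1 hx
  exact single_mem_stdSimplex ℝ i

/-- The `n`-fold subdivided singular simplex, as an affine chain of points of `X`. -/
def subdivided {d : ℕ} (n : ℕ) (σ : C(stdSimplex ℝ (Fin (d + 1)), X)) : AffChain X :=
  affPush (simplexExt σ) ((affSd (d + 1))^[n] (Finsupp.single (stdVertices d) 1))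

/-- Faces are linear maps, and subdivision is natural for these. The values of `simplexExt` off the
simplex are irrelevant because the subdivision stays in the simplex. -/
theorem subdivided_face {d : ℕ} (n : ℕ) (σ : C(stdSimplex ℝ (Fin (d + 2)), X)) (i : Fin (d + 2)) :
    subdivided n (σ.comp (faceMap i)) = affPush (simplexExt σ) ((affSd (d + 1))^[n]
      (Finsupp.single ((stdVertices d).map (faceLin i)) 1)) := by
  rw [subdivided, ← affPush_single, ← affPush_affSd_iterate]
  rw [affPush_congr (g' := simplexExt σ ∘ faceLin i)
    (s := {l | l.length = d + 1 ∧ ∀ x ∈ l, x ∈ stdSimplex ℝ (Fin (d + 1))})]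
  · generalize (affSd (d + 1))^[n] (Finsupp.single (stdVertices d) 1) = c
    suffices affPush (simplexExt σ ∘ faceLin i) =
      affPush (simplexExt σ) ∘ₗ affPush (faceLin i) from congrArg (fun f => f c) this
    exact affChain_hom_ext fun l => by simp
  · rintro l ⟨-, hl⟩ x hx
    exact simplexExt_face σ i (hl x hx)
  · exact affSd_iterate_mem_supported_self (convex_stdSimplex ℝ _) n (by simp [stdVertices])
      stdVertices_mem

theorem subdivided_mem_supported {d : ℕ} (n : ℕ) (σ : C(stdSimplex ℝ (Fin (d + 1)), X)) {U : Set X}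
    (hU : range σ ⊆ U) :
    subdivided n σ ∈ Finsupp.supported ℤ ℤ {l | l.length = d + 1 ∧ ∀ x ∈ l, x ∈ U} := by
  refine affPush_mem_supported _ ?_ (affSd_iterate_mem_supported_self (convex_stdSimplex ℝ _) n
    (by simp [stdVertices]) stdVertices_mem)
  rintro l ⟨h1, h2⟩
  refine ⟨by simpa using h1, fun x hx => ?_⟩
  obtain ⟨y, hy, rfl⟩ := List.mem_map.1 hx
  rw [simplexExt_of_mem σ (h2 y hy)]
  exact hU (mem_range_self _)

theorem affBd_subdivided_two (n : ℕ) (σ : C(stdSimplex ℝ (Fin 3), X)) :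
    affBd (subdivided n σ) = subdivided n (σ.comp (faceMap 0))
      - subdivided n (σ.comp (faceMap 1)) + subdivided n (σ.comp (faceMap 2)) := by
  rw [subdivided_face, subdivided_face, subdivided_face, subdivided, ← affPush_affBd,
    affBd_affSd_iterate, affBd_single]
  have : affBdList (stdVertices 2) = Finsupp.single ((stdVertices 1).map (faceLin 0)) 1
      - Finsupp.single ((stdVertices 1).map (faceLin 1)) 1
      + Finsupp.single ((stdVertices 1).map (faceLin 2)) 1 := by
    simp only [stdVertices, List.ofFn_succ, List.ofFn_zero, List.map_cons, List.map_nil,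
      affBdList_triple, faceLin_single]
    rfl
  rw [this, ← Module.End.coe_pow]
  simp only [map_add, map_sub]

theorem affBd_subdivided_three (n : ℕ) (σ : C(stdSimplex ℝ (Fin 4), X)) :
    affPush (simplexExt σ) (affBd ((affSd 4)^[n] (Finsupp.single (stdVertices 3) 1))) =
      subdivided n (σ.comp (faceMap 0)) - subdivided n (σ.comp (faceMap 1))
        + subdivided n (σ.comp (faceMap 2)) - subdivided n (σ.comp (faceMap 3)) := by
  rw [subdivided_face, subdivided_face, subdivided_face, subdivided_face,
    affBd_affSd_iterate, affBd_single]
  have : affBdList (stdVertices 3) = Finsupp.single ((stdVertices 2).map (faceLin 0)) 1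
      - Finsupp.single ((stdVertices 2).map (faceLin 1)) 1
      + Finsupp.single ((stdVertices 2).map (faceLin 2)) 1
      - Finsupp.single ((stdVertices 2).map (faceLin 3)) 1 := by
    simp only [stdVertices, List.ofFn_succ, List.ofFn_zero, List.map_cons, List.map_nil,
      affBdList_quadruple, faceLin_single]
    rfl
  rw [this, ← Module.End.coe_pow]
  simp only [map_add, map_sub]

/-- A family of functions of triples that is locally the coboundary of functions of pairs, which
themselves are unique up to coboundaries. -/
structure IsLocalCoboundary {ι : Type*} (V : ι → Set X) (f : X → X → X → ℝ)
    (I : ι → X → X → ℝ) : Prop where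
  isOpen : ∀ v, IsOpen (V v)
  cover : ∀ x, ∃ v, x ∈ V v
  eq : ∀ v, ∀ x ∈ V v, ∀ y ∈ V v, ∀ z ∈ V v, f x y z = I v x y + I v y z - I v x z
  exists_sub_eq : ∀ v v', ∃ g : X → ℝ, ∀ x ∈ V v ∩ V v', ∀ y ∈ V v ∩ V v',
    I v x y - I v' x y = g y - g x

variable {ι : Type*} {V : ι → Set X} {f : X → X → X → ℝ} {I : ι → X → X → ℝ}

/-- By Lebesgue's number lemma every tetrahedron of a fine subdivision is mapped to one member of
the cover, where `f` is a coboundary. -/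
theorem IsLocalCoboundary.eventually_tripleCochain_eq_zero (h : IsLocalCoboundary V f I)
    (σ : C(stdSimplex ℝ (Fin 4), X)) :
    ∀ᶠ n in atTop, tripleCochain f
      (affPush (simplexExt σ) (affBd ((affSd 4)^[n] (Finsupp.single (stdVertices 3) 1)))) = 0 := by
  have : ∀ v, ∃ O : Set (Fin 4 → ℝ), IsOpen O ∧ ((↑) : stdSimplex ℝ (Fin 4) → _) ⁻¹' O = σ ⁻¹' V v :=
    fun v => isOpen_induced_iff.1 ((h.isOpen v).preimage σ.continuous)
  choose O hO hO' using this
  obtain ⟨δ, hδ, hball⟩ := lebesgue_number_lemma_of_metric (isCompact_stdSimplex ℝ (Fin 4)) hO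
    (fun x hx => by
      obtain ⟨v, hv⟩ := h.cover (σ ⟨x, hx⟩)
      refine mem_iUnion.2 ⟨v, ?_⟩
      have : (⟨x, hx⟩ : stdSimplex ℝ (Fin 4)) ∈ σ ⁻¹' V v := hv
      rw [← hO' v] at this
      exact this)
  obtain ⟨r, hr⟩ := (stdVertices 3).finite_toSet.isBounded.exists_norm_le
  have hr' : ∀ x ∈ stdVertices 3, ‖x‖ ≤ |r| := fun x hx => (hr x hx).trans (le_abs_self r)
  have hlim : Tendsto (fun n : ℕ => (1 - ((4 + 1 : ℕ) : ℝ)⁻¹) ^ n * (2 * |r|)) atTop (𝓝 0) := by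
    have := (tendsto_pow_atTop_nhds_zero_of_lt_one (r := 1 - ((4 + 1 : ℕ) : ℝ)⁻¹)
      (by norm_num) (by norm_num)).mul_const (2 * |r|)
    simpa using this
  filter_upwards [hlim.eventually (gt_mem_nhds hδ)] with n hn
  have hs := affSd_iterate_mem_supported (m := 4) (convex_stdSimplex ℝ (Fin 4)) (r := 2 * |r|)
    (by positivity) n (Finsupp.single_mem_supported ℤ (1 : ℤ) (a := stdVertices 3)
      ⟨by simp [stdVertices], stdVertices_mem, fun x hx y hy => by
        rw [dist_eq_norm]
        linarith [norm_sub_le x y, hr' x hx, hr' y hy]⟩)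
  refine affChain_eqOn_supported (f := tripleCochain f ∘ₗ affPush (simplexExt σ) ∘ₗ affBd) (g := 0)
    ?_ hs
  rintro l ⟨h1, h2, h3⟩
  obtain ⟨a, l', rfl⟩ := List.exists_cons_of_length_eq_add_one h1
  obtain ⟨v, hv⟩ := hball a (h2 a (by simp))
  have hmem : ∀ x ∈ a :: l', simplexExt σ x ∈ V v := by
    intro x hx
    rw [simplexExt_of_mem σ (h2 x hx)]
    have hx' : x ∈ O v := hv (lt_of_le_of_lt (h3 x hx a (by simp)) hn)
    have : (⟨x, h2 x hx⟩ : stdSimplex ℝ (Fin 4)) ∈ ((↑) : stdSimplex ℝ (Fin 4) → _) ⁻¹' O v := hx'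
    rw [hO' v] at this
    exact this
  simp only [LinearMap.comp_apply, affPush_affBd, LinearMap.zero_apply]
  refine tripleCochain_affBd_eq_zero (h.eq v) ?_
  rw [affPush_single]
  refine Finsupp.single_mem_supported ℤ 1 ⟨by simpa using h1, ?_⟩
  intro x hx
  obtain ⟨y, hy, rfl⟩ := List.mem_map.1 hx
  exact hmem y hy

/-- The change of a function of pairs when an edge is subdivided is the same for two functions that
differ by a coboundary, because the values of a coboundary along the pieces telescope to its value
on the whole edge. -/
theorem pairCochain_sub_eq (n : ℕ) (e : C(stdSimplex ℝ (Fin 2), X)) {U : Set X}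
    (hU : range e ⊆ U) {J J' : X → X → ℝ} {g : X → ℝ}
    (hg : ∀ x ∈ U, ∀ y ∈ U, J x y - J' x y = g y - g x) :
    pairCochain J (subdivided n e) - J (e (stdSimplex.vertex 0)) (e (stdSimplex.vertex 1)) =
    pairCochain J' (subdivided n e) - J' (e (stdSimplex.vertex 0)) (e (stdSimplex.vertex 1)) := by
  let G : AffChain X →ₗ[ℤ] ℝ := Finsupp.linearCombination ℤ fun l => match l with
    | [a] => g a
    | _ => 0
  have hG : ∀ a, G (Finsupp.single [a] 1) = g a := fun a => by simp [G]
  have h1 : (pairCochain J - pairCochain J') (subdivided n e) = (G ∘ₗ affBd) (subdivided n e) := by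
    refine affChain_eqOn_supported ?_ (subdivided_mem_supported n e hU)
    rintro l ⟨hl, hlU⟩
    obtain ⟨a, b, rfl⟩ := List.length_eq_two.1 hl
    simp [affBdList_pair, hG, hg a (hlU a (by simp)) b (hlU b (by simp))]
  -- Subdivision fixes points, so the subdivided edge keeps its two endpoints as boundary.
  have h2 : ∀ c : AffChain (Fin 2 → ℝ), c ∈ Finsupp.supported ℤ ℤ {l : List (Fin 2 → ℝ) | l.length = 1} →
      affSd 1 c = c := fun c hc => by
    refine affChain_eqOn_supported (g := LinearMap.id) ?_ hc
    rintro l hl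
    obtain ⟨a, rfl⟩ := List.length_eq_one_iff.1 hl
    simp [affSd, affBdList, affBary]
  have h3 : affBd (subdivided n e) = Finsupp.single [e (stdSimplex.vertex 1)] 1
      - Finsupp.single [e (stdSimplex.vertex 0)] 1 := by
    rw [subdivided, ← affPush_affBd, affBd_affSd_iterate, affBd_single]
    have h4 : affBdList (stdVertices 1) = Finsupp.single [(Pi.single 1 1 : Fin 2 → ℝ)] 1
        - Finsupp.single [(Pi.single 0 1 : Fin 2 → ℝ)] 1 := by
      simp only [stdVertices, List.ofFn_succ, List.ofFn_zero, affBdList_pair]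
      rfl
    rw [h4, Function.iterate_fixed (h2 _ (Submodule.sub_mem _
      (Finsupp.single_mem_supported ℤ 1 (by simp)) (Finsupp.single_mem_supported ℤ 1 (by simp))))]
    simp [simplexExt_single]
  have h5 := hg _ (hU (mem_range_self (stdSimplex.vertex 0))) _
    (hU (mem_range_self (stdSimplex.vertex 1)))
  rw [LinearMap.comp_apply, h3, map_sub, hG, hG, LinearMap.sub_apply] at h1
  linarith

/-- A locally trivial cochain vanishes on cycles of small simplices that are null homologous up
to torsion. -/
theorem IsLocalCoboundary.eq_zero_of_smul_eq_boundary (h : IsLocalCoboundary V f I)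
    {L : (singChains X).X 2 →ₗ[ℤ] ℝ}
    (hL : ∀ σ, L (singSimplex σ) =
      f (σ (stdSimplex.vertex 0)) (σ (stdSimplex.vertex 1)) (σ (stdSimplex.vertex 2)))
    {b : (singChains X).X 2}
    (hb : b ∈ AddSubgroup.closure
      {s | ∃ σ : C(stdSimplex ℝ (Fin 3), X), (∃ v, range σ ⊆ V v) ∧ s = singSimplex σ})
    (hd : ((singChains X).d 2 1).hom b = 0) {k : ℕ} (hk : 0 < k) {c : (singChains X).X 3}
    (hc : ((singChains X).d 3 2).hom c = k • b) : L b = 0 := by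
  classical
  -- `F n` evaluates `f` after `n` subdivisions. `D n` records the change of the local primitive
  -- along a small edge under these subdivisions; its value `0` on other edges is never used.
  choose F hF using fun n : ℕ => exists_cochain (X := X) (n := 2)
    fun σ => tripleCochain f (subdivided n σ)
  choose D hD using fun n : ℕ => exists_cochain (X := X) (n := 1)
    fun e => if he : ∃ v, range e ⊆ V v then
      pairCochain (I he.choose) (subdivided n e)
        - I he.choose (e (stdSimplex.vertex 0)) (e (stdSimplex.vertex 1)) else 0
  have hD' : ∀ n (e : C(stdSimplex ℝ (Fin 2), X)) v, range e ⊆ V v → D n (singSimplex e) =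
      pairCochain (I v) (subdivided n e) - I v (e (stdSimplex.vertex 0)) (e (stdSimplex.vertex 1)) := by
    intro n e v hv
    have he : ∃ v, range e ⊆ V v := ⟨v, hv⟩
    rw [hD, dif_pos he]
    obtain ⟨g, hg⟩ := h.exists_sub_eq he.choose v
    -- The value of `D n` does not depend on which member of the cover contains the edge.
    exact pairCochain_sub_eq n e (subset_inter he.choose_spec hv) hg
  have hface : ∀ (σ : C(stdSimplex ℝ (Fin 3), X)) (i : Fin 3) (j : Fin 2),
      (σ.comp (faceMap i)) (stdSimplex.vertex j) = σ (stdSimplex.vertex (i.succAbove j)) := by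
    intro σ i j
    simp [faceMap]
  -- On a small triangle both `F n` and `L` are coboundaries of the same local primitive, so their
  -- difference sees the edges only. For a cycle it is therefore zero.
  have hFL : ∀ n, F n b - L b = D n (((singChains X).d 2 1).hom b) := by
    intro n
    let T : (singChains X).X 2 →ₗ[ℤ] ℝ := F n - L - D n ∘ₗ ((singChains X).d 2 1).hom
    have hT : b ∈ T.toAddMonoidHom.ker := by
      refine (AddSubgroup.closure_le _).2 ?_ hb
      rintro _ ⟨σ, ⟨v, hv⟩, rfl⟩
      have hv' : ∀ i, range (σ.comp (faceMap i)) ⊆ V v := by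
        rintro i _ ⟨x, rfl⟩
        exact hv (mem_range_self _)
      have h1 := tripleCochain_eq_pairCochain_affBd (h.eq v) (subdivided_mem_supported n σ hv)
      rw [affBd_subdivided_two] at h1
      have h2 := h.eq v _ (hv (mem_range_self (stdSimplex.vertex 0))) _
        (hv (mem_range_self (stdSimplex.vertex 1))) _ (hv (mem_range_self (stdSimplex.vertex 2)))
      have e0 := hD' n _ v (hv' 0)
      have e1 := hD' n _ v (hv' 1)
      have e2 := hD' n _ v (hv' 2)
      simp only [hface] at e0 e1 e2
      change F n (singSimplex σ) - L (singSimplex σ)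
        - D n (((singChains X).d 2 1).hom (singSimplex σ)) = 0
      rw [hF, hL, singChains_d_singSimplex, h1, h2, Fin.sum_univ_three]
      norm_num
      rw [e0, e1, e2]
      simp [Fin.succAbove]
      ring
    have hT' : F n b - L b - D n (((singChains X).d 2 1).hom b) = 0 := hT
    linarith
  -- Eventual vanishing is closed under sums, so it passes from single simplices to the chain `c`,
  -- whose simplices have different thresholds.
  let P : AddSubgroup ((singChains X).X 3) :=
    { carrier := {c | ∀ᶠ n in atTop, F n (((singChains X).d 3 2).hom c) = 0}
      zero_mem' := by simp
      add_mem' := fun {x y} hx hy => by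
        filter_upwards [hx, hy] with n h1 h2
        rw [map_add, map_add, h1, h2, add_zero]
      neg_mem' := fun {x} hx => by
        filter_upwards [hx] with n h1
        rw [map_neg, map_neg, h1, neg_zero] }
  have hP : c ∈ P := by
    refine singChains_induction P (fun σ => ?_) c
    filter_upwards [h.eventually_tripleCochain_eq_zero σ] with n hn
    rw [affBd_subdivided_three] at hn
    rw [singChains_d_singSimplex, Fin.sum_univ_four]
    simp only [map_add, map_sub] at hn
    norm_num [hF]
    linarith
  obtain ⟨n, hn⟩ := Eventually.exists hP
  have h1 := hFL n
  rw [hd, map_zero] at h1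
  rw [hc, map_nsmul] at hn
  -- The reals have no torsion, so the multiplicity `k` can be cancelled.
  have h2 : F n b = 0 := by
    rcases smul_eq_zero.1 hn with h | h
    · omega
    · exact h
  linarith

end LocalCochains

/-! ### Singular chains of parametrized rectangles -/

section GridChains

variable {X Y : Type} [TopologicalSpace X] [TopologicalSpace Y]

theorem singChains_d_two (σ : C(stdSimplex ℝ (Fin 3), X)) :
    ((singChains X).d 2 1).hom (singSimplex σ) = singSimplex (σ.comp (faceMap 0))
      - singSimplex (σ.comp (faceMap 1)) + singSimplex (σ.comp (faceMap 2)) := by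
  rw [singChains_d_singSimplex, Fin.sum_univ_three]
  norm_num
  abel

/-- The singular `1`-simplex obtained by restricting a path to an interval. -/
def segSimplex (e : C(ℝ, Y)) (a b : ℝ) : C(stdSimplex ℝ (Fin 2), Y) :=
  ⟨fun x => e (x 0 * a + x 1 * b), by
    have h : ∀ i, Continuous fun x : stdSimplex ℝ (Fin 2) => x i := fun i =>
      (continuous_apply i).comp continuous_subtype_val
    exact e.continuous.comp (((h 0).mul_const a).add ((h 1).mul_const b))⟩

/-- The singular `2`-simplex obtained by restricting a map of the plane to a triangle. -/
def triSimplex (Q : C(ℝ × ℝ, Y)) (a b c : ℝ × ℝ) : C(stdSimplex ℝ (Fin 3), Y) :=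
  ⟨fun x => Q (x 0 • a + x 1 • b + x 2 • c), by
    have h : ∀ i, Continuous fun x : stdSimplex ℝ (Fin 3) => x i := fun i =>
      (continuous_apply i).comp continuous_subtype_val
    exact Q.continuous.comp ((((h 0).smul continuous_const).add
      ((h 1).smul continuous_const)).add ((h 2).smul continuous_const))⟩

/-- The restriction of a map of the plane to a horizontal line. -/
def horizontal (Q : C(ℝ × ℝ, Y)) (t : ℝ) : C(ℝ, Y) := ⟨fun p => Q (p, t), by fun_prop⟩

/-- The restriction of a map of the plane to a vertical line. -/
def vertical (Q : C(ℝ × ℝ, Y)) (p : ℝ) : C(ℝ, Y) := ⟨fun t => Q (p, t), by fun_prop⟩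

theorem faceMap_apply_two (x : stdSimplex ℝ (Fin 2)) :
    (faceMap 0 x) 0 = 0 ∧ (faceMap 0 x) 1 = x 0 ∧ (faceMap 0 x) 2 = x 1 ∧
    (faceMap 1 x) 0 = x 0 ∧ (faceMap 1 x) 1 = 0 ∧ (faceMap 1 x) 2 = x 1 ∧
    (faceMap 2 x) 0 = x 0 ∧ (faceMap 2 x) 1 = x 1 ∧ (faceMap 2 x) 2 = 0 := by
  have key : ∀ (i : Fin 3) (j : Fin 3), (faceMap i x) j =
      ∑ k : Fin 2, if i.succAbove k = j then x k else 0 := by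
    intro i j
    change FunOnFinite.linearMap ℝ ℝ i.succAbove x.1 j = _
    rw [FunOnFinite.linearMap_apply_apply, Finset.sum_filter]
    rfl
  refine ⟨?_, ?_, ?_, ?_, ?_, ?_, ?_, ?_, ?_⟩ <;> rw [key, Fin.sum_univ_two] <;>
    simp [Fin.succAbove, Fin.ext_iff, Fin.lt_def]

theorem triSimplex_face_zero (Q : C(ℝ × ℝ, Y)) (a b c : ℝ × ℝ) (x : stdSimplex ℝ (Fin 2)) :
    (triSimplex Q a b c).comp (faceMap 0) x = Q (x 0 • b + x 1 • c) := by
  obtain ⟨h0, h1, h2, -⟩ := faceMap_apply_two x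
  simp [triSimplex, h0, h1, h2]

theorem triSimplex_face_one (Q : C(ℝ × ℝ, Y)) (a b c : ℝ × ℝ) (x : stdSimplex ℝ (Fin 2)) :
    (triSimplex Q a b c).comp (faceMap 1) x = Q (x 0 • a + x 1 • c) := by
  obtain ⟨-, -, -, h0, h1, h2, -⟩ := faceMap_apply_two x
  simp [triSimplex, h0, h1, h2]

theorem triSimplex_face_two (Q : C(ℝ × ℝ, Y)) (a b c : ℝ × ℝ) (x : stdSimplex ℝ (Fin 2)) :
    (triSimplex Q a b c).comp (faceMap 2) x = Q (x 0 • a + x 1 • b) := by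
  obtain ⟨-, -, -, -, -, -, h0, h1, h2⟩ := faceMap_apply_two x
  simp [triSimplex, h0, h1, h2]

/-- The singular chain of a rectangle, cut along a diagonal. -/
def rectChain (Q : C(ℝ × ℝ, Y)) (p p' t t' : ℝ) : (singChains Y).X 2 :=
  singSimplex (triSimplex Q (p, t) (p', t) (p', t'))
    - singSimplex (triSimplex Q (p, t) (p, t') (p', t'))

/-- The diagonal is face `1` of both triangles and cancels. -/
theorem d_rectChain (Q : C(ℝ × ℝ, Y)) (p p' t t' : ℝ) :
    ((singChains Y).d 2 1).hom (rectChain Q p p' t t') =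
      singSimplex (segSimplex (horizontal Q t) p p')
        + singSimplex (segSimplex (vertical Q p') t t')
        - singSimplex (segSimplex (vertical Q p) t t')
        - singSimplex (segSimplex (horizontal Q t') p p') := by
  have hx : ∀ x : stdSimplex ℝ (Fin 2), ∀ r : ℝ, x 0 * r + x 1 * r = r := fun x r => by
    rw [← add_mul, stdSimplex.add_eq_one, one_mul]
  have e1 : (triSimplex Q (p, t) (p', t) (p', t')).comp (faceMap 0) =
      segSimplex (vertical Q p') t t' := by
    ext x
    rw [triSimplex_face_zero]
    simp [segSimplex, vertical, hx]
  have e2 : (triSimplex Q (p, t) (p', t) (p', t')).comp (faceMap 1) =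
      (triSimplex Q (p, t) (p, t') (p', t')).comp (faceMap 1) := by
    ext x
    rw [triSimplex_face_one, triSimplex_face_one]
  have e3 : (triSimplex Q (p, t) (p', t) (p', t')).comp (faceMap 2) =
      segSimplex (horizontal Q t) p p' := by
    ext x
    rw [triSimplex_face_two]
    simp [segSimplex, horizontal, hx]
  have e4 : (triSimplex Q (p, t) (p, t') (p', t')).comp (faceMap 0) =
      segSimplex (horizontal Q t') p p' := by
    ext x
    rw [triSimplex_face_zero]
    simp [segSimplex, horizontal, hx]
  have e5 : (triSimplex Q (p, t) (p, t') (p', t')).comp (faceMap 2) =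
      segSimplex (vertical Q p) t t' := by
    ext x
    rw [triSimplex_face_two]
    simp [segSimplex, vertical, hx]
  rw [rectChain, map_sub, singChains_d_two, singChains_d_two, e1, e2, e3, e4, e5]
  abel

/-- Telescoping of the boundary of a grid of rectangles. -/
theorem sum_grid_boundary {A : Type*} [AddCommGroup A] (h v : ℕ → ℕ → A) (m n : ℕ) :
    ∑ k ∈ Finset.range m, ∑ l ∈ Finset.range n, (h k l + v (k + 1) l - v k l - h k (l + 1)) =
      ∑ k ∈ Finset.range m, h k 0 - ∑ k ∈ Finset.range m, h k n
        + ∑ l ∈ Finset.range n, v m l - ∑ l ∈ Finset.range n, v 0 l := by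
  have h1 : ∀ k l, h k l + v (k + 1) l - v k l - h k (l + 1) =
      -(h k (l + 1) - h k l) + (v (k + 1) l - v k l) := fun k l => by abel
  simp only [h1, Finset.sum_add_distrib, Finset.sum_neg_distrib, Finset.sum_range_sub]
  rw [Finset.sum_comm (f := fun k l => v (k + 1) l - v k l)]
  simp only [fun l => Finset.sum_range_sub (fun k => v k l) m, Finset.sum_sub_distrib]
  abel

/-- The singular chain of a grid of rectangles. -/
def gridChain (Q : C(ℝ × ℝ, Y)) (P T : ℕ → ℝ) (m n : ℕ) : (singChains Y).X 2 :=
  ∑ k ∈ Finset.range m, ∑ l ∈ Finset.range n, rectChain Q (P k) (P (k + 1)) (T l) (T (l + 1))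

/-- The singular chain of a subdivided path. -/
def pathChain (e : C(ℝ, Y)) (T : ℕ → ℝ) (n : ℕ) : (singChains Y).X 1 :=
  ∑ l ∈ Finset.range n, singSimplex (segSimplex e (T l) (T (l + 1)))

theorem d_gridChain (Q : C(ℝ × ℝ, Y)) (P T : ℕ → ℝ) (m n : ℕ) :
    ((singChains Y).d 2 1).hom (gridChain Q P T m n) =
      pathChain (horizontal Q (T 0)) P m - pathChain (horizontal Q (T n)) P m
        + pathChain (vertical Q (P m)) T n - pathChain (vertical Q (P 0)) T n := by
  simp only [gridChain, map_sum, d_rectChain]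
  exact sum_grid_boundary (fun k l => singSimplex (segSimplex (horizontal Q (T l)) (P k) (P (k + 1))))
    (fun k l => singSimplex (segSimplex (vertical Q (P k)) (T l) (T (l + 1)))) m n

/-- The constant singular simplex. -/
def constChain (n : ℕ) (y : Y) : (singChains Y).X n := singSimplex (ContinuousMap.const _ y)

/-- Of the three constant faces two cancel. Constant edges are nonzero as singular chains, so
constant triangles are needed to remove them at the poles of the sphere. -/
theorem d_constChain (y : Y) :
    ((singChains Y).d 2 1).hom (constChain 2 y) = constChain 1 y := by
  rw [constChain, singChains_d_two]
  simp only [ContinuousMap.const_comp]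
  rw [sub_self, zero_add]
  rfl

theorem pathChain_const {e : C(ℝ, Y)} {y : Y} (he : ∀ t, e t = y) (T : ℕ → ℝ) (n : ℕ) :
    pathChain e T n = n • constChain 1 y := by
  have : ∀ a b, segSimplex e a b = ContinuousMap.const _ y := fun a b => by
    ext x; simp [segSimplex, he]
  simp [pathChain, this, constChain]

/-- The value of a function of triples on the two triangles of a rectangle. -/
def rectValue (f : X → X → X → ℝ) (G : ℝ × ℝ → X) (p p' t t' : ℝ) : ℝ :=
  f (G (p, t)) (G (p', t)) (G (p', t')) - f (G (p, t)) (G (p, t')) (G (p', t'))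

variable {ι : Type*} {V : ι → Set X} {f : X → X → X → ℝ} {I : ι → X → X → ℝ}

/-- The rectangle is mapped to a single member of the cover. -/
def IsSmallRect (V : ι → Set X) (G : ℝ × ℝ → X) (p p' t t' : ℝ) : Prop :=
  ∃ v, ∀ a ∈ Icc p p', ∀ b ∈ Icc t t', G (a, b) ∈ V v

theorem range_triSimplex_subset (Q : C(ℝ × ℝ, X)) {p p' t t' : ℝ} {U : Set X}
    (hU : ∀ a ∈ Icc p p', ∀ b ∈ Icc t t', Q (a, b) ∈ U) {a b c : ℝ × ℝ}
    (ha : a ∈ Icc p p' ×ˢ Icc t t') (hb : b ∈ Icc p p' ×ˢ Icc t t')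
    (hc : c ∈ Icc p p' ×ˢ Icc t t') : range (triSimplex Q a b c) ⊆ U := by
  rintro _ ⟨x, rfl⟩
  have hconv : Convex ℝ (Icc p p' ×ˢ Icc t t') := (convex_Icc p p').prod (convex_Icc t t')
  have hs := x.2.2
  rw [Fin.sum_univ_three] at hs
  have hmem : x 0 • a + x 1 • b + x 2 • c ∈ Icc p p' ×ˢ Icc t t' := by
    have := hconv.sum_mem (t := Finset.univ) (w := fun i : Fin 3 => x i) (z := ![a, b, c])
      (fun i _ => x.2.1 i) x.2.2 (by
        intro i _
        fin_cases i
        exacts [ha, hb, hc])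
    simpa [Fin.sum_univ_three] using this
  exact hU _ hmem.1 _ hmem.2

theorem rectChain_mem_closure (Q : C(ℝ × ℝ, X)) {p p' t t' : ℝ} (hp : p ≤ p') (ht : t ≤ t')
    (h : IsSmallRect V Q p p' t t') : rectChain Q p p' t t' ∈ AddSubgroup.closure
      {s | ∃ σ : C(stdSimplex ℝ (Fin 3), X), (∃ v, range σ ⊆ V v) ∧ s = singSimplex σ} := by
  obtain ⟨v, hv⟩ := h
  refine AddSubgroup.sub_mem _ (AddSubgroup.subset_closure ⟨_, ⟨v, range_triSimplex_subset Q hv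
    ?_ ?_ ?_⟩, rfl⟩) (AddSubgroup.subset_closure ⟨_, ⟨v, range_triSimplex_subset Q hv
    ?_ ?_ ?_⟩, rfl⟩) <;> simp [hp, ht]

theorem singMap_rectChain (S : C(Y, X)) (Q : C(ℝ × ℝ, Y)) (p p' t t' : ℝ) :
    ((singMap S).f 2).hom (rectChain Q p p' t t') = rectChain (S.comp Q) p p' t t' := by
  rw [rectChain, map_sub, singMap_singSimplex, singMap_singSimplex]
  rfl

theorem singMap_gridChain (S : C(Y, X)) (Q : C(ℝ × ℝ, Y)) (P T : ℕ → ℝ) (m n : ℕ) :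
    ((singMap S).f 2).hom (gridChain Q P T m n) = gridChain (S.comp Q) P T m n := by
  simp only [gridChain, map_sum, singMap_rectChain]

theorem rectChain_eval {L : (singChains X).X 2 →ₗ[ℤ] ℝ}
    (hL : ∀ σ, L (singSimplex σ) =
      f (σ (stdSimplex.vertex 0)) (σ (stdSimplex.vertex 1)) (σ (stdSimplex.vertex 2)))
    (Q : C(ℝ × ℝ, X)) (p p' t t' : ℝ) :
    L (rectChain Q p p' t t') = rectValue f Q p p' t t' := by
  rw [rectChain, map_sub, hL, hL]
  simp [triSimplex, rectValue]

/-- A sector of the sphere: three consecutive rectangles, ending at a point. -/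
structure SphereSector (Y : Type) [TopologicalSpace Y] where
  inner : C(ℝ × ℝ, Y)
  neck : C(ℝ × ℝ, Y)
  cap : C(ℝ × ℝ, Y)
  pole : Y
  inner_one : ∀ t, inner (1, t) = neck (0, t)
  neck_one : ∀ t, neck (1, t) = cap (0, t)
  cap_one : ∀ t, cap (1, t) = pole

/-- Two sectors meet along the rays of angles `t` and `t'`. -/
def SphereSector.Meets (s : SphereSector Y) (t : ℝ) (s' : SphereSector Y) (t' : ℝ) : Prop :=
  ∀ p, s.inner (p, t) = s'.inner (p, t') ∧ s.neck (p, t) = s'.neck (p, t') ∧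
    s.cap (p, t) = s'.cap (p, t')

/-- The uniform subdivision of the unit interval. -/
def unif (N : ℕ) (k : ℕ) : ℝ := k / N

/-- The chain of a sector. -/
def SphereSector.chain (s : SphereSector Y) (N : ℕ) : (singChains Y).X 2 :=
  gridChain s.inner (unif N) (unif N) N N + gridChain s.neck (fun k => k) (unif N) 1 N
    + gridChain s.cap (unif N) (unif N) N N - N • constChain 2 s.pole

/-- The chain of a ray of a sector. -/
def SphereSector.ray (s : SphereSector Y) (N : ℕ) (t : ℝ) : (singChains Y).X 1 :=
  pathChain (horizontal s.inner t) (unif N) N + pathChain (horizontal s.neck t) (fun k => k) 1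
    + pathChain (horizontal s.cap t) (unif N) N

/-- The three grids share vertical edges, which cancel. The last vertical edge of the cap consists
of `N` constant edges at the pole, removed by the `N` constant triangles in the chain. -/
theorem SphereSector.d_chain (s : SphereSector Y) {N : ℕ} (hN : N ≠ 0) :
    ((singChains Y).d 2 1).hom (s.chain N) = s.ray N 0 - s.ray N 1
      - pathChain (vertical s.inner 0) (unif N) N := by
  have h0 : unif N 0 = 0 := by simp [unif]
  have h1 : unif N N = 1 := by simp [unif, hN]
  have e1 : vertical s.inner 1 = vertical s.neck 0 := by ext t; exact s.inner_one t
  have e2 : vertical s.neck 1 = vertical s.cap 0 := by ext t; exact s.neck_one t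
  rw [chain, map_sub, map_add, map_add, map_nsmul, d_gridChain, d_gridChain, d_gridChain,
    d_constChain, h0, h1, e1, Nat.cast_one, Nat.cast_zero, e2,
    pathChain_const (e := vertical s.cap 1) s.cap_one, ray, ray]
  abel

theorem SphereSector.Meets.ray_eq {s s' : SphereSector Y} {t t' : ℝ} (h : s.Meets t s' t') (N : ℕ) :
    s.ray N t = s'.ray N t' := by
  have e1 : horizontal s.inner t = horizontal s'.inner t' := by ext p; exact (h p).1
  have e2 : horizontal s.neck t = horizontal s'.neck t' := by ext p; exact (h p).2.1
  have e3 : horizontal s.cap t = horizontal s'.cap t' := by ext p; exact (h p).2.2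
  rw [ray, ray, e1, e2, e3]

/-- All rectangles of the sector are small. -/
def SphereSector.IsSmall (V : ι → Set X) (S : Y → X) (s : SphereSector Y) (N : ℕ) : Prop :=
  (∀ k < N, ∀ l < N, IsSmallRect V (S ∘ s.inner) (unif N k) (unif N (k + 1)) (unif N l)
    (unif N (l + 1))) ∧
  (∀ l < N, IsSmallRect V (S ∘ s.neck) 0 1 (unif N l) (unif N (l + 1))) ∧
  (∀ k < N, ∀ l < N, IsSmallRect V (S ∘ s.cap) (unif N k) (unif N (k + 1)) (unif N l)
    (unif N (l + 1)))

/-- The sum of the values of a function of triples over a grid. -/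
def gridValue (f : X → X → X → ℝ) (G : ℝ × ℝ → X) (N : ℕ) : ℝ :=
  ∑ k ∈ Finset.range N, ∑ l ∈ Finset.range N,
    rectValue f G (unif N k) (unif N (k + 1)) (unif N l) (unif N (l + 1))

/-- The sum of the values of a function of triples over a sector. -/
def SphereSector.value (f : X → X → X → ℝ) (S : Y → X) (s : SphereSector Y) (N : ℕ) : ℝ :=
  gridValue f (S ∘ s.inner) N
    + ∑ l ∈ Finset.range N, rectValue f (S ∘ s.neck) 0 1 (unif N l) (unif N (l + 1))
    + gridValue f (S ∘ s.cap) N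

theorem unif_le (N k : ℕ) : unif N k ≤ unif N (k + 1) := by
  unfold unif
  gcongr
  simp

/-- This makes the constant triangles invisible to the cochain. -/
theorem IsLocalCoboundary.diag (h : IsLocalCoboundary V f I) (h0 : ∀ v x, I v x x = 0) (x : X) :
    f x x x = 0 := by
  obtain ⟨v, hv⟩ := h.cover x
  rw [h.eq v x hv x hv x hv, h0]
  simp

theorem SphereSector.chain_mem_closure (h : IsLocalCoboundary V f I) (S : C(Y, X))
    (s : SphereSector Y) (N : ℕ) (hs : s.IsSmall V S N) :
    ((singMap S).f 2).hom (s.chain N) ∈ AddSubgroup.closure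
      {s | ∃ σ : C(stdSimplex ℝ (Fin 3), X), (∃ v, range σ ⊆ V v) ∧ s = singSimplex σ} := by
  rw [chain, map_sub, map_add, map_add, map_nsmul, singMap_gridChain, singMap_gridChain,
    singMap_gridChain]
  refine AddSubgroup.sub_mem _ (AddSubgroup.add_mem _ (AddSubgroup.add_mem _ ?_ ?_) ?_) ?_
  · refine AddSubgroup.sum_mem _ fun k hk => AddSubgroup.sum_mem _ fun l hl => ?_
    exact rectChain_mem_closure _ (unif_le _ _) (unif_le _ _)
      (hs.1 k (Finset.mem_range.1 hk) l (Finset.mem_range.1 hl))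
  · refine AddSubgroup.sum_mem _ fun k hk => AddSubgroup.sum_mem _ fun l hl => ?_
    obtain rfl : k = 0 := by simpa using hk
    refine rectChain_mem_closure _ (by simp) (unif_le _ _) ?_
    simpa using hs.2.1 l (Finset.mem_range.1 hl)
  · refine AddSubgroup.sum_mem _ fun k hk => AddSubgroup.sum_mem _ fun l hl => ?_
    exact rectChain_mem_closure _ (unif_le _ _) (unif_le _ _)
      (hs.2.2 k (Finset.mem_range.1 hk) l (Finset.mem_range.1 hl))
  · refine AddSubgroup.nsmul_mem _ ?_ _
    rw [constChain, singMap_singSimplex]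
    obtain ⟨v, hv⟩ := h.cover (S s.pole)
    refine AddSubgroup.subset_closure ⟨_, ⟨v, ?_⟩, rfl⟩
    rintro _ ⟨x, rfl⟩
    exact hv

theorem SphereSector.chain_eval (h : IsLocalCoboundary V f I) (h0 : ∀ v x, I v x x = 0)
    {L : (singChains X).X 2 →ₗ[ℤ] ℝ}
    (hL : ∀ σ, L (singSimplex σ) =
      f (σ (stdSimplex.vertex 0)) (σ (stdSimplex.vertex 1)) (σ (stdSimplex.vertex 2)))
    (S : C(Y, X)) (s : SphereSector Y) (N : ℕ) :
    L (((singMap S).f 2).hom (s.chain N)) = s.value f S N := by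
  rw [chain, map_sub, map_add, map_add, map_nsmul, singMap_gridChain, singMap_gridChain,
    singMap_gridChain, constChain, singMap_singSimplex, map_sub, map_add, map_add, map_nsmul, hL]
  have : f (((S.comp (ContinuousMap.const _ s.pole))) (stdSimplex.vertex 0 : stdSimplex ℝ (Fin 3)))
    (((S.comp (ContinuousMap.const _ s.pole))) (stdSimplex.vertex 1 : stdSimplex ℝ (Fin 3)))
    (((S.comp (ContinuousMap.const _ s.pole))) (stdSimplex.vertex 2 : stdSimplex ℝ (Fin 3))) = 0 :=
      h.diag h0 _
  rw [this, smul_zero, sub_zero]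
  simp only [gridChain, map_sum, rectChain_eval hL, value, gridValue, Finset.sum_range_one,
    Nat.cast_zero, zero_add, Nat.cast_one]
  rfl

/-- Evaluation of a locally trivial cochain on a torsion sphere made of four sectors, two around
the first two poles and two around the third pole. -/
theorem IsLocalCoboundary.sphere_value_eq_zero (h : IsLocalCoboundary V f I)
    (h0 : ∀ v x, I v x x = 0) (S : C(OnePoint ℂ, X)) (hS : IsZeroModTorsion S)
    (s : Fin 4 → SphereSector (OnePoint ℂ)) {N : ℕ} (hN : N ≠ 0) (hsmall : ∀ i, (s i).IsSmall V S N)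
    (h00 : (s 0).Meets 0 (s 0) 1) (h11 : (s 1).Meets 0 (s 1) 1)
    (h23 : (s 2).Meets 1 (s 3) 0) (h32 : (s 2).Meets 0 (s 3) 1)
    (h02 : ∀ t, (s 0).inner (0, t) = (s 2).inner (0, t))
    (h13 : ∀ t, (s 1).inner (0, t) = (s 3).inner (0, t)) :
    -(s 0).value f S N - (s 1).value f S N + (s 2).value f S N + (s 3).value f S N = 0 := by
  obtain ⟨L, hL⟩ := exists_cochain (X := X) (n := 2) fun σ =>
    f (σ (stdSimplex.vertex 0)) (σ (stdSimplex.vertex 1)) (σ (stdSimplex.vertex 2))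
  -- The signs make this a cycle: the inner circles of sectors `0` and `2`, and of `1` and `3`,
  -- cancel, as do the rays along which sectors meet.
  let a : (singChains (OnePoint ℂ)).X 2 :=
    -(s 0).chain N - (s 1).chain N + (s 2).chain N + (s 3).chain N
  have e1 : vertical (s 0).inner 0 = vertical (s 2).inner 0 := by ext1 t; exact h02 t
  have e2 : vertical (s 1).inner 0 = vertical (s 3).inner 0 := by ext1 t; exact h13 t
  have ha : ((singChains (OnePoint ℂ)).d 2 1).hom a = 0 := by
    simp only [a, map_add, map_sub, map_neg, SphereSector.d_chain _ hN]
    rw [h00.ray_eq, h11.ray_eq, h23.ray_eq, h32.ray_eq, e1, e2]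
    abel
  obtain ⟨k, hk, c, hc⟩ := hS.exists_boundary a ha
  have hb : ((singMap S).f 2).hom a ∈ AddSubgroup.closure
      {s | ∃ σ : C(stdSimplex ℝ (Fin 3), X), (∃ v, range σ ⊆ V v) ∧ s = singSimplex σ} := by
    simp only [a, map_add, map_sub, map_neg]
    have := fun i => (s i).chain_mem_closure h S N (hsmall i)
    exact AddSubgroup.add_mem _ (AddSubgroup.add_mem _ (AddSubgroup.sub_mem _
      (AddSubgroup.neg_mem _ (this 0)) (this 1)) (this 2)) (this 3)
  have hd : ((singChains X).d 2 1).hom (((singMap S).f 2).hom a) = 0 := by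
    have := congrArg (fun g => g.hom a) ((singMap S).comm 2 1)
    refine this.trans ?_
    exact (congrArg ((singMap S).f 1).hom ha).trans (map_zero _)
  have := h.eq_zero_of_smul_eq_boundary hL hb hd hk hc
  simpa only [a, map_add, map_sub, map_neg, SphereSector.chain_eval h h0 hL] using this

end GridChains

/-! ### Primitives of closed 2-forms in normed spaces -/

section Primitives

variable {E : Type*} [NormedAddCommGroup E] [NormedSpace ℝ E]
variable {F : Type*} [NormedAddCommGroup F] [NormedSpace ℝ F]

/-- The 1-form `lam` satisfies `d lam = Θ` on `U`. -/
structure IsPrimitiveOn (lam : E → E →L[ℝ] ℝ) (Θ : E → E →L[ℝ] E →L[ℝ] ℝ) (U : Set E) : Prop where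
  differentiableAt : ∀ y ∈ U, DifferentiableAt ℝ lam y
  eq : ∀ y ∈ U, ∀ a b, fderiv ℝ lam y a b - fderiv ℝ lam y b a = Θ y a b

/-- Two primitives of a 2-form differ by an exact form. -/
theorem IsPrimitiveOn.exists_hasFDerivAt_sub {lam lam' : E → E →L[ℝ] ℝ}
    {Θ : E → E →L[ℝ] E →L[ℝ] ℝ} {U : Set E} (h : IsPrimitiveOn lam Θ U)
    (h' : IsPrimitiveOn lam' Θ U) (hU : IsOpen U) (hc : Convex ℝ U) :
    ∃ g : E → ℝ, ∀ y ∈ U, HasFDerivAt g (lam y - lam' y) y := by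
  refine hc.exists_forall_hasFDerivAt_of_fderiv_symmetric hU
    (fun y hy => ((h.1 y hy).sub (h'.1 y hy)).differentiableWithinAt) ?_
  intro y hy a b
  rw [fderiv_fun_sub (h.1 y hy) (h'.1 y hy)]
  have h1 := h.2 y hy a b
  have h2 := h'.2 y hy a b
  simp only [sub_apply]
  linarith

/-- This is the product rule for the pulled-back form. The second summand contains the second
derivative of `ψ` and is symmetric in `a` and `b`, so it does not contribute to the exterior
derivative. -/
theorem hasFDerivAt_comp_fderiv {lam : E → E →L[ℝ] ℝ} {ψ : F → E} {y : F}
    (hψ : ContDiffAt ℝ 2 ψ y) (hlam : DifferentiableAt ℝ lam (ψ y)) (a b : F) :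
    DifferentiableAt ℝ (fun y => (lam (ψ y)).comp (fderiv ℝ ψ y)) y ∧
    fderiv ℝ (fun y => (lam (ψ y)).comp (fderiv ℝ ψ y)) y a b =
      fderiv ℝ lam (ψ y) (fderiv ℝ ψ y a) (fderiv ℝ ψ y b)
        + lam (ψ y) (fderiv ℝ (fderiv ℝ ψ) y a b) := by
  have h1 : HasFDerivAt (fun y => lam (ψ y)) ((fderiv ℝ lam (ψ y)).comp (fderiv ℝ ψ y)) y :=
    hlam.hasFDerivAt.comp y (hψ.differentiableAt (by norm_num)).hasFDerivAt
  have h2 : HasFDerivAt (fderiv ℝ ψ) (fderiv ℝ (fderiv ℝ ψ) y) y :=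
    ((hψ.fderiv_right (m := 1) (by norm_num)).differentiableAt (by norm_num)).hasFDerivAt
  have h3 := h1.clm_comp h2
  refine ⟨h3.differentiableAt, ?_⟩
  rw [h3.fderiv]
  simp [add_comm]

theorem IsPrimitiveOn.pullback {lam : E → E →L[ℝ] ℝ} {Θ : E → E →L[ℝ] E →L[ℝ] ℝ} {U : Set E}
    (h : IsPrimitiveOn lam Θ U) {ψ : F → E} {W : Set F} (hψ : ∀ y ∈ W, ContDiffAt ℝ 2 ψ y)
    (hW : ∀ y ∈ W, ψ y ∈ U) :
    IsPrimitiveOn (fun y => (lam (ψ y)).comp (fderiv ℝ ψ y))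
      (fun y => (Θ (ψ y)).bilinearComp (fderiv ℝ ψ y) (fderiv ℝ ψ y)) W := by
  refine ⟨fun y hy => (hasFDerivAt_comp_fderiv (hψ y hy) (h.1 _ (hW y hy)) 0 0).1,
    fun y hy a b => ?_⟩
  rw [(hasFDerivAt_comp_fderiv (hψ y hy) (h.1 _ (hW y hy)) a b).2,
    (hasFDerivAt_comp_fderiv (hψ y hy) (h.1 _ (hW y hy)) b a).2]
  -- By symmetry of the second derivative, exterior differentiation commutes with pullback.
  have hs : fderiv ℝ (fderiv ℝ ψ) y a b = fderiv ℝ (fderiv ℝ ψ) y b a :=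
    (hψ y hy).isSymmSndFDerivAt (by simp) a b
  rw [hs, ContinuousLinearMap.bilinearComp_apply, ← h.2 _ (hW y hy)]
  ring

/-- Stokes' theorem on a rectangle. -/
theorem IsPrimitiveOn.integral_rect {η : ℝ × ℝ → ℝ × ℝ →L[ℝ] ℝ}
    {Θ : ℝ × ℝ → ℝ × ℝ →L[ℝ] ℝ × ℝ →L[ℝ] ℝ} {p p' t t' : ℝ} (hp : p ≤ p') (ht : t ≤ t')
    (h : IsPrimitiveOn η Θ (Icc p p' ×ˢ Icc t t'))
    (hΘ : ContinuousOn (fun x => Θ x (1, 0) (0, 1)) (Icc p p' ×ˢ Icc t t')) :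
    ∫ x in Icc p p' ×ˢ Icc t t', Θ x (1, 0) (0, 1) =
      (∫ a in p..p', η (a, t) (1, 0)) + (∫ b in t..t', η (p', b) (0, 1))
        - (∫ b in t..t', η (p, b) (0, 1)) - ∫ a in p..p', η (a, t') (1, 0) := by
  have hIcc : Icc (p, t) (p', t') = Icc p p' ×ˢ Icc t t' := (Icc_prod_Icc _ _ _ _).symm
  have hc : ∀ v, ContinuousOn (fun x => η x v) (Icc p p' ×ˢ Icc t t') := fun v x hx =>
    (((h.1 x hx).clm_apply (differentiableAt_const v))).continuousAt.continuousWithinAt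
  have hd : ∀ v x, x ∈ Ioo p p' ×ˢ Ioo t t' → HasFDerivAt (fun x => η x v)
      ((fderiv ℝ η x).flip v) x := fun v x hx => by
    have hx' : x ∈ Icc p p' ×ˢ Icc t t' := ⟨Ioo_subset_Icc_self hx.1, Ioo_subset_Icc_self hx.2⟩
    have e : (η x).comp (0 : ℝ × ℝ →L[ℝ] ℝ × ℝ) + (fderiv ℝ η x).flip v
        = (fderiv ℝ η x).flip v := by simp
    exact e ▸ (h.1 x hx').hasFDerivAt.clm_apply (hasFDerivAt_const v x)
  have heq : ∀ x ∈ Icc p p' ×ˢ Icc t t', (fderiv ℝ η x).flip (0, 1) (1, 0)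
      + (-(fderiv ℝ η x).flip (1, 0)) (0, 1) = Θ x (1, 0) (0, 1) := fun x hx => by
    have := h.2 x hx (1, 0) (0, 1)
    rw [← this]
    simp [sub_eq_add_neg]
  -- The form `P da + Q db` corresponds to the vector field `(Q, -P)`, whose divergence is the
  -- coefficient of its exterior derivative.
  have key := integral_divergence_prod_Icc_of_hasFDerivAt_of_le
    (fun x => η x (0, 1)) (fun x => -η x (1, 0)) (fun x => (fderiv ℝ η x).flip (0, 1))
    (fun x => -(fderiv ℝ η x).flip (1, 0)) (p, t) (p', t') ⟨hp, ht⟩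
    (by rw [hIcc]; exact hc _) (by rw [hIcc]; exact (hc _).neg)
    (fun x hx => hd _ x hx) (fun x hx => (hd _ x hx).neg)
    (by
      rw [hIcc]
      exact ((hΘ.integrableOn_compact (isCompact_Icc.prod isCompact_Icc)).congr_fun
        (fun x hx => (heq x hx).symm) (measurableSet_Icc.prod measurableSet_Icc)))
  rw [hIcc, setIntegral_congr_fun (measurableSet_Icc.prod measurableSet_Icc) heq] at key
  rw [key]
  simp only [intervalIntegral.integral_neg]
  ring

variable [FiniteDimensional ℝ E]

/-- The Poincaré lemma for 2-forms. -/
theorem exists_isPrimitiveOn {Θ : E → E →L[ℝ] E →L[ℝ] ℝ} {U : Set E} (hU : IsOpen U)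
    (hc : Convex ℝ U) (hΘ : ContDiffOn ℝ 1 Θ U) (halt : ∀ y ∈ U, ∀ a, Θ y a a = 0)
    (hclosed : ∀ y ∈ U, ∀ a b c, fderiv ℝ Θ y a b c + fderiv ℝ Θ y b c a + fderiv ℝ Θ y c a b = 0) :
    ∃ lam, IsPrimitiveOn lam Θ U := by
  rcases U.eq_empty_or_nonempty with rfl | ⟨c, hcU⟩
  · exact ⟨0, by simp, by simp⟩
  let γ : E → ℝ → E := fun y t => c + t • (y - c)
  have hγ : ∀ y ∈ U, ∀ t ∈ Icc (0 : ℝ) 1, γ y t ∈ U := fun y hy t ht =>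
    hc.add_smul_sub_mem hcU hy ht
  have hd : ∀ y ∈ U, HasFDerivAt Θ (fderiv ℝ Θ y) y := fun y hy =>
    ((hΘ.differentiableOn (by norm_num)).differentiableAt (hU.mem_nhds hy)).hasFDerivAt
  have hdc : ContinuousOn (fderiv ℝ Θ) U := hΘ.continuousOn_fderiv_of_isOpen hU le_rfl
  -- This is the radial homotopy operator with centre `c`: the primitive at `y` is the integral of
  -- `t Θ(c + t(y - c))(y - c, ·)` over `t` in `[0, 1]`.
  let G : E → ℝ → E →L[ℝ] ℝ := fun y t => t • Θ (γ y t) (y - c)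
  let G' : E → ℝ → E →L[ℝ] E →L[ℝ] ℝ := fun y t =>
    t • (t • (fderiv ℝ Θ (γ y t)).flip (y - c) + Θ (γ y t))
  have hGd : ∀ y ∈ U, ∀ t ∈ Icc (0 : ℝ) 1, HasFDerivAt (fun y => G y t) (G' y t) y := by
    intro y hy t ht
    have h1 : HasFDerivAt (fun y => γ y t) (t • ContinuousLinearMap.id ℝ E) y :=
      (((hasFDerivAt_id y).sub_const c).const_smul t).const_add c
    have h2 := (hd _ (hγ y hy t ht)).comp y h1
    have h3 := (h2.clm_apply ((hasFDerivAt_id y).sub_const c)).const_smul t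
    refine h3.congr_fderiv ?_
    ext a b
    simp [G', add_comm]
  have hγc : Continuous fun x : E × ℝ => γ x.1 x.2 := by fun_prop
  have hmaps : MapsTo (fun x : E × ℝ => γ x.1 x.2) (U ×ˢ Icc 0 1) U := fun x hx =>
    hγ _ hx.1 _ hx.2
  have hGc : ContinuousOn (fun x : E × ℝ => G x.1 x.2) (U ×ˢ Icc 0 1) := by
    refine continuousOn_snd.smul (ContinuousOn.clm_apply (hΘ.continuousOn.comp hγc.continuousOn hmaps) ?_)
    fun_prop
  have hG'c : ContinuousOn (fun x : E × ℝ => G' x.1 x.2) (U ×ˢ Icc 0 1) := by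
    have h1 : ContinuousOn (fun x : E × ℝ => (fderiv ℝ Θ (γ x.1 x.2)).flip (x.1 - c)) (U ×ˢ Icc 0 1) := by
      refine ContinuousOn.clm_apply ?_ (by fun_prop)
      exact (ContinuousLinearMap.flipₗᵢ ℝ E E (E →L[ℝ] ℝ)).continuous.comp_continuousOn
        (hdc.comp hγc.continuousOn hmaps)
    exact continuousOn_snd.smul ((continuousOn_snd.smul h1).add
      (hΘ.continuousOn.comp hγc.continuousOn hmaps))
  have hsec : ∀ y ∈ U, MapsTo (fun t : ℝ => (y, t)) (Icc 0 1) (U ×ˢ Icc 0 1) := fun y hy t ht =>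
    ⟨hy, ht⟩
  have hGy : ∀ y ∈ U, ContinuousOn (G y) (Icc 0 1) := fun y hy =>
    hGc.comp (by fun_prop) (hsec y hy)
  have hG'y : ∀ y ∈ U, ContinuousOn (G' y) (Icc 0 1) := fun y hy =>
    hG'c.comp (by fun_prop) (hsec y hy)
  have hIoc : Set.uIoc (0 : ℝ) 1 ⊆ Icc 0 1 := by rw [uIoc_of_le zero_le_one]; exact Ioc_subset_Icc_self
  have hmain : ∀ y ∈ U, HasFDerivAt (fun y => ∫ t in (0 : ℝ)..1, G y t)
      (∫ t in (0 : ℝ)..1, G' y t) y := by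
    intro y hy
    obtain ⟨ε, hε, hball⟩ := Metric.nhds_basis_closedBall.mem_iff.1 (hU.mem_nhds hy)
    -- Closed balls are compact in finite dimension; this bound allows differentiation under the
    -- integral.
    obtain ⟨C, hC⟩ := ((isCompact_closedBall y ε).prod (isCompact_Icc (a := (0 : ℝ)) (b := 1))).exists_bound_of_continuousOn
      (hG'c.mono (prod_mono hball le_rfl))
    refine intervalIntegral.hasFDerivAt_integral_of_dominated_of_fderiv_le
      (Metric.closedBall_mem_nhds y hε) (bound := fun _ => C) ?_ ?_ ?_ ?_ ?_ ?_
    · filter_upwards [hU.mem_nhds hy] with z hz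
      exact ((hGy z hz).mono hIoc).aestronglyMeasurable measurableSet_uIoc
    · exact (hGy y hy).intervalIntegrable_of_Icc zero_le_one
    · exact ((hG'y y hy).mono hIoc).aestronglyMeasurable measurableSet_uIoc
    · exact ae_of_all _ fun t ht z hz => hC (z, t) ⟨hz, hIoc ht⟩
    · exact intervalIntegrable_const
    · exact ae_of_all _ fun t ht z hz => hGd z (hball hz) t (hIoc ht)
  refine ⟨fun y => ∫ t in (0 : ℝ)..1, G y t, fun y hy => (hmain y hy).differentiableAt, ?_⟩
  intro y hy a b
  rw [(hmain y hy).fderiv]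
  have hint : IntervalIntegrable (G' y) volume 0 1 :=
    (hG'y y hy).intervalIntegrable_of_Icc zero_le_one
  have e1 : ∀ a b, (∫ t in (0 : ℝ)..1, G' y t) a b = ∫ t in (0 : ℝ)..1, G' y t a b := by
    intro a b
    let T : (E →L[ℝ] E →L[ℝ] ℝ) →L[ℝ] ℝ :=
      (ContinuousLinearMap.apply ℝ ℝ b).comp (ContinuousLinearMap.apply ℝ (E →L[ℝ] ℝ) a)
    exact (T.intervalIntegral_comp_comm hint).symm
  have hint' : ∀ a b, IntervalIntegrable (fun t => G' y t a b) volume 0 1 := fun a b =>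
    (((hG'y y hy).clm_apply continuousOn_const).clm_apply
      continuousOn_const).intervalIntegrable_of_Icc zero_le_one
  rw [e1, e1, ← intervalIntegral.integral_sub (hint' a b) (hint' b a)]
  have hanti : ∀ z ∈ U, ∀ a b, Θ z b a = -Θ z a b := by
    intro z hz a b
    have := halt z hz (a + b)
    simp only [map_add, add_apply, halt z hz] at this
    linarith
  -- Derivatives of an alternating form are alternating in the last two arguments.
  have hanti' : ∀ z ∈ U, ∀ a b c, fderiv ℝ Θ z a c b = -fderiv ℝ Θ z a b c := by
    intro z hz a b c
    have h1 : HasFDerivAt (fun z => Θ z c b + Θ z b c)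
        ((((fderiv ℝ Θ z).flip c).flip b) + (((fderiv ℝ Θ z).flip b).flip c)) z := by
      have := fun u v : E => ((hd z hz).clm_apply (hasFDerivAt_const u z)).clm_apply
        (hasFDerivAt_const v z)
      refine ((this c b).add (this b c)).congr_fderiv ?_
      ext w; simp
    have h2 : HasFDerivAt (fun z => Θ z c b + Θ z b c) (0 : E →L[ℝ] ℝ) z := by
      refine (hasFDerivAt_const (0 : ℝ) z).congr_of_eventuallyEq ?_
      filter_upwards [hU.mem_nhds hz] with w hw
      rw [hanti w hw b c, neg_add_cancel]
    have h3 := congrArg (fun T => T a) (h1.unique h2)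
    simp at h3
    linarith
  -- By closedness the antisymmetrized integrand is the derivative of `t² Θ(γ(t))(a, b)`, which goes
  -- from `0` to `Θ y a b`.
  have hder : ∀ t ∈ uIcc (0 : ℝ) 1, HasDerivAt (fun t : ℝ => t ^ 2 * Θ (γ y t) a b)
      (G' y t a b - G' y t b a) t := by
    intro t ht
    rw [uIcc_of_le zero_le_one] at ht
    have hz := hγ y hy t ht
    have h1 : HasDerivAt (fun t : ℝ => γ y t) (y - c) t := by
      exact (((hasDerivAt_id t).smul_const (y - c)).const_add c).congr_deriv (one_smul _ _)
    have h2 := (hd _ hz).comp_hasDerivAt t h1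
    have h3 := (h2.clm_apply (hasDerivAt_const t a)).clm_apply (hasDerivAt_const t b)
    refine ((hasDerivAt_pow 2 t).mul h3).congr_deriv ?_
    have k1 := hclosed _ hz a b (y - c)
    have k2 := hanti' _ hz a b (y - c)
    have k4 := hanti _ hz a b
    simp [G']
    simp only [map_sub, sub_apply] at k1 k2
    linear_combination t ^ 2 * k1 - t ^ 2 * k2 + t * k4
  rw [intervalIntegral.integral_eq_sub_of_hasDerivAt hder ((hint' a b).sub (hint' b a))]
  simp [γ]

end Primitives

/-! ### Local potentials of a symplectic form -/

/-- A compact Hausdorff space has a uniformity, and the cover has a Lebesgue entourage `V`. Take `W`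
symmetric with `W ∘ W ⊆ V`: if `y` lies in a `W`-ball, then the entire ball is `V`-close to `y`. -/
theorem exists_star_refinement {X κ : Type*} [TopologicalSpace X] [CompactSpace X] [T2Space X]
    {S : κ → Set X} (ho : ∀ k, IsOpen (S k)) (hc : ∀ x, ∃ k, x ∈ S k) :
    ∃ i : X → κ, ∀ x, ∃ O, IsOpen O ∧ x ∈ O ∧ ∀ y ∈ O, O ⊆ S (i y) := by
  let _ : UniformSpace X := uniformSpaceOfCompactR1
  obtain ⟨V, hV, hVS⟩ := lebesgue_number_lemma (isCompact_univ (X := X)) ho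
    (fun x _ => mem_iUnion.2 (hc x))
  choose i hi using fun x => hVS x (mem_univ x)
  obtain ⟨W, hW, hWsymm, hWV⟩ := comp_symm_mem_uniformity_sets hV
  refine ⟨i, fun x => ⟨interior (UniformSpace.ball x W), isOpen_interior,
    mem_interior_iff_mem_nhds.2 (UniformSpace.ball_mem_nhds x hW), fun y hy z hz => hi y ?_⟩⟩
  have hy' : (x, y) ∈ W := interior_subset (s := UniformSpace.ball x W) hy
  have hz' : (x, z) ∈ W := interior_subset (s := UniformSpace.ball x W) hz
  exact hWV (SetRel.prodMk_mem_comp (hWsymm.symm _ _ hy') hz')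

/-! ### Pullbacks of forms and covector fields, read in charts. -/

section Charts

variable {E : Type*} [NormedAddCommGroup E] [NormedSpace ℝ E]
variable {M : Type} [TopologicalSpace M] [ChartedSpace E M] [IsManifold 𝓘(ℝ, E) ∞ M]
variable {F : Type*} [NormedAddCommGroup F] [NormedSpace ℝ F]

theorem contMDiffAt_chartAt_two {x₀ x : M} (hx : x ∈ (chartAt E x₀).source) :
    ContMDiffAt 𝓘(ℝ, E) 𝓘(ℝ, E) ∞ (chartAt E x₀) x :=
  contMDiffAt_of_mem_maximalAtlas (IsManifold.chart_mem_maximalAtlas x₀) hx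

theorem contMDiffAt_chartAt_symm {x₀ : M} {y : E} (hy : y ∈ (chartAt E x₀).target) :
    ContMDiffAt 𝓘(ℝ, E) 𝓘(ℝ, E) ∞ (chartAt E x₀).symm y :=
  contMDiffAt_symm_of_mem_maximalAtlas (IsManifold.chart_mem_maximalAtlas x₀) hy

theorem mfderiv_chartAt_symm_comp {x₀ x : M} (hx : x ∈ (chartAt E x₀).source)
    (a : TangentSpace 𝓘(ℝ, E) x) :
    (mfderiv 𝓘(ℝ, E) 𝓘(ℝ, E) (chartAt E x₀).symm (chartAt E x₀ x) :
      E →L[ℝ] E) (mfderiv 𝓘(ℝ, E) 𝓘(ℝ, E) (chartAt E x₀) x a) = a := by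
  have hy := (chartAt E x₀).map_source hx
  have h1 := ((contMDiffAt_chartAt_symm hy).mdifferentiableAt (by simp)).hasMFDerivAt.comp x
    ((contMDiffAt_chartAt_two hx).mdifferentiableAt (by simp)).hasMFDerivAt
  have h2 : HasMFDerivAt 𝓘(ℝ, E) 𝓘(ℝ, E) ((chartAt E x₀).symm ∘ chartAt E x₀) x
      (ContinuousLinearMap.id ℝ (TangentSpace 𝓘(ℝ, E) x)) := by
    refine (hasMFDerivAt_id x).congr_of_eventuallyEq ?_
    filter_upwards [(chartAt E x₀).open_source.mem_nhds hx] with y hy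
    exact (chartAt E x₀).left_inv hy
  exact congrArg (fun T : E →L[ℝ] E => T a) (hasMFDerivAt_unique h1 h2)

theorem fderiv_chartAt_comp {x₀ : M} {G : F → M} {p : F} (hx : G p ∈ (chartAt E x₀).source)
    (hG : MDifferentiableAt 𝓘(ℝ, F) 𝓘(ℝ, E) G p) (a : F) :
    fderiv ℝ (chartAt E x₀ ∘ G) p a =
      (mfderiv 𝓘(ℝ, E) 𝓘(ℝ, E) (chartAt E x₀) (G p) : E →L[ℝ] E)
        ((mfderiv 𝓘(ℝ, F) 𝓘(ℝ, E) G p : F →L[ℝ] E) a) := by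
  have := mfderiv_comp p ((contMDiffAt_chartAt_two hx).mdifferentiableAt (by simp)) hG
  rw [← mfderiv_eq_fderiv, this]
  rfl

theorem form_eq_formInChart (β : ∀ x : M, TangentSpace 𝓘(ℝ, E) x →L[ℝ] TangentSpace 𝓘(ℝ, E) x →L[ℝ] ℝ)
    {x₀ x : M} (hx : x ∈ (chartAt E x₀).source) (a b : TangentSpace 𝓘(ℝ, E) x) :
    β x a b = formInChart β x₀ (chartAt E x₀ x)
      (mfderiv 𝓘(ℝ, E) 𝓘(ℝ, E) (chartAt E x₀) x a)
      (mfderiv 𝓘(ℝ, E) 𝓘(ℝ, E) (chartAt E x₀) x b) := by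
  have h : formInChart β x₀ (chartAt E x₀ x)
      (mfderiv 𝓘(ℝ, E) 𝓘(ℝ, E) (chartAt E x₀) x a)
      (mfderiv 𝓘(ℝ, E) 𝓘(ℝ, E) (chartAt E x₀) x b) =
      (β ((chartAt E x₀).symm (chartAt E x₀ x)) : E →L[ℝ] E →L[ℝ] ℝ)
        ((mfderiv 𝓘(ℝ, E) 𝓘(ℝ, E) (chartAt E x₀).symm (chartAt E x₀ x) :
      E →L[ℝ] E) (mfderiv 𝓘(ℝ, E) 𝓘(ℝ, E) (chartAt E x₀) x a))
        ((mfderiv 𝓘(ℝ, E) 𝓘(ℝ, E) (chartAt E x₀).symm (chartAt E x₀ x) :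
      E →L[ℝ] E) (mfderiv 𝓘(ℝ, E) 𝓘(ℝ, E) (chartAt E x₀) x b)) := rfl
  rw [h, mfderiv_chartAt_symm_comp hx, mfderiv_chartAt_symm_comp hx]
  exact congrArg (fun x' => (β x' : E →L[ℝ] E →L[ℝ] ℝ) a b) ((chartAt E x₀).left_inv hx).symm

theorem eventually_contMDiffAt_one {G : F → M} {p : F}
    (hG : ContMDiffAt 𝓘(ℝ, F) 𝓘(ℝ, E) 1 G p) : ∀ᶠ q in 𝓝 p, ContMDiffAt 𝓘(ℝ, F) 𝓘(ℝ, E) 1 G q := by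
  have : IsManifold 𝓘(ℝ, E) 1 M := IsManifold.of_le (n := ∞) (by norm_cast)
  exact (contMDiffAt_iff_contMDiffAt_nhds (by simp)).1 hG

/-- The pullback of a field of bilinear forms under `G`. -/
def pullForm (β : ∀ x : M, TangentSpace 𝓘(ℝ, E) x →L[ℝ] TangentSpace 𝓘(ℝ, E) x →L[ℝ] ℝ)
    (G : F → M) (p : F) : F →L[ℝ] F →L[ℝ] ℝ :=
  let D : F →L[ℝ] E := mfderiv 𝓘(ℝ, F) 𝓘(ℝ, E) G p
  let B : E →L[ℝ] E →L[ℝ] ℝ := β (G p)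
  B.bilinearComp D D

/-- The pullback of a field of covectors under `G`. -/
def pullCovector (lam : M → E →L[ℝ] ℝ) (G : F → M) (p : F) : F →L[ℝ] ℝ :=
  (lam (G p)).comp (mfderiv 𝓘(ℝ, F) 𝓘(ℝ, E) G p : F →L[ℝ] E)

theorem pullForm_eq (β : ∀ x : M, TangentSpace 𝓘(ℝ, E) x →L[ℝ] TangentSpace 𝓘(ℝ, E) x →L[ℝ] ℝ)
    {x₀ : M} {G : F → M} {p : F} (hx : G p ∈ (chartAt E x₀).source)
    (hG : MDifferentiableAt 𝓘(ℝ, F) 𝓘(ℝ, E) G p) :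
    pullForm β G p = (formInChart β x₀ ((chartAt E x₀ ∘ G) p)).bilinearComp
      (fderiv ℝ (chartAt E x₀ ∘ G) p) (fderiv ℝ (chartAt E x₀ ∘ G) p) := by
  ext a b
  rw [ContinuousLinearMap.bilinearComp_apply, fderiv_chartAt_comp hx hG, fderiv_chartAt_comp hx hG]
  exact form_eq_formInChart β hx ((mfderiv 𝓘(ℝ, F) 𝓘(ℝ, E) G p : F →L[ℝ] E) a)
    ((mfderiv 𝓘(ℝ, F) 𝓘(ℝ, E) G p : F →L[ℝ] E) b)

/-- On the set `S`, the covector field `lam` is read in some chart as a primitive of `Ω`. -/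
def IsChartPotential (Ω : SymplecticForm E M) (lam : M → E →L[ℝ] ℝ) (S : Set M) : Prop :=
  ∃ (x₀ : M) (U : Set E) (η : E → E →L[ℝ] ℝ), IsPrimitiveOn η (formInChart Ω.form x₀) U ∧
    IsOpen U ∧ ∀ x ∈ S, x ∈ (chartAt E x₀).source ∧ chartAt E x₀ x ∈ U ∧
      lam x = (η (chartAt E x₀ x)).comp (mfderiv 𝓘(ℝ, E) 𝓘(ℝ, E) (chartAt E x₀) x)

theorem IsChartPotential.mono {Ω : SymplecticForm E M} {lam : M → E →L[ℝ] ℝ} {S S' : Set M}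
    (h : IsChartPotential Ω lam S) (hS : S' ⊆ S) : IsChartPotential Ω lam S' := by
  obtain ⟨x₀, U, η, h1, h2, h3⟩ := h
  exact ⟨x₀, U, η, h1, h2, fun x hx => h3 x (hS hx)⟩

theorem eventually_pullCovector_eq {x₀ : M} {η : E → E →L[ℝ] ℝ} {S : Set M} (hS : IsOpen S)
    {lam : M → E →L[ℝ] ℝ} (h : ∀ x ∈ S, x ∈ (chartAt E x₀).source ∧
      lam x = (η (chartAt E x₀ x)).comp (mfderiv 𝓘(ℝ, E) 𝓘(ℝ, E) (chartAt E x₀) x))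
    {G : F → M} {p : F} (hG : ContMDiffAt 𝓘(ℝ, F) 𝓘(ℝ, E) 1 G p) (hp : G p ∈ S) :
    pullCovector lam G =ᶠ[𝓝 p]
      fun q => (η ((chartAt E x₀ ∘ G) q)).comp (fderiv ℝ (chartAt E x₀ ∘ G) q) := by
  filter_upwards [eventually_contMDiffAt_one hG, hG.continuousAt.preimage_mem_nhds (hS.mem_nhds hp)]
    with q hq hqS
  ext a
  rw [ContinuousLinearMap.comp_apply, fderiv_chartAt_comp (h _ hqS).1 (hq.mdifferentiableAt (by simp)),
    pullCovector, (h _ hqS).2]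
  rfl

theorem ContMDiffAt.chartAt_comp {n : WithTop ℕ∞} (hn : n ≤ ∞) {x₀ : M} {G : F → M} {p : F}
    (hG : ContMDiffAt 𝓘(ℝ, F) 𝓘(ℝ, E) n G p) (hp : G p ∈ (chartAt E x₀).source) :
    ContDiffAt ℝ n (chartAt E x₀ ∘ G) p :=
  (((contMDiffAt_chartAt_two hp).of_le hn).comp p hG).contDiffAt

/-- Near each point the pulled-back potential is the pullback of the chart primitive `η` under the
chart composed with `G`, so the statement in vector spaces applies. Two derivatives of `G` are
needed for the symmetry of its second derivative. -/
theorem IsChartPotential.isPrimitiveOn_pull {Ω : SymplecticForm E M} {lam : M → E →L[ℝ] ℝ}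
    {S : Set M} (h : IsChartPotential Ω lam S) (hS : IsOpen S) {G : F → M} {W : Set F}
    (hG : ∀ p ∈ W, ContMDiffAt 𝓘(ℝ, F) 𝓘(ℝ, E) 2 G p) (hW : ∀ p ∈ W, G p ∈ S) :
    IsPrimitiveOn (pullCovector lam G) (pullForm Ω.form G) W := by
  obtain ⟨x₀, U, η, hη, hU, hlam⟩ := h
  have hchart : ∀ p ∈ W, ContDiffAt ℝ 2 (chartAt E x₀ ∘ G) p := fun p hp =>
    ContMDiffAt.chartAt_comp (by norm_cast) (hG p hp) (hlam _ (hW p hp)).1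
  have hpull := hη.pullback hchart (fun p hp => (hlam _ (hW p hp)).2.1)
  have hev : ∀ p ∈ W, _ := fun p hp => eventually_pullCovector_eq hS
    (fun x hx => ⟨(hlam x hx).1, (hlam x hx).2.2⟩) ((hG p hp).of_le (by norm_num)) (hW p hp)
  refine ⟨fun p hp => (hpull.1 p hp).congr_of_eventuallyEq (hev p hp), fun p hp a b => ?_⟩
  rw [(hev p hp).fderiv_eq, hpull.2 p hp,
    pullForm_eq Ω.form (hlam _ (hW p hp)).1 ((hG p hp).mdifferentiableAt (by norm_num))]

theorem IsChartPotential.continuousAt_pull {Ω : SymplecticForm E M} {lam : M → E →L[ℝ] ℝ}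
    {S : Set M} (h : IsChartPotential Ω lam S) (hS : IsOpen S) {G : F → M} {p : F}
    (hG : ContMDiffAt 𝓘(ℝ, F) 𝓘(ℝ, E) 1 G p) (hp : G p ∈ S) :
    ContinuousAt (pullCovector lam G) p := by
  obtain ⟨x₀, U, η, hη, hU, hlam⟩ := h
  have hchart : ContDiffAt ℝ 1 (chartAt E x₀ ∘ G) p :=
    ContMDiffAt.chartAt_comp (by simp) hG (hlam _ hp).1
  refine ContinuousAt.congr ?_ (eventually_pullCovector_eq hS
    (fun x hx => ⟨(hlam x hx).1, (hlam x hx).2.2⟩) hG hp).symm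
  refine ContinuousAt.clm_comp ?_ (hchart.fderiv_right (m := 0) (by simp)).continuousAt
  exact ContinuousAt.comp (hη.1 _ (hlam _ hp).2.1).continuousAt hchart.continuousAt

theorem continuousAt_pullForm (Ω : SymplecticForm E M) {G : F → M} {p : F}
    (hG : ContMDiffAt 𝓘(ℝ, F) 𝓘(ℝ, E) 1 G p) (a b : F) :
    ContinuousAt (fun q => pullForm Ω.form G q a b) p := by
  have hx : G p ∈ (chartAt E (G p)).source := mem_chart_source E (G p)
  have hchart : ContDiffAt ℝ 1 (chartAt E (G p) ∘ G) p :=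
    ContMDiffAt.chartAt_comp (by simp) hG hx
  have hev : pullForm Ω.form G =ᶠ[𝓝 p] fun q =>
      (formInChart Ω.form (G p) ((chartAt E (G p) ∘ G) q)).bilinearComp
      (fderiv ℝ (chartAt E (G p) ∘ G) q) (fderiv ℝ (chartAt E (G p) ∘ G) q) := by
    filter_upwards [eventually_contMDiffAt_one hG,
      hG.continuousAt.preimage_mem_nhds ((chartAt E (G p)).open_source.mem_nhds hx)] with q hq hqS
    exact pullForm_eq Ω.form hqS (hq.mdifferentiableAt (by simp))
  refine ContinuousAt.congr ?_ (hev.fun_comp (fun T => T a b)).symm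
  have hf : ContinuousAt (fderiv ℝ (chartAt E (G p) ∘ G)) p :=
    (hchart.fderiv_right (m := 0) (by simp)).continuousAt
  have hT : ContinuousAt (fun q => formInChart Ω.form (G p) ((chartAt E (G p) ∘ G) q)) p :=
    ContinuousAt.comp (f := chartAt E (G p) ∘ G) (((Ω.smooth (G p)).continuousOn).continuousAt
      ((chartAt E (G p)).open_target.mem_nhds ((chartAt E (G p)).map_source hx))) hchart.continuousAt
  exact (hT.clm_apply (hf.clm_apply continuousAt_const)).clm_apply (hf.clm_apply continuousAt_const)

end Charts

/-! ### Convex chart balls and the local potentials built from them. -/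

section ChartBalls

variable {E : Type*} [NormedAddCommGroup E] [NormedSpace ℝ E]
variable {M : Type} [TopologicalSpace M] [ChartedSpace E M]

variable (E M) in
/-- A ball in the target of a chart. -/
structure ChartBall where
  base : M
  center : E
  radius : ℝ
  subset : Metric.ball center radius ⊆ (chartAt E base).target

/-- The open subset of the manifold that corresponds to a ball in a chart. -/
def ChartBall.carrier (B : ChartBall E M) : Set M :=
  (chartAt E B.base).source ∩ chartAt E B.base ⁻¹' Metric.ball B.center B.radius

theorem ChartBall.isOpen_carrier (B : ChartBall E M) : IsOpen B.carrier :=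
  (chartAt E B.base).isOpen_inter_preimage Metric.isOpen_ball

theorem exists_chartBall {O : Set M} (hO : IsOpen O) {x : M} (hx : x ∈ O) :
    ∃ B : ChartBall E M, x ∈ B.carrier ∧ B.carrier ⊆ O := by
  have h := (chartAt E x).isOpen_inter_preimage_symm hO
  have hxx : chartAt E x x ∈ (chartAt E x).target ∩ (chartAt E x).symm ⁻¹' O :=
    ⟨mem_chart_target E x, by simpa using hx⟩
  obtain ⟨r, hr, hsub⟩ := Metric.isOpen_iff.1 h _ hxx
  refine ⟨⟨x, chartAt E x x, r, fun y hy => (hsub hy).1⟩, ⟨mem_chart_source E x,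
    Metric.mem_ball_self hr⟩, fun y hy => ?_⟩
  have := (hsub hy.2).2
  rwa [mem_preimage, (chartAt E x).left_inv hy.1] at this

/-- The smallest level of a star refinement of a family of sets indexed by points. -/
def ChartBall.Refines (B : ChartBall E M) (i : M → ChartBall E M) : Prop :=
  ∀ y ∈ B.carrier, B.carrier ⊆ (i y).carrier

/-- This is star refinement within chart balls satisfying `P`: a ball that refines `i` lies in the
ball chosen for each of its points. Iteration yields nested levels. -/
theorem exists_chartBall_refining [CompactSpace M] [T2Space M] (P : ChartBall E M → Prop)
    (hP : ∀ x, ∃ B, P B ∧ x ∈ B.carrier) :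
    ∃ i : M → ChartBall E M, (∀ x, P (i x)) ∧ ∀ x, ∃ B : ChartBall E M, B.Refines i ∧
      x ∈ B.carrier := by
  obtain ⟨i, hi⟩ := exists_star_refinement (S := fun B : {B : ChartBall E M // P B} => B.1.carrier)
    (fun B => B.1.isOpen_carrier) (fun x => by
      obtain ⟨B, hB, hx⟩ := hP x
      exact ⟨⟨B, hB⟩, hx⟩)
  refine ⟨fun x => (i x).1, fun x => (i x).2, fun x => ?_⟩
  obtain ⟨O, hO, hx, h⟩ := hi x
  obtain ⟨B, hxB, hB⟩ := exists_chartBall (E := E) hO hx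
  exact ⟨B, fun y hy => hB.trans (h y (hB hy)), hxB⟩

variable [IsManifold 𝓘(ℝ, E) ∞ M]

theorem ChartBall.exists_potential [FiniteDimensional ℝ E] (Ω : SymplecticForm E M) (B : ChartBall E M) :
    ∃ lam : M → E →L[ℝ] ℝ, IsChartPotential Ω lam B.carrier := by
  obtain ⟨η, hη⟩ := exists_isPrimitiveOn (Θ := formInChart Ω.form B.base)
    (Metric.isOpen_ball (x := B.center) (ε := B.radius)) (convex_ball _ _)
    (((Ω.smooth B.base).of_le (by norm_cast)).mono B.subset)
    (fun y _ a => Ω.alternating _ _) (fun y hy => Ω.closed B.base y (B.subset hy))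
  exact ⟨fun x => (η (chartAt E B.base x)).comp
    (mfderiv 𝓘(ℝ, E) 𝓘(ℝ, E) (chartAt E B.base) x), B.base, _, η, hη, Metric.isOpen_ball,
    fun x hx => ⟨hx.1, hx.2, rfl⟩⟩

/-- The difference of two potentials is closed, and the ball is convex in its chart, so it is exact
there. -/
theorem ChartBall.exists_primitive {Ω : SymplecticForm E M} (B : ChartBall E M)
    {lam lam' : M → E →L[ℝ] ℝ} {S S' : Set M} (h : IsChartPotential Ω lam S)
    (h' : IsChartPotential Ω lam' S') (hS : IsOpen S) (hS' : IsOpen S') (hB : B.carrier ⊆ S)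
    (hB' : B.carrier ⊆ S') :
    ∃ g : M → ℝ, ∀ x ∈ B.carrier, HasMFDerivAt 𝓘(ℝ, E) 𝓘(ℝ, ℝ) g x (lam x - lam' x) := by
  have hG : ∀ y ∈ Metric.ball B.center B.radius,
      ContMDiffAt 𝓘(ℝ, E) 𝓘(ℝ, E) 2 (chartAt E B.base).symm y := fun y hy =>
    (contMDiffAt_chartAt_symm (B.subset hy)).of_le (by norm_cast)
  have hmem : ∀ y ∈ Metric.ball B.center B.radius, (chartAt E B.base).symm y ∈ B.carrier :=
    fun y hy => ⟨(chartAt E B.base).map_target (B.subset hy), by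
      rwa [mem_preimage, (chartAt E B.base).right_inv (B.subset hy)]⟩
  obtain ⟨g, hg⟩ := (h.isPrimitiveOn_pull hS hG (fun y hy => hB (hmem y hy))).exists_hasFDerivAt_sub
    (h'.isPrimitiveOn_pull hS' hG (fun y hy => hB' (hmem y hy))) Metric.isOpen_ball (convex_ball _ _)
  refine ⟨g ∘ chartAt E B.base, fun x hx => ?_⟩
  have h1 := (hg _ hx.2).hasMFDerivAt.comp x
    ((contMDiffAt_chartAt_two hx.1).mdifferentiableAt (by simp)).hasMFDerivAt
  refine h1.congr_mfderiv ?_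
  have key : ∀ (l : M → E →L[ℝ] ℝ) (a : E),
      pullCovector l (chartAt E B.base).symm (chartAt E B.base x)
        (mfderiv 𝓘(ℝ, E) 𝓘(ℝ, E) (chartAt E B.base) x a) = l x a := by
    intro l a
    change l ((chartAt E B.base).symm (chartAt E B.base x)) _ = l x a
    rw [(chartAt E B.base).left_inv hx.1]
    exact congrArg (l x) (mfderiv_chartAt_symm_comp hx.1 a)
  refine ContinuousLinearMap.ext fun a => ?_
  exact congrArg₂ (fun s t : ℝ => s - t) (key lam a) (key lam' a)

theorem ChartBall.sub_eq_of_hasMFDerivAt (B : ChartBall E M) {g : M → ℝ}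
    (hg : ∀ x ∈ B.carrier, HasMFDerivAt 𝓘(ℝ, E) 𝓘(ℝ, ℝ) g x (0 : E →L[ℝ] ℝ)) {x y : M}
    (hx : x ∈ B.carrier) (hy : y ∈ B.carrier) : g x = g y := by
  have hmem : ∀ y ∈ Metric.ball B.center B.radius, (chartAt E B.base).symm y ∈ B.carrier :=
    fun y hy => ⟨(chartAt E B.base).map_target (B.subset hy), by
      rwa [mem_preimage, (chartAt E B.base).right_inv (B.subset hy)]⟩
  have h1 : ∀ y ∈ Metric.ball B.center B.radius,
      HasFDerivAt (g ∘ (chartAt E B.base).symm) (0 : E →L[ℝ] ℝ) y := fun y hy => by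
    have := (hg _ (hmem y hy)).comp y
      ((contMDiffAt_chartAt_symm (B.subset hy)).mdifferentiableAt (by simp)).hasMFDerivAt
    refine (this.congr_mfderiv ?_).hasFDerivAt
    exact ContinuousLinearMap.ext fun a => rfl
  have := (convex_ball B.center B.radius).is_const_of_fderivWithin_eq_zero (𝕜 := ℝ)
    (fun y hy => (h1 y hy).differentiableAt.differentiableWithinAt)
    (fun y hy => by
      rw [fderivWithin_of_isOpen Metric.isOpen_ball hy, (h1 y hy).fderiv]) hx.2 hy.2
  simpa [(chartAt E B.base).left_inv hx.1, (chartAt E B.base).left_inv hy.1] using this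

/-- Local potentials `pot v` of `Ω` on the sets of an open cover, together with cochains whose
differences are integrals of the differences of the potentials. -/
structure LocalPotentials {ι : Type*} (Ω : SymplecticForm E M) (V : ι → Set M)
    (pot : ι → M → E →L[ℝ] ℝ) (f : M → M → M → ℝ) (I : ι → M → M → ℝ) : Prop
    extends IsLocalCoboundary V f I where
  self : ∀ v x, I v x x = 0
  potential : ∀ v, IsChartPotential Ω (pot v) (V v)
  exists_primitive : ∀ v v', ∃ g : M → ℝ,
    (∀ x ∈ V v ∩ V v', HasMFDerivAt 𝓘(ℝ, E) 𝓘(ℝ, ℝ) g x (pot v x - pot v' x)) ∧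
    ∀ x ∈ V v ∩ V v', ∀ y ∈ V v ∩ V v', I v x y - I v' x y = g y - g x

/-- Intersections of chart balls need not be connected, so uniqueness of primitives on them is not
available. Three nested refinements replace good covers: whatever is to be compared on an
intersection is defined on one larger convex ball. Morally `I v x y` is the integral of `lam v - lam
x` from `x` to `y`. In `I v - I v'` the potential `lam x` cancels, leaving the coboundary of a
primitive of `lam v - lam v'`, and hence the coboundary of `I v` is independent of `v`. -/
theorem exists_localPotentials [FiniteDimensional ℝ E] [CompactSpace M] [T2Space M] (Ω : SymplecticForm E M) :
    ∃ (V : M → Set M) (pot : M → M → E →L[ℝ] ℝ) (f : M → M → M → ℝ)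
      (I : M → M → M → ℝ), LocalPotentials Ω V pot f I := by
  classical
  obtain ⟨i0, -, h0⟩ := exists_chartBall_refining (E := E) (M := M) (fun _ => True) (fun x => by
    obtain ⟨B, hB, -⟩ := exists_chartBall (E := E) isOpen_univ (mem_univ x)
    exact ⟨B, trivial, hB⟩)
  obtain ⟨i1, hi1, h1⟩ := exists_chartBall_refining (E := E) (M := M) _ h0
  obtain ⟨i2, hi2, h2⟩ := exists_chartBall_refining (E := E) (M := M) _ h1
  -- Potentials live on the balls `i0`, primitives of differences of two indexed potentials on `i1`,
  -- the functions `g v x` on `i2`, and the cover itself consists of the balls `B`.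
  choose B hB hp using h2
  let V : M → Set M := fun v => (B v).carrier
  choose lam hlam using fun x => (i0 x).exists_potential Ω
  have hV2 : ∀ (v : M), ∀ x ∈ V v, V v ⊆ (i2 x).carrier := fun v x hx => hB v x hx
  have h21 : ∀ (v : M), ∀ x ∈ V v, ∀ y ∈ V v, (i2 x).carrier ⊆ (i1 y).carrier :=
    fun v x hx y hy => hi2 x y (hV2 v x hx hy)
  have h10 : ∀ (v : M), ∀ x ∈ V v, ∀ y ∈ V v, (i1 x).carrier ⊆ (i0 y).carrier :=
    fun v x hx y hy => hi1 x y (h21 v x hx x hx (hV2 v x hx hy))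
  have hg : ∀ v x, ∃ g : M → ℝ, x ∈ V v → ∀ y ∈ (i2 x).carrier,
      HasMFDerivAt 𝓘(ℝ, E) 𝓘(ℝ, ℝ) g y (lam v y - lam x y) := by
    intro v x
    by_cases hx : x ∈ V v
    · obtain ⟨g, hg⟩ := (i2 x).exists_primitive (hlam v) (hlam x) (i0 v).isOpen_carrier
        (i0 x).isOpen_carrier ((h21 v x hx x hx).trans (h10 v x hx _ (hp v)))
        ((h21 v x hx x hx).trans (h10 v x hx x hx))
      exact ⟨g, fun _ => hg⟩
    · exact ⟨0, fun h => absurd h hx⟩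
  choose g hg using hg
  let I : M → M → M → ℝ := fun v x y => g v x y - g v x x
  have hdiff : ∀ v v', ∃ G : M → ℝ,
      (∀ x ∈ V v ∩ V v', HasMFDerivAt 𝓘(ℝ, E) 𝓘(ℝ, ℝ) G x (lam v x - lam v' x)) ∧
      ∀ x ∈ V v ∩ V v', ∀ y ∈ V v ∩ V v', I v x y - I v' x y = G y - G x := by
    intro v v'
    rcases (V v ∩ V v').eq_empty_or_nonempty with he | ⟨x₀, hx₀, hx₀'⟩
    · exact ⟨0, by simp [he], by simp [he]⟩
    -- One primitive `G` on the ball of a single point `x₀` serves for the whole intersection, even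
    -- a disconnected one.
    obtain ⟨G, hG⟩ := (i1 x₀).exists_primitive (hlam v) (hlam v')
      (i0 v).isOpen_carrier (i0 v').isOpen_carrier (h10 v x₀ hx₀ _ (hp v))
      (h10 v' x₀ hx₀' _ (hp v'))
    refine ⟨G, fun x hx => hG x (h21 v x₀ hx₀ x₀ hx₀ (hV2 v x₀ hx₀ hx.1)), ?_⟩
    intro x hx y hy
    -- Here `lam x` drops out, so `g v x - g v' x - G` has zero derivative on a connected ball that
    -- contains both `x` and `y`.
    have hd : ∀ q ∈ (i2 x).carrier, HasMFDerivAt 𝓘(ℝ, E) 𝓘(ℝ, ℝ) (g v x - g v' x - G) q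
        (0 : E →L[ℝ] ℝ) := fun q hq => by
      refine (((hg v x hx.1 q hq).sub (hg v' x hx.2 q hq)).sub
        (hG q (h21 v x hx.1 x₀ hx₀ hq))).congr_mfderiv ?_
      exact ContinuousLinearMap.ext fun a => by
        change (lam v q a - lam x q a : ℝ) - (lam v' q a - lam x q a) - (lam v q a - lam v' q a) = 0
        ring
    have := (i2 x).sub_eq_of_hasMFDerivAt hd (hV2 v x hx.1 hx.1) (hV2 v x hx.1 hy.1)
    simp only [Pi.sub_apply] at this
    simp only [I]
    linarith
  let f : M → M → M → ℝ := fun x y z => if h : ∃ v, x ∈ V v ∧ y ∈ V v ∧ z ∈ V v then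
    I h.choose x y + I h.choose y z - I h.choose x z else 0
  refine ⟨V, lam, f, I, ⟨⟨fun v => (B v).isOpen_carrier, fun x => ⟨x, hp x⟩, ?_, ?_⟩, ?_, ?_, hdiff⟩⟩
  · intro v x hx y hy z hz
    have h : ∃ v, x ∈ V v ∧ y ∈ V v ∧ z ∈ V v := ⟨v, hx, hy, hz⟩
    obtain ⟨hx', hy', hz'⟩ := h.choose_spec
    obtain ⟨G, -, hG⟩ := hdiff v h.choose
    have e1 := hG x ⟨hx, hx'⟩ y ⟨hy, hy'⟩
    have e2 := hG y ⟨hy, hy'⟩ z ⟨hz, hz'⟩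
    have e3 := hG x ⟨hx, hx'⟩ z ⟨hz, hz'⟩
    simp only [f, dif_pos h]
    linarith
  · intro v v'
    obtain ⟨G, -, hG⟩ := hdiff v v'
    exact ⟨G, hG⟩
  · intro v x
    exact sub_self _
  · exact fun v => (hlam v).mono ((hV2 v _ (hp v)).trans
      ((h21 v _ (hp v) _ (hp v)).trans (h10 v _ (hp v) _ (hp v))))

end ChartBalls

/-! ### Stokes' theorem for cochains with local potentials -/

section Rectangles

variable {E : Type*} [NormedAddCommGroup E] [NormedSpace ℝ E]
variable {M : Type} [TopologicalSpace M] [ChartedSpace E M] [IsManifold 𝓘(ℝ, E) ∞ M]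

/-- The integral of a covector field along a path. -/
def lineInt (lam : M → E →L[ℝ] ℝ) (e : ℝ → M) (a b : ℝ) : ℝ :=
  ∫ t in a..b, pullCovector lam e t 1

/-- The symplectic area of a rectangle. -/
def rectArea (Ω : SymplecticForm E M) (G : ℝ × ℝ → M) (p p' t t' : ℝ) : ℝ :=
  ∫ a in p..p', ∫ b in t..t', pullForm Ω.form G (a, b) (1, 0) (0, 1)

theorem pullCovector_horizontal (lam : M → E →L[ℝ] ℝ) {G : ℝ × ℝ → M} {a b : ℝ}
    (hG : ContMDiffAt 𝓘(ℝ, ℝ × ℝ) 𝓘(ℝ, E) 1 G (a, b)) :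
    pullCovector lam (fun a => G (a, b)) a 1 = pullCovector lam G (a, b) (1, 0) := by
  have h1 : HasFDerivAt (fun a : ℝ => (a, b)) ((ContinuousLinearMap.id ℝ ℝ).prod 0) a :=
    (hasFDerivAt_id a).prodMk (hasFDerivAt_const b a)
  have h2 := (hG.mdifferentiableAt (by simp)).hasMFDerivAt.comp a h1.hasMFDerivAt
  have h3 : mfderiv 𝓘(ℝ, ℝ) 𝓘(ℝ, E) (fun a => G (a, b)) a = _ := h2.mfderiv
  rw [pullCovector, pullCovector, h3]
  rfl

theorem pullCovector_vertical (lam : M → E →L[ℝ] ℝ) {G : ℝ × ℝ → M} {a b : ℝ}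
    (hG : ContMDiffAt 𝓘(ℝ, ℝ × ℝ) 𝓘(ℝ, E) 1 G (a, b)) :
    pullCovector lam (fun b => G (a, b)) b 1 = pullCovector lam G (a, b) (0, 1) := by
  have h1 : HasFDerivAt (fun b : ℝ => (a, b)) ((0 : ℝ →L[ℝ] ℝ).prod (ContinuousLinearMap.id ℝ ℝ)) b :=
    (hasFDerivAt_const a b).prodMk (hasFDerivAt_id b)
  have h2 := (hG.mdifferentiableAt (by simp)).hasMFDerivAt.comp b h1.hasMFDerivAt
  have h3 : mfderiv 𝓘(ℝ, ℝ) 𝓘(ℝ, E) (fun b => G (a, b)) b = _ := h2.mfderiv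
  rw [pullCovector, pullCovector, h3]
  rfl

theorem continuousOn_pullForm (Ω : SymplecticForm E M) {G : ℝ × ℝ → M} {K : Set (ℝ × ℝ)}
    (hG : ∀ x ∈ K, ContMDiffAt 𝓘(ℝ, ℝ × ℝ) 𝓘(ℝ, E) 1 G x) (v w : ℝ × ℝ) :
    ContinuousOn (fun x => pullForm Ω.form G x v w) K := fun x hx =>
  (continuousAt_pullForm Ω (hG x hx) v w).continuousWithinAt

theorem integral_prod_Icc_eq {F : ℝ × ℝ → ℝ} {p p' t t' : ℝ} (hp : p ≤ p') (ht : t ≤ t')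
    (hF : ContinuousOn F (Icc p p' ×ˢ Icc t t')) :
    ∫ x in Icc p p' ×ˢ Icc t t', F x = ∫ a in p..p', ∫ b in t..t', F (a, b) := by
  have hi := hF.integrableOn_compact (μ := volume) (isCompact_Icc.prod isCompact_Icc)
  rw [Measure.volume_eq_prod] at hi ⊢
  rw [setIntegral_prod _ hi, intervalIntegral.integral_of_le hp, integral_Icc_eq_integral_Ioc]
  congr 1 with a
  rw [intervalIntegral.integral_of_le ht, integral_Icc_eq_integral_Ioc]

variable {ι : Type*} {Ω : SymplecticForm E M} {V : ι → Set M} {pot : ι → M → E →L[ℝ] ℝ}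
  {f : M → M → M → ℝ} {I : ι → M → M → ℝ}

open Classical in
/-- The difference between the integral of a potential and the value of the cochain along a short
path. -/
def edgeDefect (V : ι → Set M) (pot : ι → M → E →L[ℝ] ℝ) (I : ι → M → M → ℝ) (e : ℝ → M)
    (a b : ℝ) : ℝ :=
  if h : ∃ v, ∀ t ∈ Icc a b, e t ∈ V v then
    lineInt (pot h.choose) e a b - I h.choose (e a) (e b) else 0

theorem LocalPotentials.intervalIntegrable (h : LocalPotentials Ω V pot f I) {e : ℝ → M} {a b : ℝ}
    (hab : a ≤ b) {v : ι} (hv : ∀ t ∈ Icc a b, e t ∈ V v)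
    (he : ∀ t ∈ Icc a b, ContMDiffAt 𝓘(ℝ, ℝ) 𝓘(ℝ, E) 1 e t) :
    IntervalIntegrable (fun t => pullCovector (pot v) e t 1) volume a b := by
  refine ContinuousOn.intervalIntegrable_of_Icc hab fun t ht => ?_
  exact (((h.potential v).continuousAt_pull (h.isOpen v) (he t ht) (hv t ht)).clm_apply
    continuousAt_const).continuousWithinAt

theorem LocalPotentials.lineInt_sub (h : LocalPotentials Ω V pot f I) {e : ℝ → M} {a b : ℝ}
    (hab : a ≤ b) {v v' : ι} (hv : ∀ t ∈ Icc a b, e t ∈ V v) (hv' : ∀ t ∈ Icc a b, e t ∈ V v')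
    (he : ∀ t ∈ Icc a b, ContMDiffAt 𝓘(ℝ, ℝ) 𝓘(ℝ, E) 1 e t) {g : M → ℝ}
    (hg : ∀ x ∈ V v ∩ V v', HasMFDerivAt 𝓘(ℝ, E) 𝓘(ℝ, ℝ) g x (pot v x - pot v' x)) :
    lineInt (pot v) e a b - lineInt (pot v') e a b = g (e b) - g (e a) := by
  have h1 := h.intervalIntegrable hab hv he
  have h2 := h.intervalIntegrable hab hv' he
  rw [lineInt, lineInt, ← intervalIntegral.integral_sub h1 h2]
  refine intervalIntegral.integral_eq_sub_of_hasDerivAt (f := g ∘ e) (fun t ht => ?_) (h1.sub h2)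
  rw [uIcc_of_le hab] at ht
  have h3 : HasFDerivAt (g ∘ e) ((pot v (e t) - pot v' (e t)).comp
      (mfderiv 𝓘(ℝ, ℝ) 𝓘(ℝ, E) e t : ℝ →L[ℝ] E)) t :=
    ((hg _ ⟨hv t ht, hv' t ht⟩).comp t
      ((he t ht).mdifferentiableAt (by simp)).hasMFDerivAt).hasFDerivAt
  exact h3.hasDerivAt

/-- The defect does not depend on the chosen index: changing it alters the line integral and the
cochain by the same difference of values of `g`. -/
theorem LocalPotentials.edgeDefect_eq (h : LocalPotentials Ω V pot f I) {e : ℝ → M} {a b : ℝ}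
    (hab : a ≤ b) {v : ι} (hv : ∀ t ∈ Icc a b, e t ∈ V v)
    (he : ∀ t ∈ Icc a b, ContMDiffAt 𝓘(ℝ, ℝ) 𝓘(ℝ, E) 1 e t) :
    edgeDefect V pot I e a b = lineInt (pot v) e a b - I v (e a) (e b) := by
  have hex : ∃ v, ∀ t ∈ Icc a b, e t ∈ V v := ⟨v, hv⟩
  rw [edgeDefect, dif_pos hex]
  obtain ⟨g, hg, hI⟩ := h.exists_primitive hex.choose v
  have e1 := h.lineInt_sub hab hex.choose_spec hv he hg
  have ha := left_mem_Icc.2 hab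
  have hb := right_mem_Icc.2 hab
  have e2 := hI (e a) ⟨hex.choose_spec a ha, hv a ha⟩ (e b) ⟨hex.choose_spec b hb, hv b hb⟩
  linarith

/-- Stokes' theorem expresses the area by line integrals of one potential over the sides, and the
cochain is the coboundary of `I v`, whose diagonal term cancels between the two triangles. What is
left are the defects of the four sides. -/
theorem LocalPotentials.rectValue_eq (h : LocalPotentials Ω V pot f I) {G : ℝ × ℝ → M} {p p' t t' : ℝ}
    (hp : p ≤ p') (ht : t ≤ t') (hsmall : IsSmallRect V G p p' t t')
    (hG : ∀ x ∈ Icc p p' ×ˢ Icc t t', ContMDiffAt 𝓘(ℝ, ℝ × ℝ) 𝓘(ℝ, E) 2 G x) :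
    rectArea Ω G p p' t t' - rectValue f G p p' t t' =
      edgeDefect V pot I (fun a => G (a, t)) p p' + edgeDefect V pot I (fun b => G (p', b)) t t'
        - edgeDefect V pot I (fun b => G (p, b)) t t'
        - edgeDefect V pot I (fun a => G (a, t')) p p' := by
  obtain ⟨v, hv⟩ := hsmall
  have hG1 : ∀ x ∈ Icc p p' ×ˢ Icc t t', ContMDiffAt 𝓘(ℝ, ℝ × ℝ) 𝓘(ℝ, E) 1 G x :=
    fun x hx => (hG x hx).of_le (by norm_num)
  have hpl := left_mem_Icc.2 hp
  have hpr := right_mem_Icc.2 hp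
  have htl := left_mem_Icc.2 ht
  have htr := right_mem_Icc.2 ht
  have hh : ∀ b ∈ Icc t t', ∀ a ∈ Icc p p', ContMDiffAt 𝓘(ℝ, ℝ) 𝓘(ℝ, E) 1 (fun a => G (a, b)) a :=
    fun b hb a ha => (hG1 (a, b) ⟨ha, hb⟩).comp a (f := fun a : ℝ => (a, b))
      (contDiffAt_id.prodMk contDiffAt_const).contMDiffAt
  have hvt : ∀ a ∈ Icc p p', ∀ b ∈ Icc t t', ContMDiffAt 𝓘(ℝ, ℝ) 𝓘(ℝ, E) 1 (fun b => G (a, b)) b :=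
    fun a ha b hb => (hG1 (a, b) ⟨ha, hb⟩).comp b (f := fun b : ℝ => (a, b))
      (contDiffAt_const.prodMk contDiffAt_id).contMDiffAt
  rw [h.edgeDefect_eq hp (fun a ha => hv a ha t htl) (hh t htl),
    h.edgeDefect_eq hp (fun a ha => hv a ha t' htr) (hh t' htr),
    h.edgeDefect_eq ht (fun b hb => hv p hpl b hb) (hvt p hpl),
    h.edgeDefect_eq ht (fun b hb => hv p' hpr b hb) (hvt p' hpr), rectValue,
    h.eq v _ (hv p hpl t htl) _ (hv p' hpr t htl) _ (hv p' hpr t' htr),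
    h.eq v _ (hv p hpl t htl) _ (hv p hpl t' htr) _ (hv p' hpr t' htr)]
  have hc := continuousOn_pullForm Ω hG1 (1, 0) (0, 1)
  have key := ((h.potential v).isPrimitiveOn_pull (h.isOpen v) hG
    (fun x hx => hv x.1 hx.1 x.2 hx.2)).integral_rect hp ht hc
  rw [integral_prod_Icc_eq hp ht hc] at key
  have eh : ∀ b ∈ Icc t t', lineInt (pot v) (fun a => G (a, b)) p p' =
      ∫ a in p..p', pullCovector (pot v) G (a, b) (1, 0) := fun b hb => by
    refine intervalIntegral.integral_congr fun a ha => ?_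
    rw [uIcc_of_le hp] at ha
    exact pullCovector_horizontal _ (hG1 (a, b) ⟨ha, hb⟩)
  have ev : ∀ a ∈ Icc p p', lineInt (pot v) (fun b => G (a, b)) t t' =
      ∫ b in t..t', pullCovector (pot v) G (a, b) (0, 1) := fun a ha => by
    refine intervalIntegral.integral_congr fun b hb => ?_
    rw [uIcc_of_le ht] at hb
    exact pullCovector_vertical _ (hG1 (a, b) ⟨ha, hb⟩)
  rw [rectArea, key, eh t htl, eh t' htr, ev p hpl, ev p' hpr]
  ring

/-- The sum of the defects of the pieces of a subdivided path. -/
def pathDefect (V : ι → Set M) (pot : ι → M → E →L[ℝ] ℝ) (I : ι → M → M → ℝ) (e : ℝ → M)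
    (N : ℕ) : ℝ :=
  ∑ l ∈ Finset.range N, edgeDefect V pot I e (unif N l) (unif N (l + 1))

theorem Icc_unif_subset {N k : ℕ} (hk : k < N) : Icc (unif N k) (unif N (k + 1)) ⊆ Icc 0 1 := by
  have hN : (0 : ℝ) < N := by exact_mod_cast (Nat.zero_le k).trans_lt hk
  refine Icc_subset_Icc (by unfold unif; positivity) ?_
  rw [unif, div_le_one hN]
  exact_mod_cast hk

theorem rectArea_eq_sum {G : ℝ × ℝ → M} {N : ℕ} (hN : N ≠ 0)
    (hG : ∀ x ∈ Icc (0 : ℝ) 1 ×ˢ Icc (0 : ℝ) 1, ContMDiffAt 𝓘(ℝ, ℝ × ℝ) 𝓘(ℝ, E) 1 G x) :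
    rectArea Ω G 0 1 0 1 = ∑ k ∈ Finset.range N, ∑ l ∈ Finset.range N,
      rectArea Ω G (unif N k) (unif N (k + 1)) (unif N l) (unif N (l + 1)) := by
  have hc := continuousOn_pullForm Ω hG (1, 0) (0, 1)
  have h0 : unif N 0 = 0 := by simp [unif]
  have h1 : unif N N = 1 := by simp [unif, hN]
  have hrow : ∀ a ∈ Icc (0 : ℝ) 1, ContinuousOn
      (fun b => pullForm Ω.form G (a, b) (1, 0) (0, 1)) (Icc 0 1) := fun a ha =>
    hc.comp (by fun_prop) (fun b hb => ⟨ha, hb⟩)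
  have hcol : ∀ l < N, IntervalIntegrable (fun a => ∫ b in unif N l..unif N (l + 1),
      pullForm Ω.form G (a, b) (1, 0) (0, 1)) volume 0 1 := by
    intro l hl
    have hle := unif_le N l
    have hi := (hc.integrableOn_compact (μ := volume) (isCompact_Icc.prod isCompact_Icc)).mono_set
      (prod_mono Ioc_subset_Icc_self (Ioc_subset_Icc_self.trans (Icc_unif_subset hl)))
    rw [IntegrableOn, Measure.volume_eq_prod, ← Measure.prod_restrict] at hi
    rw [intervalIntegrable_iff_integrableOn_Ioc_of_le zero_le_one]
    simp only [intervalIntegral.integral_of_le hle]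
    exact hi.integral_prod_left
  have hsub : ∀ {k : ℕ}, k < N → uIcc (unif N k) (unif N (k + 1)) ⊆ uIcc 0 1 := fun hk => by
    rw [uIcc_of_le (unif_le N _), uIcc_of_le zero_le_one]
    exact Icc_unif_subset hk
  have hsplit : ∀ a ∈ uIcc (0 : ℝ) 1, ∫ b in (0 : ℝ)..1, pullForm Ω.form G (a, b) (1, 0) (0, 1) =
      ∑ l ∈ Finset.range N, ∫ b in unif N l..unif N (l + 1),
        pullForm Ω.form G (a, b) (1, 0) (0, 1) := by
    intro a ha
    rw [uIcc_of_le zero_le_one] at ha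
    rw [intervalIntegral.sum_integral_adjacent_intervals, h0, h1]
    intro l hl
    exact ((hrow a ha).intervalIntegrable_of_Icc zero_le_one).mono_set (hsub hl)
  rw [rectArea, intervalIntegral.integral_congr hsplit, intervalIntegral.integral_finsetSum
    fun l hl => hcol l (Finset.mem_range.1 hl), Finset.sum_comm]
  refine Finset.sum_congr rfl fun l hl => ?_
  simp only [rectArea]
  rw [intervalIntegral.sum_integral_adjacent_intervals (a := unif N), h0, h1]
  intro k hk
  exact (hcol l (Finset.mem_range.1 hl)).mono_set (hsub hk)

/-- Defects do not depend on the choice of potential, so those of interior edges cancel between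
neighbouring cells. -/
theorem LocalPotentials.gridValue_eq (h : LocalPotentials Ω V pot f I) {G : ℝ × ℝ → M} {N : ℕ}
    (hN : N ≠ 0)
    (hG : ∀ x ∈ Icc (0 : ℝ) 1 ×ˢ Icc (0 : ℝ) 1, ContMDiffAt 𝓘(ℝ, ℝ × ℝ) 𝓘(ℝ, E) 2 G x)
    (hsmall : ∀ k < N, ∀ l < N, IsSmallRect V G (unif N k) (unif N (k + 1)) (unif N l)
      (unif N (l + 1))) :
    rectArea Ω G 0 1 0 1 - gridValue f G N =
      pathDefect V pot I (fun a => G (a, 0)) N - pathDefect V pot I (fun a => G (a, 1)) N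
        + pathDefect V pot I (fun b => G (1, b)) N - pathDefect V pot I (fun b => G (0, b)) N := by
  have h0 : unif N 0 = 0 := by simp [unif]
  have h1 : unif N N = 1 := by simp [unif, hN]
  rw [rectArea_eq_sum hN fun x hx => (hG x hx).of_le (by norm_num), gridValue,
    ← Finset.sum_sub_distrib]
  simp only [← Finset.sum_sub_distrib]
  have := sum_grid_boundary
    (fun k l => edgeDefect V pot I (fun a => G (a, unif N l)) (unif N k) (unif N (k + 1)))
    (fun k l => edgeDefect V pot I (fun b => G (unif N k, b)) (unif N l) (unif N (l + 1))) N N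
  simp only [h0, h1] at this
  simp only [pathDefect, ← this]
  refine Finset.sum_congr rfl fun k hk => Finset.sum_congr rfl fun l hl => ?_
  rw [Finset.mem_range] at hk hl
  exact h.rectValue_eq (unif_le N k) (unif_le N l) (hsmall k hk l hl) fun x hx =>
    hG x ⟨Icc_unif_subset hk hx.1, Icc_unif_subset hl hx.2⟩

/-- Sufficiently fine subdivisions of the unit square are small. -/
theorem eventually_isSmallRect {X : Type} [TopologicalSpace X] {V : ι → Set X}
    (hV : ∀ v, IsOpen (V v)) (hcov : ∀ x, ∃ v, x ∈ V v) {G : ℝ × ℝ → X}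
    (hG : ContinuousOn G (Icc (0 : ℝ) 1 ×ˢ Icc (0 : ℝ) 1)) :
    ∀ᶠ N : ℕ in atTop, ∀ k < N, ∀ l < N, IsSmallRect V G (unif N k) (unif N (k + 1)) (unif N l)
      (unif N (l + 1)) := by
  have hK : IsCompact (Icc (0 : ℝ) 1 ×ˢ Icc (0 : ℝ) 1) := isCompact_Icc.prod isCompact_Icc
  have hx : ∀ v, ∃ U : Set (ℝ × ℝ), IsOpen U ∧ G ⁻¹' V v ∩ (Icc (0 : ℝ) 1 ×ˢ Icc (0 : ℝ) 1)
      = U ∩ (Icc (0 : ℝ) 1 ×ˢ Icc (0 : ℝ) 1) := fun v =>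
    (continuousOn_iff'.1 hG) _ (hV v)
  choose U hUo hU using hx
  obtain ⟨δ, hδ, hleb⟩ := lebesgue_number_lemma_of_metric hK hUo (fun x hx => by
    obtain ⟨v, hv⟩ := hcov (G x)
    exact mem_iUnion.2 ⟨v, ((hU v).subset ⟨hv, hx⟩).1⟩)
  obtain ⟨N0, hN0⟩ := exists_nat_gt (1 / δ)
  filter_upwards [eventually_ge_atTop N0] with N hN k hk l hl
  have hNpos : (0 : ℝ) < N := by exact_mod_cast (Nat.zero_le k).trans_lt hk
  have hlt : 1 / (N : ℝ) < δ := by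
    rw [div_lt_iff₀ hNpos]
    rw [div_lt_iff₀ hδ] at hN0
    have : (N0 : ℝ) ≤ N := by exact_mod_cast hN
    nlinarith
  have hcell : ∀ {j : ℕ} {a : ℝ}, a ∈ Icc (unif N j) (unif N (j + 1)) → |a - unif N j| < δ := by
    intro j a ha
    rw [abs_of_nonneg (sub_nonneg.2 ha.1)]
    refine lt_of_le_of_lt ?_ hlt
    have := ha.2
    simp only [unif, Nat.cast_add, Nat.cast_one, add_div] at this ⊢
    linarith
  have hmem : (unif N k, unif N l) ∈ Icc (0 : ℝ) 1 ×ˢ Icc (0 : ℝ) 1 :=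
    ⟨Icc_unif_subset hk (left_mem_Icc.2 (unif_le N k)),
      Icc_unif_subset hl (left_mem_Icc.2 (unif_le N l))⟩
  obtain ⟨v, hv⟩ := hleb _ hmem
  refine ⟨v, fun a ha b hb => ?_⟩
  have hab : (a, b) ∈ U v := hv (by
    rw [Metric.mem_ball, Prod.dist_eq, max_lt_iff]
    exact ⟨hcell ha, hcell hb⟩)
  exact ((hU v).superset ⟨hab, Icc_unif_subset hk ha, Icc_unif_subset hl hb⟩).1

end Rectangles

/-! ### Holomorphic cylindrical ends -/

open Complex in
/-- An injective holomorphic function has nonvanishing derivative. -/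
theorem deriv_ne_zero_of_injOn {f : ℂ → ℂ} {z₀ : ℂ} (hf : AnalyticAt ℂ f z₀) {U : Set ℂ}
    (hU : U ∈ 𝓝 z₀) (hinj : InjOn f U) : deriv f z₀ ≠ 0 := by
  have hf1 : AnalyticAt ℂ (fun z => f z - f z₀) z₀ := hf.sub analyticAt_const
  -- Infinite order would make `f` constant near `z₀`, against injectivity.
  have hne : analyticOrderAt (fun z => f z - f z₀) z₀ ≠ ⊤ := by
    rw [Ne, analyticOrderAt_eq_top]
    intro h
    obtain ⟨z, ⟨hz1, hz2⟩, hz3⟩ := ((h.filter_mono nhdsWithin_le_nhds).and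
      (mem_nhdsWithin_of_mem_nhds hU)).and (self_mem_nhdsWithin (s := {z₀}ᶜ)) |>.exists
    exact hz3 (hinj hz2 (mem_of_mem_nhds hU) (sub_eq_zero.1 hz1))
  obtain ⟨n, hn⟩ := ENat.ne_top_iff_exists.1 hne
  obtain ⟨g, hg, hg0, hfg⟩ := (hf1.analyticOrderAt_eq_natCast (n := n)).1 hn.symm
  have hn0 : n ≠ 0 := by
    rintro rfl
    have := hfg.self_of_nhds
    simp at this
    exact hg0 this.symm
  -- Division by `g z₀` makes the base equal to `1` at `z₀`, where the principal root is analytic.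
  -- Thus `r` is a local coordinate in which `f` is a constant plus `g z₀ * r ^ n`.
  let G : ℂ → ℂ := fun z => (g z / g z₀) ^ (1 / n : ℂ)
  have hGa : AnalyticAt ℂ G z₀ := (hg.div analyticAt_const hg0).cpow analyticAt_const (by
    simp [div_self hg0])
  have hG0 : G z₀ = 1 := by simp [G, div_self hg0]
  let r : ℂ → ℂ := fun z => (z - z₀) * G z
  have hra : AnalyticAt ℂ r z₀ := (analyticAt_id.sub analyticAt_const).mul hGa
  have hrd : HasStrictDerivAt r 1 z₀ := by
    have h1 : HasDerivAt r (1 * G z₀ + (z₀ - z₀) * deriv G z₀) z₀ :=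
      ((hasDerivAt_id z₀).sub_const z₀).mul hGa.differentiableAt.hasDerivAt
    rw [hG0, sub_self, zero_mul, add_zero, one_mul] at h1
    rw [← h1.deriv]
    exact hra.hasStrictDerivAt
  have hr0 : r z₀ = 0 := by simp [r]
  have hmap : map r (𝓝 z₀) = 𝓝 0 := by rw [hrd.map_nhds_eq one_ne_zero, hr0]
  have hrn : ∀ᶠ z in 𝓝 z₀, f z = f z₀ + g z₀ * r z ^ n := by
    filter_upwards [hfg] with z hz
    have hc : G z ^ n = g z / g z₀ := by
      simp only [G, one_div]
      exact cpow_nat_inv_pow _ hn0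
    rw [mul_pow, hc]
    have : f z = f z₀ + (z - z₀) ^ n • g z := by rw [← hz]; ring
    rw [this, smul_eq_mul]
    field_simp
  have hn1 : n = 1 := by
    by_contra hn1
    -- For `n > 1` the points with coordinates `w` and `ζ w` have the same value, contradicting
    -- injectivity.
    have hζ := Complex.isPrimitiveRoot_exp n hn0
    set ζ := Complex.exp (2 * Real.pi * I / n) with hζdef
    have hζ1 : ζ ≠ 1 := hζ.ne_one (by omega)
    have hW : r '' {z | z ∈ U ∧ f z = f z₀ + g z₀ * r z ^ n} ∈ 𝓝 (0 : ℂ) := by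
      rw [← hmap]
      exact image_mem_map (inter_mem hU hrn)
    have hWζ : (fun w => ζ * w) ⁻¹' (r '' {z | z ∈ U ∧ f z = f z₀ + g z₀ * r z ^ n}) ∈ 𝓝 (0 : ℂ) :=
      (continuous_const.mul continuous_id).continuousAt.preimage_mem_nhds (by simpa using hW)
    obtain ⟨w, ⟨⟨z₁, ⟨h1U, h1⟩, hw1⟩, ⟨z₂, ⟨h2U, h2⟩, hw2⟩⟩, hw0⟩ :=
      Filter.nonempty_of_mem (inter_mem (mem_nhdsWithin_of_mem_nhds (inter_mem hW hWζ))
        (self_mem_nhdsWithin (s := {(0 : ℂ)}ᶜ)))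
    have heq : f z₁ = f z₂ := by
      rw [h1, h2, hw1, hw2, mul_pow, hζ.pow_eq_one, one_mul]
    have := hinj h1U h2U heq
    subst this
    rw [hw1] at hw2
    apply hζ1
    have hw0' : w ≠ 0 := hw0
    have : (1 : ℂ) * w = ζ * w := by rw [one_mul]; exact hw2
    exact (mul_right_cancel₀ hw0' this).symm
  subst hn1
  have hd : HasDerivAt f (g z₀) z₀ := by
    have h2 : HasDerivAt (fun z => f z₀ + g z₀ * r z ^ 1) (g z₀) z₀ := by
      simpa using (hrd.hasDerivAt.const_mul (g z₀)).const_add (f z₀)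
    exact h2.congr_of_eventuallyEq hrn
  rwa [hd.deriv]

open Complex Function.Periodic in
/-- The leading coefficient of an injective holomorphic map of a half cylinder to a punctured
disc. -/
theorem exists_tendsto_div_qParam {ψ : ℂ → ℂ} (hd : DifferentiableOn ℂ ψ {ζ | 0 < ζ.im})
    (hper : ∀ ζ, 0 < ζ.im → ψ (ζ + 1) = ψ ζ) (h0 : ∀ ζ, 0 < ζ.im → ψ ζ ≠ 0)
    (hinj : ∀ ζ ζ', 0 < ζ.im → 0 < ζ'.im → ψ ζ = ψ ζ' → ∃ n : ℤ, ζ' = ζ + n)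
    (hlim : Tendsto ψ (comap im atTop) (𝓝 0)) :
    ∃ c : ℂ, c ≠ 0 ∧ Tendsto (fun ζ => ψ ζ / exp (2 * Real.pi * I * ζ)) (comap im atTop) (𝓝 c) := by
  classical
  -- The extension by zero is periodic on the whole plane and agrees with `ψ` near `i∞`.
  let φ : ℂ → ℂ := fun ζ => if 0 < ζ.im then ψ ζ else 0
  have hφ : ∀ ζ, 0 < ζ.im → φ ζ = ψ ζ := fun ζ h => if_pos h
  have hev : ∀ᶠ ζ : ℂ in comap im atTop, 0 < ζ.im := tendsto_comap.eventually (eventually_gt_atTop 0)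
  have hφper : Function.Periodic φ (1 : ℝ) := by
    intro ζ
    by_cases h : 0 < ζ.im
    · have h' : 0 < (ζ + (1 : ℝ)).im := by simpa using h
      rw [hφ _ h, hφ _ h', ofReal_one, hper _ h]
    · have h' : ¬ 0 < (ζ + (1 : ℝ)).im := by simpa using h
      simp only [φ, if_neg h, if_neg h']
  have hopen : IsOpen {ζ : ℂ | 0 < ζ.im} := isOpen_lt continuous_const continuous_im
  have hφd : ∀ ζ : ℂ, 0 < ζ.im → DifferentiableAt ℂ φ ζ := fun ζ h => by
    refine (hd.differentiableAt (hopen.mem_nhds h)).congr_of_eventuallyEq ?_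
    filter_upwards [hopen.mem_nhds h] with ζ' h' using hφ ζ' h'
  have hφlim : Tendsto φ (comap im atTop) (𝓝 0) := hlim.congr' (hev.mono fun ζ h => (hφ ζ h).symm)
  set F := cuspFunction 1 φ with hF
  have hF0 : F 0 = 0 := cuspFunction_zero_of_zero_at_inf one_pos hφlim
  have hFq : ∀ ζ, F (qParam 1 ζ) = φ ζ := eq_cuspFunction (h := 1) one_ne_zero hφper
  -- As a function of `q = exp(2πiζ)`, the map is bounded near the puncture, which is thus a
  -- removable singularity. The extension remains injective on the unit disc because `ψ` has no
  -- zeros.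
  have hFd0 : DifferentiableAt ℂ F 0 := differentiableAt_cuspFunction_zero one_pos hφper
    (hev.mono hφd) (hφlim.isBigO_one ℝ)
  have hball : ∀ q ∈ Metric.ball (0 : ℂ) 1, q ≠ 0 → ∃ ζ : ℂ, 0 < ζ.im ∧ q = qParam 1 ζ := by
    intro q hq hq0
    refine ⟨invQParam 1 q, ?_, (qParam_right_inv one_ne_zero hq0).symm⟩
    rw [← norm_qParam_lt_iff one_pos 0, qParam_right_inv one_ne_zero hq0]
    simpa using hq
  have hFdiff : DifferentiableOn ℂ F (Metric.ball 0 1) := by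
    intro q hq
    rcases eq_or_ne q 0 with rfl | hq0
    · exact hFd0.differentiableWithinAt
    · obtain ⟨ζ, hζ, rfl⟩ := hball q hq hq0
      exact (differentiableAt_cuspFunction one_ne_zero hφper (hφd ζ hζ)).differentiableWithinAt
  have hFinj : InjOn F (Metric.ball 0 1) := by
    intro q hq q' hq' heq
    rcases eq_or_ne q 0 with rfl | hq0 <;> rcases eq_or_ne q' 0 with rfl | hq0'
    · rfl
    · obtain ⟨ζ, hζ, rfl⟩ := hball q' hq' hq0'
      rw [hF0, hFq, hφ _ hζ] at heq
      exact absurd heq.symm (h0 ζ hζ)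
    · obtain ⟨ζ, hζ, rfl⟩ := hball q hq hq0
      rw [hF0, hFq, hφ _ hζ] at heq
      exact absurd heq (h0 ζ hζ)
    · obtain ⟨ζ, hζ, rfl⟩ := hball q hq hq0
      obtain ⟨ζ', hζ', rfl⟩ := hball q' hq' hq0'
      rw [hFq, hFq, hφ _ hζ, hφ _ hζ'] at heq
      obtain ⟨n, rfl⟩ := hinj ζ ζ' hζ hζ' heq
      simp only [qParam, ofReal_one, div_one, mul_add, exp_add]
      have : exp (2 * Real.pi * I * n) = 1 := by
        rw [mul_comm]; exact exp_int_mul_two_pi_mul_I n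
      rw [this, mul_one]
  have hFan : AnalyticAt ℂ F 0 := hFdiff.analyticAt (Metric.ball_mem_nhds 0 one_pos)
  have hc := deriv_ne_zero_of_injOn hFan (Metric.ball_mem_nhds 0 one_pos) hFinj
  refine ⟨deriv F 0, hc, ?_⟩
  -- The quotient in the claim is `F(q)/q`, which tends to the nonzero derivative of `F` at `0`.
  have hslope := hFd0.hasDerivAt.tendsto_slope_zero.comp (qParam_tendsto (h := 1) one_pos)
  refine hslope.congr' ?_
  filter_upwards [hev] with ζ hζ
  simp only [Function.comp, zero_add, hF0, sub_zero, smul_eq_mul]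
  rw [hFq, hφ _ hζ, qParam, ofReal_one, div_one, inv_mul_eq_div]

/-! ### Coordinates on the ends. -/

section Ends

variable (C : CylindricalEnds)

theorem endSign_mul_self (i : Fin 3) : endSign i * endSign i = 1 := by
  fin_cases i <;> norm_num [endSign]

theorem depth_point (i : Fin 3) (s t : ℝ) :
    depth i (((-(endSign i * s) : ℝ) : ℂ) + t * Complex.I) = s := by
  have := endSign_mul_self i
  simp [depth, ← mul_assoc, this]

theorem eq_coord (i : Fin 3) (w : ℂ) :
    w = ((-(endSign i * depth i w) : ℝ) : ℂ) + w.im * Complex.I := by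
  have := endSign_mul_self i
  simp only [depth, mul_neg, ← mul_assoc, this, one_mul, neg_neg]
  exact (Complex.re_add_im w).symm

theorem CylindricalEnds.chart_eq_point (i : Fin 3) (w : ℂ) :
    C.chart i w = C.point i (depth i w) w.im := by
  rw [CylindricalEnds.point, ← eq_coord]

theorem continuous_depth (i : Fin 3) : Continuous (depth i) := by
  unfold depth; fun_prop

theorem isOpen_depth_pos (i : Fin 3) : IsOpen {w | 0 < depth i w} :=
  isOpen_lt continuous_const (continuous_depth i)

theorem CylindricalEnds.analyticAt (i : Fin 3) {w : ℂ} (hw : 0 < depth i w) :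
    AnalyticAt ℂ (C.chart i) w :=
  (C.holomorphic i).analyticAt ((isOpen_depth_pos i).mem_nhds hw)

theorem CylindricalEnds.chart_add_int (i : Fin 3) {w : ℂ} (hw : 0 < depth i w) (n : ℤ) :
    C.chart i (w + n * Complex.I) = C.chart i w := by
  refine ((C.eq_iff i w _ hw ?_).2 ⟨n, rfl⟩).symm
  simpa [depth] using hw

theorem CylindricalEnds.point_add_int (i : Fin 3) {s : ℝ} (hs : 0 < s) (t : ℝ) (n : ℤ) :
    C.point i s (t + n) = C.point i s t := by
  rw [CylindricalEnds.point, CylindricalEnds.point,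
    ← C.chart_add_int i (w := ((-(endSign i * s) : ℝ) : ℂ) + t * Complex.I) (by rwa [depth_point]) n]
  push_cast
  ring_nf

/-- Points of a ball of radius `1/2` are less than `1` apart, so no nontrivial integral translation
relates them. -/
theorem CylindricalEnds.injOn_nhds (i : Fin 3) {w : ℂ} (hw : 0 < depth i w) :
    InjOn (C.chart i) (Metric.ball w (1 / 2) ∩ {w | 0 < depth i w}) := by
  rintro a ⟨ha, ha'⟩ b ⟨hb, hb'⟩ hab
  obtain ⟨n, hn⟩ := (C.eq_iff i a b ha' hb').1 hab
  have hd : dist b a < 1 := by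
    have := dist_triangle_right b a w
    rw [Metric.mem_ball] at ha hb
    linarith
  rw [hn, Complex.dist_eq, add_sub_cancel_left, norm_mul, Complex.norm_I, mul_one,
    Complex.norm_intCast] at hd
  have : n = 0 := Int.abs_lt_one_iff.1 (by exact_mod_cast hd)
  simp [hn, this]

theorem CylindricalEnds.deriv_ne_zero (i : Fin 3) {w : ℂ} (hw : 0 < depth i w) :
    deriv (C.chart i) w ≠ 0 :=
  deriv_ne_zero_of_injOn (C.analyticAt i hw)
    (inter_mem (Metric.ball_mem_nhds w (by norm_num)) ((isOpen_depth_pos i).mem_nhds hw))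
    (C.injOn_nhds i hw)

theorem CylindricalEnds.map_nhds (i : Fin 3) {w : ℂ} (hw : 0 < depth i w) :
    map (C.chart i) (𝓝 w) = 𝓝 (C.chart i w) :=
  (C.analyticAt i hw).hasStrictDerivAt.map_nhds_eq (C.deriv_ne_zero i hw)

end Ends

/-! ### Shape of deep loops near the punctures. -/

section Asymptotics

open Complex in
-- Shifting the angle by the argument of `c` makes the leading coefficient positive, so that deep
-- loops are standard circles up to a relative error of at most `1/2`.
theorem exists_phase_of_tendsto {ψ : ℂ → ℂ} {c : ℂ} (hc : c ≠ 0)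
    (h : Tendsto (fun ζ => ψ ζ / exp (2 * Real.pi * I * ζ)) (comap im atTop) (𝓝 c)) :
    ∃ o : ℝ, ∀ᶠ y : ℝ in atTop, ∀ x : ℝ, ∃ δ : ℂ, ‖δ‖ ≤ 1 / 2 ∧
      ψ ((o + x : ℝ) + y * I) = ((‖c‖ * Real.exp (-(2 * Real.pi * y)) : ℝ) : ℂ) *
        exp (2 * Real.pi * x * I) * (1 + δ) := by
  refine ⟨-(arg c / (2 * Real.pi)), ?_⟩
  have hev : ∀ᶠ ζ : ℂ in comap im atTop, ‖ψ ζ / exp (2 * Real.pi * I * ζ) - c‖ ≤ ‖c‖ / 2 := by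
    have := h.eventually (Metric.closedBall_mem_nhds c (half_pos (norm_pos_iff.2 hc)))
    filter_upwards [this] with ζ hζ
    rwa [← dist_eq]
  rw [eventually_comap] at hev
  filter_upwards [hev] with y hy x
  set ζ : ℂ := ((-(arg c / (2 * Real.pi)) + x : ℝ) : ℂ) + y * I with hζ
  have him : ζ.im = y := by rw [hζ, add_im, ofReal_im, im_ofReal_mul, I_im, mul_one, zero_add]
  refine ⟨ψ ζ / exp (2 * Real.pi * I * ζ) / c - 1, ?_, ?_⟩
  · have := hy ζ him
    rw [div_sub_one hc, norm_div, div_le_iff₀ (norm_pos_iff.2 hc)]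
    linarith
  · have hce : c = ‖c‖ * exp (arg c * I) := (norm_mul_exp_arg_mul_I c).symm
    have hE : exp (2 * Real.pi * I * ζ) * exp (arg c * I) =
        exp ((-(2 * Real.pi * y) : ℝ) : ℂ) * exp (2 * Real.pi * x * I) := by
      rw [← exp_add, ← exp_add]
      congr 1
      rw [hζ]
      have : (Real.pi : ℂ) ≠ 0 := by exact_mod_cast Real.pi_ne_zero
      push_cast
      field_simp
      linear_combination (2 * Real.pi * y : ℂ) * I_sq
    have hne : exp (2 * Real.pi * I * ζ) ≠ 0 := exp_ne_zero _
    rw [add_sub_cancel, ofReal_mul, ofReal_exp, mul_assoc ((‖c‖ : ℝ) : ℂ), ← hE]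
    have : (‖c‖ : ℂ) * (exp (2 * Real.pi * I * ζ) * exp (arg c * I)) =
        exp (2 * Real.pi * I * ζ) * c := by
      linear_combination (exp (2 * Real.pi * I * ζ)) * hce.symm
    rw [this]
    field_simp

variable (C : CylindricalEnds)

theorem CylindricalEnds.eventually_not_mem {K : Set ℂ} (hK : IsCompact K) (hKp : K ⊆ pants)
    (i : Fin 3) : ∃ T, 0 < T ∧ ∀ w, T ≤ depth i w → C.chart i w ∉ K := by
  have hopen : IsOpen (((↑) : ℂ → OnePoint ℂ) '' K)ᶜ := by
    rw [isOpen_compl_iff]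
    exact (hK.image OnePoint.continuous_coe).isClosed
  have hmem : puncture i ∈ (((↑) : ℂ → OnePoint ℂ) '' K)ᶜ := by
    rintro ⟨z, hz, hzi⟩
    have hzp := hKp hz
    fin_cases i <;> simp [puncture] at hzi <;> simp [pants, hzi] at hzp
  have h := (C.tendsto_puncture i).eventually (hopen.mem_nhds hmem)
  rw [eventually_comap] at h
  obtain ⟨T, hT⟩ := eventually_atTop.1 h
  exact ⟨max T 1, by positivity, fun w hw hwK =>
    hT _ ((le_max_left _ _).trans hw) w rfl ⟨_, hwK, rfl⟩⟩

theorem tendsto_comap_depth {α : Type*} {l : Filter α} {g : α → ℂ} (i : Fin 3)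
    (h : Tendsto (fun a => depth i (g a)) l atTop) : Tendsto g l (comap (depth i) atTop) :=
  tendsto_comap_iff.2 h

theorem CylindricalEnds.tendsto_chart_zero : Tendsto (C.chart 0) (comap (depth 0) atTop) (𝓝 0) :=
  OnePoint.isOpenEmbedding_coe.isInducing.tendsto_nhds_iff.2 (C.tendsto_puncture 0)

theorem CylindricalEnds.tendsto_chart_one : Tendsto (C.chart 1) (comap (depth 1) atTop) (𝓝 1) :=
  OnePoint.isOpenEmbedding_coe.isInducing.tendsto_nhds_iff.2 (C.tendsto_puncture 1)

theorem CylindricalEnds.tendsto_chart_two :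
    Tendsto (C.chart 2) (comap (depth 2) atTop) (Bornology.cobounded ℂ) := by
  rw [Metric.cobounded_eq_cocompact, ← OnePoint.comap_coe_nhds_infty (X := ℂ) |>.trans coclosedCompact_eq_cocompact]
  exact tendsto_comap_iff.2 (C.tendsto_puncture 2)

open Complex in
-- The substitution `w = I ζ` turns the half cylinder into the upper half plane, and `σ` moves the
-- puncture to `0`. Positivity of the real part says that the loop stays within a right angle of the
-- standard circle, so that straight segments between them miss the puncture.
theorem CylindricalEnds.exists_phase {i : Fin 3} (hi : endSign i = 1) {σ : ℂ → ℂ}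
    (hσ : Differentiable ℂ σ) (hσi : Function.Injective σ) (hσ0 : ∀ z ∈ pants, σ z ≠ 0)
    (hlim : Tendsto (fun w => σ (C.chart i w)) (comap (depth i) atTop) (𝓝 0)) :
    ∃ o : ℝ, ∀ᶠ s : ℝ in atTop, ∀ t : ℝ,
      0 < (σ (C.point i s (o + t)) * exp (-(2 * Real.pi * t * I))).re ∧
        ‖σ (C.point i s (o + t))‖ < 1 := by
  have hdep : ∀ ζ : ℂ, depth i (I * ζ) = ζ.im := fun ζ => by simp [depth, hi]
  have hten : Tendsto (fun ζ : ℂ => I * ζ) (comap im atTop) (comap (depth i) atTop) :=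
    tendsto_comap_depth i (by simpa only [hdep] using tendsto_comap)
  obtain ⟨c, hc, h⟩ := exists_tendsto_div_qParam (ψ := fun ζ => σ (C.chart i (I * ζ)))
    (fun ζ hζ => (hσ.differentiableAt.comp ζ (((C.analyticAt i
      (by rwa [hdep])).differentiableAt).comp ζ (by fun_prop))).differentiableWithinAt)
    (fun ζ hζ => by
      have := C.chart_add_int i (w := I * ζ) (by rwa [hdep]) 1
      rw [mul_add, mul_one, ← this, Int.cast_one, one_mul])
    (fun ζ hζ => hσ0 _ (C.mem_pants i _ (by rwa [hdep])))
    (fun ζ ζ' hζ hζ' heq => by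
      obtain ⟨n, hn⟩ := (C.eq_iff i _ _ (by rwa [hdep]) (by rwa [hdep])).1 (hσi heq)
      refine ⟨n, mul_left_cancel₀ I_ne_zero ?_⟩
      rw [hn]; ring)
    (hlim.comp hten)
  obtain ⟨o, ho⟩ := exists_phase_of_tendsto hc h
  have hsmall : ∀ᶠ w in comap (depth i) atTop, ‖σ (C.chart i w)‖ < 1 := by
    have := hlim.norm.eventually_lt_const (u := 1) (by simp)
    exact this
  rw [eventually_comap] at hsmall
  refine ⟨o, ?_⟩
  filter_upwards [ho, hsmall] with s hs hs1 t
  have hpt : C.point i s (o + t) = C.chart i (I * (((o + t : ℝ) : ℂ) + s * I)) := by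
    rw [CylindricalEnds.point, hi]
    congr 1
    push_cast
    linear_combination (-(s : ℂ)) * I_sq
  refine ⟨?_, hs1 _ (depth_point i s (o + t))⟩
  obtain ⟨δ, hδ, he⟩ := hs t
  have hre := (abs_le.1 ((abs_re_le_norm δ).trans hδ)).1
  have hcancel : exp (2 * Real.pi * t * I) * exp (-(2 * Real.pi * t * I)) = 1 := by
    rw [← exp_add, add_neg_cancel, exp_zero]
  rw [hpt, he, mul_right_comm, mul_assoc _ (exp _) (exp _), hcancel, mul_one, re_ofReal_mul]
  refine mul_pos (mul_pos (norm_pos_iff.2 hc) (Real.exp_pos _)) ?_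
  rw [add_re, one_re]
  linarith

open Complex in
-- At infinity the previous analysis is applied to the inverse of the chart. The angle runs through
-- half a turn while `t` runs through `[0, 1]`, and the offset `1/4` lets the directions go from `i`
-- through `-1` to `-i`, so that this half loop can be joined to the circle around `0`.
theorem CylindricalEnds.exists_phase_two : ∃ o : ℝ, ∀ R : ℝ, ∀ᶠ s : ℝ in atTop, ∀ t : ℝ,
    R < (C.point 2 s (o + t / 2) * exp (-(Real.pi * (t + 1 / 2) * I))).re := by
  have hi : endSign 2 = -1 := rfl
  have hdep : ∀ ζ : ℂ, depth 2 (-(I * ζ)) = ζ.im := fun ζ => by simp [depth, hi]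
  have hten : Tendsto (fun ζ : ℂ => -(I * ζ)) (comap im atTop) (comap (depth 2) atTop) :=
    tendsto_comap_depth 2 (by simpa only [hdep] using tendsto_comap)
  have hne : ∀ ζ : ℂ, 0 < ζ.im → C.chart 2 (-(I * ζ)) ≠ 0 := fun ζ hζ h0 => by
    have := C.mem_pants 2 (-(I * ζ)) (by rwa [hdep])
    simp [pants, h0] at this
  obtain ⟨c, hc, h⟩ := exists_tendsto_div_qParam (ψ := fun ζ => (C.chart 2 (-(I * ζ)))⁻¹)
    (fun ζ hζ => (DifferentiableAt.inv (h := fun ζ => C.chart 2 (-(I * ζ))) (((C.analyticAt 2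
      (by rwa [hdep])).differentiableAt).comp ζ (by fun_prop)) (hne ζ hζ)).differentiableWithinAt)
    (fun ζ hζ => by
      have := C.chart_add_int 2 (w := -(I * ζ)) (by rwa [hdep]) (-1)
      rw [mul_add, mul_one, ← this, Int.cast_neg, Int.cast_one]
      congr 2; ring)
    (fun ζ hζ => inv_ne_zero (hne ζ hζ))
    (fun ζ ζ' hζ hζ' heq => by
      obtain ⟨n, hn⟩ := (C.eq_iff 2 _ _ (by rwa [hdep]) (by rwa [hdep])).1 (inv_injective heq)
      refine ⟨-n, mul_left_cancel₀ I_ne_zero ?_⟩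
      push_cast
      linear_combination -hn)
    ((tendsto_inv₀_cobounded.comp C.tendsto_chart_two).comp hten)
  obtain ⟨o, ho⟩ := exists_phase_of_tendsto hc h
  refine ⟨-o + 1 / 4, fun R => ?_⟩
  -- The constant `2/9` is the lower bound `(1/2) / (9/4)` for the real part of `(1 + δ)⁻¹` when
  -- `‖δ‖ ≤ 1/2`.
  have hbig : Tendsto (fun s : ℝ => (‖c‖ * Real.exp (-(2 * Real.pi * s)))⁻¹ * (2 / 9)) atTop atTop := by
    have h1 : Tendsto (fun s : ℝ => Real.exp (2 * Real.pi * s)) atTop atTop :=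
      Real.tendsto_exp_atTop.comp (tendsto_id.const_mul_atTop (by positivity))
    have h2 := (h1.const_mul_atTop (inv_pos.2 (norm_pos_iff.2 hc))).atTop_mul_const
      (by norm_num : (0 : ℝ) < 2 / 9)
    refine h2.congr fun s => ?_
    rw [mul_inv, Real.exp_neg, inv_inv]
  filter_upwards [ho, hbig.eventually_gt_atTop R, eventually_gt_atTop 0] with s hs hR hs0 t
  have hpt : C.point 2 s (-o + 1 / 4 + t / 2) =
      C.chart 2 (-(I * (((o + (-(t / 2) - 1 / 4) : ℝ) : ℂ) + s * I))) := by
    rw [CylindricalEnds.point, hi]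
    congr 1
    push_cast
    linear_combination (s : ℂ) * I_sq
  obtain ⟨δ, hδ, he⟩ := hs (-(t / 2) - 1 / 4)
  have hre := (abs_le.1 ((abs_re_le_norm δ).trans hδ)).1
  rw [inv_eq_iff_eq_inv] at he
  have hcancel : (exp (2 * Real.pi * ((-(t / 2) - 1 / 4 : ℝ) : ℂ) * I))⁻¹ *
      exp (-(Real.pi * (t + 1 / 2) * I)) = 1 := by
    rw [← exp_neg, ← exp_add, exp_eq_one_iff]
    refine ⟨0, ?_⟩
    push_cast; ring
  rw [hpt, he, mul_inv, mul_inv, mul_right_comm, mul_assoc _ (exp _)⁻¹ (exp _), hcancel, mul_one,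
    ← ofReal_inv, re_ofReal_mul]
  refine hR.trans_le ?_
  gcongr
  have hn : normSq (1 + δ) ≤ 9 / 4 := by
    rw [normSq_eq_norm_sq]
    have : ‖1 + δ‖ ≤ 3 / 2 := (norm_add_le _ _).trans (by rw [norm_one]; linarith)
    nlinarith [norm_nonneg (1 + δ)]
  have hre1 : (1 : ℝ) / 2 ≤ (1 + δ).re := by rw [add_re, one_re]; linarith
  have hpos : 0 < normSq (1 + δ) := normSq_pos.2 fun h0 => by
    rw [h0, zero_re] at hre1; norm_num at hre1
  rw [inv_re, le_div_iff₀ hpos]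
  linarith

end Asymptotics

/-! ### Compression of the ends, and segments that avoid the punctures. -/

section Compression

variable (C : CylindricalEnds)

theorem isOpen_pants : IsOpen pants := (Set.toFinite {(0 : ℂ), 1}).isClosed.isOpen_compl

theorem CylindricalEnds.exists_im_mem (i : Fin 3) {w : ℂ} (hw : 0 < depth i w) :
    ∃ w', depth i w' = depth i w ∧ w'.im ∈ Ico (0 : ℝ) 1 ∧ C.chart i w' = C.chart i w := by
  refine ⟨w + ((-⌊w.im⌋ : ℤ) : ℂ) * Complex.I, by simp [depth], ?_, C.chart_add_int i hw _⟩
  have : (w + ((-⌊w.im⌋ : ℤ) : ℂ) * Complex.I).im = Int.fract w.im := by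
    simp [Int.fract, sub_eq_add_neg]
  rw [this]
  exact ⟨Int.fract_nonneg _, Int.fract_lt_one _⟩

/-- The image of a closed half cylinder is closed in the pair of pants. -/
theorem CylindricalEnds.eventually_not_mem_image (i : Fin 3) {T : ℝ} (hT : 0 < T) {z : ℂ}
    (hz : z ∈ pants) (h : ∀ w, T ≤ depth i w → C.chart i w ≠ z) :
    ∀ᶠ z' in 𝓝 z, ∀ w, T ≤ depth i w → C.chart i w ≠ z' := by
  obtain ⟨K, hK, hzK, hKp⟩ := exists_compact_subset isOpen_pants hz
  -- Only a compact piece of the cylinder can meet a compact neighbourhood of `z`, and the image of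
  -- a compact set is closed.
  obtain ⟨T', hT', hexit⟩ := C.eventually_not_mem hK hKp i
  let B : Set ℂ := depth i ⁻¹' Icc T T' ∩ Complex.im ⁻¹' Icc 0 1
  have hBc : IsCompact B := by
    refine Metric.isCompact_of_isClosed_isBounded
      ((isClosed_Icc.preimage (continuous_depth i)).inter (isClosed_Icc.preimage Complex.continuous_im)) ?_
    refine (Metric.isBounded_iff_subset_closedBall 0).2 ⟨T' + 1, fun w hw => ?_⟩
    rw [mem_closedBall_zero_iff]
    have h1 : |w.re| = |depth i w| := by
      have := endSign_mul_self i
      rw [depth, abs_neg, abs_mul]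
      have : |endSign i| = 1 := by fin_cases i <;> simp [endSign]
      rw [this, one_mul]
    have h2 : |depth i w| ≤ T' := abs_le.2 ⟨by linarith [hw.1.1], hw.1.2⟩
    have h3 : |w.im| ≤ 1 := abs_le.2 ⟨by linarith [hw.2.1], hw.2.2⟩
    linarith [Complex.norm_le_abs_re_add_abs_im w]
  have himg : IsCompact (C.chart i '' B) := hBc.image_of_continuousOn fun w hw =>
    (C.analyticAt i (hT.trans_le hw.1.1)).continuousAt.continuousWithinAt
  have hzB : z ∉ C.chart i '' B := by
    rintro ⟨w, hw, hwz⟩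
    exact h w hw.1.1 hwz
  filter_upwards [himg.isClosed.isOpen_compl.mem_nhds hzB, mem_interior_iff_mem_nhds.1 hzK]
    with z' hz'B hz'K w hw heq
  have hw' : depth i w < T' := not_le.1 fun hle => hexit w hle (heq ▸ hz'K)
  obtain ⟨w', h1, h2, h3⟩ := C.exists_im_mem i (hT.trans_le hw)
  exact hz'B ⟨w', ⟨by rw [mem_preimage, h1]; exact ⟨hw, hw'.le⟩, h2.1, h2.2.le⟩, h3.trans heq⟩

/-- The compression of `[1, ∞)` to `[1, 2)`. -/
def squash (s : ℝ) : ℝ := if s ≤ 1 then s else 2 - 1 / s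

theorem continuous_squash : Continuous squash := by
  refine continuous_if_le continuous_id continuous_const continuousOn_id ?_ ?_
  · intro s hs
    have : s ≠ 0 := (zero_lt_one.trans_le hs).ne'
    exact (continuousAt_const.sub (continuousAt_const.div continuousAt_id this)).continuousWithinAt
  · rintro s rfl
    norm_num

theorem squash_pos {s : ℝ} (hs : 0 < s) : 0 < squash s := by
  unfold squash
  split_ifs with h
  · exact hs
  · rw [sub_pos, div_lt_iff₀ hs]; linarith

open Classical in
/-- The compression of the ends of the pair of pants. -/
def CylindricalEnds.compress (z : ℂ) : ℂ :=
  if h : ∃ q : Fin 3 × ℂ, 1 < depth q.1 q.2 ∧ C.chart q.1 q.2 = z then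
    C.point h.choose.1 (squash (depth h.choose.1 h.choose.2)) h.choose.2.im else z

/-- The point chosen in the definition is unique up to an integral rotation, because the ends are
disjoint and each chart is injective modulo rotations. -/
theorem CylindricalEnds.compress_chart (i : Fin 3) {w : ℂ} (hw : 0 < depth i w) :
    C.compress (C.chart i w) = C.point i (squash (depth i w)) w.im := by
  have hkey : ∀ j w', 0 < depth j w' → C.chart j w' = C.chart i w →
      j = i ∧ depth i w' = depth i w ∧ ∃ n : ℤ, w.im = w'.im + n := by
    intro j w' hw' heq
    have hji : j = i := by
      by_contra hne
      exact C.disjoint j i hne w' w hw' hw heq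
    subst hji
    obtain ⟨n, rfl⟩ := (C.eq_iff j w' w hw' hw).1 heq
    exact ⟨rfl, by simp [depth], n, by simp⟩
  by_cases h : ∃ q : Fin 3 × ℂ, 1 < depth q.1 q.2 ∧ C.chart q.1 q.2 = C.chart i w
  · rw [compress, dif_pos h]
    obtain ⟨h1, h2⟩ := h.choose_spec
    obtain ⟨e1, e2, n, e3⟩ := hkey _ _ (zero_lt_one.trans h1) h2
    rw [e1, e2, e3, C.point_add_int i (squash_pos hw)]
  · rw [compress, dif_neg h]
    have hle : depth i w ≤ 1 := not_lt.1 fun hlt => h ⟨(i, w), hlt, rfl⟩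
    rw [squash, if_pos hle, ← C.chart_eq_point]

/-- On an end the chart is a local homeomorphism and the formula in coordinates is continuous. Off
the ends the map is the identity nearby, because the parts of depth at least `1` have closed image.
-/
theorem CylindricalEnds.continuousAt_compress {z : ℂ} (hz : z ∈ pants) :
    ContinuousAt C.compress z := by
  by_cases h : ∃ q : Fin 3 × ℂ, 0 < depth q.1 q.2 ∧ C.chart q.1 q.2 = z
  · obtain ⟨⟨i, w⟩, hw, rfl⟩ := h
    dsimp only at hw ⊢
    rw [ContinuousAt, ← C.map_nhds i hw, tendsto_map'_iff, C.compress_chart i hw]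
    have hg : Continuous fun w => ((-(endSign i * squash (depth i w)) : ℝ) : ℂ) + w.im * Complex.I := by
      have := continuous_squash.comp (continuous_depth i)
      fun_prop
    have hc : ContinuousAt (fun w => C.point i (squash (depth i w)) w.im) w :=
      ContinuousAt.comp (f := fun w => ((-(endSign i * squash (depth i w)) : ℝ) : ℂ)
        + w.im * Complex.I) (C.analyticAt i (by rw [depth_point]; exact squash_pos hw)).continuousAt
        hg.continuousAt
    refine Tendsto.congr' ?_ hc
    filter_upwards [(isOpen_depth_pos i).mem_nhds hw] with w' hw'
    exact (C.compress_chart i hw').symm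
  · have hev : ∀ᶠ z' in 𝓝 z, C.compress z' = z' := by
      have h1 : ∀ᶠ z' in 𝓝 z, ∀ i, ∀ w, 1 ≤ depth i w → C.chart i w ≠ z' :=
        eventually_all.2 fun i => C.eventually_not_mem_image i one_pos hz fun w hw heq =>
          h ⟨(i, w), zero_lt_one.trans_le hw, heq⟩
      filter_upwards [h1] with z' hz'
      rw [compress, dif_neg]
      rintro ⟨q, hq1, hq2⟩
      exact hz' q.1 q.2 hq1.le hq2
    exact continuousAt_id.congr (hev.mono fun z' h => h.symm)

/-- `squash` inverts the reparametrization `s ↦ 1 / (2 - s)` in the definition of a capping. So the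
sphere, precomposed with the compression, is the smooth map `u`. -/
theorem IsCapping.comp_compress {M : Type} {w : Fin 3 → ℂ → M} {u : ℂ → M} {S : OnePoint ℂ → M}
    (h : IsCapping C w u S) {z : ℂ} (hz : z ∈ pants) : S (C.compress z) = u z := by
  by_cases hq : ∃ q : Fin 3 × ℂ, 1 < depth q.1 q.2 ∧ C.chart q.1 q.2 = z
  · obtain ⟨⟨i, w'⟩, hw, rfl⟩ := hq
    dsimp only at hw ⊢
    have hpos : 0 < depth i w' := zero_lt_one.trans hw
    rw [C.compress_chart i hpos, squash, if_neg (not_le.2 hw), h.neck, C.chart_eq_point]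
    · congr 2
      rw [sub_sub_cancel, one_div_one_div]
    · have : 1 / depth i w' ≤ 1 := by rw [div_le_one hpos]; exact hw.le
      linarith
    · have : 0 < 1 / depth i w' := by positivity
      linarith
  · rw [CylindricalEnds.compress, dif_neg hq]
    exact h.center z hz fun i p hp heq => hq ⟨(i, p), hp, heq⟩

open Complex in
/-- The linear homotopy from a circle of radius `1/2` to a given path. -/
def conn (a : ℝ → ℂ) (p t : ℝ) : ℂ := (1 - p) * (1 / 2 * exp (2 * Real.pi * t * I)) + p * a t

theorem one_sub_mem_pants {z : ℂ} (hz : z ∈ pants) : 1 - z ∈ pants := by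
  simp only [pants, mem_compl_iff, mem_insert_iff, mem_singleton_iff, not_or] at hz ⊢
  refine ⟨fun h => hz.2 (sub_eq_zero.1 h).symm, fun h => hz.1 ?_⟩
  linear_combination -h

open Complex in
-- After rotation by `exp(-2πit)` both ends of the segment have positive real part, so it misses
-- `0`. Both ends have norm less than `1`, so it misses `1`.
theorem conn_mem_pants_of_norm_lt {a : ℝ → ℂ} {p t : ℝ} (hp : p ∈ Icc (0 : ℝ) 1)
    (h1 : 0 < (a t * exp (-(2 * Real.pi * t * I))).re) (h2 : ‖a t‖ < 1) : conn a p t ∈ pants := by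
  have hcancel : exp (2 * Real.pi * t * I) * exp (-(2 * Real.pi * t * I)) = 1 := by
    rw [← exp_add, add_neg_cancel, exp_zero]
  simp only [pants, mem_compl_iff, mem_insert_iff, mem_singleton_iff, not_or]
  constructor
  · intro h0
    have h3 : (1 - p : ℝ) / 2 + p * (a t * exp (-(2 * Real.pi * t * I))).re = 0 := by
      have h4 : (((1 - p) / 2 : ℝ) : ℂ) + (p : ℝ) * (a t * exp (-(2 * Real.pi * t * I))) = 0 := by
        have : conn a p t * exp (-(2 * Real.pi * t * I)) = 0 := by rw [h0, zero_mul]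
        rw [← this, conn]
        push_cast
        linear_combination (-(1 - p) / 2 : ℂ) * hcancel
      have := congrArg re h4
      rwa [add_re, re_ofReal_mul, ofReal_re, zero_re] at this
    rcases hp.1.eq_or_lt with rfl | hp0
    · norm_num at h3
    · have : 0 < p * (a t * exp (-(2 * Real.pi * t * I))).re := mul_pos hp0 h1
      linarith [hp.2]
  · intro h0
    have hE : ‖exp (2 * Real.pi * t * I)‖ = 1 := by
      have := norm_exp_ofReal_mul_I (2 * Real.pi * t)
      push_cast at this; exact this
    have : ‖conn a p t‖ ≤ (1 - p) * (1 / 2) + p * ‖a t‖ := by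
      refine (norm_add_le _ _).trans (le_of_eq ?_)
      have e1 : ‖(1 - p : ℂ)‖ = 1 - p := by
        rw [← ofReal_one, ← ofReal_sub, norm_real, Real.norm_of_nonneg (by linarith [hp.2])]
      rw [norm_mul, norm_mul, norm_mul, e1, hE, norm_real, Real.norm_of_nonneg hp.1]
      norm_num
    rw [h0, norm_one] at this
    rcases hp.1.eq_or_lt with rfl | hp0
    · norm_num at this
    · nlinarith [hp.2]

open Complex in
-- After rotation by `exp(-iπ(t + 1/2))` the circle contributes a nonnegative real part and the loop
-- a positive one, so the segment misses `0` for `p > 0`. The rotated point `1` has real part at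
-- most `0`, so it is missed too. At `p = 0` the norm is `1/2`.
theorem conn_mem_pants_of_re_pos {a : ℝ → ℂ} {p t : ℝ} (hp : p ∈ Icc (0 : ℝ) 1)
    (ht : t ∈ Icc (0 : ℝ) 1) (h1 : 0 < (a t * exp (-(Real.pi * (t + 1 / 2) * I))).re) :
    conn a p t ∈ pants := by
  have hcos : 0 ≤ Real.cos (Real.pi * (t - 1 / 2)) := by
    refine Real.cos_nonneg_of_neg_pi_div_two_le_of_le ?_ ?_ <;> nlinarith [Real.pi_pos, ht.1, ht.2]
  have hrot : conn a p t * exp (-(Real.pi * (t + 1 / 2) * I)) =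
      (((1 - p) / 2 : ℝ) : ℂ) * exp ((Real.pi * (t - 1 / 2) : ℝ) * I)
        + (p : ℝ) * (a t * exp (-(Real.pi * (t + 1 / 2) * I))) := by
    have : exp ((Real.pi * (t - 1 / 2) : ℝ) * I) =
        exp (2 * Real.pi * t * I) * exp (-(Real.pi * (t + 1 / 2) * I)) := by
      rw [← exp_add]; congr 1; push_cast; ring
    rw [this, conn]
    push_cast
    ring
  have hre : (conn a p t * exp (-(Real.pi * (t + 1 / 2) * I))).re =
      (1 - p) / 2 * Real.cos (Real.pi * (t - 1 / 2))
        + p * (a t * exp (-(Real.pi * (t + 1 / 2) * I))).re := by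
    rw [hrot, add_re, re_ofReal_mul, re_ofReal_mul, exp_ofReal_mul_I_re]
  have hone : (exp (-(Real.pi * (t + 1 / 2) * I))).re = -Real.cos (Real.pi * (t - 1 / 2)) := by
    have : exp (-(Real.pi * (t + 1 / 2) * I)) = exp ((-(Real.pi * (t - 1 / 2) + Real.pi) : ℝ) * I) := by
      congr 1; push_cast; ring
    rw [this, exp_ofReal_mul_I_re, Real.cos_neg, Real.cos_add_pi]
  have hzero : p = 0 → ‖conn a p t‖ = 1 / 2 := by
    rintro rfl
    have := norm_exp_ofReal_mul_I (2 * Real.pi * t)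
    push_cast at this
    simp [conn, this]
  have hnn : 0 ≤ (1 - p) / 2 * Real.cos (Real.pi * (t - 1 / 2)) :=
    mul_nonneg (by linarith [hp.2]) hcos
  simp only [pants, mem_compl_iff, mem_insert_iff, mem_singleton_iff, not_or]
  rcases hp.1.eq_or_lt with hp0 | hp0
  · have := hzero hp0.symm
    exact ⟨fun h => by rw [h, norm_zero] at this; norm_num at this,
      fun h => by rw [h, norm_one] at this; norm_num at this⟩
  · have hpos := mul_pos hp0 h1
    refine ⟨fun h => ?_, fun h => ?_⟩
    · rw [h, zero_mul, zero_re] at hre; linarith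
    · rw [h, one_mul, hone] at hre; linarith

end Compression

theorem sum_range_mul_eq {A : Type*} [AddCommMonoid A] (g : ℕ → A) (m n : ℕ) :
    ∑ l ∈ Finset.range (m * n), g l =
      ∑ J ∈ Finset.range m, ∑ l ∈ Finset.range n, g (J * n + l) := by
  induction m with
  | zero => simp
  | succ m ih => rw [Finset.sum_range_succ, ← ih, add_mul, one_mul, Finset.sum_range_add]

/-! ### Thin necks between two loops. -/

section Neck

variable {E : Type*} [NormedAddCommGroup E] [NormedSpace ℝ E]
variable {M : Type} [TopologicalSpace M] [ChartedSpace E M] [IsManifold 𝓘(ℝ, E) ∞ M]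
variable {ι : Type*} {Ω : SymplecticForm E M} {V : ι → Set M} {pot : ι → M → E →L[ℝ] ℝ}
  {f : M → M → M → ℝ} {I : ι → M → M → ℝ}

/-- The contribution of a thin strip between two paths, subdivided into arcs. -/
def stripValue (pot : ι → M → E →L[ℝ] ℝ) (I : ι → M → M → ℝ) (v : ℕ → ι) (m : ℕ) (U W : ℝ → M) :
    ℝ :=
  ∑ J ∈ Finset.range m, (lineInt (pot (v J)) W (unif m J) (unif m (J + 1))
    - lineInt (pot (v J)) U (unif m J) (unif m (J + 1))
    + (I (v J) (U (unif m J)) (W (unif m J))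
      - I (v J) (U (unif m (J + 1))) (W (unif m (J + 1)))))

theorem unif_mul_add {m n : ℕ} (hn : n ≠ 0) (J : ℕ) : unif (m * n) (J * n) = unif m J := by
  have : (n : ℝ) ≠ 0 := by exact_mod_cast hn
  simp only [unif, Nat.cast_mul]
  exact mul_div_mul_right _ _ this

theorem unif_mono (N : ℕ) : Monotone (unif N) := monotone_nat_of_le_succ (unif_le N)

theorem Icc_unif_subset_arc {m n : ℕ} {J l : ℕ} (hl : l < n) :
    Icc (unif (m * n) (J * n + l)) (unif (m * n) (J * n + l + 1)) ⊆
      Icc (unif m J) (unif m (J + 1)) := by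
  have hn : n ≠ 0 := by omega
  rw [← unif_mul_add hn J, ← unif_mul_add hn (J + 1)]
  refine Icc_subset_Icc (unif_mono _ (by omega)) (unif_mono _ ?_)
  rw [add_mul, one_mul]
  omega

/-- Over one arc the neck lies in a single member of the cover, so its value is a coboundary. The
terms along the sides cancel those in the defects, and the transverse terms telescope over the arc.
The result does not depend on the refinement `n`, which can thus be chosen after `m`; no smoothness
of `Q` between its sides is needed. -/
theorem LocalPotentials.pathDefect_sub_add_neck (h : LocalPotentials Ω V pot f I)
    {U W : ℝ → M} {Q : ℝ × ℝ → M} {m n : ℕ} (hn : n ≠ 0) {v : ℕ → ι}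
    (hQ0 : ∀ t ∈ Icc (0 : ℝ) 1, Q (0, t) = U t) (hQ1 : ∀ t ∈ Icc (0 : ℝ) 1, Q (1, t) = W t)
    (hU : ∀ t ∈ Icc (0 : ℝ) 1, ContMDiffAt 𝓘(ℝ, ℝ) 𝓘(ℝ, E) 1 U t)
    (hW : ∀ t ∈ Icc (0 : ℝ) 1, ContMDiffAt 𝓘(ℝ, ℝ) 𝓘(ℝ, E) 1 W t)
    (hv : ∀ J < m, ∀ p ∈ Icc (0 : ℝ) 1, ∀ t ∈ Icc (unif m J) (unif m (J + 1)),
      Q (p, t) ∈ V (v J)) :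
    pathDefect V pot I W (m * n) - pathDefect V pot I U (m * n)
      + ∑ l ∈ Finset.range (m * n),
          rectValue f Q 0 1 (unif (m * n) l) (unif (m * n) (l + 1)) =
      stripValue pot I v m U W := by
  have h0 : (0 : ℝ) ∈ Icc (0 : ℝ) 1 := left_mem_Icc.2 zero_le_one
  have h1 : (1 : ℝ) ∈ Icc (0 : ℝ) 1 := right_mem_Icc.2 zero_le_one
  rw [pathDefect, pathDefect, ← Finset.sum_sub_distrib, ← Finset.sum_add_distrib, sum_range_mul_eq,
    stripValue]
  refine Finset.sum_congr rfl fun J hJ => ?_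
  rw [Finset.mem_range] at hJ
  have harc := Icc_unif_subset hJ
  have hUv : ∀ t ∈ Icc (unif m J) (unif m (J + 1)), U t ∈ V (v J) := fun t ht => by
    rw [← hQ0 t (harc ht)]; exact hv J hJ 0 h0 t ht
  have hWv : ∀ t ∈ Icc (unif m J) (unif m (J + 1)), W t ∈ V (v J) := fun t ht => by
    rw [← hQ1 t (harc ht)]; exact hv J hJ 1 h1 t ht
  let F : ℕ → ℝ := fun l => unif (m * n) (J * n + l)
  have hF0 : F 0 = unif m J := unif_mul_add hn J
  have hFn : F n = unif m (J + 1) := by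
    rw [← unif_mul_add hn (J + 1), add_mul, one_mul]
  -- The same index `v J` is used for all pieces of an arc, which makes the transverse terms
  -- telescope.
  have hterm : ∀ l ∈ Finset.range n,
      edgeDefect V pot I W (F l) (F (l + 1)) - edgeDefect V pot I U (F l) (F (l + 1))
        + rectValue f Q 0 1 (F l) (F (l + 1)) =
      (lineInt (pot (v J)) W (F l) (F (l + 1)) - lineInt (pot (v J)) U (F l) (F (l + 1)))
        + (I (v J) (U (F l)) (W (F l)) - I (v J) (U (F (l + 1))) (W (F (l + 1)))) := by
    intro l hl
    have hsub : Icc (F l) (F (l + 1)) ⊆ Icc (unif m J) (unif m (J + 1)) :=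
      Icc_unif_subset_arc (Finset.mem_range.1 hl)
    have hle : F l ≤ F (l + 1) := unif_le _ _
    have ha := left_mem_Icc.2 hle
    have hb := right_mem_Icc.2 hle
    rw [h.edgeDefect_eq hle (fun t ht => hWv t (hsub ht)) (fun t ht => hW t (harc (hsub ht))),
      h.edgeDefect_eq hle (fun t ht => hUv t (hsub ht)) (fun t ht => hU t (harc (hsub ht))),
      rectValue, hQ0 _ (harc (hsub ha)), hQ0 _ (harc (hsub hb)), hQ1 _ (harc (hsub ha)),
      hQ1 _ (harc (hsub hb)),
      h.eq (v J) _ (hUv _ (hsub ha)) _ (hWv _ (hsub ha)) _ (hWv _ (hsub hb)),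
      h.eq (v J) _ (hUv _ (hsub ha)) _ (hUv _ (hsub hb)) _ (hWv _ (hsub hb))]
    ring
  have hlint : ∀ e : ℝ → M, (∀ t ∈ Icc (unif m J) (unif m (J + 1)), e t ∈ V (v J)) →
      (∀ t ∈ Icc (0 : ℝ) 1, ContMDiffAt 𝓘(ℝ, ℝ) 𝓘(ℝ, E) 1 e t) →
      ∑ l ∈ Finset.range n, lineInt (pot (v J)) e (F l) (F (l + 1)) =
        lineInt (pot (v J)) e (unif m J) (unif m (J + 1)) := by
    intro e hev he
    rw [← hF0, ← hFn]
    simp only [lineInt]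
    refine intervalIntegral.sum_integral_adjacent_intervals (a := F) fun l hl => ?_
    have hsub : Icc (F l) (F (l + 1)) ⊆ Icc (unif m J) (unif m (J + 1)) :=
      Icc_unif_subset_arc hl
    exact h.intervalIntegrable (unif_le _ _) (fun t ht => hev t (hsub ht))
      (fun t ht => he t (harc (hsub ht)))
  refine (Finset.sum_congr rfl hterm).trans ?_
  rw [Finset.sum_add_distrib, Finset.sum_sub_distrib, hlint W hWv hW, hlint U hUv hU,
    Finset.sum_range_sub' (fun l => I (v J) (U (F l)) (W (F l))) n, hF0, hFn]

end Neck

/-! ### Sectors of the capped sphere. -/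

section Sectors

variable (C : CylindricalEnds)

/-- The point of the unit interval closest to a given one. -/
def clamp (t : ℝ) : ℝ := max 0 (min 1 t)

theorem continuous_clamp : Continuous clamp := by unfold clamp; fun_prop

theorem clamp_mem (t : ℝ) : clamp t ∈ Icc (0 : ℝ) 1 :=
  ⟨le_max_left _ _, max_le zero_le_one (min_le_left _ _)⟩

theorem clamp_eq {t : ℝ} (ht : t ∈ Icc (0 : ℝ) 1) : clamp t = t := by
  rw [clamp, min_eq_right ht.2, max_eq_right ht.1]

theorem CylindricalEnds.continuousAt_point (i : Fin 3) {s : ℝ} (hs : 0 < s) (t : ℝ) :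
    ContinuousAt (fun x : ℝ × ℝ => C.point i x.1 x.2) (s, t) := by
  have hg : Continuous fun x : ℝ × ℝ => ((-(endSign i * x.1) : ℝ) : ℂ) + x.2 * Complex.I := by
    fun_prop
  exact ContinuousAt.comp (f := fun x : ℝ × ℝ => ((-(endSign i * x.1) : ℝ) : ℂ) + x.2 * Complex.I)
    (C.analyticAt i (by rwa [depth_point])).continuousAt hg.continuousAt

theorem CylindricalEnds.continuous_point_comp {Y : Type*} [TopologicalSpace Y] (i : Fin 3)
    {g a : Y → ℝ} (hg : Continuous g) (ha : Continuous a) (h : ∀ y, 0 < g y) :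
    Continuous fun y => C.point i (g y) (a y) :=
  continuous_iff_continuousAt.2 fun y => ContinuousAt.comp (f := fun y => (g y, a y))
    (C.continuousAt_point i (h y) (a y)) (hg.prodMk ha).continuousAt

open Classical in
/-- The cap of a sector: a disc around a puncture in polar coordinates. -/
def CylindricalEnds.capMap (i : Fin 3) (α : ℝ → ℝ) (r : ℝ) (x : ℝ × ℝ) : OnePoint ℂ :=
  if x.1 < 1 then ((C.point i (2 / ((1 - x.1) * r)) (α x.2) : ℂ) : OnePoint ℂ) else puncture i

/-- Away from `p = 1` this is continuity of the chart. As `p` tends to `1` the depth `2 / ((1 - p)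
r)` tends to infinity, and points of large depth converge to the puncture uniformly in the angle. -/
theorem CylindricalEnds.continuous_capMap (i : Fin 3) {α : ℝ → ℝ} (hα : Continuous α) {r : ℝ}
    (hr : 0 < r) : Continuous fun x : ℝ × ℝ => C.capMap i α r (clamp x.1, clamp x.2) := by
  suffices h : ∀ x : ℝ × ℝ, x.1 ≤ 1 → ContinuousWithinAt (C.capMap i α r) (Iic 1 ×ˢ univ) x by
    have h2 : ContinuousOn (C.capMap i α r) (Iic 1 ×ˢ univ) := fun x hx => h x hx.1
    exact h2.comp_continuous ((continuous_clamp.comp continuous_fst).prodMk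
      (continuous_clamp.comp continuous_snd)) fun x => ⟨(clamp_mem _).2, mem_univ _⟩
  rintro ⟨p, t⟩ hp
  rcases hp.lt_or_eq with hp | hp
  · have hp' : p < 1 := hp
    have hpos : 0 < (1 - p) * r := mul_pos (by linarith) hr
    have h1 : ContinuousAt (fun x : ℝ × ℝ => C.point i (2 / ((1 - x.1) * r)) (α x.2)) (p, t) := by
      refine ContinuousAt.comp (g := fun x : ℝ × ℝ => C.point i x.1 x.2) (x := (p, t))
        (f := fun x : ℝ × ℝ => (2 / ((1 - x.1) * r), α x.2))
        (C.continuousAt_point i (s := 2 / ((1 - p) * r)) (div_pos two_pos hpos) (α t)) ?_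
      refine ContinuousAt.prodMk (continuousAt_const.div (by fun_prop) hpos.ne') (by fun_prop)
    have h2 : ContinuousAt (fun x : ℝ × ℝ =>
        ((C.point i (2 / ((1 - x.1) * r)) (α x.2) : ℂ) : OnePoint ℂ)) (p, t) :=
      OnePoint.continuous_coe.continuousAt.comp h1
    refine (h2.congr ?_).continuousWithinAt
    filter_upwards [(isOpen_Iio.preimage continuous_fst).mem_nhds (show (p, t).1 ∈ Iio 1 from hp)]
      with x hx
    exact (if_pos hx).symm
  · have hp' : p = 1 := hp
    subst hp'
    rw [ContinuousWithinAt]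
    have hval : C.capMap i α r (1, t) = puncture i := if_neg (lt_irrefl _)
    rw [hval, tendsto_def]
    intro O hO
    have hev := (C.tendsto_puncture i).eventually hO
    rw [eventually_comap] at hev
    obtain ⟨T, hT⟩ := eventually_atTop.1 hev
    have hnear : ∀ᶠ x : ℝ × ℝ in 𝓝[Iic 1 ×ˢ univ] (1, t), (max T 1) * ((1 - x.1) * r) < 2 := by
      refine nhdsWithin_le_nhds (ContinuousAt.eventually_lt (by fun_prop) continuousAt_const ?_)
      norm_num
    filter_upwards [hnear] with x hx
    by_cases hlt : x.1 < 1
    · rw [mem_preimage, capMap, if_pos hlt]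
      have hpos : 0 < (1 - x.1) * r := mul_pos (by linarith) hr
      refine hT _ ?_ _ (depth_point i _ _)
      exact (le_max_left T 1).trans ((le_div_iff₀ hpos).2 hx.le)
    · rw [mem_preimage, capMap, if_neg hlt]
      exact mem_of_mem_nhds hO

theorem neck_radius_pos {L r : ℝ} (hL : 1 < L) (hr : 0 < r) (p : ℝ) :
    0 < (1 - clamp p) * (2 - 1 / L) + clamp p * (2 / r) := by
  obtain ⟨h0, h1⟩ := clamp_mem p
  have e1 : 0 < 2 - 1 / L := by
    have : 1 / L < 1 := (div_lt_one (by linarith)).2 hL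
    linarith
  have e2 : 0 < 2 / r := by positivity
  rcases h0.eq_or_lt with h | h
  · rw [← h]; linarith
  · have := mul_pos h e2
    have := mul_nonneg (sub_nonneg.2 h1) e1.le
    linarith

/-- The data of a sector of the sphere: a homotopy in the pair of pants, ending on a circle of the
`i`-th end at distance `L` from the boundary. -/
structure SectorData where
  end_ : Fin 3
  angle : ℝ → ℝ
  length : ℝ
  radius : ℝ
  homotopy : ℝ × ℝ → ℂ
  one_lt_length : 1 < length
  radius_pos : 0 < radius
  continuous_angle : Continuous angle
  continuousOn_homotopy : ContinuousOn homotopy (Icc 0 1 ×ˢ Icc 0 1)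
  mem_pants : ∀ p ∈ Icc (0 : ℝ) 1, ∀ t ∈ Icc (0 : ℝ) 1, homotopy (p, t) ∈ pants
  homotopy_one : ∀ t ∈ Icc (0 : ℝ) 1, homotopy (1, t) = C.point end_ length (angle t)

variable {C}

/-- The sector of the sphere with given data. -/
def SectorData.sector (d : SectorData C) : SphereSector (OnePoint ℂ) where
  -- The maps of a sector are defined on the whole plane, hence the clamping to the unit square.
  inner := ⟨fun x => ((C.compress (d.homotopy (clamp x.1, clamp x.2)) : ℂ) : OnePoint ℂ), by
    refine OnePoint.continuous_coe.comp (continuous_iff_continuousAt.2 fun x => ?_)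
    have hc : Continuous fun x : ℝ × ℝ => d.homotopy (clamp x.1, clamp x.2) :=
      d.continuousOn_homotopy.comp_continuous ((continuous_clamp.comp continuous_fst).prodMk
        (continuous_clamp.comp continuous_snd)) fun x => ⟨clamp_mem _, clamp_mem _⟩
    exact ContinuousAt.comp (f := fun x : ℝ × ℝ => d.homotopy (clamp x.1, clamp x.2))
      (C.continuousAt_compress (d.mem_pants _ (clamp_mem _) _ (clamp_mem _))) hc.continuousAt⟩
  -- Depth `L` is compressed to `2 - 1 / L`, and depth `2 / r` is where the cap shows the circle of
  -- radius `r`; the neck interpolates between these depths.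
  neck := ⟨fun x => ((C.point d.end_ ((1 - clamp x.1) * (2 - 1 / d.length)
      + clamp x.1 * (2 / d.radius)) (d.angle (clamp x.2)) : ℂ) : OnePoint ℂ),
    OnePoint.continuous_coe.comp (C.continuous_point_comp d.end_
      (by have := continuous_clamp; fun_prop)
      (d.continuous_angle.comp (continuous_clamp.comp continuous_snd))
      (fun x => neck_radius_pos d.one_lt_length d.radius_pos x.1))⟩
  cap := ⟨fun x => C.capMap d.end_ d.angle d.radius (clamp x.1, clamp x.2),
    C.continuous_capMap d.end_ d.continuous_angle d.radius_pos⟩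
  pole := puncture d.end_
  inner_one t := by
    have hL := d.one_lt_length
    have h1 : clamp 1 = 1 := clamp_eq (right_mem_Icc.2 zero_le_one)
    have h0 : clamp 0 = 0 := clamp_eq (left_mem_Icc.2 zero_le_one)
    simp only [ContinuousMap.coe_mk, h1, h0, d.homotopy_one _ (clamp_mem t)]
    rw [CylindricalEnds.point, C.compress_chart d.end_ (by rw [depth_point]; linarith), depth_point,
      squash, if_neg (not_le.2 hL)]
    simp
  neck_one t := by
    have h1 : clamp 1 = 1 := clamp_eq (right_mem_Icc.2 zero_le_one)
    have h0 : clamp 0 = 0 := clamp_eq (left_mem_Icc.2 zero_le_one)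
    simp [h1, h0, CylindricalEnds.capMap]
  cap_one t := by
    have h1 : clamp 1 = 1 := clamp_eq (right_mem_Icc.2 zero_le_one)
    simp [h1, CylindricalEnds.capMap]

variable {M : Type} {w : Fin 3 → ℂ → M} {u : ℂ → M} {S : OnePoint ℂ → M}

theorem SectorData.comp_inner (d : SectorData C) (h : IsCapping C w u S) {p t : ℝ}
    (hp : p ∈ Icc (0 : ℝ) 1) (ht : t ∈ Icc (0 : ℝ) 1) :
    S (d.sector.inner (p, t)) = u (d.homotopy (p, t)) := by
  simp only [sector, ContinuousMap.coe_mk, clamp_eq hp, clamp_eq ht]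
  exact h.comp_compress C (d.mem_pants p hp t ht)

/-- The disc in polar coordinates. -/
def polarDisc (w : ℂ → M) (α : ℝ → ℝ) (r : ℝ) (x : ℝ × ℝ) : M :=
  w ((((1 - x.1) * r : ℝ) : ℂ) * Complex.exp (2 * Real.pi * (α x.2) * Complex.I))

/-- A radius below `1` keeps the depth at least `2`, hence in the capping region, and the circles
inside the open disc, where the disc map is smooth as a map on an open set. -/
theorem SectorData.comp_cap (d : SectorData C) (h : IsCapping C w u S) (hr : d.radius < 1)
    {p t : ℝ} (hp : p ∈ Icc (0 : ℝ) 1) (ht : t ∈ Icc (0 : ℝ) 1) :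
    S (d.sector.cap (p, t)) = polarDisc (w d.end_) d.angle d.radius (p, t) := by
  simp only [sector, ContinuousMap.coe_mk, clamp_eq hp, clamp_eq ht, CylindricalEnds.capMap, polarDisc]
  have hrp := d.radius_pos
  split_ifs with hlt
  · have hpos : 0 < (1 - p) * d.radius := mul_pos (by linarith) hrp
    rw [h.cap]
    · congr 2
      push_cast
      field_simp
    · rw [le_div_iff₀ hpos]
      nlinarith [hp.1]
  · have : p = 1 := le_antisymm hp.2 (not_lt.1 hlt)
    rw [h.pole, this]
    simp

theorem SectorData.comp_neck_one (d : SectorData C) (h : IsCapping C w u S) (hr : d.radius < 1)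
    {t : ℝ} (ht : t ∈ Icc (0 : ℝ) 1) :
    S (d.sector.neck (1, t)) = polarDisc (w d.end_) d.angle d.radius (0, t) := by
  rw [d.sector.neck_one, d.comp_cap h hr (left_mem_Icc.2 zero_le_one) ht]

end Sectors

/-! ### The cochain on the capped sphere in terms of areas and neck contributions. -/

section SphereArea

variable {E : Type*} [NormedAddCommGroup E] [NormedSpace ℝ E]
variable {M : Type} [TopologicalSpace M] [ChartedSpace E M] [IsManifold 𝓘(ℝ, E) ∞ M]
variable {ι : Type*} {Ω : SymplecticForm E M} {V : ι → Set M} {pot : ι → M → E →L[ℝ] ℝ}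
  {f : M → M → M → ℝ} {I : ι → M → M → ℝ}
variable {C : CylindricalEnds} {w : Fin 3 → ℂ → M} {u : ℂ → M} {S : OnePoint ℂ → M}

theorem LocalPotentials.pathDefect_const (h : LocalPotentials Ω V pot f I) {e : ℝ → M} {x : M}
    (he : ∀ t, e t = x) (N : ℕ) : pathDefect V pot I e N = 0 := by
  obtain rfl : e = fun _ => x := funext he
  refine Finset.sum_eq_zero fun l _ => ?_
  rw [edgeDefect]
  split_ifs with hv
  · rw [h.self, sub_zero, lineInt]
    have : ∀ (lam : M → E →L[ℝ] ℝ) (t : ℝ), pullCovector lam (fun _ : ℝ => x) t 1 = 0 := by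
      intro lam t
      have h0 : mfderiv 𝓘(ℝ, ℝ) 𝓘(ℝ, E) (fun _ : ℝ => x) t = 0 := mfderiv_const
      change lam x ((mfderiv 𝓘(ℝ, ℝ) 𝓘(ℝ, E) (fun _ : ℝ => x) t : ℝ →L[ℝ] E) 1) = 0
      rw [h0]
      exact map_zero (lam x)
    simp [this]
  · rfl

theorem gridValue_congr {f : M → M → M → ℝ} {G G' : ℝ × ℝ → M} {N : ℕ}
    (h : ∀ p ∈ Icc (0 : ℝ) 1, ∀ t ∈ Icc (0 : ℝ) 1, G (p, t) = G' (p, t)) :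
    gridValue f G N = gridValue f G' N := by
  refine Finset.sum_congr rfl fun k hk => Finset.sum_congr rfl fun l hl => ?_
  rw [Finset.mem_range] at hk hl
  have hk1 := Icc_unif_subset hk (left_mem_Icc.2 (unif_le N k))
  have hk2 := Icc_unif_subset hk (right_mem_Icc.2 (unif_le N k))
  have hl1 := Icc_unif_subset hl (left_mem_Icc.2 (unif_le N l))
  have hl2 := Icc_unif_subset hl (right_mem_Icc.2 (unif_le N l))
  simp only [rectValue, h _ hk1 _ hl1, h _ hk1 _ hl2, h _ hk2 _ hl1, h _ hk2 _ hl2]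

theorem IsSmallRect.congr {G G' : ℝ × ℝ → M} {N k l : ℕ} (hk : k < N) (hl : l < N)
    (h : ∀ p ∈ Icc (0 : ℝ) 1, ∀ t ∈ Icc (0 : ℝ) 1, G (p, t) = G' (p, t))
    (hG : IsSmallRect V G (unif N k) (unif N (k + 1)) (unif N l) (unif N (l + 1))) :
    IsSmallRect V G' (unif N k) (unif N (k + 1)) (unif N l) (unif N (l + 1)) := by
  obtain ⟨v, hv⟩ := hG
  exact ⟨v, fun a ha b hb => h a (Icc_unif_subset hk ha) b (Icc_unif_subset hl hb) ▸ hv a ha b hb⟩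

/-- The annulus traced out by a section over the homotopy of a sector. -/
def SectorData.annulus (d : SectorData C) (u : ℂ → M) (x : ℝ × ℝ) : M := u (d.homotopy x)

/-- The disc attached to a sector. -/
def SectorData.disc (d : SectorData C) (w : Fin 3 → ℂ → M) : ℝ × ℝ → M :=
  polarDisc (w d.end_) d.angle d.radius

/-- The smoothness assumptions on a sector. -/
structure SectorData.IsSmooth (E : Type*) [NormedAddCommGroup E] [NormedSpace ℝ E]
    [ChartedSpace E M] (d : SectorData C) (w : Fin 3 → ℂ → M) (u : ℂ → M) : Prop where
  annulus : ∀ x ∈ Icc (0 : ℝ) 1 ×ˢ Icc (0 : ℝ) 1,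
    ContMDiffAt 𝓘(ℝ, ℝ × ℝ) 𝓘(ℝ, E) 2 (d.annulus u) x
  disc : ∀ x ∈ Icc (0 : ℝ) 1 ×ˢ Icc (0 : ℝ) 1,
    ContMDiffAt 𝓘(ℝ, ℝ × ℝ) 𝓘(ℝ, E) 2 (d.disc w) x
  radius_lt : d.radius < 1

/-- The boundary terms of a ray of a sector. -/
def SectorData.rayDefect (d : SectorData C) (V : ι → Set M) (pot : ι → M → E →L[ℝ] ℝ)
    (I : ι → M → M → ℝ) (w : Fin 3 → ℂ → M) (u : ℂ → M) (N : ℕ) (t : ℝ) : ℝ :=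
  pathDefect V pot I (fun p => d.annulus u (p, t)) N
    + pathDefect V pot I (fun p => d.disc w (p, t)) N

/-- The area of a sector, up to the contribution of the neck. -/
def SectorData.area (d : SectorData C) (Ω : SymplecticForm E M) (w : Fin 3 → ℂ → M)
    (u : ℂ → M) : ℝ :=
  rectArea Ω (d.annulus u) 0 1 0 1 + rectArea Ω (d.disc w) 0 1 0 1

/-- The contribution of the neck of a sector. -/
def SectorData.neckValue (d : SectorData C) (pot : ι → M → E →L[ℝ] ℝ) (I : ι → M → M → ℝ)
    (w : Fin 3 → ℂ → M) (u : ℂ → M) (v : ℕ → ι) (m : ℕ) : ℝ :=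
  stripValue pot I v m (fun t => d.annulus u (1, t)) (fun t => d.disc w (0, t))

theorem contMDiffAt_vertical {n : WithTop ℕ∞} {G : ℝ × ℝ → M} {p t : ℝ}
    (h : ContMDiffAt 𝓘(ℝ, ℝ × ℝ) 𝓘(ℝ, E) n G (p, t)) :
    ContMDiffAt 𝓘(ℝ, ℝ) 𝓘(ℝ, E) n (fun t => G (p, t)) t :=
  h.comp t (f := fun b : ℝ => (p, b)) (contDiffAt_const.prodMk contDiffAt_id).contMDiffAt

/-- Stokes' theorem is used on the annulus and on the disc, which are smooth. Their edges along the
neck are absorbed by the neck contribution, and the inner edge of the disc is constant. Only the two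
rays and the initial circle of the annulus remain. -/
theorem SectorData.value_eq (d : SectorData C) (h : LocalPotentials Ω V pot f I)
    (hS : IsCapping C w u S) (hd : d.IsSmooth E w u) {m n : ℕ} (hm : m ≠ 0) (hn : n ≠ 0) {v : ℕ → ι}
    (hv : ∀ J < m, ∀ p ∈ Icc (0 : ℝ) 1, ∀ t ∈ Icc (unif m J) (unif m (J + 1)),
      S (d.sector.neck (p, t)) ∈ V (v J))
    (hsmall : d.sector.IsSmall V S (m * n)) :
    d.sector.value f S (m * n) = d.area Ω w u + d.neckValue pot I w u v m
      - d.rayDefect V pot I w u (m * n) 0 + d.rayDefect V pot I w u (m * n) 1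
      + pathDefect V pot I (fun t => d.annulus u (0, t)) (m * n) := by
  have h0 : (0 : ℝ) ∈ Icc (0 : ℝ) 1 := left_mem_Icc.2 zero_le_one
  have h1 : (1 : ℝ) ∈ Icc (0 : ℝ) 1 := right_mem_Icc.2 zero_le_one
  have hmn : m * n ≠ 0 := mul_ne_zero hm hn
  have ei : ∀ p ∈ Icc (0 : ℝ) 1, ∀ t ∈ Icc (0 : ℝ) 1,
      (S ∘ d.sector.inner) (p, t) = d.annulus u (p, t) := fun p hp t ht => d.comp_inner hS hp ht
  have ec : ∀ p ∈ Icc (0 : ℝ) 1, ∀ t ∈ Icc (0 : ℝ) 1,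
      (S ∘ d.sector.cap) (p, t) = d.disc w (p, t) := fun p hp t ht =>
    d.comp_cap hS hd.radius_lt hp ht
  have e1 := h.gridValue_eq hmn hd.annulus
    (fun k hk l hl => (hsmall.1 k hk l hl).congr hk hl ei)
  have e2 := h.gridValue_eq hmn hd.disc
    (fun k hk l hl => (hsmall.2.2 k hk l hl).congr hk hl ec)
  have e3 := h.pathDefect_sub_add_neck (Q := S ∘ d.sector.neck) (m := m) hn (v := v)
    (U := fun t => d.annulus u (1, t)) (W := fun t => d.disc w (0, t))
    (fun t ht => by
      rw [← ei 1 h1 t ht]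
      exact congrArg S (d.sector.inner_one t).symm)
    (fun t ht => d.comp_neck_one hS hd.radius_lt ht)
    (fun t ht => contMDiffAt_vertical ((hd.annulus (1, t) ⟨h1, ht⟩).of_le (by norm_num)))
    (fun t ht => contMDiffAt_vertical ((hd.disc (0, t) ⟨h0, ht⟩).of_le (by norm_num)))
    hv
  have e4 : pathDefect V pot I (fun t => d.disc w (1, t)) (m * n) = 0 :=
    h.pathDefect_const (x := w d.end_ 0) (fun t => by simp [disc, polarDisc]) _
  rw [SphereSector.value, gridValue_congr ei, gridValue_congr ec, area, neckValue, rayDefect,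
    rayDefect]
  linarith

/-- Two sectors of the sphere meet along rays. -/
structure SectorData.Meets (d : SectorData C) (t : ℝ) (d' : SectorData C) (t' : ℝ) : Prop where
  homotopy : ∀ p, d.homotopy (p, t) = d'.homotopy (p, t')
  end_ : d.end_ = d'.end_
  length : d.length = d'.length
  radius : d.radius = d'.radius
  angle : ∃ n : ℤ, d'.angle t' = d.angle t + n

theorem SectorData.Meets.sector {d d' : SectorData C} {t t' : ℝ} (h : d.Meets t d' t')
    (ht : t ∈ Icc (0 : ℝ) 1) (ht' : t' ∈ Icc (0 : ℝ) 1) :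
    d.sector.Meets t d'.sector t' := by
  obtain ⟨n, hn⟩ := h.angle
  have hr := d'.radius_pos
  intro p
  refine ⟨?_, ?_, ?_⟩
  · simp only [SectorData.sector, ContinuousMap.coe_mk, clamp_eq ht, clamp_eq ht', h.homotopy]
  · simp only [SectorData.sector, ContinuousMap.coe_mk, clamp_eq ht, clamp_eq ht', h.end_,
      h.length, h.radius, hn]
    rw [C.point_add_int _ (neck_radius_pos d'.one_lt_length hr p)]
  · simp only [SectorData.sector, ContinuousMap.coe_mk, clamp_eq ht, clamp_eq ht', h.end_,
      h.radius, hn, CylindricalEnds.capMap]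
    split_ifs with hlt
    · rw [C.point_add_int]
      exact div_pos two_pos (mul_pos (by linarith) hr)
    · rfl

theorem exp_two_pi_add_int (t : ℝ) (n : ℤ) :
    Complex.exp (2 * Real.pi * ((t + n : ℝ) : ℂ) * Complex.I) =
      Complex.exp (2 * Real.pi * t * Complex.I) := by
  have : (2 * Real.pi * ((t + n : ℝ) : ℂ) * Complex.I : ℂ) =
      2 * Real.pi * t * Complex.I + n * (2 * Real.pi * Complex.I) := by push_cast; ring
  rw [this, Complex.exp_add, Complex.exp_int_mul_two_pi_mul_I, mul_one]

theorem SectorData.Meets.rayDefect {d d' : SectorData C} {t t' : ℝ} (h : d.Meets t d' t') (N : ℕ) :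
    d.rayDefect V pot I w u N t = d'.rayDefect V pot I w u N t' := by
  obtain ⟨n, hn⟩ := h.angle
  have e1 : (fun p => d.annulus u (p, t)) = fun p => d'.annulus u (p, t') :=
    funext fun p => by simp only [SectorData.annulus, h.homotopy]
  have e2 : (fun p => d.disc w (p, t)) = fun p => d'.disc w (p, t') :=
    funext fun p => by
      simp only [SectorData.disc, polarDisc, h.end_, h.radius, hn, exp_two_pi_add_int]
  rw [SectorData.rayDefect, SectorData.rayDefect, e1, e2]

/-- The signed areas of the sectors of a sphere that is homologically trivial modulo torsion add
up to zero. -/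
theorem LocalPotentials.sectors_eq_zero (h : LocalPotentials Ω V pot f I) {S : C(OnePoint ℂ, M)}
    (hS : IsCapping C w u S) (hS0 : IsZeroModTorsion S) (d : Fin 4 → SectorData C)
    (hd : ∀ e, (d e).IsSmooth E w u) {m : ℕ} (hm : m ≠ 0) {v : Fin 4 → ℕ → ι}
    (hv : ∀ e, ∀ J < m, ∀ p ∈ Icc (0 : ℝ) 1, ∀ t ∈ Icc (unif m J) (unif m (J + 1)),
      S ((d e).sector.neck (p, t)) ∈ V (v e J))
    (h00 : (d 0).Meets 0 (d 0) 1) (h11 : (d 1).Meets 0 (d 1) 1)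
    (h23 : (d 2).Meets 1 (d 3) 0) (h32 : (d 2).Meets 0 (d 3) 1)
    (h02 : ∀ t, (d 0).homotopy (0, t) = (d 2).homotopy (0, t))
    (h13 : ∀ t, (d 1).homotopy (0, t) = (d 3).homotopy (0, t)) :
    -((d 0).area Ω w u + (d 0).neckValue pot I w u (v 0) m)
      - ((d 1).area Ω w u + (d 1).neckValue pot I w u (v 1) m)
      + ((d 2).area Ω w u + (d 2).neckValue pot I w u (v 2) m)
      + ((d 3).area Ω w u + (d 3).neckValue pot I w u (v 3) m) = 0 := by
  have h0 : (0 : ℝ) ∈ Icc (0 : ℝ) 1 := left_mem_Icc.2 zero_le_one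
  have h1 : (1 : ℝ) ∈ Icc (0 : ℝ) 1 := right_mem_Icc.2 zero_le_one
  have hinner : ∀ e, ∀ᶠ N : ℕ in atTop, ∀ k < N, ∀ l < N,
      IsSmallRect V (S ∘ (d e).sector.inner) (unif N k) (unif N (k + 1)) (unif N l)
      (unif N (l + 1)) := fun e => eventually_isSmallRect h.isOpen h.cover
    (S.continuous.comp (d e).sector.inner.continuous).continuousOn
  have hcap : ∀ e, ∀ᶠ N : ℕ in atTop, ∀ k < N, ∀ l < N,
      IsSmallRect V (S ∘ (d e).sector.cap) (unif N k) (unif N (k + 1)) (unif N l)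
      (unif N (l + 1)) := fun e => eventually_isSmallRect h.isOpen h.cover
    (S.continuous.comp (d e).sector.cap.continuous).continuousOn
  have hmul : Tendsto (fun n : ℕ => m * n) atTop atTop :=
    tendsto_id.const_mul_atTop' (Nat.pos_of_ne_zero hm)
  obtain ⟨n, hn⟩ := ((((hmul.eventually (eventually_all.2 hinner)).and
    (hmul.eventually (eventually_all.2 hcap))).and (eventually_ne_atTop 0))).exists
  obtain ⟨⟨hni, hnc⟩, hn0⟩ := hn
  have hsmall : ∀ e, (d e).sector.IsSmall V S (m * n) := by
    intro e
    refine ⟨hni e, fun l hl => ?_, hnc e⟩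
    -- A small cell of the neck lies in an arc, whose index is the quotient by `n`, and the whole
    -- neck over that arc is already in one member of the cover.
    have hnpos : 0 < n := Nat.pos_of_ne_zero hn0
    have hJ : l / n < m := (Nat.div_lt_iff_lt_mul hnpos).2 hl
    refine ⟨v e (l / n), fun a ha b hb => hv e _ hJ a ha b ?_⟩
    have := Icc_unif_subset_arc (m := m) (J := l / n) (Nat.mod_lt l hnpos)
    rw [Nat.div_add_mod' l n] at this
    exact this hb
  have key := h.toIsLocalCoboundary.sphere_value_eq_zero h.self S hS0 (fun e => (d e).sector)
    (mul_ne_zero hm hn0) hsmall (h00.sector h0 h1) (h11.sector h0 h1) (h23.sector h1 h0)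
    (h32.sector h0 h1)
    (fun t => by
      simp only [SectorData.sector, ContinuousMap.coe_mk, clamp_eq h0, h02])
    (fun t => by
      simp only [SectorData.sector, ContinuousMap.coe_mk, clamp_eq h0, h13])
  have e := fun e => (d e).value_eq h hS (hd e) hm hn0 (hv e) (hsmall e)
  have r00 := h00.rayDefect (V := V) (pot := pot) (I := I) (w := w) (u := u) (m * n)
  have r11 := h11.rayDefect (V := V) (pot := pot) (I := I) (w := w) (u := u) (m * n)
  have r23 := h23.rayDefect (V := V) (pot := pot) (I := I) (w := w) (u := u) (m * n)
  have r32 := h32.rayDefect (V := V) (pot := pot) (I := I) (w := w) (u := u) (m * n)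
  have b02 : (fun t => (d 0).annulus u (0, t)) = fun t => (d 2).annulus u (0, t) :=
    funext fun t => by simp only [SectorData.annulus, h02]
  have b13 : (fun t => (d 1).annulus u (0, t)) = fun t => (d 3).annulus u (0, t) :=
    funext fun t => by simp only [SectorData.annulus, h13]
  have e0 := e 0
  have e1 := e 1
  rw [b02] at e0
  rw [b13] at e1
  linarith [e 2, e 3]

end SphereArea

/-! ### Green's theorem in the plane -/

section Plane

/-- The area form of the plane. -/
def planeDet : ℂ →L[ℝ] ℂ →L[ℝ] ℝ :=
  Complex.reCLM.smulRight Complex.imCLM - Complex.imCLM.smulRight Complex.reCLM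

theorem planeDet_apply (a b : ℂ) : planeDet a b = a.re * b.im - a.im * b.re := by
  simp [planeDet]

/-- Every 2-form in the plane is closed, so the Poincaré lemma applies to any density. -/
theorem exists_isPrimitiveOn_plane {W : ℂ → ℝ} (hW : ContDiff ℝ 1 W) :
    ∃ η, IsPrimitiveOn η (fun z => W z • planeDet) univ := by
  refine exists_isPrimitiveOn isOpen_univ convex_univ
    (hW.smul contDiff_const).contDiffOn (fun z _ a => ?_) (fun z _ a b c => ?_)
  · simp [planeDet_apply, mul_comm]
  · have hd : HasFDerivAt (fun z => W z • planeDet) ((fderiv ℝ W z).smulRight planeDet) z :=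
      ((hW.differentiable (by norm_num)) z).hasFDerivAt.smul_const planeDet
    have hlin : ∀ a : ℂ, fderiv ℝ W z a = a.re * fderiv ℝ W z 1 + a.im * fderiv ℝ W z Complex.I := by
      intro a
      conv_lhs => rw [← Complex.re_add_im a]
      have : ((a.re : ℂ) + a.im * Complex.I) = a.re • (1 : ℂ) + a.im • Complex.I := by simp
      rw [this, map_add, map_smul, map_smul, smul_eq_mul, smul_eq_mul]
    rw [hd.fderiv]
    simp only [ContinuousLinearMap.smulRight_apply, smul_apply, planeDet_apply,
      smul_eq_mul]
    rw [hlin a, hlin b, hlin c]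
    ring

/-- The integral of a 1-form in the plane along a path. -/
def pathInt (η : ℂ → ℂ →L[ℝ] ℝ) (c : ℝ → ℂ) (a b : ℝ) : ℝ := ∫ t in a..b, η (c t) (deriv c t)

/-- The integral of the 2-form with density `W` over a rectangle. -/
def planeArea (W : ℂ → ℝ) (G : ℝ × ℝ → ℂ) (p p' t t' : ℝ) : ℝ :=
  ∫ x in Icc p p' ×ˢ Icc t t', W (G x) * planeDet (fderiv ℝ G x (1, 0)) (fderiv ℝ G x (0, 1))

theorem deriv_horizontal {G : ℝ × ℝ → ℂ} {a b : ℝ} (hG : DifferentiableAt ℝ G (a, b)) :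
    deriv (fun a => G (a, b)) a = fderiv ℝ G (a, b) (1, 0) := by
  have h1 : HasDerivAt (fun a : ℝ => (a, b)) (1, 0) a := (hasDerivAt_id a).prodMk (hasDerivAt_const a b)
  exact (hG.hasFDerivAt.comp_hasDerivAt a h1).deriv

theorem deriv_vertical {G : ℝ × ℝ → ℂ} {a b : ℝ} (hG : DifferentiableAt ℝ G (a, b)) :
    deriv (fun b => G (a, b)) b = fderiv ℝ G (a, b) (0, 1) := by
  have h1 : HasDerivAt (fun b : ℝ => (a, b)) (0, 1) b := (hasDerivAt_const b a).prodMk (hasDerivAt_id b)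
  exact (hG.hasFDerivAt.comp_hasDerivAt b h1).deriv

theorem continuousOn_planeDensity {W : ℂ → ℝ} (hW : Continuous W) {G : ℝ × ℝ → ℂ}
    {K : Set (ℝ × ℝ)} (hG : ∀ x ∈ K, ContDiffAt ℝ 2 G x) :
    ContinuousOn (fun x => W (G x) * planeDet (fderiv ℝ G x (1, 0)) (fderiv ℝ G x (0, 1))) K := by
  intro x hx
  have hf : ContinuousAt (fderiv ℝ G) x :=
    ((hG x hx).fderiv_right (m := 1) (by norm_num)).continuousAt
  have hp : Continuous fun y : ℂ × ℂ => planeDet y.1 y.2 := by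
    simp only [planeDet_apply]; fun_prop
  exact ((ContinuousAt.comp (f := G) hW.continuousAt (hG x hx).continuousAt).mul
    (ContinuousAt.comp (f := fun x => (fderiv ℝ G x (1, 0), fderiv ℝ G x (0, 1)))
      hp.continuousAt ((hf.clm_apply continuousAt_const).prodMk
        (hf.clm_apply continuousAt_const)))).continuousWithinAt

theorem planeArea_eq {W : ℂ → ℝ} (hW : Continuous W) {η : ℂ → ℂ →L[ℝ] ℝ}
    (hη : IsPrimitiveOn η (fun z => W z • planeDet) univ) {G : ℝ × ℝ → ℂ} {p p' t t' : ℝ}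
    (hp : p ≤ p') (ht : t ≤ t') (hG : ∀ x ∈ Icc p p' ×ˢ Icc t t', ContDiffAt ℝ 2 G x) :
    planeArea W G p p' t t' = pathInt η (fun a => G (a, t)) p p' + pathInt η (fun b => G (p', b)) t t'
      - pathInt η (fun b => G (p, b)) t t' - pathInt η (fun a => G (a, t')) p p' := by
  have key := (hη.pullback hG (fun x _ => mem_univ (G x))).integral_rect hp ht
    (continuousOn_planeDensity hW hG)
  have hd : ∀ x ∈ Icc p p' ×ˢ Icc t t', DifferentiableAt ℝ G x := fun x hx =>
    (hG x hx).differentiableAt (by norm_num)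
  have hpl := left_mem_Icc.2 hp
  have hpr := right_mem_Icc.2 hp
  have htl := left_mem_Icc.2 ht
  have htr := right_mem_Icc.2 ht
  have eh : ∀ b ∈ Icc t t', pathInt η (fun a => G (a, b)) p p' =
      ∫ a in p..p', ((η (G (a, b))).comp (fderiv ℝ G (a, b))) (1, 0) := fun b hb => by
    refine intervalIntegral.integral_congr fun a ha => ?_
    rw [uIcc_of_le hp] at ha
    simp only [deriv_horizontal (hd (a, b) ⟨ha, hb⟩), ContinuousLinearMap.comp_apply]
  have ev : ∀ a ∈ Icc p p', pathInt η (fun b => G (a, b)) t t' =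
      ∫ b in t..t', ((η (G (a, b))).comp (fderiv ℝ G (a, b))) (0, 1) := fun a ha => by
    refine intervalIntegral.integral_congr fun b hb => ?_
    rw [uIcc_of_le ht] at hb
    simp only [deriv_vertical (hd (a, b) ⟨ha, hb⟩), ContinuousLinearMap.comp_apply]
  rw [eh t htl, eh t' htr, ev p hpl, ev p' hpr, ← key]
  rfl

theorem planeArea_eq_zero {W : ℂ → ℝ} {G : ℝ × ℝ → ℂ} {p p' t t' : ℝ}
    (h : ∀ x ∈ Icc p p' ×ˢ Icc t t', W (G x) = 0) : planeArea W G p p' t t' = 0 := by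
  rw [planeArea, setIntegral_congr_fun (g := fun _ => 0)
    (measurableSet_Icc.prod measurableSet_Icc) fun x hx => by simp only [h x hx, zero_mul]]
  simp

theorem pathInt_const (η : ℂ → ℂ →L[ℝ] ℝ) (z : ℂ) (a b : ℝ) : pathInt η (fun _ => z) a b = 0 := by
  simp [pathInt]

theorem pathInt_comp_affine (η : ℂ → ℂ →L[ℝ] ℝ) {c : ℝ → ℂ} (hc : Differentiable ℝ c)
    (κ o a b : ℝ) : pathInt η (fun t => c (o + κ * t)) a b = pathInt η c (o + κ * a) (o + κ * b) := by
  have hd : ∀ t, deriv (fun t => c (o + κ * t)) t = κ • deriv c (o + κ * t) := by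
    intro t
    have h1 : HasDerivAt (fun t => o + κ * t) κ t := by
      simpa using ((hasDerivAt_id t).const_mul κ).const_add o
    exact ((hc _).hasDerivAt.scomp t h1).deriv
  simp only [pathInt, hd, map_smul, smul_eq_mul]
  rw [intervalIntegral.integral_const_mul]
  exact intervalIntegral.mul_integral_comp_add_mul (f := fun t => η (c t) (deriv c t)) κ o

theorem pathInt_periodic (η : ℂ → ℂ →L[ℝ] ℝ) {c : ℝ → ℂ} (hc : ∀ t, c (t + 1) = c t) (a : ℝ) :
    pathInt η c a (a + 1) = pathInt η c 0 1 := by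
  have hper : Function.Periodic (fun t => η (c t) (deriv c t)) 1 := by
    intro t
    have : deriv c (t + 1) = deriv c t := by
      rw [← deriv_comp_add_const c 1 t]
      congr 1
      exact funext hc
    simp only [hc, this]
  have := hper.intervalIntegral_add_eq a 0
  rw [zero_add] at this
  exact this

/-- Green's theorem for a homotopy of loops. -/
theorem pathInt_sub_eq_planeArea {W : ℂ → ℝ} (hW : Continuous W) {η : ℂ → ℂ →L[ℝ] ℝ}
    (hη : IsPrimitiveOn η (fun z => W z • planeDet) univ) {G : ℝ × ℝ → ℂ} {p p' t t' : ℝ}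
    (hp : p ≤ p') (ht : t ≤ t') (hG : ∀ x ∈ Icc p p' ×ˢ Icc t t', ContDiffAt ℝ 2 G x)
    (hper : ∀ᶠ a in 𝓝ˢ (Icc p p'), G (a, t) = G (a, t')) :
    pathInt η (fun b => G (p', b)) t t' - pathInt η (fun b => G (p, b)) t t' =
      planeArea W G p p' t t' := by
  have he : pathInt η (fun a => G (a, t)) p p' = pathInt η (fun a => G (a, t')) p p' := by
    refine intervalIntegral.integral_congr fun a ha => ?_
    rw [uIcc_of_le hp] at ha
    have h1 : (fun a => G (a, t)) =ᶠ[𝓝 a] fun a => G (a, t') :=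
      hper.filter_mono (nhds_le_nhdsSet ha)
    simp only [h1.deriv_eq, h1.self_of_nhds]
  rw [planeArea_eq hW hη hp ht hG, he]
  ring

/-- The loop is contracted radially to the centre of the ball; the homotopy stays in the ball, where
the density is zero. -/
theorem pathInt_eq_zero {W : ℂ → ℝ} (hW : Continuous W) {η : ℂ → ℂ →L[ℝ] ℝ}
    (hη : IsPrimitiveOn η (fun z => W z • planeDet) univ) {c : ℝ → ℂ} (hc : ContDiff ℝ 2 c)
    (hper : ∀ t, c (t + 1) = c t) {z : ℂ} {r : ℝ} (h0 : ∀ y ∈ Metric.ball z r, W y = 0)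
    (hmem : ∀ t, c t ∈ Metric.ball z r) : pathInt η c 0 1 = 0 := by
  let G : ℝ × ℝ → ℂ := fun x => z + x.1 • (c x.2 - z)
  have hG : ContDiff ℝ 2 G :=
    contDiff_const.add (contDiff_fst.smul ((hc.comp contDiff_snd).sub contDiff_const))
  have h := pathInt_sub_eq_planeArea (p := 0) (p' := 1) (t := 0) (t' := 1) hW hη zero_le_one zero_le_one (fun x _ => hG.contDiffAt)
    (Eventually.of_forall fun a => by
      have := hper 0
      rw [zero_add] at this
      simp only [G, this])
  rw [planeArea_eq_zero fun x hx => h0 _ ((convex_ball z r).add_smul_sub_mem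
    (Metric.mem_ball_self (Metric.pos_of_mem_ball (hmem 0))) (hmem _) hx.1)] at h
  simp only [G, zero_smul, add_zero, one_smul, add_sub_cancel, pathInt_const, sub_zero] at h
  exact h

open Complex in
/-- Polar coordinates on a disc. -/
theorem planeArea_polar (W : ℂ → ℝ) (R : ℝ) :
    planeArea W (fun x => x.1 * exp (x.2 * I)) 0 R (-Real.pi) Real.pi =
      ∫ z in Metric.ball 0 R, W z := by
  let G : ℝ × ℝ → ℂ := fun x => x.1 * exp (x.2 * I)
  have hG : ContDiff ℝ 2 G := by
    refine (ofRealCLM.contDiff.comp contDiff_fst).mul ?_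
    exact ((ofRealCLM.contDiff.comp contDiff_snd).mul contDiff_const).cexp
  change planeArea W G 0 R (-Real.pi) Real.pi = _
  rw [← integral_indicator Metric.isOpen_ball.measurableSet, planeArea,
    ← Complex.integral_comp_polarCoord_symm]
  have hdet : ∀ x : ℝ × ℝ, planeDet (fderiv ℝ G x (1, 0)) (fderiv ℝ G x (0, 1)) = x.1 := by
    rintro ⟨r, θ⟩
    have hd : DifferentiableAt ℝ G (r, θ) := hG.differentiable (by norm_num) _
    rw [← deriv_horizontal hd, ← deriv_vertical hd]
    have e1 : HasDerivAt (fun a : ℝ => G (a, θ)) (exp (θ * I)) r := by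
      simpa using (ofRealCLM.hasDerivAt (x := r)).mul_const (exp (θ * I))
    have e2 : HasDerivAt (fun b : ℝ => G (r, b)) (r * (exp (θ * I) * I)) θ := by
      have := ((ofRealCLM.hasDerivAt (x := θ)).mul_const I).cexp.const_mul (r : ℂ)
      simpa using this
    rw [e1.deriv, e2.deriv, planeDet_apply, exp_mul_I, ← ofReal_cos, ← ofReal_sin]
    simp only [add_re, add_im, mul_re, mul_im, ofReal_re, ofReal_im, I_re, I_im]
    linear_combination r * Real.cos_sq_add_sin_sq θ
  have hsymm : ∀ x : ℝ × ℝ, Complex.polarCoord.symm x = G x := fun x => by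
    simp only [G]
    rw [Complex.polarCoord_symm_apply, exp_mul_I, ofReal_cos, ofReal_sin]
  have hn : ∀ {x : ℝ × ℝ}, 0 < x.1 → ‖G x‖ = x.1 := fun {x} hx => by
    simp only [G]
    rw [norm_mul, norm_exp_ofReal_mul_I, mul_one, norm_real, Real.norm_of_nonneg hx.le]
  simp only [hdet, hsymm, smul_eq_mul]
  have hae : (Icc 0 R ×ˢ Icc (-Real.pi) Real.pi : Set (ℝ × ℝ)) =ᵐ[volume]
      (Ioo 0 R ×ˢ Ioo (-Real.pi) Real.pi : Set (ℝ × ℝ)) := by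
    rw [Measure.volume_eq_prod]
    exact Measure.set_prod_ae_eq Ioo_ae_eq_Icc.symm Ioo_ae_eq_Icc.symm
  rw [setIntegral_congr_set hae]
  have htarget : polarCoord.target = (Ioi (0 : ℝ) ×ˢ Ioo (-Real.pi) Real.pi) := rfl
  rw [htarget]
  simp only [mul_comm (W _)]
  rw [setIntegral_eq_of_subset_of_forall_sdiff_eq_zero (s := Ioo 0 R ×ˢ Ioo (-Real.pi) Real.pi)
    (measurableSet_Ioi.prod measurableSet_Ioo) (prod_mono Ioo_subset_Ioi_self le_rfl)]
  · refine setIntegral_congr_fun (measurableSet_Ioo.prod measurableSet_Ioo) fun x hx => ?_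
    rw [indicator_of_mem (mem_ball_zero_iff.2 ((hn hx.1.1).trans_lt hx.1.2))]
  · rintro x ⟨⟨hr, hθ⟩, hx⟩
    have hRr : R ≤ x.1 := not_lt.1 fun hlt => hx ⟨⟨hr, hlt⟩, hθ⟩
    rw [indicator_of_notMem, mul_zero]
    rw [mem_ball_zero_iff, hn hr, not_lt]
    exact hRr

open Complex in
/-- Stokes' theorem for a disc. -/
theorem pathInt_circle {W : ℂ → ℝ} (hW : Continuous W) {η : ℂ → ℂ →L[ℝ] ℝ}
    (hη : IsPrimitiveOn η (fun z => W z • planeDet) univ) {R : ℝ} (hR : 0 < R) :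
    pathInt η (fun θ => R * exp (θ * I)) (-Real.pi) Real.pi = ∫ z in Metric.ball 0 R, W z := by
  have hpi : -Real.pi ≤ Real.pi := by linarith [Real.pi_pos]
  let G : ℝ × ℝ → ℂ := fun x => x.1 * exp (x.2 * I)
  have hG : ContDiff ℝ 2 G := by
    refine (ofRealCLM.contDiff.comp contDiff_fst).mul ?_
    exact ((ofRealCLM.contDiff.comp contDiff_snd).mul contDiff_const).cexp
  have hper : ∀ a : ℝ, G (a, -Real.pi) = G (a, Real.pi) := fun a => by
    simp only [G]
    rw [ofReal_neg, neg_mul, exp_neg, exp_pi_mul_I]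
    norm_num
  have h := pathInt_sub_eq_planeArea (p := 0) (p' := R) (t := -Real.pi) (t' := Real.pi) hW hη hR.le
    hpi (fun x _ => hG.contDiffAt) (Eventually.of_forall hper)
  have hz : pathInt η (fun b => G (0, b)) (-Real.pi) Real.pi = 0 := by
    simp only [G, ofReal_zero, zero_mul, pathInt_const]
  rw [hz, sub_zero] at h
  exact h.trans (planeArea_polar W R)

end Plane

/-! ### The sectors of the capped pair of pants -/

section PantsSectors

variable (C : CylindricalEnds)

/-- The loops at distance `L` from the boundaries of the ends, rotated by `o`, are so close to the
punctures that they can be joined linearly to standard loops. -/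
structure CylindricalEnds.IsDeep (o : Fin 3 → ℝ) (L : ℝ) : Prop where
  one_lt : 1 < L
  zero : ∀ t : ℝ, 0 < (C.point 0 L (o 0 + t) * Complex.exp (-(2 * Real.pi * t * Complex.I))).re ∧
    ‖C.point 0 L (o 0 + t)‖ < 1
  one : ∀ t : ℝ,
    0 < ((1 - C.point 1 L (o 1 + t)) * Complex.exp (-(2 * Real.pi * t * Complex.I))).re ∧
      ‖1 - C.point 1 L (o 1 + t)‖ < 1
  two : ∀ t : ℝ, 1 < (C.point 2 L (o 2 + t / 2) *
    Complex.exp (-(Real.pi * (t + 1 / 2) * Complex.I))).re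

theorem CylindricalEnds.exists_isDeep : ∃ o : Fin 3 → ℝ, (∀ᶠ L in atTop, C.IsDeep o L) ∧
    ∀ R : ℝ, ∀ᶠ s in atTop, ∀ t : ℝ, R < (C.point 2 s (o 2 + t / 2) *
      Complex.exp (-(Real.pi * (t + 1 / 2) * Complex.I))).re := by
  obtain ⟨o0, h0⟩ := C.exists_phase (i := 0) rfl (σ := fun z => z) differentiable_id
    Function.injective_id (fun z hz h => hz (by simp [h])) C.tendsto_chart_zero
  obtain ⟨o1, h1⟩ := C.exists_phase (i := 1) rfl (σ := fun z => 1 - z)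
    (by fun_prop) (sub_right_injective) (fun z hz h => hz (by simp [(sub_eq_zero.1 h).symm]))
    (by simpa using C.tendsto_chart_one.const_sub 1)
  obtain ⟨o2, h2⟩ := C.exists_phase_two
  refine ⟨![o0, o1, o2], ?_, h2⟩
  filter_upwards [h0, h1, h2 1, eventually_gt_atTop 1] with L a0 a1 a2 a3
  exact ⟨a3, a0, a1, a2⟩

/-- The end reached by a sector. -/
def sectorEnd : Fin 4 → Fin 3 := ![0, 1, 2, 2]

/-- The angular speed of a sector. -/
def sectorRate : Fin 4 → ℝ := ![1, 1, 1 / 2, 1 / 2]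

/-- The initial angle of a sector. -/
def sectorOffset (o : Fin 3 → ℝ) : Fin 4 → ℝ := ![o 0, o 1, o 2, o 2 + 1 / 2]

/-- The angle function of a sector. -/
def sectorAngle (o : Fin 3 → ℝ) (e : Fin 4) (t : ℝ) : ℝ := sectorOffset o e + sectorRate e * t

/-- The symmetry `z ↦ 1 - z` of the pair of pants, for the sectors in its second half. -/
def sectorFlip (e : Fin 4) (z : ℂ) : ℂ := ![0, 1, 0, 1] e + ![1, -1, 1, -1] e * z

/-- The homotopy of a sector, from a circle of radius `1/2` around `0` or `1` to the end. -/
def CylindricalEnds.sectorHomotopy (o : Fin 3 → ℝ) (L : ℝ) (e : Fin 4) (x : ℝ × ℝ) : ℂ :=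
  sectorFlip e (conn (fun t => sectorFlip e (C.point (sectorEnd e) L (sectorAngle o e t))) x.1 x.2)

theorem sectorFlip_flip (e : Fin 4) (z : ℂ) : sectorFlip e (sectorFlip e z) = z := by
  fin_cases e <;> simp [sectorFlip]

theorem sectorFlip_mem_pants (e : Fin 4) {z : ℂ} (hz : z ∈ pants) : sectorFlip e z ∈ pants := by
  have := one_sub_mem_pants hz
  fin_cases e <;> simpa [sectorFlip, ← sub_eq_add_neg]

theorem CylindricalEnds.contDiff_point (i : Fin 3) {L : ℝ} (hL : 0 < L) :
    ContDiff ℝ ∞ (C.point i L) := by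
  rw [contDiff_iff_contDiffAt]
  intro t
  have h1 : ContDiffAt ℝ ∞ (C.chart i) (((-(endSign i * L) : ℝ) : ℂ) + t * Complex.I) :=
    ((C.analyticAt i (by rwa [depth_point])).contDiffAt (n := ∞)).restrict_scalars ℝ
  exact h1.comp t ((contDiff_const.add
    (Complex.ofRealCLM.contDiff.mul contDiff_const)).contDiffAt)

theorem contDiff_sectorFlip (e : Fin 4) : ContDiff ℝ ∞ (sectorFlip e) :=
  contDiff_const.add (contDiff_const.mul contDiff_id)

theorem continuous_sectorAngle (o : Fin 3 → ℝ) (e : Fin 4) : Continuous (sectorAngle o e) := by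
  unfold sectorAngle; fun_prop

theorem contDiff_sectorAngle (o : Fin 3 → ℝ) (e : Fin 4) : ContDiff ℝ ∞ (sectorAngle o e) := by
  unfold sectorAngle; fun_prop

theorem CylindricalEnds.contDiff_sectorHomotopy (o : Fin 3 → ℝ) {L : ℝ} (hL : 0 < L) (e : Fin 4) :
    ContDiff ℝ ∞ (C.sectorHomotopy o L e) := by
  refine (contDiff_sectorFlip e).comp ?_
  unfold conn
  have h1 : ContDiff ℝ ∞ fun x : ℝ × ℝ => ((x.1 : ℝ) : ℂ) :=
    Complex.ofRealCLM.contDiff.comp contDiff_fst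
  have h2 : ContDiff ℝ ∞ fun x : ℝ × ℝ => ((x.2 : ℝ) : ℂ) :=
    Complex.ofRealCLM.contDiff.comp contDiff_snd
  refine ((contDiff_const.sub h1).mul (contDiff_const.mul
    (((contDiff_const.mul h2).mul contDiff_const).cexp))).add (h1.mul ?_)
  exact (contDiff_sectorFlip e).comp ((C.contDiff_point (sectorEnd e) hL).comp
    ((contDiff_sectorAngle o e).comp contDiff_snd))

variable {C}

/-- Sectors `0` and `1` stay in unit discs around their punctures. Sector `2` stays on one side of a
rotating line, and sector `3` is treated like it after the symmetry `z ↦ 1 - z`. -/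
theorem CylindricalEnds.IsDeep.sectorHomotopy_mem {o : Fin 3 → ℝ} {L : ℝ} (h : C.IsDeep o L)
    (e : Fin 4) {p t : ℝ} (hp : p ∈ Icc (0 : ℝ) 1) (ht : t ∈ Icc (0 : ℝ) 1) :
    C.sectorHomotopy o L e (p, t) ∈ pants := by
  refine sectorFlip_mem_pants e ?_
  have h0 := h.zero t
  have h1 := h.one t
  have h2 := h.two t
  have h3 := h.two (t + 1)
  fin_cases e
  · refine conn_mem_pants_of_norm_lt hp ?_ ?_ <;>
      simp [sectorFlip, sectorEnd, sectorAngle, sectorOffset, sectorRate] <;> simp_all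
  · refine conn_mem_pants_of_norm_lt hp ?_ ?_ <;>
      simp [sectorFlip, sectorEnd, sectorAngle, sectorOffset, sectorRate, ← sub_eq_add_neg] <;>
      simp_all
  · refine conn_mem_pants_of_re_pos hp ht ?_
    have : sectorFlip 2 (C.point (sectorEnd 2) L (sectorAngle o 2 t)) =
        C.point 2 L (o 2 + t / 2) := by
      simp [sectorFlip, sectorEnd, sectorAngle, sectorOffset, sectorRate, div_eq_inv_mul]
    change 0 < (sectorFlip 2 (C.point (sectorEnd 2) L (sectorAngle o 2 t)) * _).re
    rw [this]
    linarith
  · refine conn_mem_pants_of_re_pos hp ht ?_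
    have e1 : sectorFlip 3 (C.point (sectorEnd 3) L (sectorAngle o 3 t)) =
        1 - C.point 2 L (o 2 + (t + 1) / 2) := by
      simp [sectorFlip, sectorEnd, sectorAngle, sectorOffset, sectorRate, ← sub_eq_add_neg]
      congr 1
      ring
    change 0 < (sectorFlip 3 (C.point (sectorEnd 3) L (sectorAngle o 3 t)) * _).re
    -- The second half of the loop at infinity points in the opposite direction, which compensates
    -- the sign in `1 - z`.
    have e2 : Complex.exp (-(Real.pi * ((t + 1 : ℝ) + 1 / 2) * Complex.I)) =
        -Complex.exp (-(Real.pi * (t + 1 / 2) * Complex.I)) := by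
      have : (-(Real.pi * ((t + 1 : ℝ) + 1 / 2) * Complex.I) : ℂ) =
          -(Real.pi * (t + 1 / 2) * Complex.I) - Real.pi * Complex.I := by push_cast; ring
      rw [this, Complex.exp_sub, Complex.exp_pi_mul_I, div_neg, div_one]
    rw [e2, mul_neg, Complex.neg_re] at h3
    rw [e1, sub_mul, one_mul, Complex.sub_re]
    -- The summand `1` contributes at least `-1` to the real part. This is why `IsDeep.two` asks for
    -- more than `1` and not only for positivity.
    have hn : ‖Complex.exp (-(Real.pi * (t + 1 / 2) * Complex.I))‖ = 1 := by
      have := Complex.norm_exp_ofReal_mul_I (-(Real.pi * (t + 1 / 2)))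
      push_cast at this
      rwa [neg_mul] at this
    have := (abs_le.1 ((Complex.abs_re_le_norm _).trans hn.le)).1
    linarith

theorem CylindricalEnds.sectorHomotopy_one (o : Fin 3 → ℝ) (L : ℝ) (e : Fin 4) (t : ℝ) :
    C.sectorHomotopy o L e (1, t) = C.point (sectorEnd e) L (sectorAngle o e t) := by
  simp [sectorHomotopy, conn, sectorFlip_flip]

/-- The sectors of the capped pair of pants. -/
def CylindricalEnds.IsDeep.sectorData {o : Fin 3 → ℝ} {L : ℝ} (h : C.IsDeep o L) {r : ℝ}
    (hr : 0 < r) (e : Fin 4) : SectorData C where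
  end_ := sectorEnd e
  angle := sectorAngle o e
  length := L
  radius := r
  homotopy := C.sectorHomotopy o L e
  one_lt_length := h.one_lt
  radius_pos := hr
  continuous_angle := continuous_sectorAngle o e
  continuousOn_homotopy :=
    (C.contDiff_sectorHomotopy o (zero_lt_one.trans h.one_lt) e).continuous.continuousOn
  mem_pants p hp t ht := h.sectorHomotopy_mem e hp ht
  homotopy_one t _ := C.sectorHomotopy_one o L e t

theorem CylindricalEnds.point_eq_of_add_one (i : Fin 3) {L : ℝ} (hL : 0 < L) {a b : ℝ}
    (h : b = a + 1) : C.point i L b = C.point i L a := by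
  have := C.point_add_int i hL a 1
  rw [Int.cast_one] at this
  rw [h, this]

/-! ### The rays and circles along which the four sectors meet. -/

section Meets

variable {o : Fin 3 → ℝ} {L : ℝ} (h : C.IsDeep o L) {r : ℝ} (hr : 0 < r)

theorem CylindricalEnds.IsDeep.meets_zero : (h.sectorData hr 0).Meets 0 (h.sectorData hr 0) 1 where
  homotopy p := by
    have hp := C.point_eq_of_add_one 0 (zero_lt_one.trans h.one_lt) (rfl : o 0 + 1 = o 0 + 1)
    simp [sectorData, sectorHomotopy, conn, sectorFlip, sectorEnd, sectorAngle, sectorOffset,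
      sectorRate] at hp ⊢
    exact Or.inl hp.symm
  end_ := rfl
  length := rfl
  radius := rfl
  angle := ⟨1, by simp [sectorData, sectorAngle, sectorRate]⟩

theorem CylindricalEnds.IsDeep.meets_one : (h.sectorData hr 1).Meets 0 (h.sectorData hr 1) 1 where
  homotopy p := by
    have hp := C.point_eq_of_add_one 1 (zero_lt_one.trans h.one_lt) (rfl : o 1 + 1 = o 1 + 1)
    simp [sectorData, sectorHomotopy, conn, sectorFlip, sectorEnd, sectorAngle, sectorOffset,
      sectorRate] at hp ⊢
    exact Or.inl hp.symm
  end_ := rfl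
  length := rfl
  radius := rfl
  angle := ⟨1, by simp [sectorData, sectorAngle, sectorRate]⟩

theorem CylindricalEnds.IsDeep.meets_two_three :
    (h.sectorData hr 2).Meets 1 (h.sectorData hr 3) 0 where
  homotopy p := by
    simp [sectorData, sectorHomotopy, conn, sectorFlip, sectorEnd, sectorAngle, sectorOffset,
      sectorRate]
    ring
  end_ := rfl
  length := rfl
  radius := rfl
  angle := ⟨0, by simp [sectorData, sectorAngle, sectorRate, sectorOffset]⟩

theorem CylindricalEnds.IsDeep.meets_two_three_symm :
    (h.sectorData hr 2).Meets 0 (h.sectorData hr 3) 1 where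
  homotopy p := by
    have hp := C.point_eq_of_add_one 2 (zero_lt_one.trans h.one_lt)
      (show o 2 + 2⁻¹ + 2⁻¹ = o 2 + 1 by norm_num [add_assoc])
    simp [sectorData, sectorHomotopy, conn, sectorFlip, sectorEnd, sectorAngle, sectorOffset,
      sectorRate]
    rw [hp]
    ring
  end_ := rfl
  length := rfl
  radius := rfl
  angle := ⟨1, by simp [sectorData, sectorAngle, sectorRate, sectorOffset]; ring⟩

theorem CylindricalEnds.sectorHomotopy_zero_two (o : Fin 3 → ℝ) (L t : ℝ) :
    C.sectorHomotopy o L 0 (0, t) = C.sectorHomotopy o L 2 (0, t) := by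
  simp [sectorHomotopy, conn, sectorFlip]

theorem CylindricalEnds.sectorHomotopy_one_three (o : Fin 3 → ℝ) (L t : ℝ) :
    C.sectorHomotopy o L 1 (0, t) = C.sectorHomotopy o L 3 (0, t) := by
  simp [sectorHomotopy, conn, sectorFlip]

end Meets

variable {E : Type*} [NormedAddCommGroup E] [NormedSpace ℝ E]
variable {M : Type} [TopologicalSpace M] [ChartedSpace E M]
variable {w : Fin 3 → ℂ → M} {u : ℂ → M}

theorem contMDiffAt_polarDisc {w : ℂ → M} (hw : ContMDiffOn 𝓘(ℝ, ℂ) 𝓘(ℝ, E) ∞ w (Metric.closedBall 0 1))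
    {α : ℝ → ℝ} (hα : ContDiff ℝ ∞ α) {r : ℝ} {x : ℝ × ℝ} (hx : |(1 - x.1) * r| < 1) :
    ContMDiffAt 𝓘(ℝ, ℝ × ℝ) 𝓘(ℝ, E) ∞ (polarDisc w α r) x := by
  have hg : ContDiff ℝ ∞ fun x : ℝ × ℝ => (((1 - x.1) * r : ℝ) : ℂ) *
      Complex.exp (2 * Real.pi * (α x.2) * Complex.I) := by
    refine (Complex.ofRealCLM.contDiff.comp
      ((contDiff_const.sub contDiff_fst).mul contDiff_const)).mul ?_
    exact ((contDiff_const.mul (Complex.ofRealCLM.contDiff.comp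
      (hα.comp contDiff_snd))).mul contDiff_const).cexp
  refine ContMDiffAt.comp (g := w) x (hw.contMDiffAt ?_) hg.contMDiff.contMDiffAt
  refine Filter.mem_of_superset (Metric.isOpen_ball.mem_nhds ?_) Metric.ball_subset_closedBall
  have := Complex.norm_exp_ofReal_mul_I (2 * Real.pi * α x.2)
  push_cast at this
  rw [mem_ball_zero_iff, norm_mul, this, mul_one, Complex.norm_real]
  exact hx

theorem CylindricalEnds.IsDeep.isSmooth {o : Fin 3 → ℝ} {L : ℝ} (h : C.IsDeep o L) {r : ℝ}
    (hr : 0 < r) (hr1 : r < 1) (e : Fin 4) (hu : ContMDiffOn 𝓘(ℝ, ℂ) 𝓘(ℝ, E) ∞ u pants)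
    (hw : ∀ i, ContMDiffOn 𝓘(ℝ, ℂ) 𝓘(ℝ, E) ∞ (w i) (Metric.closedBall 0 1)) :
    (h.sectorData hr e).IsSmooth E w u where
  annulus x hx := by
    have h2 : (2 : WithTop ℕ∞) ≤ ∞ := by norm_cast
    refine (ContMDiffAt.comp (g := u) x (hu.contMDiffAt (isOpen_pants.mem_nhds
      (h.sectorHomotopy_mem e hx.1 hx.2))) ?_).of_le h2
    exact (C.contDiff_sectorHomotopy o (zero_lt_one.trans h.one_lt) e).contMDiff.contMDiffAt
  disc x hx := by
    have h2 : (2 : WithTop ℕ∞) ≤ ∞ := by norm_cast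
    refine (contMDiffAt_polarDisc (hw _) (contDiff_sectorAngle o e) ?_).of_le h2
    change |(1 - x.1) * r| < 1
    rw [abs_of_nonneg (mul_nonneg (by linarith [hx.1.2]) hr.le)]
    have : (1 - x.1) * r ≤ 1 * r := mul_le_mul_of_nonneg_right (by linarith [hx.1.1]) hr.le
    linarith
  radius_lt := hr1

end PantsSectors

/-! ### Densities on the pair of pants -/

section Density

variable (C : CylindricalEnds)

/-- The coordinate `τ + it` of the point of an end with given distance and angle. -/
def endCoord (i : Fin 3) (x : ℝ × ℝ) : ℂ := ((-(endSign i * x.1) : ℝ) : ℂ) + x.2 * Complex.I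

/-- The integral of the 2-form with density `D` over the part `a ≤ s ≤ b` of an end. -/
def CylindricalEnds.endArea (D : ℂ → ℝ) (i : Fin 3) (a b : ℝ) : ℝ :=
  ∫ x in Icc a b ×ˢ Icc (0 : ℝ) 1, D (C.point i x.1 x.2) * ‖deriv (C.chart i) (endCoord i x)‖ ^ 2

theorem depth_endCoord (i : Fin 3) (x : ℝ × ℝ) : depth i (endCoord i x) = x.1 :=
  depth_point i x.1 x.2

theorem contDiff_endCoord (i : Fin 3) : ContDiff ℝ ∞ (endCoord i) :=
  (Complex.ofRealCLM.contDiff.comp (contDiff_const.mul contDiff_fst).neg).add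
    ((Complex.ofRealCLM.contDiff.comp contDiff_snd).mul contDiff_const)

theorem CylindricalEnds.contDiffAt_point_prod (i : Fin 3) {x : ℝ × ℝ} (hx : 0 < x.1) :
    ContDiffAt ℝ ∞ (fun x : ℝ × ℝ => C.point i x.1 x.2) x := by
  have h1 : ContDiffAt ℝ ∞ (C.chart i) (endCoord i x) :=
    ((C.analyticAt i (by rwa [depth_endCoord])).contDiffAt (n := ∞)).restrict_scalars ℝ
  exact h1.comp x (contDiff_endCoord i).contDiffAt

theorem CylindricalEnds.hasDerivAt_point_fst (i : Fin 3) {s : ℝ} (hs : 0 < s) (t : ℝ) :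
    HasDerivAt (fun s => C.point i s t) (-endSign i * deriv (C.chart i) (endCoord i (s, t))) s := by
  have h1 := (C.analyticAt i (w := endCoord i (s, t)) (by rwa [depth_endCoord])).differentiableAt.hasDerivAt
  have h2 : HasDerivAt (fun s => endCoord i (s, t)) (-endSign i : ℂ) s := by
    have h3 : HasDerivAt (fun s : ℝ => -(endSign i * s)) (-endSign i) s := by
      have h4 : HasDerivAt (fun s : ℝ => -endSign i * s) (-endSign i) s := by
        simpa only [mul_one, id] using (hasDerivAt_id s).const_mul (-endSign i)
      simpa only [neg_mul] using h4
    have := h3.ofReal_comp.add_const (t * Complex.I)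
    rw [Complex.ofReal_neg] at this
    exact this
  exact h1.scomp s h2

theorem CylindricalEnds.hasDerivAt_point_snd (i : Fin 3) {s : ℝ} (hs : 0 < s) (t : ℝ) :
    HasDerivAt (fun t => C.point i s t) (Complex.I * deriv (C.chart i) (endCoord i (s, t))) t := by
  have h1 := (C.analyticAt i (w := endCoord i (s, t)) (by rwa [depth_endCoord])).differentiableAt.hasDerivAt
  have h2 : HasDerivAt (fun t => endCoord i (s, t)) Complex.I t := by
    have := ((hasDerivAt_id t).ofReal_comp.mul_const Complex.I).const_add
      ((-(endSign i * s) : ℝ) : ℂ)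
    rwa [Complex.ofReal_one, one_mul] at this
  exact h1.scomp t h2

/-- The coordinates `(s, t)` are negatively oriented on the first two ends, where `s = -τ`, and
positively on the third. -/
theorem CylindricalEnds.planeArea_point (W : ℂ → ℝ) (i : Fin 3) {a b : ℝ} (ha : 0 < a) :
    planeArea W (fun x => C.point i x.1 x.2) a b 0 1 = -(endSign i * C.endArea W i a b) := by
  rw [planeArea, endArea, ← integral_const_mul, ← integral_neg]
  refine setIntegral_congr_fun (measurableSet_Icc.prod measurableSet_Icc) fun x hx => ?_
  have hx0 : 0 < x.1 := ha.trans_le hx.1.1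
  have hd : DifferentiableAt ℝ (fun x : ℝ × ℝ => C.point i x.1 x.2) (x.1, x.2) :=
    (C.contDiffAt_point_prod i hx0).differentiableAt (by simp)
  have e1 := deriv_horizontal hd
  have e2 := deriv_vertical hd
  rw [(C.hasDerivAt_point_fst i hx0 x.2).deriv] at e1
  rw [(C.hasDerivAt_point_snd i hx0 x.2).deriv] at e2
  have e3 : ∀ z : ℂ, planeDet (-endSign i * z) (Complex.I * z) = -(endSign i * ‖z‖ ^ 2) := by
    intro z
    rw [planeDet_apply, ← Complex.ofReal_neg, Complex.re_ofReal_mul, Complex.im_ofReal_mul,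
      ← Complex.normSq_eq_norm_sq, Complex.normSq_apply]
    simp
    ring
  change _ * planeDet (fderiv ℝ (fun x : ℝ × ℝ => C.point i x.1 x.2) (x.1, x.2) (1, 0))
    (fderiv ℝ (fun x : ℝ × ℝ => C.point i x.1 x.2) (x.1, x.2) (0, 1)) = _
  rw [← e1, ← e2, e3]
  ring

theorem CylindricalEnds.continuousOn_endDensity {D : ℂ → ℝ} (hD : ContinuousOn D pants) (i : Fin 3) :
    ContinuousOn (fun x : ℝ × ℝ => D (C.point i x.1 x.2) * ‖deriv (C.chart i) (endCoord i x)‖ ^ 2)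
      (Ioi 0 ×ˢ univ) := by
  intro x hx
  have hdep : 0 < depth i (endCoord i x) := by rw [depth_endCoord]; exact hx.1
  have h1 : ContinuousAt (fun x : ℝ × ℝ => D (C.point i x.1 x.2)) x :=
    ContinuousAt.comp (f := fun x : ℝ × ℝ => C.point i x.1 x.2)
      (hD.continuousAt (isOpen_pants.mem_nhds (C.mem_pants i _ hdep)))
      (C.contDiffAt_point_prod i hx.1).continuousAt
  have h2 : ContinuousAt (fun x : ℝ × ℝ => deriv (C.chart i) (endCoord i x)) x :=
    ContinuousAt.comp (f := endCoord i) (C.analyticAt i hdep).deriv.continuousAt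
      (contDiff_endCoord i).continuous.continuousAt
  exact (h1.mul (h2.norm.pow 2)).continuousWithinAt

theorem CylindricalEnds.integrableOn_endDensity {D : ℂ → ℝ} (hD : ContinuousOn D pants) (i : Fin 3)
    {a : ℝ} (ha : 0 < a) (b : ℝ) :
    IntegrableOn (fun x : ℝ × ℝ => D (C.point i x.1 x.2) * ‖deriv (C.chart i) (endCoord i x)‖ ^ 2)
      (Icc a b ×ˢ Icc 0 1) :=
  ((C.continuousOn_endDensity hD i).mono (prod_mono (fun _ h => ha.trans_le h.1)
    (subset_univ _))).integrableOn_compact (isCompact_Icc.prod isCompact_Icc)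

theorem CylindricalEnds.endArea_add {D : ℂ → ℝ} (hD : ContinuousOn D pants) (i : Fin 3)
    {a b c : ℝ} (ha : 0 < a) (hab : a ≤ b) (hbc : b ≤ c) :
    C.endArea D i a b + C.endArea D i b c = C.endArea D i a c := by
  have hi := C.integrableOn_endDensity hD i ha c
  rw [endArea, endArea, endArea, ← Icc_union_Icc_eq_Icc hab hbc, union_prod]
  refine (setIntegral_union₀ ?_ ((measurableSet_Icc.prod measurableSet_Icc).nullMeasurableSet)
    (C.integrableOn_endDensity hD i ha b) (C.integrableOn_endDensity hD i (ha.trans_le hab) c)).symm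
  rw [AEDisjoint, prod_inter_prod, Icc_inter_Icc_eq_singleton hab hbc, Measure.volume_eq_prod,
    Measure.prod_prod]
  simp

theorem measurePreserving_endCoord (i : Fin 3) : MeasurePreserving (endCoord i) volume volume := by
  have h1 : MeasurePreserving (fun s : ℝ => -(endSign i * s)) volume volume := by
    have hn : MeasurePreserving (fun s : ℝ => -s) volume volume := Measure.measurePreserving_neg volume
    fin_cases i
    · simpa [endSign] using hn
    · simpa [endSign] using hn
    · have : (fun s : ℝ => -(endSign 2 * s)) = id := by funext s; simp [endSign]
      exact this ▸ MeasurePreserving.id volume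
  have h2 : MeasurePreserving (Prod.map (fun s : ℝ => -(endSign i * s)) (id : ℝ → ℝ))
      (volume.prod volume) (volume.prod volume) := h1.prod (MeasurePreserving.id volume)
  have h3 := (Complex.volume_preserving_equiv_real_prod.symm).comp h2
  have h4 : endCoord i = Complex.measurableEquivRealProd.symm ∘
      Prod.map (fun s : ℝ => -(endSign i * s)) (id : ℝ → ℝ) := by
    funext x
    apply Complex.ext <;> simp [endCoord]
  rw [h4]
  exact h3

theorem measurableEmbedding_endCoord (i : Fin 3) : MeasurableEmbedding (endCoord i) := by
  refine (contDiff_endCoord i).continuous.measurableEmbedding fun x y h => ?_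
  have h1 := congrArg (depth i) h
  have h2 := congrArg Complex.im h
  simp only [depth_endCoord] at h1
  simp [endCoord] at h2
  exact Prod.ext h1 h2

/-- A fundamental domain of the part `a ≤ s ≤ b` of an end, in the coordinate `τ + it`. -/
def endStrip (i : Fin 3) (a b : ℝ) : Set ℂ :=
  {w | depth i w ∈ Icc a b ∧ w.im ∈ Ico (0 : ℝ) 1}

theorem measurableSet_endStrip (i : Fin 3) (a b : ℝ) : MeasurableSet (endStrip i a b) :=
  (measurableSet_Icc.preimage (continuous_depth i).measurable).inter
    (measurableSet_Ico.preimage Complex.measurable_im)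

theorem CylindricalEnds.injOn_endStrip (i : Fin 3) {a b : ℝ} (ha : 0 < a) :
    InjOn (C.chart i) (endStrip i a b) := by
  intro w hw w' hw' h
  obtain ⟨n, rfl⟩ := (C.eq_iff i w w' (ha.trans_le hw.1.1) (ha.trans_le hw'.1.1)).1 h
  have h1 := hw.2
  have h2 := hw'.2
  simp only [Complex.add_im, Complex.mul_im, Complex.intCast_re, Complex.I_im, mul_one,
    Complex.intCast_im, Complex.I_re, mul_zero, add_zero, mem_Ico] at h1 h2
  have h3 : (n : ℝ) < 1 := by linarith
  have h4 : (-1 : ℝ) < n := by linarith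
  have h5 : n = 0 := by
    have : n < 1 := by exact_mod_cast h3
    have : -1 < n := by exact_mod_cast h4
    omega
  simp [h5]

theorem det_smulRight_one (a : ℂ) :
    ((ContinuousLinearMap.toSpanSingleton ℂ a).restrictScalars ℝ).det = ‖a‖ ^ 2 := by
  rw [← Complex.normSq_eq_norm_sq, ← Algebra.norm_complex_apply, Algebra.norm_apply,
    ContinuousLinearMap.det]
  congr 1
  ext <;> simp [mul_comm]

/-- This is the change of variables under a holomorphic map, whose Jacobian is the squared modulus
of its derivative, on a fundamental domain of the rotations. -/
theorem CylindricalEnds.setIntegral_endStrip (W : ℂ → ℝ) (i : Fin 3) {a b : ℝ} (ha : 0 < a) :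
    ∫ z in C.chart i '' endStrip i a b, W z = C.endArea W i a b := by
  rw [integral_image_eq_integral_abs_det_fderiv_smul volume (measurableSet_endStrip i a b)
    (fun w hw => ((C.analyticAt i (ha.trans_le hw.1.1)).differentiableAt.hasDerivAt.hasFDerivAt.restrictScalars
      ℝ).hasFDerivWithinAt) (C.injOn_endStrip i ha)]
  rw [← (measurePreserving_endCoord i).setIntegral_preimage_emb (measurableEmbedding_endCoord i)]
  have hpre : endCoord i ⁻¹' endStrip i a b = Icc a b ×ˢ Ico 0 1 := by
    ext x
    simp only [endStrip, mem_preimage, mem_ofPred_eq, depth_endCoord, mem_prod]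
    simp [endCoord]
  have hae : (Icc a b ×ˢ Ico 0 1 : Set (ℝ × ℝ)) =ᵐ[volume] (Icc a b ×ˢ Icc 0 1 : Set (ℝ × ℝ)) := by
    rw [Measure.volume_eq_prod]
    exact Measure.set_prod_ae_eq (ae_eq_refl _) Ico_ae_eq_Icc
  rw [hpre, setIntegral_congr_set hae, endArea]
  refine setIntegral_congr_fun (measurableSet_Icc.prod measurableSet_Icc) fun x _ => ?_
  change |_| • W (C.point i x.1 x.2) = _
  rw [det_smulRight_one, abs_of_nonneg (by positivity), smul_eq_mul, mul_comm]

/-- A density that is nonnegative off the ends integrates to at least its integral over the ends. -/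
theorem CylindricalEnds.sum_endArea_le {W : ℂ → ℝ} (hW : Integrable W) {a : Fin 3 → ℝ} {b : ℝ}
    (ha : ∀ i, 0 < a i)
    (hnonneg : ∀ z, (∀ i w, a i < depth i w → depth i w ≤ b → C.chart i w ≠ z) → 0 ≤ W z) :
    ∑ i, C.endArea W i (a i) b ≤ ∫ z, W z := by
  have hmeas : ∀ i, MeasurableSet (C.chart i '' endStrip i (a i) b) := fun i =>
    (measurableSet_endStrip i _ _).image_of_continuousOn_injOn
      (fun w hw => (C.analyticAt i ((ha i).trans_le hw.1.1)).continuousAt.continuousWithinAt)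
      (C.injOn_endStrip i (ha i))
  have hdisj : Pairwise (Function.onFun Disjoint fun i => C.chart i '' endStrip i (a i) b) := by
    intro i j hij
    rw [Function.onFun, disjoint_left]
    rintro _ ⟨w, hw, rfl⟩ ⟨w', hw', h⟩
    exact C.disjoint i j hij w w' ((ha i).trans_le hw.1.1) ((ha j).trans_le hw'.1.1) h.symm
  have h1 : ∑ i, C.endArea W i (a i) b = ∫ z in ⋃ i, C.chart i '' endStrip i (a i) b, W z := by
    rw [integral_iUnion_fintype hmeas hdisj fun i => hW.integrableOn]
    exact Finset.sum_congr rfl fun i _ => (C.setIntegral_endStrip W i (ha i)).symm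
  rw [h1, ← integral_add_compl (MeasurableSet.iUnion hmeas) hW]
  refine le_add_of_nonneg_right (setIntegral_nonneg (MeasurableSet.iUnion hmeas).compl fun z hz =>
    hnonneg z fun i w hw hwb heq => hz ?_)
  obtain ⟨w', h2, h3, h4⟩ := C.exists_im_mem i ((ha i).trans hw)
  exact mem_iUnion.2 ⟨i, w', ⟨h2 ▸ ⟨hw.le, hwb⟩, h3⟩, h4.trans heq⟩

end Density

/-! ### Green's theorem on the sectors. -/

section Sectors

variable {C : CylindricalEnds}

/-- A density on an open set can be truncated away from the complement. -/
theorem exists_truncation {U : Set ℂ} (hU : IsOpen U) {D : ℂ → ℝ} (hD : ContDiffOn ℝ 1 D U) {K : Set ℂ} (hK : IsCompact K)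
    (hKp : K ⊆ U) : ∃ (W : ℂ → ℝ) (K' : Set ℂ), ContDiff ℝ 1 W ∧ IsCompact K' ∧ K' ⊆ U ∧
      (∀ z ∈ K, W z = D z) ∧ (∀ z ∉ K', W z = 0) ∧ ∀ z ∈ U, 0 ≤ D z → 0 ≤ W z := by
  obtain ⟨K', hK', hKK', hK'p⟩ := exists_compact_between hK hU hKp
  obtain ⟨χ, h0, h1, h01⟩ := exists_contMDiffMap_zero_one_of_isClosed (n := (1 : ℕ∞)) 𝓘(ℝ, ℂ)
    (s := (interior K')ᶜ) (t := K) isOpen_interior.isClosed_compl hK.isClosed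
    (disjoint_compl_left_iff_subset.2 hKK')
  have hW0 : ∀ z ∉ K', χ z * D z = 0 := fun z hz => by
    rw [h0 (fun h => hz (interior_subset h)), Pi.zero_apply, zero_mul]
  refine ⟨fun z => χ z * D z, K', ?_, hK', hK'p, fun z hz => ?_, hW0, fun z _ hz =>
    mul_nonneg (h01 z).1 hz⟩
  · rw [contDiff_iff_contDiffAt]
    intro z
    by_cases hz : z ∈ U
    · have hχ : ContDiffAt ℝ 1 χ z := χ.contMDiff.contDiff.contDiffAt
      exact hχ.mul (hD.contDiffAt (hU.mem_nhds hz))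
    · refine (contDiffAt_const (c := (0 : ℝ))).congr_of_eventuallyEq ?_
      filter_upwards [hK'.isClosed.isOpen_compl.mem_nhds (fun h => hz (hK'p h))] with y hy
      exact hW0 y hy
  · simp only [h1 hz, Pi.one_apply, one_mul]

variable {W : ℂ → ℝ} {η : ℂ → ℂ →L[ℝ] ℝ}

theorem continuous_pathInt_integrand (hη : ∀ z, ContinuousAt η z) {c : ℝ → ℂ} (hc : ContDiff ℝ 1 c) :
    Continuous fun t => η (c t) (deriv c t) :=
  ((continuous_iff_continuousAt.2 hη).comp hc.continuous).clm_apply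
    (hc.continuous_deriv (by simp))

/-- Green's theorem for the sectors of the pair of pants. -/
theorem CylindricalEnds.sum_planeArea_sectors (hW : Continuous W)
    (hη : IsPrimitiveOn η (fun z => W z • planeDet) univ) {o : Fin 3 → ℝ} {L : ℝ}
    (h : C.IsDeep o L) :
    -planeArea W (C.sectorHomotopy o L 0) 0 1 0 1 - planeArea W (C.sectorHomotopy o L 1) 0 1 0 1
      + planeArea W (C.sectorHomotopy o L 2) 0 1 0 1 + planeArea W (C.sectorHomotopy o L 3) 0 1 0 1 =
    pathInt η (C.point 2 L) 0 1 - pathInt η (C.point 0 L) 0 1 - pathInt η (C.point 1 L) 0 1 := by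
  have hL := zero_lt_one.trans h.one_lt
  have key := fun e => planeArea_eq (p := 0) (p' := 1) (t := 0) (t' := 1) hW hη zero_le_one
    zero_le_one (G := C.sectorHomotopy o L e)
    (fun x _ => ((C.contDiff_sectorHomotopy o hL e).of_le (by norm_cast)).contDiffAt)
  -- The outer edge of a sector is an affinely reparametrized arc of a deep loop. Sectors `2` and
  -- `3` together cover the loop at infinity once.
  have hright : ∀ e, pathInt η (fun b => C.sectorHomotopy o L e (1, b)) 0 1 =
      pathInt η (C.point (sectorEnd e) L) (sectorOffset o e) (sectorOffset o e + sectorRate e) := by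
    intro e
    have := pathInt_comp_affine η ((C.contDiff_point (sectorEnd e) hL).differentiable (by simp))
      (sectorRate e) (sectorOffset o e) 0 1
    rw [mul_zero, mul_one, add_zero] at this
    rw [← this]
    congr 1
    funext t
    rw [C.sectorHomotopy_one, sectorAngle]
  have hper : ∀ i t, C.point i L (t + 1) = C.point i L t := fun i t =>
    C.point_eq_of_add_one i hL rfl
  have e0 : pathInt η (fun b => C.sectorHomotopy o L 0 (1, b)) 0 1 =
      pathInt η (C.point 0 L) 0 1 := (hright 0).trans (pathInt_periodic η (hper 0) _)
  have e1 : pathInt η (fun b => C.sectorHomotopy o L 1 (1, b)) 0 1 =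
      pathInt η (C.point 1 L) 0 1 := (hright 1).trans (pathInt_periodic η (hper 1) _)
  have e2 : pathInt η (fun b => C.sectorHomotopy o L 2 (1, b)) 0 1 +
      pathInt η (fun b => C.sectorHomotopy o L 3 (1, b)) 0 1 = pathInt η (C.point 2 L) 0 1 := by
    rw [hright 2, hright 3]
    have hc := continuous_pathInt_integrand (fun z => (hη.1 z (mem_univ z)).continuousAt)
      ((C.contDiff_point 2 hL).of_le (by norm_cast))
    have := intervalIntegral.integral_add_adjacent_intervals
      (hc.intervalIntegrable (μ := volume) (o 2) (o 2 + 1 / 2))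
      (hc.intervalIntegrable (o 2 + 1 / 2) (o 2 + 1 / 2 + 1 / 2))
    refine this.trans ?_
    rw [show o 2 + 1 / 2 + 1 / 2 = o 2 + 1 by ring]
    exact pathInt_periodic η (hper 2) _
  have b00 := funext (h.meets_zero zero_lt_one).homotopy
  have b11 := funext (h.meets_one zero_lt_one).homotopy
  have b23 := funext (h.meets_two_three zero_lt_one).homotopy
  have b32 := funext (h.meets_two_three_symm zero_lt_one).homotopy
  simp only [IsDeep.sectorData] at b00 b11 b23 b32
  have b02 := funext (C.sectorHomotopy_zero_two o L)
  have b13 := funext (C.sectorHomotopy_one_three o L)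
  have k0 := key 0
  have k1 := key 1
  have k2 := key 2
  have k3 := key 3
  rw [b00, b02, e0] at k0
  rw [b11, b13, e1] at k1
  rw [b32, b23] at k2
  linarith

theorem CylindricalEnds.pathInt_point_sub (hW : Continuous W)
    (hη : IsPrimitiveOn η (fun z => W z • planeDet) univ) (i : Fin 3) {a b : ℝ} (ha : 0 < a)
    (hab : a ≤ b) : pathInt η (C.point i b) 0 1 - pathInt η (C.point i a) 0 1 =
      -(endSign i * C.endArea W i a b) := by
  rw [← C.planeArea_point W i ha]
  refine pathInt_sub_eq_planeArea (G := fun x => C.point i x.1 x.2) hW hη hab zero_le_one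
    (fun x hx => (C.contDiffAt_point_prod i (ha.trans_le hx.1.1)).of_le (by norm_cast)) ?_
  have : Ioi (0 : ℝ) ∈ 𝓝ˢ (Icc a b) :=
    isOpen_Ioi.mem_nhdsSet.2 fun x hx => ha.trans_le hx.1
  filter_upwards [this] with x hx
  exact (C.point_eq_of_add_one i hx (zero_add 1).symm).symm

/-- A neighbourhood of the puncture avoids the support of the density, and deep loops lie in a ball
inside it. -/
theorem CylindricalEnds.eventually_pathInt_eq_zero (hW : Continuous W)
    (hη : IsPrimitiveOn η (fun z => W z • planeDet) univ) {K : Set ℂ} (hK : IsCompact K)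
    (hW0 : ∀ z ∉ K, W z = 0) (i : Fin 3) {z : ℂ} (hz : z ∉ K)
    (hlim : Tendsto (C.chart i) (comap (depth i) atTop) (𝓝 z)) :
    ∀ᶠ s in atTop, pathInt η (C.point i s) 0 1 = 0 := by
  obtain ⟨r, hr, hball⟩ := Metric.isOpen_iff.1 hK.isClosed.isOpen_compl z hz
  have hev := hlim.eventually (Metric.ball_mem_nhds z hr)
  rw [eventually_comap] at hev
  filter_upwards [hev, eventually_gt_atTop 0] with s hs hs0
  exact pathInt_eq_zero hW hη ((C.contDiff_point i hs0).of_le (by norm_cast))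
    (fun t => C.point_eq_of_add_one i hs0 rfl) (fun y hy => hW0 y (hball hy))
    fun t => hs _ (depth_point i s t)

open Complex in
-- A deep loop at infinity is joined by segments to a round circle that encloses the support. The
-- segments avoid the support, so both line integrals agree, and on the circle Green's theorem gives
-- the whole integral.
theorem CylindricalEnds.eventually_pathInt_eq_integral (hW : Continuous W)
    (hη : IsPrimitiveOn η (fun z => W z • planeDet) univ) {K : Set ℂ} (hK : IsCompact K)
    (hW0 : ∀ z ∉ K, W z = 0) {o : ℝ} (ho : ∀ R : ℝ, ∀ᶠ s in atTop, ∀ t : ℝ,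
      R < (C.point 2 s (o + t / 2) * exp (-(Real.pi * (t + 1 / 2) * I))).re) :
    ∀ᶠ s in atTop, pathInt η (C.point 2 s) 0 1 = ∫ z, W z := by
  obtain ⟨R, hR0, hR⟩ : ∃ R, 0 < R ∧ K ⊆ Metric.ball 0 R := by
    obtain ⟨R, hR⟩ := hK.isBounded.subset_ball 0
    exact ⟨max R 1, by positivity, hR.trans (Metric.ball_subset_ball (le_max_left _ _))⟩
  have hzero : ∀ z : ℂ, R ≤ ‖z‖ → W z = 0 := fun z hz => hW0 z fun hzK => by
    have := hR hzK
    rw [mem_ball_zero_iff] at this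
    linarith
  filter_upwards [ho R, eventually_gt_atTop 0] with s hs hs0
  have hpi := Real.pi_pos
  have hpt := (C.contDiff_point 2 hs0)
  -- The shift by `1/4` and the change of speed align the loop with the direction `exp(iθ)` of the
  -- circle.
  let c : ℝ → ℂ := fun θ => C.point 2 s (o - 1 / 4 + (2 * Real.pi)⁻¹ * θ)
  have hc : ContDiff ℝ ∞ c := hpt.comp (by fun_prop)
  let G : ℝ × ℝ → ℂ := fun x => (1 - x.1 : ℝ) * (R * exp (x.2 * I)) + (x.1 : ℝ) * c x.2
  have hG : ContDiff ℝ ∞ G := by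
    refine ((ofRealCLM.contDiff.comp (contDiff_const.sub contDiff_fst)).mul (contDiff_const.mul
      ((ofRealCLM.contDiff.comp contDiff_snd).mul contDiff_const).cexp)).add
      ((ofRealCLM.contDiff.comp contDiff_fst).mul (hc.comp contDiff_snd))
  have hnorm : ∀ x ∈ Icc (0 : ℝ) 1 ×ˢ Icc (-Real.pi) Real.pi, R ≤ ‖G x‖ := by
    rintro ⟨p, θ⟩ ⟨hp, -⟩
    have h1 := hs (θ / Real.pi - 1 / 2)
    have h2 : exp (-(Real.pi * ((θ / Real.pi - 1 / 2 : ℝ) + 1 / 2) * I)) = exp (-(θ * I)) := by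
      congr 3
      push_cast
      field_simp
      ring
    have h3 : C.point 2 s (o + (θ / Real.pi - 1 / 2) / 2) = c θ := by
      simp only [c]
      congr 1
      field_simp
      ring
    rw [h2, h3] at h1
    have h4 : ‖exp (-(θ * I))‖ = 1 := by
      have := norm_exp_ofReal_mul_I (-θ)
      rwa [ofReal_neg, neg_mul] at this
    have h5 : G (p, θ) * exp (-(θ * I)) =
        ((1 - p) * R : ℝ) + (p : ℝ) * (c θ * exp (-(θ * I))) := by
      have : exp (θ * I) * exp (-(θ * I)) = 1 := by rw [← exp_add, add_neg_cancel, exp_zero]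
      simp only [G]
      push_cast
      linear_combination ((1 - p) * R : ℂ) * this
    have h6 := re_le_norm (G (p, θ) * exp (-(θ * I)))
    rw [norm_mul, h4, mul_one, h5, add_re, ofReal_re, re_ofReal_mul] at h6
    have := mul_le_mul_of_nonneg_left h1.le hp.1
    have h7 : (1 - p) * R + p * R = R := by ring
    linarith
  have hper : ∀ θ, c (θ + 2 * Real.pi) = c θ := fun θ =>
    C.point_eq_of_add_one 2 hs0 (by field_simp; ring)
  have key := pathInt_sub_eq_planeArea (p := 0) (p' := 1) (t := -Real.pi) (t' := Real.pi)
    (G := G) hW hη zero_le_one (by linarith) (fun x _ => (hG.of_le (by norm_cast)).contDiffAt)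
    (Eventually.of_forall fun a => by
      have h1 := hper (-Real.pi)
      rw [show -Real.pi + 2 * Real.pi = Real.pi by ring] at h1
      have h2 : exp (-Real.pi * I) = exp (Real.pi * I) := by
        rw [neg_mul, exp_neg, exp_pi_mul_I]; norm_num
      simp only [G, h1, ofReal_neg, h2])
  rw [planeArea_eq_zero fun x hx => hzero _ (hnorm x hx)] at key
  simp only [G, sub_self, ofReal_zero, zero_mul, zero_add, ofReal_one, one_mul, sub_zero,
    add_zero] at key
  have hball : ∫ z in Metric.ball 0 R, W z = ∫ z, W z :=
    setIntegral_eq_integral_of_forall_compl_eq_zero fun z hz => hzero z (by simpa using hz)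
  rw [pathInt_circle hW hη hR0, hball] at key
  have haff := pathInt_comp_affine η (hpt.differentiable (by simp)) (2 * Real.pi)⁻¹ (o - 1 / 4)
    (-Real.pi) Real.pi
  have h8 : o - 1 / 4 + (2 * Real.pi)⁻¹ * Real.pi = o - 1 / 4 + (2 * Real.pi)⁻¹ * (-Real.pi) + 1 := by
    field_simp; ring
  rw [h8, pathInt_periodic η (fun t => C.point_eq_of_add_one 2 hs0 rfl)] at haff
  rw [← haff]
  exact sub_eq_zero.1 key

/-- The integral of a density over the sectors of the pair of pants is at least its integral over
the ends, if the density is nonnegative elsewhere. -/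
theorem CylindricalEnds.IsDeep.sum_endArea_le {o : Fin 3 → ℝ} {L : ℝ} (h : C.IsDeep o L)
    (ho : ∀ R : ℝ, ∀ᶠ s in atTop, ∀ t : ℝ, R < (C.point 2 s (o 2 + t / 2) *
      Complex.exp (-(Real.pi * (t + 1 / 2) * Complex.I))).re)
    {D : ℂ → ℝ} (hD : ContDiffOn ℝ 1 D pants) {a : Fin 3 → ℝ} (ha : ∀ i, 0 < a i)
    (haL : ∀ i, a i ≤ L)
    (hnonneg : ∀ z ∈ pants, (∀ i w, a i < depth i w → C.chart i w ≠ z) → 0 ≤ D z) :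
    ∑ i, C.endArea D i (a i) L ≤
      -planeArea D (C.sectorHomotopy o L 0) 0 1 0 1 - planeArea D (C.sectorHomotopy o L 1) 0 1 0 1
        + planeArea D (C.sectorHomotopy o L 2) 0 1 0 1
        + planeArea D (C.sectorHomotopy o L 3) 0 1 0 1 := by
  have hL := zero_lt_one.trans h.one_lt
  let K₁ : Set ℂ := ⋃ e, C.sectorHomotopy o L e '' (Icc 0 1 ×ˢ Icc 0 1)
  let K₂ : Set ℂ := ⋃ i, (fun x : ℝ × ℝ => C.point i x.1 x.2) '' (Icc (a i) L ×ˢ Icc 0 1)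
  have hK : IsCompact (K₁ ∪ K₂) := by
    refine IsCompact.union (isCompact_iUnion fun e => ?_) (isCompact_iUnion fun i => ?_)
    · exact (isCompact_Icc.prod isCompact_Icc).image (C.contDiff_sectorHomotopy o hL e).continuous
    · exact (isCompact_Icc.prod isCompact_Icc).image_of_continuousOn fun x hx =>
        (C.contDiffAt_point_prod i ((ha i).trans_le hx.1.1)).continuousAt.continuousWithinAt
  have hKp : K₁ ∪ K₂ ⊆ pants := by
    refine union_subset (iUnion_subset fun e => ?_) (iUnion_subset fun i => ?_)
    · rintro _ ⟨x, hx, rfl⟩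
      exact h.sectorHomotopy_mem e hx.1 hx.2
    · rintro _ ⟨x, hx, rfl⟩
      exact C.mem_pants i _ (by rw [depth_point]; exact (ha i).trans_le hx.1.1)
  -- The density need not extend over the punctures. Truncation away from the sectors and the
  -- cylinders of depth at most `L` makes it a compactly supported density on the plane, with a
  -- global primitive.
  obtain ⟨W, K', hW, hK', hK'p, hWD, hW0, hWn⟩ := exists_truncation isOpen_pants hD hK hKp
  have hWc := hW.continuous
  obtain ⟨η, hη⟩ := exists_isPrimitiveOn_plane hW
  have hsec : ∀ e, planeArea D (C.sectorHomotopy o L e) 0 1 0 1 =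
      planeArea W (C.sectorHomotopy o L e) 0 1 0 1 := fun e =>
    setIntegral_congr_fun (measurableSet_Icc.prod measurableSet_Icc) fun x hx => by
      simp only [hWD _ (Or.inl (mem_iUnion.2 ⟨e, mem_image_of_mem _ hx⟩))]
  have hend : ∀ i, C.endArea D i (a i) L = C.endArea W i (a i) L := fun i =>
    setIntegral_congr_fun (measurableSet_Icc.prod measurableSet_Icc) fun x hx => by
      simp only [hWD _ (Or.inr (mem_iUnion.2 ⟨i, x, hx, rfl⟩))]
  have hfar : ∀ i, ∀ᶠ s in atTop, ∀ w, s ≤ depth i w → C.chart i w ∉ K' := fun i => by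
    obtain ⟨T, hT, hTw⟩ := C.eventually_not_mem hK' hK'p i
    filter_upwards [eventually_ge_atTop T] with s hs w hw using hTw w (hs.trans hw)
  obtain ⟨s, ⟨⟨⟨hs0, hs1⟩, hs2⟩, hsL⟩, hsfar⟩ := ((((C.eventually_pathInt_eq_zero hWc hη hK' hW0 0
    (fun h => hK'p h (by simp)) C.tendsto_chart_zero).and (C.eventually_pathInt_eq_zero hWc hη hK' hW0 1
    (fun h => hK'p h (by simp)) C.tendsto_chart_one)).and
    (C.eventually_pathInt_eq_integral hWc hη hK' hW0 ho)).and
    (eventually_ge_atTop L)).and (eventually_all.2 hfar) |>.exists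
  have hint : Integrable W := hWc.integrable_of_hasCompactSupport
    (HasCompactSupport.intro hK' hW0)
  -- The depth `s` is beyond the support, so the truncated density is zero deeper in the ends and
  -- nonnegative off the ends.
  have hle := C.sum_endArea_le (b := s) hint ha fun z hz => by
    by_cases hzp : z ∈ pants
    · by_cases hex : ∃ i w, a i < depth i w ∧ C.chart i w = z
      · obtain ⟨i, w, hw, rfl⟩ := hex
        refine (hW0 _ (hsfar i w ?_)).ge
        by_contra! hlt
        exact hz i w hw hlt.le rfl
      · push Not at hex
        exact hWn z hzp (hnonneg z hzp hex)
    · exact (hW0 z fun hz' => hzp (hK'p hz')).ge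
  have hadd := fun i => C.endArea_add (D := W) hWc.continuousOn i (ha i) (haL i) hsL
  -- The pieces of the ends between `L` and `s` relate the loops at depth `L` to loops whose line
  -- integrals are known.
  have hcyl := fun i => C.pathInt_point_sub hWc hη i hL hsL
  have c0 := hcyl 0
  have c1 := hcyl 1
  have c2 := hcyl 2
  have hs : endSign 0 = 1 ∧ endSign 1 = 1 ∧ endSign 2 = -1 := ⟨rfl, rfl, rfl⟩
  rw [hs0, hs.1] at c0
  rw [hs1, hs.2.1] at c1
  rw [hs2, hs.2.2] at c2
  rw [hsec, hsec, hsec, hsec, C.sum_planeArea_sectors hWc hη h, Fin.sum_univ_three, hend, hend, hend]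
  rw [Fin.sum_univ_three] at hle
  linarith [hadd 0, hadd 1, hadd 2]

end Sectors

/-! ### The energy inequality -/

section Energy

variable {E : Type*} [NormedAddCommGroup E] [NormedSpace ℝ E]
variable {M : Type} [TopologicalSpace M] [ChartedSpace E M]

theorem SymplecticForm.neg_swap (Ω : SymplecticForm E M) (x : M) (a b : TangentSpace 𝓘(ℝ, E) x) :
    Ω.form x a b = -Ω.form x b a := by
  have key : ∀ B : E →L[ℝ] E →L[ℝ] ℝ, (∀ v, B v v = 0) → ∀ a b, B a b = -B b a := by
    intro B hB a b
    have h := hB (a + b)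
    have e : B (a + b) (a + b) = B a a + B a b + (B b a + B b b) := by simp
    rw [e, hB, hB] at h
    linarith
  exact key (Ω.form x) (Ω.alternating x) a b

variable [IsManifold 𝓘(ℝ, E) ∞ M] {u : ℂ → M} {C : CylindricalEnds}

/-- The density of the pullback of the symplectic form under a map from the plane. -/
def mapDensity (Ω : SymplecticForm E M) (u : ℂ → M) (z : ℂ) : ℝ :=
  pullForm Ω.form u z 1 Complex.I

theorem contDiffAt_mapDensity (Ω : SymplecticForm E M) {z : ℂ}
    (hu : ContMDiffAt 𝓘(ℝ, ℂ) 𝓘(ℝ, E) ∞ u z) : ContDiffAt ℝ 1 (mapDensity Ω u) z := by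
  have hx : u z ∈ (chartAt E (u z)).source := mem_chart_source E (u z)
  have hchart : ContDiffAt ℝ ∞ (chartAt E (u z) ∘ u) z := ContMDiffAt.chartAt_comp le_rfl hu hx
  have hev : mapDensity Ω u =ᶠ[𝓝 z] fun q => formInChart Ω.form (u z) ((chartAt E (u z) ∘ u) q)
      (fderiv ℝ (chartAt E (u z) ∘ u) q 1) (fderiv ℝ (chartAt E (u z) ∘ u) q Complex.I) := by
    filter_upwards [eventually_contMDiffAt_one (hu.of_le (by norm_cast)),
      hu.continuousAt.preimage_mem_nhds ((chartAt E (u z)).open_source.mem_nhds hx)] with q hq hqS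
    rw [mapDensity, pullForm_eq Ω.form hqS (hq.mdifferentiableAt (by simp))]
    rfl
  refine ContDiffAt.congr_of_eventuallyEq ?_ hev
  have hf : ContDiffAt ℝ 1 (fderiv ℝ (chartAt E (u z) ∘ u)) z :=
    (hchart.of_le (m := 2) (by norm_cast)).fderiv_right (by norm_num)
  have hT : ContDiffAt ℝ 1 (fun q => formInChart Ω.form (u z) ((chartAt E (u z) ∘ u) q)) z :=
    ContDiffAt.comp z (((Ω.smooth (u z)).contDiffAt
      ((chartAt E (u z)).open_target.mem_nhds ((chartAt E (u z)).map_source hx))).of_le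
        (by norm_cast)) (hchart.of_le (by norm_cast))
  exact (hT.clm_apply (hf.clm_apply contDiffAt_const)).clm_apply (hf.clm_apply contDiffAt_const)

theorem pullForm_plane (Ω : SymplecticForm E M) (u : ℂ → M) (z a b : ℂ) :
    pullForm Ω.form u z a b = mapDensity Ω u z * planeDet a b := by
  have hself : ∀ c, pullForm Ω.form u z c c = 0 := fun c => Ω.alternating (u z) _
  have hdec : ∀ c : ℂ, c = c.re • (1 : ℂ) + c.im • Complex.I := fun c => by
    simp [Complex.re_add_im]
  have hswap : pullForm Ω.form u z Complex.I 1 = -mapDensity Ω u z := Ω.neg_swap (u z) _ _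
  rw [planeDet_apply]
  conv_lhs => rw [hdec a, hdec b]
  simp only [map_add, map_smul, add_apply, smul_apply, smul_eq_mul, hself, hswap]
  rw [← mapDensity]
  ring

theorem rectArea_comp (Ω : SymplecticForm E M) {N : ℝ × ℝ → ℂ}
    (hu : ∀ x ∈ Icc (0 : ℝ) 1 ×ˢ Icc (0 : ℝ) 1, ContMDiffAt 𝓘(ℝ, ℂ) 𝓘(ℝ, E) 1 u (N x))
    (hN : ContDiff ℝ 1 N) :
    rectArea Ω (fun x => u (N x)) 0 1 0 1 = planeArea (mapDensity Ω u) N 0 1 0 1 := by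
  rw [rectArea, ← integral_prod_Icc_eq zero_le_one zero_le_one
    (continuousOn_pullForm Ω (G := fun x => u (N x))
      (fun x hx => (hu x hx).comp x hN.contMDiff.contMDiffAt) _ _), planeArea]
  refine setIntegral_congr_fun (measurableSet_Icc.prod measurableSet_Icc) fun x hx => ?_
  have h1 : mfderiv 𝓘(ℝ, ℝ × ℝ) 𝓘(ℝ, E) (fun x => u (N x)) x = _ :=
    mfderiv_comp x ((hu x hx).mdifferentiableAt (by simp))
      (hN.differentiable (by simp) x).mdifferentiableAt
  rw [mfderiv_eq_fderiv] at h1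
  refine Eq.trans ?_ (pullForm_plane Ω u (N x) (fderiv ℝ N x (1, 0)) (fderiv ℝ N x (0, 1)))
  simp only [pullForm]
  rw [h1]
  rfl

variable (E) in
/-- The differential of a map from the plane. -/
def planeDeriv (u : ℂ → M) (z : ℂ) : ℂ →L[ℝ] E := mfderiv 𝓘(ℝ, ℂ) 𝓘(ℝ, E) u z

variable (E) in
/-- The differential of a function. -/
def funDeriv (F : M → ℝ) (x : M) : E →L[ℝ] ℝ := mfderiv 𝓘(ℝ, E) 𝓘(ℝ, ℝ) F x

/-- The derivative of the coordinate of an end at the point with given distance and angle. -/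
def CylindricalEnds.endDeriv (C : CylindricalEnds) (i : Fin 3) (s t : ℝ) : ℂ :=
  deriv (C.chart i) (endCoord i (s, t))

theorem hasDerivAt_comp_point {F : M → ℝ} (i : Fin 3) {s t : ℝ} (hs : 0 < s)
    (hF : MDifferentiableAt 𝓘(ℝ, E) 𝓘(ℝ, ℝ) F (u (C.point i s t)))
    (hu : MDifferentiableAt 𝓘(ℝ, ℂ) 𝓘(ℝ, E) u (C.point i s t)) :
    HasDerivAt (fun s => F (u (C.point i s t)))
      (-endSign i * funDeriv E F (u (C.point i s t)) (planeDeriv E u (C.point i s t) (C.endDeriv i s t))) s := by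
  have h0 : HasFDerivAt (fun s => C.point i s t) (ContinuousLinearMap.toSpanSingleton ℝ
    (-endSign i * C.endDeriv i s t : ℂ)) s := (C.hasDerivAt_point_fst i hs t).hasFDerivAt
  have h1 := h0.hasMFDerivAt
  have h2 := hF.hasMFDerivAt.comp s (hu.hasMFDerivAt.comp (f := fun s => C.point i s t) s h1)
  have h3 : HasDerivAt (fun s => F (u (C.point i s t))) (funDeriv E F (u (C.point i s t))
    (planeDeriv E u (C.point i s t) ((1 : ℝ) • (-endSign i * C.endDeriv i s t)))) s :=
      (show HasFDerivAt _ ((funDeriv E F (u (C.point i s t))).comp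
        ((planeDeriv E u (C.point i s t)).comp (ContinuousLinearMap.toSpanSingleton ℝ
          (-endSign i * C.endDeriv i s t : ℂ)))) s from h2.hasFDerivAt).hasDerivAt
  rwa [one_smul, ← Complex.ofReal_neg, ← Complex.real_smul, map_smul, map_smul, smul_eq_mul] at h3

variable {Ω : SymplecticForm E M} {R₁ R₂ : Fin 3 → ℝ} {ρ : Fin 3 → ℝ → ℝ} {H : Fin 3 → ℝ → M → ℝ}
  {J₀ : ∀ x : M, TangentSpace 𝓘(ℝ, E) x →L[ℝ] TangentSpace 𝓘(ℝ, E) x}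
  {J : Fin 3 → ℝ → ℝ → ∀ x : M, TangentSpace 𝓘(ℝ, E) x →L[ℝ] TangentSpace 𝓘(ℝ, E) x}
  {Jt : ℂ → ∀ x : M, (ℂ × TangentSpace 𝓘(ℝ, E) x) →L[ℝ] (ℂ × TangentSpace 𝓘(ℝ, E) x)}

theorem IsCutOff.mem_Icc {R₁ R₂ : ℝ} {ρ : ℝ → ℝ} (h : IsCutOff R₁ R₂ ρ) (s : ℝ) :
    ρ s ∈ Icc (0 : ℝ) 1 := by
  constructor
  · rw [← h.eq_zero _ (min_le_right s R₁)]
    exact h.monotone (min_le_left _ _)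
  · rw [← h.eq_one _ (le_max_right s R₂)]
    exact h.monotone (le_max_left _ _)

theorem IsCompatible.nonneg {J : ∀ x : M, TangentSpace 𝓘(ℝ, E) x →L[ℝ] TangentSpace 𝓘(ℝ, E) x}
    (h : IsCompatible Ω J) (x : M) (v : TangentSpace 𝓘(ℝ, E) x) : 0 ≤ Ω.form x v (J x v) := by
  by_cases hv : v = 0
  · have : Ω.form x v (J x v) = 0 := by
      have h0 := congrArg (fun T : E →L[ℝ] ℝ => T (J x v)) (map_zero (Ω.form x : E →L[ℝ] E →L[ℝ] ℝ))
      rw [hv] at h0 ⊢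
      exact h0
    exact this.ge
  · exact (h.pos x v hv).le

/-- Off the ends `u` is `J₀`-holomorphic, so the density is the squared norm of the derivative in
direction `1`. -/
theorem mapDensity_nonneg (hJt : IsHCompatible Ω C R₁ ρ H J₀ J Jt) (hJ₀ : IsCompatible Ω J₀)
    (hu : IsHolomorphicSection Jt u) {z : ℂ} (hz : z ∈ pants)
    (h : ∀ i w, R₁ i < depth i w → C.chart i w ≠ z) : 0 ≤ mapDensity Ω u z := by
  have h1 := hu.holomorphic z hz 1
  rw [hJt.on_center z hz h, mul_one] at h1
  have h2 := congrArg Prod.snd h1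
  have h4 : planeDeriv E u z Complex.I = J₀ (u z) (planeDeriv E u z 1) := h2.symm
  have h5 : mapDensity Ω u z = (Ω.form (u z) : E →L[ℝ] E →L[ℝ] ℝ) (planeDeriv E u z 1)
    (planeDeriv E u z Complex.I) := rfl
  rw [h5, h4]
  exact hJ₀.nonneg (u z) (planeDeriv E u z 1)

/-- On the ends, `∂_t u = J ∂_τ u + ρ X`. -/
theorem IsHolomorphicSection.eq_on_end (hJt : IsHCompatible Ω C R₁ ρ H J₀ J Jt)
    (hu : IsHolomorphicSection Jt u) (i : Fin 3) {s : ℝ} (hs : 0 < s) (t : ℝ) :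
    planeDeriv E u (C.point i s t) (Complex.I * C.endDeriv i s t) =
      (J i (ρ i s) t (u (C.point i s t)) : E →L[ℝ] E) (planeDeriv E u (C.point i s t)
        (C.endDeriv i s t)) + ρ i s • (hamVF Ω (H i) t (u (C.point i s t)) : E) := by
  have hdep : 0 < depth i (endCoord i (s, t)) := by rwa [depth_endCoord]
  have h1 := hu.holomorphic (C.point i s t) (C.mem_pants i _ hdep) (C.endDeriv i s t)
  have h2 := hJt.on_end i _ hdep (u (C.point i s t)) 1 0
    (planeDeriv E u (C.point i s t) (C.endDeriv i s t))
  have him : (endCoord i (s, t)).im = t := by simp [endCoord]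
  simp only [Complex.ofReal_one, Complex.ofReal_zero, zero_mul, add_zero, mul_one, one_mul,
    zero_smul, depth_endCoord, him] at h2
  refine (congrArg Prod.snd h1).symm.trans ((congrArg Prod.snd h2).trans ?_)
  exact congrArg (fun a : E => (J i (ρ i s) t (u (C.point i s t)) : E →L[ℝ] E) a
    + ρ i s • (hamVF Ω (H i) t (u (C.point i s t)) : E)) (sub_zero _)

/-- The density of the symplectic form along a holomorphic section, on the ends. -/
theorem IsHolomorphicSection.mapDensity_mul [FiniteDimensional ℝ E]
    (hJt : IsHCompatible Ω C R₁ ρ H J₀ J Jt)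
    (hu : IsHolomorphicSection Jt u) (i : Fin 3) {s : ℝ} (hs : 0 < s) (t : ℝ) :
    mapDensity Ω u (C.point i s t) * ‖C.endDeriv i s t‖ ^ 2 =
      energyDensity Ω C ρ J u i s t
        - ρ i s * funDeriv E (H i t) (u (C.point i s t))
          (planeDeriv E u (C.point i s t) (C.endDeriv i s t)) := by
  have h1 := pullForm_plane Ω u (C.point i s t) (C.endDeriv i s t) (Complex.I * C.endDeriv i s t)
  have h2 : planeDet (C.endDeriv i s t) (Complex.I * C.endDeriv i s t) = ‖C.endDeriv i s t‖ ^ 2 := by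
    rw [planeDet_apply, ← Complex.normSq_eq_norm_sq, Complex.normSq_apply]
    simp
  rw [h2] at h1
  rw [← h1]
  have h3 : pullForm Ω.form u (C.point i s t) (C.endDeriv i s t) (Complex.I * C.endDeriv i s t) =
      (Ω.form (u (C.point i s t)) : E →L[ℝ] E →L[ℝ] ℝ)
        (planeDeriv E u (C.point i s t) (C.endDeriv i s t))
        (planeDeriv E u (C.point i s t) (Complex.I * C.endDeriv i s t)) := rfl
  rw [h3, hu.eq_on_end hJt i hs t, map_add, map_smul, smul_eq_mul]
  have h4 : (Ω.form (u (C.point i s t)) : E →L[ℝ] E →L[ℝ] ℝ)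
      (planeDeriv E u (C.point i s t) (C.endDeriv i s t)) (hamVF Ω (H i) t (u (C.point i s t)) : E) =
      -funDeriv E (H i t) (u (C.point i s t))
        (planeDeriv E u (C.point i s t) (C.endDeriv i s t)) := by
    refine (Ω.neg_swap (u (C.point i s t)) _ _).trans (congrArg Neg.neg ?_)
    exact hamVF_spec Ω (H i) t (u (C.point i s t)) (planeDeriv E u (C.point i s t) (C.endDeriv i s t))
  rw [h4, mul_neg, ← sub_eq_add_neg]
  rfl

theorem continuousOn_deriv_of_contDiffAt {F : Type*} [NormedAddCommGroup F] [NormedSpace ℝ F]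
    {g : ℝ → F} {K : Set ℝ} (hg : ∀ s ∈ K, ContDiffAt ℝ 1 g s) : ContinuousOn (deriv g) K :=
  fun s hs => (((hg s hs).continuousAt_fderiv (by simp)).clm_apply
    (continuousAt_const (y := (1 : ℝ)))).continuousWithinAt

/-- Integration by parts for the Hamiltonian term, on a ray of an end. -/
theorem le_integral_mul_deriv {R₁ R₂ L σ : ℝ} {ρ g : ℝ → ℝ} {m₁ : ℝ} (hρ : IsCutOff R₁ R₂ ρ)
    (hL : R₂ ≤ L) (hg : ∀ s ∈ Icc R₁ L, ContDiffAt ℝ 1 g s) (hgm : ∀ s, σ * g s ≤ m₁) :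
    σ * g L - m₁ ≤ ∫ s in R₁..L, σ * (ρ s * deriv g s) := by
  have hR : R₁ ≤ L := hρ.lt.le.trans hL
  have hρd : ContDiff ℝ 1 ρ := hρ.smooth.of_le (by norm_cast)
  have hρ' := hρd.continuous_deriv (by simp)
  have hg' : ContinuousOn (deriv g) (Icc R₁ L) := continuousOn_deriv_of_contDiffAt hg
  have hgi : IntervalIntegrable (deriv g) volume R₁ L := hg'.intervalIntegrable_of_Icc hR
  have hgc : ContinuousOn g (Icc R₁ L) := fun s hs => (hg s hs).continuousAt.continuousWithinAt
  have hpos : ∀ s, 0 ≤ deriv ρ s := fun s => hρ.monotone.deriv_nonneg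
  have parts := intervalIntegral.integral_mul_deriv_eq_deriv_mul (a := R₁) (b := L)
    (fun s _ => (hρd.differentiable (by simp) s).hasDerivAt)
    (fun s hs => ((hg s (by rwa [uIcc_of_le hR] at hs)).differentiableAt (by simp)).hasDerivAt)
    (hρ'.intervalIntegrable _ _) hgi
  have hint : ∫ s in R₁..L, deriv ρ s = 1 := by
    rw [intervalIntegral.integral_deriv_eq_sub (fun s _ => hρd.differentiable (by simp) s)
      (hρ'.intervalIntegrable _ _), hρ.eq_one L hL, hρ.eq_zero R₁ le_rfl, sub_zero]
  -- The derivative of the cut-off is nonnegative with integral `1`, so the averaged term is at most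
  -- `m₁`.
  have hle : ∫ s in R₁..L, σ * (deriv ρ s * g s) ≤ ∫ s in R₁..L, m₁ * deriv ρ s := by
    refine intervalIntegral.integral_mono_on hR ?_ ((hρ'.intervalIntegrable _ _).const_mul m₁)
      fun s hs => ?_
    · exact ((hρ'.continuousOn.mul hgc).intervalIntegrable_of_Icc hR).const_mul σ
    · have := mul_le_mul_of_nonneg_right (hgm s) (hpos s)
      linarith
  rw [intervalIntegral.integral_const_mul, intervalIntegral.integral_const_mul, hint] at hle
  rw [intervalIntegral.integral_const_mul, parts, hρ.eq_one L hL, hρ.eq_zero R₁ le_rfl]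
  linarith

theorem IsHolomorphicSection.mdifferentiableAt_point (hu : IsHolomorphicSection Jt u) (i : Fin 3)
    {s : ℝ} (hs : 0 < s) (t : ℝ) : ContMDiffAt 𝓘(ℝ, ℂ) 𝓘(ℝ, E) ∞ u (C.point i s t) :=
  hu.smooth.contMDiffAt (isOpen_pants.mem_nhds (C.mem_pants i _ (by rwa [depth_point])))

/-- The energy inequality on an end. -/
theorem IsHolomorphicSection.le_endArea [FiniteDimensional ℝ E]
    (hρ : ∀ i, IsCutOff (R₁ i) (R₂ i) (ρ i)) (hH : ∀ i, IsPeriodicHamiltonian E (H i))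
    (hJ : ∀ i, IsACSPath Ω J₀ (J i)) (hJt : IsHCompatible Ω C R₁ ρ H J₀ J Jt)
    (hu : IsHolomorphicSection Jt u) (i : Fin 3) {L : ℝ} (hL : R₂ i ≤ L) {m : ℝ → ℝ}
    (hm : Continuous m) (hHm : ∀ t x, endSign i * H i t x ≤ m t) :
    endSign i * (∫ t in (0 : ℝ)..1, H i t (u (C.point i L t))) - ∫ t in (0 : ℝ)..1, m t ≤
      C.endArea (mapDensity Ω u) i (R₁ i) L := by
  have hR1 := (hρ i).pos
  have hR : R₁ i ≤ L := (hρ i).lt.le.trans hL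
  have hL0 : 0 < L := hR1.trans_le hR
  have hD : ContinuousOn (mapDensity Ω u) pants := fun z hz =>
    (contDiffAt_mapDensity Ω (hu.smooth.contMDiffAt
      (isOpen_pants.mem_nhds hz))).continuousAt.continuousWithinAt
  let F : ℝ × ℝ → ℝ := fun y => mapDensity Ω u (C.point i y.2 y.1) * ‖C.endDeriv i y.2 y.1‖ ^ 2
  have hF : ContinuousOn F (Icc 0 1 ×ˢ Icc (R₁ i) L) := by
    have hmaps : MapsTo Prod.swap (Icc (0 : ℝ) 1 ×ˢ Icc (R₁ i) L) (Ioi (0 : ℝ) ×ˢ (univ : Set ℝ)) :=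
      fun y hy => ⟨hR1.trans_le hy.2.1, mem_univ _⟩
    have h1 := (C.continuousOn_endDensity hD i).comp continuous_swap.continuousOn hmaps
    refine h1.congr fun y _ => ?_
    obtain ⟨t, s⟩ := y
    simp only [F, Function.comp_apply, Prod.swap_prod_mk, CylindricalEnds.endDeriv]
  have hFi := hF.integrableOn_compact (μ := volume) (isCompact_Icc.prod isCompact_Icc)
  have hcont : Continuous fun t => endSign i * H i t (u (C.point i L t)) - m t := by
    refine (continuous_const.mul ?_).sub hm
    have h1 : Continuous fun t => u (C.point i L t) := continuous_iff_continuousAt.2 fun t =>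
      ContinuousAt.comp (f := C.point i L) (hu.mdifferentiableAt_point i hL0 t).continuousAt
        (C.contDiff_point i hL0).continuous.continuousAt
    exact (hH i).smooth.continuous.comp (continuous_id.prodMk h1)
  have hswap : C.endArea (mapDensity Ω u) i (R₁ i) L = ∫ t in Icc (0 : ℝ) 1, ∫ s in Icc (R₁ i) L, F (t, s) := by
    rw [Measure.volume_eq_prod] at hFi
    rw [← setIntegral_prod _ hFi, ← Measure.volume_eq_prod, CylindricalEnds.endArea,
      Measure.volume_eq_prod, ← setIntegral_prod_swap]
    simp only [F, Prod.fst_swap, Prod.snd_swap, CylindricalEnds.endDeriv, Prod.swap]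
  have hpt : ∀ t ∈ Icc (0 : ℝ) 1, endSign i * H i t (u (C.point i L t)) - m t ≤
      ∫ s in Icc (R₁ i) L, F (t, s) := by
    intro t ht
    let g : ℝ → ℝ := fun s => H i t (u (C.point i s t))
    have hHt : ContMDiff 𝓘(ℝ, E) 𝓘(ℝ, ℝ) ∞ (H i t) :=
      (hH i).smooth.comp (contMDiff_const.prodMk contMDiff_id)
    have hg : ∀ s ∈ Icc (R₁ i) L, ContDiffAt ℝ 1 g s := fun s hs => by
      have hs0 : 0 < s := hR1.trans_le hs.1
      have h1 : ContDiffAt ℝ ∞ (fun s => C.point i s t) s :=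
        ContDiffAt.comp (g := fun x : ℝ × ℝ => C.point i x.1 x.2) (f := fun s => (s, t)) s
          (C.contDiffAt_point_prod i (x := (s, t)) hs0) (contDiffAt_id.prodMk contDiffAt_const)
      have h2 : ContMDiffAt 𝓘(ℝ, ℝ) 𝓘(ℝ, ℝ) ∞ g s := ContMDiffAt.comp (g := H i t) s hHt.contMDiffAt
        ((hu.mdifferentiableAt_point i hs0 t).comp s h1.contMDiffAt)
      exact h2.contDiffAt.of_le (by norm_cast)
    have hg' : ContinuousOn (deriv g) (Icc (R₁ i) L) := continuousOn_deriv_of_contDiffAt hg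
    refine (le_integral_mul_deriv (hρ i) hL hg fun s => hHm t _).trans ?_
    rw [integral_Icc_eq_integral_Ioc, ← intervalIntegral.integral_of_le hR]
    refine intervalIntegral.integral_mono_on hR ?_ ?_ fun s hs => ?_
    · exact ((((hρ i).smooth.continuous.continuousOn.mul hg').intervalIntegrable_of_Icc
        hR).const_mul _)
    · refine ContinuousOn.intervalIntegrable_of_Icc hR (hF.comp (by fun_prop) fun s hs => ⟨ht, hs⟩)
    · have hs0 : 0 < s := hR1.trans_le hs.1
      have h1 : deriv g s = _ := (hasDerivAt_comp_point (F := H i t) i hs0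
        (hHt.contMDiffAt.mdifferentiableAt (by simp))
        ((hu.mdifferentiableAt_point i hs0 t).mdifferentiableAt (by simp))).deriv
      have h2 := hu.mapDensity_mul hJt i hs0 t
      -- Discarding this energy is the only loss on the ends apart from the bound on the
      -- Hamiltonian.
      have h3 : 0 ≤ energyDensity Ω C ρ J u i s t :=
        ((hJ i).compatible _ ((hρ i).mem_Icc s) t).nonneg (u (C.point i s t)) _
      have h4 := endSign_mul_self i
      simp only [F]
      rw [h2, h1]
      generalize funDeriv E (H i t) (u (C.point i s t)) _ = q
      -- The derivative in `s` is `-endSign i` times the derivative in `τ`, which turns the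
      -- Hamiltonian term into the integrand handled by integration by parts.
      have h5 : endSign i * (ρ i s * (-endSign i * q)) = -(ρ i s * q) := by
        linear_combination (-(ρ i s * q)) * h4
      rw [h5]
      linarith
  have hmi : IntervalIntegrable m volume 0 1 := hm.intervalIntegrable _ _
  have hHi : IntervalIntegrable (fun t => endSign i * H i t (u (C.point i L t))) volume 0 1 := by
    simpa only [sub_add_cancel] using (hcont.fun_add hm).intervalIntegrable (μ := volume) 0 1
  rw [hswap, ← intervalIntegral.integral_const_mul, ← intervalIntegral.integral_sub hHi hmi,
    intervalIntegral.integral_of_le zero_le_one, ← integral_Icc_eq_integral_Ioc]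
  refine setIntegral_mono_on hcont.continuousOn.integrableOn_Icc ?_ measurableSet_Icc hpt
  rw [Measure.volume_eq_prod, IntegrableOn, ← Measure.prod_restrict] at hFi
  exact hFi.integral_prod_left

theorem continuous_iSup_ham [CompactSpace M] [Nonempty M] {H : ℝ → M → ℝ}
    (hH : IsPeriodicHamiltonian E H) : Continuous fun t => ⨆ x, H t x := by
  have := IsCompact.continuous_sSup (f := H) (isCompact_univ (X := M)) hH.smooth.continuous
  simpa [image_univ, sSup_range] using this

theorem continuous_iInf_ham [CompactSpace M] [Nonempty M] {H : ℝ → M → ℝ}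
    (hH : IsPeriodicHamiltonian E H) : Continuous fun t => ⨅ x, H t x := by
  have := IsCompact.continuous_sInf (f := H) (isCompact_univ (X := M)) hH.smooth.continuous
  simpa [image_univ, sInf_range] using this

/-- The energy inequality for holomorphic sections over the pair of pants. -/
theorem IsHolomorphicSection.energy_inequality [FiniteDimensional ℝ E] [CompactSpace M]
    (hρ : ∀ i, IsCutOff (R₁ i) (R₂ i) (ρ i)) (hH : ∀ i, IsPeriodicHamiltonian E (H i))
    (hJ₀ : IsCompatible Ω J₀) (hJ : ∀ i, IsACSPath Ω J₀ (J i))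
    (hJt : IsHCompatible Ω C R₁ ρ H J₀ J Jt)
    (hu : IsHolomorphicSection Jt u) {o : Fin 3 → ℝ} {L : ℝ} (h : C.IsDeep o L)
    (ho : ∀ R : ℝ, ∀ᶠ s in atTop, ∀ t : ℝ, R < (C.point 2 s (o 2 + t / 2) *
      Complex.exp (-(Real.pi * (t + 1 / 2) * Complex.I))).re) (hL : ∀ i, R₂ i ≤ L) :
    (∫ t in (0 : ℝ)..1, H 0 t (u (C.point 0 L t))) + (∫ t in (0 : ℝ)..1, H 1 t (u (C.point 1 L t)))
        - (∫ t in (0 : ℝ)..1, H 2 t (u (C.point 2 L t))) - (EPlus (H 0) + EPlus (H 1)) - EMinus (H 2) ≤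
      -rectArea Ω (fun x => u (C.sectorHomotopy o L 0 x)) 0 1 0 1
        - rectArea Ω (fun x => u (C.sectorHomotopy o L 1 x)) 0 1 0 1
        + rectArea Ω (fun x => u (C.sectorHomotopy o L 2 x)) 0 1 0 1
        + rectArea Ω (fun x => u (C.sectorHomotopy o L 3 x)) 0 1 0 1 := by
  have hne : Nonempty M := ⟨u 0⟩
  have hbd : ∀ i t, BddAbove (range (H i t)) ∧ BddBelow (range (H i t)) := fun i t => by
    have hc : Continuous (H i t) :=
      (hH i).smooth.continuous.comp (continuous_const.prodMk continuous_id)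
    have := isCompact_range hc
    exact ⟨this.bddAbove, this.bddBelow⟩
  have h0 := hu.le_endArea hρ hH hJ hJt 0 (hL 0) (continuous_iSup_ham (hH 0)) fun t x => by
    have := le_ciSup (hbd 0 t).1 x
    simpa [endSign] using this
  have h1 := hu.le_endArea hρ hH hJ hJt 1 (hL 1) (continuous_iSup_ham (hH 1)) fun t x => by
    have := le_ciSup (hbd 1 t).1 x
    simpa [endSign] using this
  have h2 := hu.le_endArea hρ hH hJ hJt 2 (hL 2) (m := fun t => -⨅ x, H 2 t x)
    (continuous_iInf_ham (hH 2)).neg fun t x => by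
    have := ciInf_le (hbd 2 t).2 x
    simpa [endSign] using this
  have hs : endSign 0 = 1 ∧ endSign 1 = 1 ∧ endSign 2 = -1 := ⟨rfl, rfl, rfl⟩
  rw [hs.1] at h0
  rw [hs.2.1] at h1
  rw [hs.2.2] at h2
  have hsum := h.sum_endArea_le ho (D := mapDensity Ω u) (a := R₁)
    (fun z hz => (contDiffAt_mapDensity Ω (hu.smooth.contMDiffAt
      (isOpen_pants.mem_nhds hz))).contDiffWithinAt)
    (fun i => (hρ i).pos) (fun i => (hρ i).lt.le.trans (hL i))
    (fun z hz hzi => mapDensity_nonneg hJt hJ₀ hu hz hzi)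
  have hrect : ∀ e, rectArea Ω (fun x => u (C.sectorHomotopy o L e x)) 0 1 0 1 =
      planeArea (mapDensity Ω u) (C.sectorHomotopy o L e) 0 1 0 1 := fun e =>
    rectArea_comp Ω (fun x hx => (hu.smooth.contMDiffAt (isOpen_pants.mem_nhds
      (h.sectorHomotopy_mem e hx.1 hx.2))).of_le (by norm_cast))
      ((C.contDiff_sectorHomotopy o (zero_lt_one.trans h.one_lt) e).of_le (by norm_cast))
  rw [hrect, hrect, hrect, hrect]
  rw [Fin.sum_univ_three] at hsum
  simp only [EPlus, EMinus]
  linarith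

end Energy

/-! ### Limits of line integrals -/

section Limits

variable {E : Type*} [NormedAddCommGroup E] [NormedSpace ℝ E] {α : Type*} {ℓ : Filter α}

/-- With the covector frozen at the left endpoint the integral is exact and depends only on the ends
of the path; the error is at most `ε` times the length. -/
theorem norm_integral_clm_le {A B ε : ℝ} (hAB : A ≤ B) {ζ : ℝ → E →L[ℝ] ℝ}
    (hζ : ContinuousOn ζ (Icc A B)) (hε : ∀ t ∈ Icc A B, ‖ζ t - ζ A‖ ≤ ε) {d : ℝ → E}
    (hd : ∀ t ∈ Icc A B, ContDiffAt ℝ 1 d t) :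
    |∫ t in A..B, ζ t (deriv d t)| ≤ ε * (∫ t in A..B, ‖deriv d t‖) + ‖ζ A‖ * (‖d B‖ + ‖d A‖) := by
  have hd' : ContinuousOn (deriv d) (Icc A B) := continuousOn_deriv_of_contDiffAt hd
  have hu := uIcc_of_le hAB
  have hi1 : IntervalIntegrable (fun t => (ζ t - ζ A) (deriv d t)) volume A B :=
    ((hζ.sub continuousOn_const).clm_apply hd').intervalIntegrable_of_Icc hAB
  have hi2 : IntervalIntegrable (fun t => ζ A (deriv d t)) volume A B :=
    (continuousOn_const.clm_apply hd').intervalIntegrable_of_Icc hAB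
  have hin : IntervalIntegrable (fun t => ‖deriv d t‖) volume A B :=
    hd'.norm.intervalIntegrable_of_Icc hAB
  have hder : ∫ t in A..B, ζ A (deriv d t) = ζ A (d B) - ζ A (d A) := by
    refine intervalIntegral.integral_eq_sub_of_hasDerivAt (f := fun t => ζ A (d t)) (fun t ht => ?_) hi2
    rw [hu] at ht
    exact (ζ A).hasFDerivAt.comp_hasDerivAt t ((hd t ht).differentiableAt (by simp)).hasDerivAt
  have hsplit : ∫ t in A..B, ζ t (deriv d t) =
      (∫ t in A..B, (ζ t - ζ A) (deriv d t)) + (ζ A (d B) - ζ A (d A)) := by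
    rw [← hder, ← intervalIntegral.integral_add hi1 hi2]
    refine intervalIntegral.integral_congr fun t _ => ?_
    simp
  have h1 : |∫ t in A..B, (ζ t - ζ A) (deriv d t)| ≤ ε * ∫ t in A..B, ‖deriv d t‖ := by
    rw [← intervalIntegral.integral_const_mul]
    refine intervalIntegral.norm_integral_le_of_norm_le (E := ℝ) hAB ?_ (hin.const_mul ε)
    refine Eventually.of_forall fun t ht => ?_
    exact ((ζ t - ζ A).le_opNorm _).trans
      (mul_le_mul_of_nonneg_right (hε t (Ioc_subset_Icc_self ht)) (norm_nonneg _))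
  have h2 : |ζ A (d B) - ζ A (d A)| ≤ ‖ζ A‖ * (‖d B‖ + ‖d A‖) := by
    rw [mul_add]
    exact (norm_sub_le (ζ A (d B)) (ζ A (d A))).trans (add_le_add ((ζ A).le_opNorm _) ((ζ A).le_opNorm _))
  rw [hsplit]
  exact (abs_add_le _ _).trans (add_le_add h1 h2)

/-- If paths converge uniformly to zero and their lengths are bounded, then the integrals of a
continuous covector field along them tend to zero. -/
theorem tendsto_integral_clm {A B K : ℝ} (hAB : A ≤ B) {ζ : ℝ → E →L[ℝ] ℝ}
    (hζ : ContinuousOn ζ (Icc A B)) {d : α → ℝ → E}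
    (hd : ∀ᶠ a in ℓ, ∀ t ∈ Icc A B, ContDiffAt ℝ 1 (d a) t)
    (hunif : ∀ ε > 0, ∀ᶠ a in ℓ, ∀ t ∈ Icc A B, ‖d a t‖ ≤ ε)
    (hK : ∀ᶠ a in ℓ, ∫ t in A..B, ‖deriv (d a) t‖ ≤ K) :
    Tendsto (fun a => ∫ t in A..B, ζ t (deriv (d a) t)) ℓ (𝓝 0) := by
  rw [Metric.tendsto_nhds]
  intro ε hε
  obtain ⟨c, hc⟩ := isCompact_Icc.exists_bound_of_continuousOn hζ
  set K' := max K 0 + 1 with hK'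
  have hK'0 : 0 < K' := by positivity
  -- On pieces shorter than `δ` the covector varies so little that all the length contributes at
  -- most `ε / 3`.
  obtain ⟨δ, hδ, hδζ⟩ := Metric.uniformContinuousOn_iff.1
    (isCompact_Icc.uniformContinuousOn_of_continuous hζ) (ε / (3 * K')) (by positivity)
  obtain ⟨n, hn⟩ := exists_nat_gt ((B - A) / δ)
  have hn0 : (0 : ℝ) < n + 1 := by positivity
  let τ : ℕ → ℝ := fun k => A + k * ((B - A) / (n + 1))
  have hstep : 0 ≤ (B - A) / (n + 1) := div_nonneg (by linarith) hn0.le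
  have hstepδ : (B - A) / (n + 1) < δ := by
    rw [div_lt_iff₀ hn0]
    rw [div_lt_iff₀ hδ] at hn
    nlinarith
  have hτs : ∀ k, τ (k + 1) = τ k + (B - A) / (n + 1) := fun k => by
    simp only [τ]; push_cast; ring
  have hτle : ∀ k, τ k ≤ τ (k + 1) := fun k => by rw [hτs]; linarith
  have hτ0 : τ 0 = A := by simp [τ]
  have hτn : τ (n + 1) = B := by
    simp only [τ]; push_cast; field_simp; ring
  have hτmono : Monotone τ := monotone_nat_of_le_succ hτle
  have hsub : ∀ k < n + 1, Icc (τ k) (τ (k + 1)) ⊆ Icc A B := fun k hk => by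
    rw [← hτ0, ← hτn]
    exact Icc_subset_Icc (hτmono (Nat.zero_le k)) (hτmono hk)
  have hc0 : 0 ≤ c := (norm_nonneg _).trans (hc A (left_mem_Icc.2 hAB))
  -- With this uniform bound on the paths the endpoint terms of the `n + 1` pieces add up to `ε /
  -- 3`.
  set ε₂ := ε / (3 * ((n + 1) * (2 * (c + 1)))) with hε₂
  have hε₂0 : 0 < ε₂ := by positivity
  filter_upwards [hd, hunif ε₂ hε₂0, hK] with a had hau haK
  have hd' : ContinuousOn (deriv (d a)) (Icc A B) := continuousOn_deriv_of_contDiffAt had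
  have hadj : ∀ {F : ℝ → ℝ}, ContinuousOn F (Icc A B) →
      ∑ k ∈ Finset.range (n + 1), ∫ t in τ k..τ (k + 1), F t = ∫ t in A..B, F t := by
    intro F hF
    rw [← hτ0, ← hτn]
    exact intervalIntegral.sum_integral_adjacent_intervals fun k hk =>
      (hF.mono (hsub k hk)).intervalIntegrable_of_Icc (hτle k)
  have hpiece : ∀ k ∈ Finset.range (n + 1), |∫ t in τ k..τ (k + 1), ζ t (deriv (d a) t)| ≤
      ε / (3 * K') * (∫ t in τ k..τ (k + 1), ‖deriv (d a) t‖) + (c + 1) * (2 * ε₂) := by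
    intro k hk
    have hk' := Finset.mem_range.1 hk
    have hl := hsub k hk' (left_mem_Icc.2 (hτle k))
    have hr := hsub k hk' (right_mem_Icc.2 (hτle k))
    refine (norm_integral_clm_le (hτle k) (hζ.mono (hsub k hk')) (ε := ε / (3 * K')) (fun t ht => ?_)
      fun t ht => had t (hsub k hk' ht)).trans (add_le_add le_rfl ?_)
    · rw [← dist_eq_norm]
      refine (hδζ t (hsub k hk' ht) _ hl ?_).le
      rw [Real.dist_eq, abs_of_nonneg (by linarith [ht.1])]
      have := ht.2
      rw [hτs] at this
      linarith
    · refine mul_le_mul ((hc _ hl).trans (by linarith)) ?_ (by positivity) (by positivity)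
      linarith [hau _ hl, hau _ hr]
  rw [Real.dist_eq, sub_zero, ← hadj (hζ.clm_apply hd')]
  have hsum := (Finset.abs_sum_le_sum_abs _ _).trans (Finset.sum_le_sum hpiece)
  rw [Finset.sum_add_distrib, ← Finset.mul_sum, hadj hd'.norm, Finset.sum_const, Finset.card_range,
    nsmul_eq_mul] at hsum
  refine hsum.trans_lt ?_
  have h1 : ε / (3 * K') * (∫ t in A..B, ‖deriv (d a) t‖) ≤ ε / 3 := by
    have : ∫ t in A..B, ‖deriv (d a) t‖ ≤ K' := by
      rw [hK']; linarith [le_max_left K 0]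
    calc _ ≤ ε / (3 * K') * K' := mul_le_mul_of_nonneg_left this (by positivity)
      _ = ε / 3 := by field_simp
  have h2 : ((n + 1 : ℕ) : ℝ) * ((c + 1) * (2 * ε₂)) = ε / 3 := by
    rw [hε₂]; push_cast; field_simp
  rw [h2]
  linarith

/-- Convergence that is locally uniform near a compact set is uniform on it. -/
theorem eventually_forall_of_tendsto {X Y : Type*} [TopologicalSpace X] {K : Set X}
    (hK : IsCompact K) {g : α × X → Y} {s : Set Y} (h : ∀ x ∈ K, ∀ᶠ p in ℓ ×ˢ 𝓝 x, g p ∈ s) :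
    ∀ᶠ a in ℓ, ∀ x ∈ K, g (a, x) ∈ s := by
  have h1 : {p | g p ∈ s} ∈ ℓ ×ˢ 𝓝ˢ K := hK.mem_prod_nhdsSet_of_forall h
  have h2 : {p | g p ∈ s} ∈ ℓ ×ˢ 𝓟 K := Filter.prod_mono_right ℓ principal_le_nhdsSet h1
  rw [mem_prod_principal] at h2
  exact h2

variable {M : Type} [TopologicalSpace M] [ChartedSpace E M] [IsManifold 𝓘(ℝ, E) ∞ M]

/-- The line integrals of a local potential along converging paths of bounded length converge. -/
theorem IsChartPotential.tendsto_lineInt {Ω : SymplecticForm E M} {lam : M → E →L[ℝ] ℝ} {V : Set M}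
    (h : IsChartPotential Ω lam V) (hV : IsOpen V) {A B : ℝ} (hAB : A ≤ B) {P : α → ℝ → M} {z : ℝ → M}
    (hP : ∀ᶠ a in ℓ, ∀ t ∈ Icc A B, ContMDiffAt 𝓘(ℝ, ℝ) 𝓘(ℝ, E) 1 (P a) t)
    (hz : ∀ t ∈ Icc A B, ContMDiffAt 𝓘(ℝ, ℝ) 𝓘(ℝ, E) 1 z t)
    (hlim : ∀ t ∈ Icc A B, Tendsto (fun p : α × ℝ => P p.1 p.2) (ℓ ×ˢ 𝓝 t) (𝓝 (z t)))
    (hzV : ∀ t ∈ Icc A B, z t ∈ V)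
    (hK : ∀ x₀ : M, (∀ t ∈ Icc A B, z t ∈ (chartAt E x₀).source) →
      ∃ K, ∀ᶠ a in ℓ, ∫ t in A..B, ‖deriv (chartAt E x₀ ∘ P a) t‖ ≤ K) :
    Tendsto (fun a => lineInt lam (P a) A B) ℓ (𝓝 (lineInt lam z A B)) := by
  obtain ⟨x₀, U, η, hη, hU, hlam⟩ := h
  obtain ⟨K, hK⟩ := hK x₀ fun t ht => (hlam _ (hzV t ht)).1
  have hPV : ∀ᶠ a in ℓ, ∀ t ∈ Icc A B, P a t ∈ V :=
    eventually_forall_of_tendsto isCompact_Icc (g := fun p : α × ℝ => P p.1 p.2) fun t ht =>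
      (hlim t ht).eventually (hV.mem_nhds (hzV t ht))
  let c : ℝ → E := chartAt E x₀ ∘ z
  let e : α → ℝ → E := fun a => chartAt E x₀ ∘ P a
  have hc : ∀ t ∈ Icc A B, ContDiffAt ℝ 1 c t := fun t ht =>
    ContMDiffAt.chartAt_comp (by simp) (hz t ht) (hlam _ (hzV t ht)).1
  have he : ∀ᶠ a in ℓ, ∀ t ∈ Icc A B, ContDiffAt ℝ 1 (e a) t := by
    filter_upwards [hP, hPV] with a ha haV t ht
    exact ContMDiffAt.chartAt_comp (by simp) (ha t ht) (hlam _ (haV t ht)).1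
  have hlime : ∀ t ∈ Icc A B, Tendsto (fun p : α × ℝ => e p.1 p.2) (ℓ ×ˢ 𝓝 t) (𝓝 (c t)) :=
    fun t ht => (((chartAt E x₀).continuousAt (hlam _ (hzV t ht)).1).tendsto).comp (hlim t ht)
  have hlimc : ∀ t ∈ Icc A B, Tendsto (fun p : α × ℝ => c p.2) (ℓ ×ˢ 𝓝 t) (𝓝 (c t)) :=
    fun t ht => (hc t ht).continuousAt.tendsto.comp tendsto_snd
  have hηc : ∀ t ∈ Icc A B, ContinuousAt η (c t) := fun t ht =>
    (hη.1 _ (hlam _ (hzV t ht)).2.1).continuousAt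
  have hdiff : ∀ ε > 0, ∀ᶠ a in ℓ, ∀ t ∈ Icc A B, ‖e a t - c t‖ ≤ ε := by
    intro ε hε
    refine eventually_forall_of_tendsto isCompact_Icc (g := fun p : α × ℝ => ‖e p.1 p.2 - c p.2‖)
      (s := Iic ε) fun t ht => ?_
    have := ((hlime t ht).sub (hlimc t ht)).norm
    rw [sub_self, norm_zero] at this
    exact (this.eventually_lt_const hε).mono fun _ h => h.le
  have hηdiff : ∀ ε > 0, ∀ᶠ a in ℓ, ∀ t ∈ Icc A B, ‖η (e a t) - η (c t)‖ ≤ ε := by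
    intro ε hε
    refine eventually_forall_of_tendsto isCompact_Icc
      (g := fun p : α × ℝ => ‖η (e p.1 p.2) - η (c p.2)‖) (s := Iic ε) fun t ht => ?_
    have := (((hηc t ht).tendsto.comp (hlime t ht)).sub
      ((hηc t ht).tendsto.comp (hlimc t ht))).norm
    rw [sub_self, norm_zero] at this
    exact (this.eventually_lt_const hε).mono fun _ h => h.le
  have hval : ∀ {Q : ℝ → M}, (∀ t ∈ Icc A B, ContMDiffAt 𝓘(ℝ, ℝ) 𝓘(ℝ, E) 1 Q t) →
      (∀ t ∈ Icc A B, Q t ∈ V) → lineInt lam Q A B =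
        ∫ t in A..B, η ((chartAt E x₀ ∘ Q) t) (deriv (chartAt E x₀ ∘ Q) t) := by
    intro Q hQ hQV
    refine intervalIntegral.integral_congr fun t ht => ?_
    rw [uIcc_of_le hAB] at ht
    have := (eventually_pullCovector_eq hV (fun x hx => ⟨(hlam x hx).1, (hlam x hx).2.2⟩)
      (hQ t ht) (hQV t ht)).self_of_nhds
    simp only [this]
    rfl
  have hζ : ContinuousOn (fun t => η (c t)) (Icc A B) := fun t ht =>
    (ContinuousAt.comp (g := η) (hηc t ht) (hc t ht).continuousAt).continuousWithinAt
  have hderc : ContinuousOn (deriv c) (Icc A B) := continuousOn_deriv_of_contDiffAt hc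
  -- With `e` the approximating path and `c` the limit in the chart, `η(e) e' - η(c) c'` splits into
  -- `η(c) (e - c)'` and `(η(e) - η(c)) e'`. The first is small by freezing the covector, the second
  -- by uniform convergence and bounded length.
  have hmain := tendsto_integral_clm (d := fun a t => e a t - c t) (ℓ := ℓ)
    (K := K + ∫ t in A..B, ‖deriv c t‖) hAB hζ
    (by filter_upwards [he] with a ha t ht using (ha t ht).sub (hc t ht)) hdiff (by
      filter_upwards [he, hK] with a ha haK
      have hdere : ContinuousOn (deriv (e a)) (Icc A B) := continuousOn_deriv_of_contDiffAt ha
      have i1 : IntervalIntegrable (fun t => ‖deriv (e a) t‖) volume A B :=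
        hdere.norm.intervalIntegrable_of_Icc hAB
      have i2 : IntervalIntegrable (fun t => ‖deriv c t‖) volume A B :=
        hderc.norm.intervalIntegrable_of_Icc hAB
      have heq : ∀ t ∈ Icc A B, deriv (fun t => e a t - c t) t = deriv (e a) t - deriv c t :=
        fun t ht => deriv_fun_sub ((ha t ht).differentiableAt (by simp))
          ((hc t ht).differentiableAt (by simp))
      calc ∫ t in A..B, ‖deriv (fun t => e a t - c t) t‖
          ≤ ∫ t in A..B, (‖deriv (e a) t‖ + ‖deriv c t‖) := by
            refine intervalIntegral.integral_mono_on hAB ?_ (i1.add i2) fun t ht => ?_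
            · refine ContinuousOn.intervalIntegrable_of_Icc hAB ?_
              exact ((hdere.sub hderc).congr heq).norm
            · rw [heq t ht]
              exact norm_sub_le _ _
        _ ≤ _ := by
            rw [intervalIntegral.integral_add i1 i2]
            linarith)
  have hrest : Tendsto (fun a => ∫ t in A..B, (η (e a t) - η (c t)) (deriv (e a) t)) ℓ (𝓝 0) := by
    rw [Metric.tendsto_nhds]
    intro ε hε
    have hK0 : 0 < max K 0 + 1 := by positivity
    filter_upwards [he, hK, hPV, hηdiff (ε / (2 * (max K 0 + 1))) (by positivity)]
      with a ha haK haV haη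
    have hdere : ContinuousOn (deriv (e a)) (Icc A B) := continuousOn_deriv_of_contDiffAt ha
    rw [Real.dist_eq, sub_zero]
    have h1 : |∫ t in A..B, (η (e a t) - η (c t)) (deriv (e a) t)| ≤
        ∫ t in A..B, ε / (2 * (max K 0 + 1)) * ‖deriv (e a) t‖ := by
      refine intervalIntegral.norm_integral_le_of_norm_le (E := ℝ) (μ := volume) hAB (Eventually.of_forall fun t ht => ?_)
        ((hdere.norm.intervalIntegrable_of_Icc hAB).const_mul _)
      exact ((η (e a t) - η (c t)).le_opNorm _).trans (mul_le_mul_of_nonneg_right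
        (haη t (Ioc_subset_Icc_self ht)) (norm_nonneg _))
    rw [intervalIntegral.integral_const_mul] at h1
    refine h1.trans_lt ?_
    calc ε / (2 * (max K 0 + 1)) * ∫ t in A..B, ‖deriv (e a) t‖
        ≤ ε / (2 * (max K 0 + 1)) * (max K 0 + 1) :=
          mul_le_mul_of_nonneg_left (haK.trans (by linarith [le_max_left K 0])) (by positivity)
      _ = ε / 2 := by field_simp
      _ < ε := by linarith
  have hsum := (hmain.add hrest).add_const (lineInt lam z A B)
  rw [add_zero, zero_add] at hsum
  refine hsum.congr' ?_
  filter_upwards [he, hP, hPV] with a ha haP haV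
  have hdere : ContinuousOn (deriv (e a)) (Icc A B) := continuousOn_deriv_of_contDiffAt ha
  have hηe : ContinuousOn (fun t => η (e a t)) (Icc A B) := fun t ht =>
    (ContinuousAt.comp (g := η) (f := e a) (hη.1 _ (hlam _ (haV t ht)).2.1).continuousAt
      (ha t ht).continuousAt).continuousWithinAt
  rw [hval haP haV, hval hz hzV]
  have heq : ∀ t ∈ Icc A B, deriv (fun t => e a t - c t) t = deriv (e a) t - deriv c t :=
    fun t ht => deriv_fun_sub ((ha t ht).differentiableAt (by simp))
      ((hc t ht).differentiableAt (by simp))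
  have i1 : IntervalIntegrable (fun t => η (c t) (deriv (fun t => e a t - c t) t)) volume A B :=
    (hζ.clm_apply ((hdere.sub hderc).congr heq)).intervalIntegrable_of_Icc hAB
  have i2 : IntervalIntegrable (fun t => (η (e a t) - η (c t)) (deriv (e a) t)) volume A B :=
    ((hηe.sub hζ).clm_apply hdere).intervalIntegrable_of_Icc hAB
  have i3 : IntervalIntegrable (fun t => η (c t) (deriv c t)) volume A B :=
    (hζ.clm_apply hderc).intervalIntegrable_of_Icc hAB
  change _ + _ + (∫ t in A..B, η (c t) (deriv c t)) = ∫ t in A..B, η (e a t) (deriv (e a) t)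
  rw [← intervalIntegral.integral_add i1 i2, ← intervalIntegral.integral_add (i1.add i2) i3]
  refine intervalIntegral.integral_congr fun t ht => ?_
  rw [uIcc_of_le hAB] at ht
  simp only [heq t ht, sub_apply, map_sub]
  ring

end Limits

/-! ### Local bounds -/

section Bounds

variable {E : Type*} [NormedAddCommGroup E] [NormedSpace ℝ E] {α : Type*} {ℓ : Filter α}

/-- Local bounds, valid eventually in a filter, are made uniform on a compact set; the maximum of
constants is harmless because `b` is nonnegative. -/
theorem exists_forall_bound {X : Type*} [TopologicalSpace X] {K : Set X} (hK : IsCompact K)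
    {g b : α × X → ℝ} (hb : ∀ p, 0 ≤ b p)
    (h : ∀ x ∈ K, ∃ c, ∀ᶠ p in ℓ ×ˢ 𝓝 x, g p ≤ c * b p) :
    ∃ c, ∀ᶠ a in ℓ, ∀ x ∈ K, g (a, x) ≤ c * b (a, x) := by
  refine hK.induction_on (p := fun s => ∃ c, ∀ᶠ a in ℓ, ∀ x ∈ s, g (a, x) ≤ c * b (a, x))
    ⟨0, by simp⟩ ?_ ?_ ?_
  · rintro s t hst ⟨c, hc⟩
    exact ⟨c, hc.mono fun a ha x hx => ha x (hst hx)⟩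
  · rintro s t ⟨c, hc⟩ ⟨c', hc'⟩
    refine ⟨max c c', (hc.and hc').mono fun a ha x hx => ?_⟩
    rcases hx with hx | hx
    · exact (ha.1 x hx).trans (mul_le_mul_of_nonneg_right (le_max_left _ _) (hb _))
    · exact (ha.2 x hx).trans (mul_le_mul_of_nonneg_right (le_max_right _ _) (hb _))
  · intro x hx
    obtain ⟨c, hc⟩ := h x hx
    obtain ⟨pa, hpa, px, hpx, hpq⟩ := eventually_prod_iff.1 hc
    exact ⟨{y | px y}, mem_nhdsWithin_of_mem_nhds hpx, c, hpa.mono fun a ha y hy => hpq ha hy⟩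

/-- The form has a positive minimum on the unit sphere. Half of it survives every perturbation whose
norm is below the other half. -/
theorem exists_forall_posDef [FiniteDimensional ℝ E] {Q₀ : E →L[ℝ] E →L[ℝ] ℝ}
    (h : ∀ v, v ≠ 0 → 0 < Q₀ v v) : ∃ δ > 0, ∀ᶠ Q in 𝓝 Q₀, ∀ v, δ * ‖v‖ ^ 2 ≤ Q v v := by
  obtain ⟨δ, hδ, hQ⟩ : ∃ δ > 0, ∀ v, 2 * δ * ‖v‖ ^ 2 ≤ Q₀ v v := by
    have hc : Continuous fun v => Q₀ v v := Q₀.continuous.clm_apply continuous_id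
    -- The sphere is empty only in the zero space, where any constant works.
    rcases (Metric.sphere (0 : E) 1).eq_empty_or_nonempty with hempty | hne
    · refine ⟨1, one_pos, fun v => ?_⟩
      by_cases hv : v = 0
      · simp [hv]
      · have : (‖v‖⁻¹ • v) ∈ Metric.sphere (0 : E) 1 := by
          rw [mem_sphere_zero_iff_norm, norm_smul, norm_inv, norm_norm,
            inv_mul_cancel₀ (norm_ne_zero_iff.2 hv)]
        rw [hempty] at this
        exact this.elim
    · obtain ⟨v₀, hv₀, hmin⟩ := (isCompact_sphere (0 : E) 1).exists_isMinOn hne hc.continuousOn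
      have hv₀n : v₀ ≠ 0 := by
        rintro rfl
        simp at hv₀
      refine ⟨Q₀ v₀ v₀ / 2, half_pos (h v₀ hv₀n), fun v => ?_⟩
      by_cases hv : v = 0
      · simp [hv]
      have hn := norm_ne_zero_iff.2 hv
      have hmem : (‖v‖⁻¹ • v) ∈ Metric.sphere (0 : E) 1 := by
        rw [mem_sphere_zero_iff_norm, norm_smul, norm_inv, norm_norm, inv_mul_cancel₀ hn]
      have h1 : Q₀ v₀ v₀ ≤ Q₀ (‖v‖⁻¹ • v) (‖v‖⁻¹ • v) := hmin hmem
      rw [map_smul, map_smul, smul_apply, smul_eq_mul, smul_eq_mul] at h1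
      have h2 := mul_le_mul_of_nonneg_right h1 (sq_nonneg ‖v‖)
      have h3 : ‖v‖⁻¹ * (‖v‖⁻¹ * Q₀ v v) * ‖v‖ ^ 2 = Q₀ v v := by field_simp
      linarith
  refine ⟨δ, hδ, ?_⟩
  filter_upwards [Metric.ball_mem_nhds Q₀ hδ] with Q hQb v
  have h1 : |(Q - Q₀) v v| ≤ δ * ‖v‖ ^ 2 := by
    have h2 := ((Q - Q₀) v).le_opNorm v
    have h3 := (Q - Q₀).le_opNorm v
    have h4 : ‖Q - Q₀‖ ≤ δ := by rw [← dist_eq_norm]; exact (Metric.mem_ball.1 hQb).le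
    calc |(Q - Q₀) v v| ≤ ‖(Q - Q₀) v‖ * ‖v‖ := h2
      _ ≤ (δ * ‖v‖) * ‖v‖ := by gcongr; exact h3.trans (by gcongr)
      _ = δ * ‖v‖ ^ 2 := by ring
  have h5 : (Q - Q₀) v v = Q v v - Q₀ v v := by simp
  rw [h5] at h1
  linarith [hQ v, (abs_le.1 h1).1]

variable {M : Type} [TopologicalSpace M] [ChartedSpace E M] [IsManifold 𝓘(ℝ, E) ∞ M]

variable (E) in
/-- The differential of the chart around `x₀`. -/
def chartDeriv (x₀ x : M) : E →L[ℝ] E := mfderiv 𝓘(ℝ, E) 𝓘(ℝ, E) (chartAt E x₀) x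

theorem endoInChart_chartDeriv (J : ∀ x : M, TangentSpace 𝓘(ℝ, E) x →L[ℝ] TangentSpace 𝓘(ℝ, E) x)
    {x₀ x : M} (hx : x ∈ (chartAt E x₀).source) (a : E) :
    endoInChart J x₀ (chartAt E x₀ x) (chartDeriv E x₀ x a) =
      chartDeriv E x₀ x ((J x : E →L[ℝ] E) a) := by
  have h : endoInChart J x₀ (chartAt E x₀ x) (chartDeriv E x₀ x a) =
      chartDeriv E x₀ ((chartAt E x₀).symm (chartAt E x₀ x))
        ((J ((chartAt E x₀).symm (chartAt E x₀ x)) : E →L[ℝ] E)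
          ((mfderiv 𝓘(ℝ, E) 𝓘(ℝ, E) (chartAt E x₀).symm (chartAt E x₀ x) : E →L[ℝ] E)
            (chartDeriv E x₀ x a))) := rfl
  have h2 : (mfderiv 𝓘(ℝ, E) 𝓘(ℝ, E) (chartAt E x₀).symm (chartAt E x₀ x) : E →L[ℝ] E)
      (chartDeriv E x₀ x a) = a := mfderiv_chartAt_symm_comp hx a
  rw [h, h2]
  exact congrArg (fun x' => chartDeriv E x₀ x' ((J x' : E →L[ℝ] E) a)) ((chartAt E x₀).left_inv hx)

/-- The metrics of a compatible family are bounded below in a chart. -/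
theorem IsACSPath.exists_lower_bound [FiniteDimensional ℝ E] {Ω : SymplecticForm E M}
    {J₀ : ∀ x : M, TangentSpace 𝓘(ℝ, E) x →L[ℝ] TangentSpace 𝓘(ℝ, E) x}
    {J : ℝ → ℝ → ∀ x : M, TangentSpace 𝓘(ℝ, E) x →L[ℝ] TangentSpace 𝓘(ℝ, E) x}
    (hJ : IsACSPath Ω J₀ J) {x₀ x₁ : M} (hx : x₁ ∈ (chartAt E x₀).source) (t₀ : ℝ) :
    ∃ δ > 0, ∀ᶠ q : ℝ × M in 𝓝 (t₀, x₁), ∀ a : E, δ * ‖chartDeriv E x₀ q.2 a‖ ^ 2 ≤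
      (Ω.form q.2 : E →L[ℝ] E →L[ℝ] ℝ) a ((J 1 q.1 q.2 : E →L[ℝ] E) a) := by
  have h1 : (1 : ℝ) ∈ Icc (0 : ℝ) 1 := right_mem_Icc.2 zero_le_one
  let Q : ℝ × M → E →L[ℝ] E →L[ℝ] ℝ := fun q =>
    (formInChart Ω.form x₀ (chartAt E x₀ q.2)).bilinearComp (ContinuousLinearMap.id ℝ E)
      (endoInChart (J 1 q.1) x₀ (chartAt E x₀ q.2))
  have htarget := (chartAt E x₀).map_source hx
  have hQ : ∀ q : ℝ × M, q.2 ∈ (chartAt E x₀).source → ∀ a : E,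
      Q q (chartDeriv E x₀ q.2 a) (chartDeriv E x₀ q.2 a) =
        (Ω.form q.2 : E →L[ℝ] E →L[ℝ] ℝ) a ((J 1 q.1 q.2 : E →L[ℝ] E) a) := by
    intro q hq a
    simp only [Q, ContinuousLinearMap.bilinearComp_apply, ContinuousLinearMap.id_apply]
    rw [endoInChart_chartDeriv _ hq]
    exact (form_eq_formInChart Ω.form hq a ((J 1 q.1 q.2 : E →L[ℝ] E) a)).symm
  have hcont : ContinuousAt Q (t₀, x₁) := by
    have hφ : ContinuousAt (fun q : ℝ × M => chartAt E x₀ q.2) (t₀, x₁) :=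
      ContinuousAt.comp (f := Prod.snd) ((chartAt E x₀).continuousAt hx) continuousAt_snd
    have hB : ContinuousAt (fun q : ℝ × M => formInChart Ω.form x₀ (chartAt E x₀ q.2)) (t₀, x₁) :=
      ContinuousAt.comp (f := fun q : ℝ × M => chartAt E x₀ q.2)
        ((Ω.smooth x₀).continuousOn.continuousAt ((chartAt E x₀).open_target.mem_nhds htarget)) hφ
    have hJc : ContinuousOn (fun p : ℝ × E => endoInChart (J 1 p.1) x₀ p.2)
        (univ ×ˢ (chartAt E x₀).target) :=
      (hJ.smooth x₀).continuousOn.comp (f := fun p : ℝ × E => ((1 : ℝ), p.1, p.2)) (by fun_prop)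
        fun p hp => ⟨h1, mem_univ _, hp.2⟩
    have hJc' : ContinuousAt (fun q : ℝ × M => endoInChart (J 1 q.1) x₀ (chartAt E x₀ q.2)) (t₀, x₁) :=
      ContinuousAt.comp (f := fun q : ℝ × M => (q.1, chartAt E x₀ q.2))
        (hJc.continuousAt ((isOpen_univ.prod (chartAt E x₀).open_target).mem_nhds
          ⟨mem_univ _, htarget⟩)) (continuousAt_fst.prodMk hφ)
    have hflip : Q = fun q => (((ContinuousLinearMap.compL ℝ E E ℝ).flip
        (endoInChart (J 1 q.1) x₀ (chartAt E x₀ q.2))).comp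
        (formInChart Ω.form x₀ (chartAt E x₀ q.2))) := by
      funext q; ext a b; rfl
    rw [hflip]
    exact ContinuousAt.clm_comp
      ((ContinuousLinearMap.compL ℝ E E ℝ).flip.continuous.continuousAt.comp hJc') hB
  obtain ⟨δ, hδ, hev⟩ := exists_forall_posDef (Q₀ := Q (t₀, x₁)) (by
    intro v hv
    -- The differential of the chart is injective, hence surjective in finite dimension, so
    -- positivity transfers to the chart.
    obtain ⟨a, rfl⟩ : ∃ a, chartDeriv E x₀ x₁ a = v := by
      have hs : ∀ a : E, chartDeriv E x₀ x₁ a = 0 → a = 0 := fun a ha => by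
        let T : E →L[ℝ] E := mfderiv 𝓘(ℝ, E) 𝓘(ℝ, E) (chartAt E x₀).symm (chartAt E x₀ x₁)
        have h2 : T (chartDeriv E x₀ x₁ a) = a := mfderiv_chartAt_symm_comp hx a
        rw [ha] at h2
        exact h2.symm.trans T.map_zero
      exact LinearMap.injective_iff_surjective.1
        ((injective_iff_map_eq_zero (chartDeriv E x₀ x₁ : E →ₗ[ℝ] E)).2 hs) v
    have ha : a ≠ 0 := by rintro rfl; exact hv (map_zero _)
    rw [hQ (t₀, x₁) hx]
    exact (hJ.compatible 1 h1 t₀).pos x₁ a ha)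
  refine ⟨δ, hδ, ?_⟩
  have hsrc : ∀ᶠ q : ℝ × M in 𝓝 (t₀, x₁), q.2 ∈ (chartAt E x₀).source :=
    continuousAt_snd.preimage_mem_nhds ((chartAt E x₀).open_source.mem_nhds hx)
  filter_upwards [hcont.eventually hev, hsrc] with q hq hqs a
  rw [← hQ q hqs a]
  exact hq _

/-- The differential of a Hamiltonian is bounded in a chart. -/
theorem IsPeriodicHamiltonian.exists_bound {H : ℝ → M → ℝ} (hH : IsPeriodicHamiltonian E H)
    {x₀ x₁ : M} (hx : x₁ ∈ (chartAt E x₀).source) (t₀ : ℝ) :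
    ∃ c, 0 ≤ c ∧ ∀ᶠ q : ℝ × M in 𝓝 (t₀, x₁), ∀ a : E,
      |funDeriv E (H q.1) q.2 a| ≤ c * ‖chartDeriv E x₀ q.2 a‖ := by
  let k : ℝ × E → ℝ := fun p => H p.1 ((chartAt E x₀).symm p.2)
  have hk : ∀ p : ℝ × E, p.2 ∈ (chartAt E x₀).target → ContDiffAt ℝ ∞ k p := by
    intro p hp
    have h1 : ContMDiffAt 𝓘(ℝ, ℝ × E) (𝓘(ℝ, ℝ).prod 𝓘(ℝ, E)) ∞
        (fun p : ℝ × E => (p.1, (chartAt E x₀).symm p.2)) p := by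
      have h2 : ContMDiffAt 𝓘(ℝ, ℝ × E) 𝓘(ℝ, E) ∞ (fun p : ℝ × E => (chartAt E x₀).symm p.2) p :=
        (contMDiffAt_chartAt_symm hp).comp p contDiffAt_snd.contMDiffAt
      exact contDiffAt_fst.contMDiffAt.prodMk h2
    exact (ContMDiffAt.comp (g := fun q : ℝ × M => H q.1 q.2) p hH.smooth.contMDiffAt h1).contDiffAt
  have htarget := (chartAt E x₀).map_source hx
  have hcont := (hk (t₀, chartAt E x₀ x₁) htarget).continuousAt_fderiv (by simp)
  have hφ : ContinuousAt (fun q : ℝ × M => (q.1, chartAt E x₀ q.2)) (t₀, x₁) :=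
    continuousAt_fst.prodMk (ContinuousAt.comp (f := Prod.snd) ((chartAt E x₀).continuousAt hx)
      continuousAt_snd)
  have hnorm : ContinuousAt (fun q : ℝ × M => ‖fderiv ℝ k (q.1, chartAt E x₀ q.2)‖) (t₀, x₁) :=
    (ContinuousAt.comp (f := fun q : ℝ × M => (q.1, chartAt E x₀ q.2)) hcont hφ).norm
  refine ⟨‖fderiv ℝ k (t₀, chartAt E x₀ x₁)‖ + 1, by positivity, ?_⟩
  have hsrc : ∀ᶠ q : ℝ × M in 𝓝 (t₀, x₁), q.2 ∈ (chartAt E x₀).source :=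
    continuousAt_snd.preimage_mem_nhds ((chartAt E x₀).open_source.mem_nhds hx)
  filter_upwards [hsrc, hnorm.eventually_lt continuousAt_const (lt_add_one _)] with q hq hqn a
  have h1 : HasFDerivAt (fun y => k (q.1, y)) ((fderiv ℝ k (q.1, chartAt E x₀ q.2)).comp
      ((0 : E →L[ℝ] ℝ).prod (ContinuousLinearMap.id ℝ E))) (chartAt E x₀ q.2) :=
    ((hk (q.1, chartAt E x₀ q.2) ((chartAt E x₀).map_source hq)).differentiableAt
      (by simp)).hasFDerivAt.comp _ ((hasFDerivAt_const _ _).prodMk (hasFDerivAt_id _))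
  have h2 := h1.hasMFDerivAt.comp q.2
    ((contMDiffAt_chartAt_two hq).mdifferentiableAt (by simp)).hasMFDerivAt
  have h3 : (fun y => k (q.1, y)) ∘ chartAt E x₀ =ᶠ[𝓝 q.2] H q.1 := by
    filter_upwards [(chartAt E x₀).open_source.mem_nhds hq] with y hy
    simp only [k, Function.comp_apply, (chartAt E x₀).left_inv hy]
  have h4 : funDeriv E (H q.1) q.2 a = fderiv ℝ k (q.1, chartAt E x₀ q.2)
      (0, chartDeriv E x₀ q.2 a) := by
    have := (h2.congr_of_eventuallyEq h3.symm).mfderiv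
    exact congrArg (fun T : E →L[ℝ] ℝ => T a) this
  rw [h4]
  refine ((fderiv ℝ k (q.1, chartAt E x₀ q.2)).le_opNorm _).trans ?_
  refine mul_le_mul hqn.le ?_ (norm_nonneg _) (by positivity)
  rw [Prod.norm_mk, norm_zero, max_eq_right (norm_nonneg _)]

/-- The Hamiltonian vector field and the image of a vector under the almost complex structure, in
a chart. -/
theorem exists_velocity_bound [FiniteDimensional ℝ E] {Ω : SymplecticForm E M}
    {J₀ : ∀ x : M, TangentSpace 𝓘(ℝ, E) x →L[ℝ] TangentSpace 𝓘(ℝ, E) x}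
    {J : ℝ → ℝ → ∀ x : M, TangentSpace 𝓘(ℝ, E) x →L[ℝ] TangentSpace 𝓘(ℝ, E) x}
    (hJ : IsACSPath Ω J₀ J) {H : ℝ → M → ℝ} (hH : IsPeriodicHamiltonian E H)
    {x₀ x₁ : M} (hx : x₁ ∈ (chartAt E x₀).source) (t₀ : ℝ) :
    ∃ c, ∀ᶠ q : ℝ × M in 𝓝 (t₀, x₁), ∀ a : E,
      ‖chartDeriv E x₀ q.2 ((J 1 q.1 q.2 : E →L[ℝ] E) a + (hamVF Ω H q.1 q.2 : E))‖ ≤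
        c * (1 + (Ω.form q.2 : E →L[ℝ] E →L[ℝ] ℝ) a ((J 1 q.1 q.2 : E →L[ℝ] E) a)) := by
  obtain ⟨δ, hδ, h1⟩ := hJ.exists_lower_bound hx t₀
  obtain ⟨c, hc, h2⟩ := hH.exists_bound hx t₀
  refine ⟨1 + δ⁻¹ + c / δ, ?_⟩
  have h01 : (1 : ℝ) ∈ Icc (0 : ℝ) 1 := right_mem_Icc.2 zero_le_one
  filter_upwards [h1, h2] with q hq1 hq2 a
  let B : E →L[ℝ] E →L[ℝ] ℝ := Ω.form q.2
  let T : E →L[ℝ] E := J 1 q.1 q.2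
  let X : E := hamVF Ω H q.1 q.2
  let D : E →L[ℝ] E := chartDeriv E x₀ q.2
  have hcomp := hJ.compatible 1 h01 q.1
  have hTT : ∀ a : E, T (T a) = -a := hcomp.sq q.2
  -- The almost complex structure is an isometry of its metric, so a bound for `a` in the metric
  -- also bounds `T a`.
  have hBT : ∀ a : E, B (T a) (T (T a)) = B a (T a) := by
    intro a
    have h3 : B (T a) (T (T a)) = -B (T a) a := by rw [hTT, map_neg]
    have h4 : B (T a) a = -B a (T a) := Ω.neg_swap q.2 (T a) a
    rw [h3, h4, neg_neg]
  have hnonneg : ∀ a : E, 0 ≤ B a (T a) := hcomp.nonneg q.2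
  have hlow : ∀ a : E, δ * ‖D a‖ ^ 2 ≤ B a (T a) := hq1
  have e1 : ∀ a : E, ‖D (T a)‖ ≤ 1 + δ⁻¹ * B a (T a) := by
    intro a
    have h3 := hlow (T a)
    rw [hBT] at h3
    have h4 : ‖D (T a)‖ ^ 2 ≤ δ⁻¹ * B a (T a) := by
      rw [← div_eq_inv_mul, le_div_iff₀ hδ]
      linarith
    nlinarith [sq_nonneg (‖D (T a)‖ - 1)]
  have hX : ∀ b : E, B X b = funDeriv E (H q.1) q.2 b := fun b => hamVF_spec Ω H q.1 q.2 b
  -- The squared metric norm of `X` is the differential of `H` applied to `T X`. Being at most `c ‖D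
  -- (T X)‖` and at least `δ ‖D (T X)‖²`, it controls first `D (T X)` and then `D X`. No smoothness
  -- of the Hamiltonian vector field is needed.
  have e2 : ‖D X‖ ≤ c / δ := by
    have h3 := hlow (T X)
    rw [hBT] at h3
    have h4 : B X (T X) ≤ c * ‖D (T X)‖ := by
      rw [hX]
      exact (le_abs_self _).trans (hq2 (T X))
    have h5 := hlow X
    have h6 : δ * ‖D (T X)‖ ≤ c := by
      rcases (norm_nonneg (D (T X))).eq_or_lt with h | h
      · rw [← h, mul_zero]; exact hc
      · nlinarith
    have h7 : (δ * ‖D X‖) ^ 2 ≤ c ^ 2 := by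
      have : δ * (δ * ‖D X‖ ^ 2) ≤ δ * (c * ‖D (T X)‖) :=
        mul_le_mul_of_nonneg_left (h5.trans h4) hδ.le
      nlinarith
    rw [le_div_iff₀ hδ, mul_comm]
    exact (sq_le_sq₀ (by positivity) hc).1 h7
  have h8 := hnonneg a
  change ‖D (T a + X)‖ ≤ (1 + δ⁻¹ + c / δ) * (1 + B a (T a))
  rw [map_add]
  refine (norm_add_le _ _).trans ((add_le_add (e1 a) e2).trans ?_)
  have h9 : 0 ≤ c / δ * B a (T a) := by positivity
  have h10 : 0 < δ⁻¹ := by positivity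
  nlinarith

/-- The derivative of a smooth disc is bounded in charts, up to the boundary. -/
theorem exists_bound_disc {w : ℂ → M} (hw : ContMDiffOn 𝓘(ℝ, ℂ) 𝓘(ℝ, E) ∞ w (Metric.closedBall 0 1))
    {q₀ : ℂ} (hq₀ : q₀ ∈ Metric.closedBall (0 : ℂ) 1) {x₀ : M} (hx : w q₀ ∈ (chartAt E x₀).source) :
    ∃ c, 0 ≤ c ∧ ∀ᶠ q in 𝓝[Metric.ball 0 1] q₀, w q ∈ (chartAt E x₀).source ∧
      ContMDiffAt 𝓘(ℝ, ℂ) 𝓘(ℝ, E) ∞ w q ∧ ‖fderiv ℝ (chartAt E x₀ ∘ w) q‖ ≤ c := by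
  have h1 : ContDiffWithinAt ℝ 1 (chartAt E x₀ ∘ w) (Metric.closedBall 0 1) q₀ := by
    have : ContMDiffWithinAt 𝓘(ℝ, ℂ) 𝓘(ℝ, E) ∞ (chartAt E x₀ ∘ w) (Metric.closedBall 0 1) q₀ :=
      ContMDiffAt.comp_contMDiffWithinAt q₀ (contMDiffAt_chartAt_two hx) (hw q₀ hq₀)
    exact this.contDiffWithinAt.of_le (by norm_cast)
  -- On the convex closed disc a smooth map is locally Lipschitz up to the boundary, and the
  -- Lipschitz constant bounds its derivative at interior points.
  obtain ⟨c, T, hT, hlip⟩ := h1.exists_lipschitzOnWith (convex_closedBall 0 1)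
  have hsub : Metric.ball (0 : ℂ) 1 ⊆ Metric.closedBall 0 1 := Metric.ball_subset_closedBall
  have hsrc : ∀ᶠ q in 𝓝[Metric.ball 0 1] q₀, w q ∈ (chartAt E x₀).source :=
    ((hw q₀ hq₀).continuousWithinAt.mono hsub).preimage_mem_nhdsWithin
      ((chartAt E x₀).open_source.mem_nhds hx)
  have hTn : ∀ᶠ q in 𝓝[Metric.ball 0 1] q₀, T ∈ 𝓝 q := by
    have h2 : T ∈ 𝓝[Metric.ball 0 1] q₀ := nhdsWithin_mono _ hsub hT
    have h3 := eventually_mem_nhdsWithin_iff.2 h2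
    filter_upwards [h3, self_mem_nhdsWithin] with q hq hqb
    rwa [Metric.isOpen_ball.nhdsWithin_eq hqb] at hq
  refine ⟨c, c.2, ?_⟩
  filter_upwards [hsrc, hTn, self_mem_nhdsWithin] with q hq hqT hqb
  exact ⟨hq, hw.contMDiffAt (Filter.mem_of_superset (Metric.isOpen_ball.mem_nhds hqb) hsub),
    norm_fderiv_le_of_lipschitzOn ℝ hqT hlip⟩

end Bounds

/-! ### Asymptotics on the ends -/

section Asymptotics

variable {E : Type*} [NormedAddCommGroup E] [NormedSpace ℝ E]
variable {M : Type} [TopologicalSpace M] [ChartedSpace E M] [IsManifold 𝓘(ℝ, E) ∞ M]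
variable {Ω : SymplecticForm E M} {C : CylindricalEnds} {R₁ R₂ : Fin 3 → ℝ} {ρ : Fin 3 → ℝ → ℝ}
  {H : Fin 3 → ℝ → M → ℝ}
  {J₀ : ∀ x : M, TangentSpace 𝓘(ℝ, E) x →L[ℝ] TangentSpace 𝓘(ℝ, E) x}
  {J : Fin 3 → ℝ → ℝ → ∀ x : M, TangentSpace 𝓘(ℝ, E) x →L[ℝ] TangentSpace 𝓘(ℝ, E) x}
  {Jt : ℂ → ∀ x : M, (ℂ × TangentSpace 𝓘(ℝ, E) x) →L[ℝ] (ℂ × TangentSpace 𝓘(ℝ, E) x)}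
  {z : Fin 3 → ℝ → M} {u : ℂ → M}

theorem energyDensity_nonneg (hρ : ∀ i, IsCutOff (R₁ i) (R₂ i) (ρ i))
    (hJ : ∀ i, IsACSPath Ω J₀ (J i)) (i : Fin 3) (s t : ℝ) :
    0 ≤ energyDensity Ω C ρ J u i s t :=
  ((hJ i).compatible _ ((hρ i).mem_Icc s) t).nonneg (u (C.point i s t)) _

theorem CylindricalEnds.endDeriv_add_one (i : Fin 3) {s : ℝ} (hs : 0 < s) (t : ℝ) :
    C.endDeriv i s (t + 1) = C.endDeriv i s t := by
  have h1 : endCoord i (s, t + 1) = endCoord i (s, t) + Complex.I := by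
    simp only [endCoord]; push_cast; ring
  rw [endDeriv, endDeriv, h1, ← deriv_comp_add_const]
  refine Filter.EventuallyEq.deriv_eq ?_
  have h2 : 0 < depth i (endCoord i (s, t)) := by rwa [depth_endCoord]
  filter_upwards [(isOpen_depth_pos i).mem_nhds h2] with y hy
  have := C.chart_add_int i hy 1
  rwa [Int.cast_one, one_mul] at this

theorem energyDensity_add_one (hρ : ∀ i, IsCutOff (R₁ i) (R₂ i) (ρ i))
    (hJ : ∀ i, IsACSPath Ω J₀ (J i)) (i : Fin 3) {s : ℝ} (hs : 0 < s) (t : ℝ) :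
    energyDensity Ω C ρ J u i s (t + 1) = energyDensity Ω C ρ J u i s t := by
  let F : ℝ → ℂ → ℂ → ℝ := fun t p a => (Ω.form (u p) : E →L[ℝ] E →L[ℝ] ℝ) (planeDeriv E u p a)
    ((J i (ρ i s) t (u p) : E →L[ℝ] E) (planeDeriv E u p a))
  have h1 : ∀ t, energyDensity Ω C ρ J u i s t = F t (C.point i s t) (C.endDeriv i s t) :=
    fun t => rfl
  have h2 : ∀ p a, F (t + 1) p a = F t p a := fun p a => by
    simp only [F]
    rw [(hJ i).periodic _ ((hρ i).mem_Icc s)]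
  rw [h1, h1, C.endDeriv_add_one i hs, C.point_eq_of_add_one i hs rfl, h2]

variable (Ω C ρ J u) in
/-- The loops at distance `s` from the boundaries of the ends have small energy. -/
def IsLowEnergy (s : ℝ) : Prop :=
  ∀ i, IntervalIntegrable (energyDensity Ω C ρ J u i s) volume 0 1 ∧
    ∫ t in (0 : ℝ)..1, energyDensity Ω C ρ J u i s t ≤ 1

/-- If all deep levels failed, the sum of the three loop energies would be at least `1` at almost
every large depth, so a positive constant would be integrable on a half line. Summing over the ends
provides levels that work for all of them at once. -/
theorem HasFiniteEnergy.frequently (h : HasFiniteEnergy Ω C ρ J u) :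
    ∃ᶠ s in atTop, IsLowEnergy Ω C ρ J u s := by
  have hint : ∀ i, Integrable (fun p : ℝ × ℝ => energyDensity Ω C ρ J u i p.1 p.2)
      ((volume.restrict (Ioi 0)).prod (volume.restrict (Ioc 0 1))) := fun i => by
    have := h i
    rwa [IntegrableOn, Measure.volume_eq_prod, ← Measure.prod_restrict] at this
  have hae : ∀ᵐ s ∂(volume.restrict (Ioi (0 : ℝ))), ∀ i,
      Integrable (energyDensity Ω C ρ J u i s) (volume.restrict (Ioc 0 1)) :=
    ae_all_iff.2 fun i => (hint i).prod_right_ae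
  have hsum : Integrable (fun s => ∑ i, |∫ t in Ioc (0 : ℝ) 1, energyDensity Ω C ρ J u i s t|)
      (volume.restrict (Ioi 0)) :=
    integrable_finsetSum _ fun i _ => (hint i).integral_prod_left.abs
  intro hnot
  obtain ⟨s₀, hs₀⟩ := eventually_atTop.1 hnot
  have hsub : Ioi (max s₀ 0) ⊆ Ioi (0 : ℝ) := Ioi_subset_Ioi (le_max_right _ _)
  have hone : IntegrableOn (fun _ : ℝ => (1 : ℝ)) (Ioi (max s₀ 0)) := by
    refine Integrable.mono' (hsum.mono_measure (Measure.restrict_mono hsub le_rfl))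
      aestronglyMeasurable_const ?_
    filter_upwards [ae_restrict_of_ae_restrict_of_subset hsub hae,
      ae_restrict_mem measurableSet_Ioi] with s hs hs'
    rw [norm_one]
    by_contra! hlt
    refine hs₀ s ((le_max_left _ _).trans hs'.le) fun i => ?_
    refine ⟨(intervalIntegrable_iff_integrableOn_Ioc_of_le zero_le_one).2 (hs i), ?_⟩
    rw [intervalIntegral.integral_of_le zero_le_one]
    exact (le_abs_self _).trans ((Finset.single_le_sum (f := fun i =>
      |∫ t in Ioc (0 : ℝ) 1, energyDensity Ω C ρ J u i s t|) (fun i _ => abs_nonneg _)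
      (Finset.mem_univ i)).trans hlt.le)
  rw [integrableOn_const_iff] at hone
  simp at hone

/-- The energy along an arc of a loop. -/
theorem IsLowEnergy.integral_le (hρ : ∀ i, IsCutOff (R₁ i) (R₂ i) (ρ i))
    (hJ : ∀ i, IsACSPath Ω J₀ (J i)) {s : ℝ} (h : IsLowEnergy Ω C ρ J u s) (hs : 0 < s) (i : Fin 3)
    {o κ A B : ℝ} (hκ : 0 < κ) (hκ1 : κ ≤ 1) (hA : 0 ≤ A) (hAB : A ≤ B) (hB : B ≤ 1) :
    IntervalIntegrable (fun t => energyDensity Ω C ρ J u i s (o + κ * t)) volume A B ∧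
      ∫ t in A..B, energyDensity Ω C ρ J u i s (o + κ * t) ≤ κ⁻¹ := by
  have hper : Function.Periodic (energyDensity Ω C ρ J u i s) 1 :=
    fun t => energyDensity_add_one hρ hJ i hs t
  have hi : ∀ a b, IntervalIntegrable (energyDensity Ω C ρ J u i s) volume a b := fun a b =>
    hper.intervalIntegrable₀ one_ne_zero (h i).1 a b
  constructor
  · have h1 := ((hi (κ * A + o) (κ * B + o)).comp_add_right o).comp_mul_left (c := κ)
    simp only [add_sub_cancel_right, mul_div_cancel_left₀ _ hκ.ne'] at h1
    simpa only [add_comm o] using h1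
  · rw [intervalIntegral.integral_comp_add_mul _ hκ.ne', smul_eq_mul]
    refine mul_le_of_le_one_right (inv_pos.2 hκ).le ?_
    have h1 : o ≤ o + κ * A := by nlinarith
    have h2 : o + κ * A ≤ o + κ * B := by nlinarith
    have h3 : o + κ * B ≤ o + 1 := by nlinarith
    refine (intervalIntegral.integral_mono_interval h1 h2 h3 (Eventually.of_forall fun t =>
      energyDensity_nonneg hρ hJ i s t) (hi _ _)).trans ?_
    have h4 := hper.intervalIntegral_add_eq o 0
    rw [zero_add] at h4
    rw [h4]
    exact (h i).2

/-- The derivative of a section along the loops of an end. -/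
theorem deriv_chart_comp_point {x₀ : M} (i : Fin 3) {s : ℝ} (hs : 0 < s) (o κ t : ℝ)
    (hu : MDifferentiableAt 𝓘(ℝ, ℂ) 𝓘(ℝ, E) u (C.point i s (o + κ * t)))
    (hx : u (C.point i s (o + κ * t)) ∈ (chartAt E x₀).source) :
    deriv (chartAt E x₀ ∘ fun t => u (C.point i s (o + κ * t))) t =
      κ • chartDeriv E x₀ (u (C.point i s (o + κ * t)))
        (planeDeriv E u (C.point i s (o + κ * t)) (Complex.I * C.endDeriv i s (o + κ * t))) := by
  have h1 : HasDerivAt (fun t => o + κ * t) κ t := by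
    simpa using ((hasDerivAt_id t).const_mul κ).const_add o
  have h2 : HasDerivAt (fun t => C.point i s (o + κ * t))
      (κ • (Complex.I * C.endDeriv i s (o + κ * t))) t :=
    HasDerivAt.scomp (g₁ := fun t => C.point i s t) t (C.hasDerivAt_point_snd i hs (o + κ * t)) h1
  have h3 : DifferentiableAt ℝ (chartAt E x₀ ∘ u) (C.point i s (o + κ * t)) :=
    (((contMDiffAt_chartAt_two hx).mdifferentiableAt (by simp)).comp _ hu).differentiableAt
  have h4 := (h3.hasFDerivAt.comp_hasDerivAt t h2).deriv
  rw [map_smul, fderiv_chartAt_comp hx hu] at h4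
  exact h4

variable [FiniteDimensional ℝ E]

/-- The line integrals along the loops of an end converge to those along the asymptotic orbit. -/
theorem IsHolomorphicSection.tendsto_lineInt (hρ : ∀ i, IsCutOff (R₁ i) (R₂ i) (ρ i))
    (hH : ∀ i, IsPeriodicHamiltonian E (H i)) (hJ : ∀ i, IsACSPath Ω J₀ (J i))
    (hJt : IsHCompatible Ω C R₁ ρ H J₀ J Jt) (hu : IsHolomorphicSection Jt u)
    (hz : IsAsymptotic C z u) (i : Fin 3) (hzi : ContMDiff 𝓘(ℝ, ℝ) 𝓘(ℝ, E) ∞ (z i))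
    {ℓ : Filter ℝ} (hℓ : ℓ ≤ atTop) (hlow : ∀ᶠ s in ℓ, IsLowEnergy Ω C ρ J u s)
    {lam : M → E →L[ℝ] ℝ} {V : Set M} (h : IsChartPotential Ω lam V) (hV : IsOpen V)
    {o κ A B : ℝ} (hκ : 0 < κ) (hκ1 : κ ≤ 1) (hA : 0 ≤ A) (hAB : A ≤ B) (hB : B ≤ 1)
    (hzV : ∀ t ∈ Icc A B, z i (o + κ * t) ∈ V) :
    Tendsto (fun s => lineInt lam (fun t => u (C.point i s (o + κ * t))) A B) ℓ
      (𝓝 (lineInt lam (fun t => z i (o + κ * t)) A B)) := by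
  have haff : ContDiff ℝ ∞ fun t : ℝ => o + κ * t := contDiff_const.add (contDiff_const.mul contDiff_id)
  have hpos : ∀ᶠ s in ℓ, 0 < s := hℓ (eventually_gt_atTop 0)
  have hlim : ∀ t, Tendsto (fun p : ℝ × ℝ => u (C.point i p.1 (o + κ * p.2))) (ℓ ×ˢ 𝓝 t)
      (𝓝 (z i (o + κ * t))) := fun t =>
    (hz i (o + κ * t)).comp (((tendsto_id.mono_left hℓ).comp tendsto_fst).prodMk
      ((haff.continuous.tendsto t).comp tendsto_snd))
  refine h.tendsto_lineInt hV hAB ?_ (fun t _ => ?_) (fun t _ => hlim t) hzV fun x₀ hx₀ => ?_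
  · filter_upwards [hpos] with s hs t _
    refine ContMDiffAt.comp (g := u) t ((hu.mdifferentiableAt_point i hs _).of_le (by norm_cast)) ?_
    exact (((C.contDiff_point i hs).comp haff).of_le (by norm_cast)).contMDiff.contMDiffAt
  · exact (ContMDiffAt.comp (g := z i) t hzi.contMDiffAt haff.contMDiff.contMDiffAt).of_le
      (by norm_cast)
  -- In a chart the speed of a deep loop is at most a constant times one plus the energy density,
  -- since the cut-off is `1` there and the velocity is `J ∂_τ u + X_H`.
  obtain ⟨c, hc⟩ := exists_forall_bound (ℓ := ℓ) (K := Icc A B) isCompact_Icc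
    (g := fun p : ℝ × ℝ => ‖deriv (chartAt E x₀ ∘ fun t => u (C.point i p.1 (o + κ * t))) p.2‖)
    (b := fun p => 1 + energyDensity Ω C ρ J u i p.1 (o + κ * p.2))
    (fun p => add_nonneg zero_le_one (energyDensity_nonneg hρ hJ i _ _)) (by
      intro t ht
      obtain ⟨c, hc⟩ := exists_velocity_bound (hJ i) (hH i) (hx₀ t ht) (o + κ * t)
      refine ⟨c, ?_⟩
      have h1 : Tendsto (fun p : ℝ × ℝ => (o + κ * p.2, u (C.point i p.1 (o + κ * p.2))))
          (ℓ ×ˢ 𝓝 t) (𝓝 (o + κ * t, z i (o + κ * t))) :=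
        Tendsto.prodMk_nhds ((haff.continuous.tendsto t).comp tendsto_snd) (hlim t)
      have h2 : ∀ᶠ p : ℝ × ℝ in ℓ ×ˢ 𝓝 t, 0 < p.1 ∧ R₂ i ≤ p.1 :=
        tendsto_fst.eventually (hpos.and (hℓ (eventually_ge_atTop (R₂ i))))
      filter_upwards [h1.eventually hc, h2, (hlim t).eventually
        ((chartAt E x₀).open_source.mem_nhds (hx₀ t ht))] with p hp hp2 hp3
      have h3 := hp (planeDeriv E u (C.point i p.1 (o + κ * p.2)) (C.endDeriv i p.1 (o + κ * p.2)))
      have h4 := hu.eq_on_end hJt i hp2.1 (o + κ * p.2)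
      have h5 : energyDensity Ω C ρ J u i p.1 (o + κ * p.2) =
        (Ω.form (u (C.point i p.1 (o + κ * p.2))) : E →L[ℝ] E →L[ℝ] ℝ)
          (planeDeriv E u (C.point i p.1 (o + κ * p.2)) (C.endDeriv i p.1 (o + κ * p.2)))
          ((J i (ρ i p.1) (o + κ * p.2) (u (C.point i p.1 (o + κ * p.2))) : E →L[ℝ] E)
            (planeDeriv E u (C.point i p.1 (o + κ * p.2)) (C.endDeriv i p.1 (o + κ * p.2)))) := rfl
      rw [(hρ i).eq_one _ hp2.2] at h4 h5
      rw [one_smul] at h4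
      rw [deriv_chart_comp_point i hp2.1 o κ p.2
        ((hu.mdifferentiableAt_point i hp2.1 _).mdifferentiableAt (by simp)) hp3, norm_smul,
        Real.norm_of_nonneg hκ.le, h5, h4]
      exact (mul_le_of_le_one_left (norm_nonneg _) hκ1).trans h3)
  -- The lengths are bounded since the loop energies are at most `1`; the factor `κ⁻¹` comes from
  -- the slower parametrization.
  refine ⟨max c 0 * (1 + κ⁻¹), ?_⟩
  have hsrc : ∀ᶠ s in ℓ, ∀ t ∈ Icc A B, u (C.point i s (o + κ * t)) ∈ (chartAt E x₀).source :=
    eventually_forall_of_tendsto isCompact_Icc (g := fun p : ℝ × ℝ => u (C.point i p.1 (o + κ * p.2)))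
      fun t ht => (hlim t).eventually ((chartAt E x₀).open_source.mem_nhds (hx₀ t ht))
  filter_upwards [hc, hpos, hlow, hsrc] with s hs hs0 hsl hss
  obtain ⟨hi, hle⟩ := hsl.integral_le (o := o) hρ hJ hs0 i hκ hκ1 hA hAB hB
  have hi' : IntervalIntegrable (fun t => 1 + energyDensity Ω C ρ J u i s (o + κ * t)) volume A B :=
    intervalIntegrable_const.add hi
  have hder : ContinuousOn (deriv (chartAt E x₀ ∘ fun t => u (C.point i s (o + κ * t)))) (Icc A B) := by
    refine continuousOn_deriv_of_contDiffAt fun t ht => ?_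
    refine ContMDiffAt.chartAt_comp (by norm_cast) ?_ (hss t ht)
    refine ContMDiffAt.comp (g := u) t ((hu.mdifferentiableAt_point i hs0 _).of_le (by norm_cast)) ?_
    exact (((C.contDiff_point i hs0).comp haff).of_le (by norm_cast)).contMDiff.contMDiffAt
  calc ∫ t in A..B, ‖deriv (chartAt E x₀ ∘ fun t => u (C.point i s (o + κ * t))) t‖
      ≤ ∫ t in A..B, max c 0 * (1 + energyDensity Ω C ρ J u i s (o + κ * t)) := by
        refine intervalIntegral.integral_mono_on hAB (hder.norm.intervalIntegrable_of_Icc hAB)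
          (hi'.const_mul _) fun t ht => (hs t ht).trans ?_
        exact mul_le_mul_of_nonneg_right (le_max_left _ _)
          (add_nonneg zero_le_one (energyDensity_nonneg hρ hJ i _ _))
    _ = max c 0 * ((B - A) + ∫ t in A..B, energyDensity Ω C ρ J u i s (o + κ * t)) := by
        rw [intervalIntegral.integral_const_mul, intervalIntegral.integral_add intervalIntegrable_const hi]
        simp
    _ ≤ max c 0 * (1 + κ⁻¹) :=
        mul_le_mul_of_nonneg_left (add_le_add (by linarith) hle) (le_max_right _ _)

/-- The line integrals along the circles of a disc converge to those along its boundary. -/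
theorem tendsto_lineInt_disc {w : ℂ → M}
    (hw : ContMDiffOn 𝓘(ℝ, ℂ) 𝓘(ℝ, E) ∞ w (Metric.closedBall 0 1)) {ζ : ℝ → M}
    (hζ : ContMDiff 𝓘(ℝ, ℝ) 𝓘(ℝ, E) ∞ ζ)
    (hwζ : ∀ t : ℝ, w (Complex.exp (2 * Real.pi * t * Complex.I)) = ζ t)
    {lam : M → E →L[ℝ] ℝ} {V : Set M} (h : IsChartPotential Ω lam V) (hV : IsOpen V)
    {o κ A B : ℝ} (hAB : A ≤ B) (hzV : ∀ t ∈ Icc A B, ζ (o + κ * t) ∈ V) :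
    Tendsto (fun r => lineInt lam (fun t => polarDisc w (fun t => o + κ * t) r (0, t)) A B) (𝓝[<] 1)
      (𝓝 (lineInt lam (fun t => ζ (o + κ * t)) A B)) := by
  have haff : ContDiff ℝ ∞ fun t : ℝ => o + κ * t := contDiff_const.add (contDiff_const.mul contDiff_id)
  let N : ℝ × ℝ → ℂ := fun p => p.1 * Complex.exp (2 * Real.pi * ((o + κ * p.2 : ℝ) : ℂ) * Complex.I)
  have hN : Continuous N := by fun_prop
  have hr : ∀ᶠ r : ℝ in 𝓝[<] 1, 0 < r ∧ r < 1 :=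
    (eventually_nhdsWithin_of_eventually_nhds (eventually_gt_nhds one_pos)).and self_mem_nhdsWithin
  have hexp : ∀ a : ℝ, ‖Complex.exp (2 * Real.pi * (a : ℂ) * Complex.I)‖ = 1 := fun a => by
    have := Complex.norm_exp_ofReal_mul_I (2 * Real.pi * a)
    push_cast at this
    exact this
  have hnorm : ∀ p : ℝ × ℝ, ‖N p‖ = |p.1| := fun p => by
    simp only [N]
    rw [norm_mul, hexp, mul_one, Complex.norm_real, Real.norm_eq_abs]
  have hpath : ∀ r t, polarDisc w (fun t => o + κ * t) r (0, t) = w (N (r, t)) := fun r t => by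
    simp [polarDisc, N]
  have hN1 : ∀ t, N (1, t) = Complex.exp (2 * Real.pi * ((o + κ * t : ℝ) : ℂ) * Complex.I) := fun t => by
    simp [N]
  have hwN : ∀ t, w (N (1, t)) = ζ (o + κ * t) := fun t => by rw [hN1, hwζ]
  have hNball : ∀ t, Tendsto N (𝓝[<] (1 : ℝ) ×ˢ 𝓝 t) (𝓝[Metric.ball 0 1] (N (1, t))) := fun t => by
    refine tendsto_nhdsWithin_iff.2 ⟨(hN.tendsto (1, t)).mono_left ?_, ?_⟩
    · rw [nhds_prod_eq]
      exact Filter.prod_mono_left _ nhdsWithin_le_nhds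
    · filter_upwards [tendsto_fst.eventually hr] with p hp
      rw [mem_ball_zero_iff, hnorm, abs_of_pos hp.1]
      exact hp.2
  have hmem : ∀ t, N (1, t) ∈ Metric.closedBall (0 : ℂ) 1 := fun t => by
    rw [mem_closedBall_zero_iff, hnorm, abs_one]
  have hP : ∀ᶠ r in 𝓝[<] (1 : ℝ), ∀ t, ContMDiffAt 𝓘(ℝ, ℝ) 𝓘(ℝ, E) 1
      (fun t => polarDisc w (fun t => o + κ * t) r (0, t)) t := by
    filter_upwards [hr] with r hr t
    refine contMDiffAt_vertical ((contMDiffAt_polarDisc hw haff ?_).of_le (by norm_cast))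
    rw [sub_zero, one_mul, abs_of_pos hr.1]
    exact hr.2
  refine h.tendsto_lineInt hV hAB (hP.mono fun r hr t _ => hr t) (fun t _ => ?_) (fun t _ => ?_) hzV
    fun x₀ hx₀ => ?_
  · exact (ContMDiffAt.comp (g := ζ) t hζ.contMDiffAt haff.contMDiff.contMDiffAt).of_le
      (by norm_cast)
  · simp only [hpath, ← hwN]
    exact ((hw _ (hmem t)).continuousWithinAt.mono Metric.ball_subset_closedBall).tendsto.comp (hNball t)
  obtain ⟨c, hc⟩ := exists_forall_bound (ℓ := 𝓝[<] (1 : ℝ)) (K := Icc A B) isCompact_Icc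
    (g := fun p : ℝ × ℝ => ‖deriv (chartAt E x₀ ∘ fun t => polarDisc w (fun t => o + κ * t) p.1 (0, t)) p.2‖)
    (b := fun _ => 1) (fun p => zero_le_one) (by
      intro t ht
      obtain ⟨c, hc0, hc⟩ := exists_bound_disc hw (hmem t) (x₀ := x₀) (by rw [hwN]; exact hx₀ t ht)
      -- This is the bound for the differential of the disc times the speed of the circle at radius
      -- at most `1`.
      refine ⟨c * (2 * Real.pi * |κ|), ?_⟩
      filter_upwards [(hNball t).eventually hc, tendsto_fst.eventually hr] with p hp hp1
      simp only [hpath, mul_one]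
      have h1 : HasDerivAt (fun t : ℝ => ((o + κ * t : ℝ) : ℂ)) (κ : ℂ) p.2 := by
        have : HasDerivAt (fun t => o + κ * t) κ p.2 := by
          simpa using ((hasDerivAt_id p.2).const_mul κ).const_add o
        exact this.ofReal_comp
      have h2 : HasDerivAt (fun t => N (p.1, t)) (N p * (2 * Real.pi * κ * Complex.I)) p.2 := by
        have := (((h1.const_mul (2 * Real.pi : ℂ)).mul_const Complex.I).cexp).const_mul (p.1 : ℂ)
        rw [← mul_assoc] at this
        exact this
      have h3 : DifferentiableAt ℝ (chartAt E x₀ ∘ w) (N p) :=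
        (((contMDiffAt_chartAt_two hp.1).mdifferentiableAt (by simp)).comp _
          (hp.2.1.mdifferentiableAt (by simp))).differentiableAt
      have h4 := (h3.hasFDerivAt.comp_hasDerivAt p.2 h2).deriv
      change ‖deriv ((chartAt E x₀ ∘ w) ∘ fun t => N (p.1, t)) p.2‖ ≤ _
      rw [h4]
      refine ((fderiv ℝ (chartAt E x₀ ∘ w) (N p)).le_opNorm _).trans
        (mul_le_mul hp.2.2 ?_ (norm_nonneg _) hc0)
      rw [norm_mul, hnorm, abs_of_pos hp1.1]
      have h5 : ‖(2 * Real.pi * κ * Complex.I : ℂ)‖ = 2 * Real.pi * |κ| := by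
        simp [abs_of_pos Real.pi_pos]
      rw [h5]
      exact mul_le_of_le_one_left (by positivity) hp1.2.le)
  refine ⟨c * (B - A), ?_⟩
  have hsrc : ∀ᶠ r in 𝓝[<] (1 : ℝ), ∀ t ∈ Icc A B,
      polarDisc w (fun t => o + κ * t) r (0, t) ∈ (chartAt E x₀).source :=
    eventually_forall_of_tendsto isCompact_Icc
      (g := fun p : ℝ × ℝ => polarDisc w (fun t => o + κ * t) p.1 (0, p.2)) fun t ht => by
        obtain ⟨c, -, hc⟩ := exists_bound_disc hw (hmem t) (x₀ := x₀) (by rw [hwN]; exact hx₀ t ht)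
        filter_upwards [(hNball t).eventually hc] with p hp
        rw [hpath]
        exact hp.1
  filter_upwards [hc, hP, hsrc] with r hrc hrP hrs
  have hder : ContinuousOn (deriv (chartAt E x₀ ∘
      fun t => polarDisc w (fun t => o + κ * t) r (0, t))) (Icc A B) :=
    continuousOn_deriv_of_contDiffAt fun t ht =>
      ContMDiffAt.chartAt_comp (by norm_cast) (hrP t) (hrs t ht)
  calc ∫ t in A..B, ‖deriv (chartAt E x₀ ∘ fun t => polarDisc w (fun t => o + κ * t) r (0, t)) t‖
      ≤ ∫ t in A..B, c := by
        refine intervalIntegral.integral_mono_on hAB (hder.norm.intervalIntegrable_of_Icc hAB)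
          intervalIntegrable_const fun t ht => ?_
        have := hrc t ht
        rwa [mul_one] at this
    _ = c * (B - A) := by rw [intervalIntegral.integral_const, smul_eq_mul, mul_comm]

/-- The integrals of a Hamiltonian along the loops of an end converge. -/
theorem IsHolomorphicSection.tendsto_integral_ham (hH : ∀ i, IsPeriodicHamiltonian E (H i))
    (hu : IsHolomorphicSection Jt u) (hz : IsAsymptotic C z u) (i : Fin 3)
    (hzi : Continuous (z i)) :
    Tendsto (fun s => ∫ t in (0 : ℝ)..1, H i t (u (C.point i s t))) atTop
      (𝓝 (∫ t in (0 : ℝ)..1, H i t (z i t))) := by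
  have hHc : Continuous fun p : ℝ × M => H i p.1 p.2 := (hH i).smooth.continuous
  have hzc : Continuous fun t => H i t (z i t) := hHc.comp (continuous_id.prodMk hzi)
  rw [Metric.tendsto_nhds]
  intro ε hε
  have hunif : ∀ᶠ s in atTop, ∀ t ∈ Icc (0 : ℝ) 1, |H i t (u (C.point i s t)) - H i t (z i t)| < ε / 2 := by
    refine eventually_forall_of_tendsto isCompact_Icc
      (g := fun p : ℝ × ℝ => |H i p.2 (u (C.point i p.1 p.2)) - H i p.2 (z i p.2)|)
      (s := Iio (ε / 2)) fun t _ => ?_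
    have h1 : Tendsto (fun p : ℝ × ℝ => H i p.2 (u (C.point i p.1 p.2))) (atTop ×ˢ 𝓝 t)
        (𝓝 (H i t (z i t))) :=
      (hHc.tendsto (t, z i t)).comp (Tendsto.prodMk_nhds tendsto_snd (hz i t))
    have h2 := (h1.sub ((hzc.tendsto t).comp tendsto_snd)).abs
    rw [sub_self, abs_zero] at h2
    exact h2.eventually_lt_const (half_pos hε)
  filter_upwards [hunif, eventually_gt_atTop 0] with s hs hs0
  have hc : Continuous fun t => H i t (u (C.point i s t)) :=
    hHc.comp (continuous_id.prodMk (continuous_iff_continuousAt.2 fun t =>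
      ContinuousAt.comp (f := C.point i s) (hu.mdifferentiableAt_point i hs0 t).continuousAt
        (C.contDiff_point i hs0).continuous.continuousAt))
  rw [Real.dist_eq, ← intervalIntegral.integral_sub (hc.intervalIntegrable _ _)
    (hzc.intervalIntegrable _ _)]
  have := intervalIntegral.norm_integral_le_of_norm_le_const (a := 0) (b := 1) (C := ε / 2)
    (f := fun t => H i t (u (C.point i s t)) - H i t (z i t)) fun t ht => by
      rw [uIoc_of_le zero_le_one] at ht
      exact (hs t (Ioc_subset_Icc_self ht)).le
  rw [Real.norm_eq_abs] at this
  refine this.trans_lt ?_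
  norm_num
  linarith

end Asymptotics

/-! ### Necks and caps -/

section Caps

variable {E : Type*} [NormedAddCommGroup E] [NormedSpace ℝ E]
variable {M : Type} [TopologicalSpace M] [ChartedSpace E M] [IsManifold 𝓘(ℝ, E) ∞ M]
variable {Ω : SymplecticForm E M} {C : CylindricalEnds}

/-! ### The limit of the contribution of a neck. -/

section Strip

variable {ι α : Type*} {V : ι → Set M} {pot : ι → M → E →L[ℝ] ℝ} {f : M → M → M → ℝ}
  {I : ι → M → M → ℝ} {ℓ : Filter α}

/-- The difference is that of a function `g`, continuous at `x`, between two points that both tend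
to `x`. Thus the index at the end of an arc can be replaced by one that depends only on the limit
point. -/
theorem LocalPotentials.tendsto_sub (h : LocalPotentials Ω V pot f I) {v v' : ι} {x : M}
    (hv : x ∈ V v) (hv' : x ∈ V v') {P Q : α → M} (hP : Tendsto P ℓ (𝓝 x))
    (hQ : Tendsto Q ℓ (𝓝 x)) :
    Tendsto (fun a => I v (P a) (Q a) - I v' (P a) (Q a)) ℓ (𝓝 0) := by
  obtain ⟨g, hg, hI⟩ := h.exists_primitive v v'
  have hx : V v ∩ V v' ∈ 𝓝 x := ((h.isOpen v).inter (h.isOpen v')).mem_nhds ⟨hv, hv'⟩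
  have hgc : Tendsto g (𝓝 x) (𝓝 (g x)) := (hg x ⟨hv, hv'⟩).continuousAt
  have h1 := (hgc.comp hQ).sub (hgc.comp hP)
  rw [sub_self] at h1
  refine h1.congr' ?_
  filter_upwards [hP hx, hQ hx] with a ha hb
  exact (hI _ ha _ hb).symm

/-- The contribution of a neck whose sides converge to the same path. -/
theorem LocalPotentials.tendsto_stripValue (h : LocalPotentials Ω V pot f I) {U W : α → ℝ → M}
    {z : ℝ → M} {v : ℕ → ι} {m : ℕ} (hm : m ≠ 0) {b : M → ι} (hb : ∀ x, x ∈ V (b x))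
    (hv : ∀ J < m, ∀ t ∈ Icc (unif m J) (unif m (J + 1)), z t ∈ V (v J))
    (hUi : ∀ J < m, Tendsto (fun a => lineInt (pot (v J)) (U a) (unif m J) (unif m (J + 1))) ℓ
      (𝓝 (lineInt (pot (v J)) z (unif m J) (unif m (J + 1)))))
    (hWi : ∀ J < m, Tendsto (fun a => lineInt (pot (v J)) (W a) (unif m J) (unif m (J + 1))) ℓ
      (𝓝 (lineInt (pot (v J)) z (unif m J) (unif m (J + 1)))))
    (hU : ∀ t, Tendsto (fun a => U a t) ℓ (𝓝 (z t))) (hW : ∀ t, Tendsto (fun a => W a t) ℓ (𝓝 (z t))) :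
    Tendsto (fun a => stripValue pot I v m (U a) (W a)
      - (I (b (z 0)) (U a 0) (W a 0) - I (b (z 1)) (U a 1) (W a 1))) ℓ (𝓝 0) := by
  have h0 : unif m 0 = 0 := by simp [unif]
  have h1 : unif m m = 1 := by simp [unif, hm]
  have hterm : ∀ J ∈ Finset.range m, Tendsto (fun a =>
      (lineInt (pot (v J)) (W a) (unif m J) (unif m (J + 1))
        - lineInt (pot (v J)) (U a) (unif m J) (unif m (J + 1)))
      + ((I (v J) (U a (unif m J)) (W a (unif m J))
          - I (b (z (unif m J))) (U a (unif m J)) (W a (unif m J)))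
        - (I (v J) (U a (unif m (J + 1))) (W a (unif m (J + 1)))
          - I (b (z (unif m (J + 1)))) (U a (unif m (J + 1))) (W a (unif m (J + 1)))))) ℓ (𝓝 0) := by
    intro J hJ
    rw [Finset.mem_range] at hJ
    have e1 := (hWi J hJ).sub (hUi J hJ)
    have e2 := h.tendsto_sub (hv J hJ _ (left_mem_Icc.2 (unif_le m J))) (hb _) (hU (unif m J))
      (hW (unif m J))
    have e3 := h.tendsto_sub (hv J hJ _ (right_mem_Icc.2 (unif_le m J))) (hb _) (hU (unif m (J + 1)))
      (hW (unif m (J + 1)))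
    simpa only [sub_self, add_zero] using e1.add (e2.sub e3)
  have hsum := tendsto_finsetSum _ hterm
  rw [Finset.sum_const_zero] at hsum
  refine hsum.congr fun a => ?_
  -- With the index `b` of the limit point, neighbouring arcs have the same transverse term at their
  -- common end, so only the ends of the strip survive.
  have htel := Finset.sum_range_sub' (fun J => I (b (z (unif m J))) (U a (unif m J)) (W a (unif m J))) m
  simp only [h0, h1] at htel
  rw [← htel, stripValue, ← Finset.sum_sub_distrib]
  refine Finset.sum_congr rfl fun J _ => ?_
  ring

end Strip

/-- Long necks are mapped into neighbourhoods of the asymptotic orbits. -/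
theorem IsCapping.eventually_neck_mem {w : Fin 3 → ℂ → M} {u : ℂ → M} {S : C(OnePoint ℂ, M)}
    (hS : IsCapping C w u S) (i : Fin 3) {ζ : ℝ → M}
    (hw : ∀ t : ℝ, w i (Complex.exp (2 * Real.pi * t * Complex.I)) = ζ t)
    {V : Set M} (hV : IsOpen V) {α : ℝ → ℝ} (hα : Continuous α) {A B : ℝ}
    (hζ : ∀ t ∈ Icc A B, ζ (α t) ∈ V) :
    ∀ᶠ x : ℝ × ℝ in atTop ×ˢ 𝓝[<] 1, ∀ p ∈ Icc (0 : ℝ) 1, ∀ t ∈ Icc A B,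
      S (C.point i ((1 - p) * (2 - 1 / x.1) + p * (2 / x.2)) (α t)) ∈ V := by
  have key := eventually_forall_of_tendsto (ℓ := (atTop : Filter ℝ) ×ˢ 𝓝[<] (1 : ℝ))
    (K := Icc (0 : ℝ) 1 ×ˢ Icc A B) (isCompact_Icc.prod isCompact_Icc)
    (g := fun q : (ℝ × ℝ) × (ℝ × ℝ) =>
      S (C.point i ((1 - q.2.1) * (2 - 1 / q.1.1) + q.2.1 * (2 / q.1.2)) (α q.2.2)))
    (s := V) (by
      rintro ⟨p, t⟩ ⟨hp, ht⟩
      have e1 : Tendsto (fun q : (ℝ × ℝ) × (ℝ × ℝ) => 1 / q.1.1)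
          (((atTop : Filter ℝ) ×ˢ 𝓝[<] (1 : ℝ)) ×ˢ 𝓝 (p, t)) (𝓝 0) := by
        simp only [one_div]
        exact tendsto_inv_atTop_zero.comp (tendsto_fst.comp tendsto_fst)
      have e2 : Tendsto (fun q : (ℝ × ℝ) × (ℝ × ℝ) => q.1.2)
          (((atTop : Filter ℝ) ×ˢ 𝓝[<] (1 : ℝ)) ×ˢ 𝓝 (p, t)) (𝓝 1) :=
        tendsto_nhds_of_tendsto_nhdsWithin (tendsto_snd.comp tendsto_fst)
      have e3 : Tendsto (fun q : (ℝ × ℝ) × (ℝ × ℝ) => q.2)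
          (((atTop : Filter ℝ) ×ˢ 𝓝[<] (1 : ℝ)) ×ˢ 𝓝 (p, t)) (𝓝 (p, t)) := tendsto_snd
      have e4 := (continuous_fst.tendsto (p, t)).comp e3
      have e5 := ((hα.comp continuous_snd).tendsto (p, t)).comp e3
      have e6 := ((e4.const_sub 1).mul (e1.const_sub 2)).add
        (e4.mul ((tendsto_const_nhds (x := (2 : ℝ))).div e2 one_ne_zero))
      -- In the limit the entire neck sits at depth `2`, where the sphere is the boundary of the
      -- cap, that is, the orbit.
      have e7 : (1 - p) * (2 - 0) + p * (2 / 1) = (2 : ℝ) := by ring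
      rw [e7] at e6
      have e8 := (C.continuousAt_point i two_pos (α t)).tendsto.comp (e6.prodMk_nhds e5)
      have e9 := ((S.continuous.comp OnePoint.continuous_coe).tendsto (C.point i 2 (α t))).comp e8
      have e10 : S (C.point i 2 (α t)) = ζ (α t) := by
        rw [hS.cap i 2 (α t) le_rfl, ← hw, Complex.ofReal_ofNat, div_self (two_ne_zero' ℂ), one_mul]
      refine e9.eventually (hV.mem_nhds ?_)
      simp only [Function.comp_apply]
      rw [e10]
      exact hζ t ht)
  exact key.mono fun x hx p hp t ht => hx (p, t) ⟨hp, ht⟩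

/-- The area of a sector of a disc, in terms of its boundary angles. -/
theorem exists_rectArea_polarDisc (Ω : SymplecticForm E M) {w : ℂ → M}
    (hw : ContMDiffOn 𝓘(ℝ, ℂ) 𝓘(ℝ, E) ∞ w (Metric.closedBall 0 1)) {r : ℝ} (hr : 0 < r) (hr1 : r < 1) :
    ∃ Φ : ℝ → ℝ, (∀ o κ, rectArea Ω (polarDisc w (fun t => o + κ * t) r) 0 1 0 1 = Φ o - Φ (o + κ)) ∧
      ∀ t, Φ (t + 1) = Φ t + ∫ q in Metric.ball 0 r, mapDensity Ω w q := by
  have hwb : ∀ q ∈ Metric.ball (0 : ℂ) 1, ContMDiffAt 𝓘(ℝ, ℂ) 𝓘(ℝ, E) ∞ w q := fun q hq =>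
    hw.contMDiffAt (Filter.mem_of_superset (Metric.isOpen_ball.mem_nhds hq) Metric.ball_subset_closedBall)
  have hrb : Metric.closedBall (0 : ℂ) r ⊆ Metric.ball 0 1 := Metric.closedBall_subset_ball hr1
  -- Truncation extends the density from the disc of radius `r` to the plane, where it has a
  -- primitive.
  obtain ⟨W, -, hW, -, -, hWD, -, -⟩ := exists_truncation Metric.isOpen_ball
    (fun q hq => (contDiffAt_mapDensity Ω (hwb q hq)).contDiffWithinAt) (isCompact_closedBall 0 r) hrb
  obtain ⟨η, hη⟩ := exists_isPrimitiveOn_plane hW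
  have hexp : ∀ a : ℝ, ‖Complex.exp (2 * Real.pi * (a : ℂ) * Complex.I)‖ = 1 := fun a => by
    have := Complex.norm_exp_ofReal_mul_I (2 * Real.pi * a)
    push_cast at this
    exact this
  let c : ℝ → ℂ := fun t => r * Complex.exp (2 * Real.pi * t * Complex.I)
  have hofReal : ContDiff ℝ 2 ((↑) : ℝ → ℂ) := Complex.ofRealCLM.contDiff
  have hc : ContDiff ℝ 2 c :=
    contDiff_const.mul ((contDiff_const.mul hofReal).mul contDiff_const).cexp
  have hcper : ∀ t, c (t + 1) = c t := fun t => by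
    have := exp_two_pi_add_int t 1
    rw [Int.cast_one] at this
    simp only [c, this]
  have hcirc : pathInt η c 0 1 = ∫ q in Metric.ball 0 r, mapDensity Ω w q := by
    have e1 := pathInt_periodic η hcper (-(1 / 2))
    have hc' : Differentiable ℝ fun θ : ℝ => (r : ℂ) * Complex.exp (θ * Complex.I) :=
      (contDiff_const.mul (hofReal.mul contDiff_const).cexp).differentiable (by norm_num)
    have e2 := pathInt_comp_affine η hc' (2 * Real.pi) 0 (-(1 / 2)) (-(1 / 2) + 1)
    have e3 : (fun t : ℝ => (r : ℂ) * Complex.exp (((0 + 2 * Real.pi * t : ℝ) : ℂ) * Complex.I)) = c := by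
      funext t; simp [c]
    have e4 : 0 + 2 * Real.pi * (-(1 / 2)) = -Real.pi := by ring
    have e5 : 0 + 2 * Real.pi * (-(1 / 2) + 1) = Real.pi := by ring
    rw [e3, e4, e5, pathInt_circle hW.continuous hη hr] at e2
    rw [← e1, e2]
    exact setIntegral_congr_fun Metric.isOpen_ball.measurableSet fun q hq =>
      hWD q (Metric.ball_subset_closedBall hq)
  have hint : ∀ a b, IntervalIntegrable (fun t => η (c t) (deriv c t)) volume a b := fun a b =>
    (continuous_pathInt_integrand (fun y => (hη.1 y (mem_univ y)).continuousAt)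
      (hc.of_le (by norm_num))).intervalIntegrable a b
  let ray : ℝ → ℝ := fun t => pathInt η (fun a => ((1 - a : ℝ) : ℂ) * c t) 0 1
  -- By Green's theorem the area of a sector is given by its two rays and its arc. Collecting them
  -- by angle gives a function that increases by the area of the disc after a full turn.
  refine ⟨fun t => ray t + pathInt η c 0 t, fun o κ => ?_, fun t => ?_⟩
  · let N : ℝ × ℝ → ℂ := fun x => ((1 - x.1 : ℝ) : ℂ) * c (o + κ * x.2)
    have hN : ContDiff ℝ 2 N := (hofReal.comp (contDiff_const.sub contDiff_fst)).mul
      (hc.comp (contDiff_const.add (contDiff_const.mul contDiff_snd)))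
    have hpolar : polarDisc w (fun t => o + κ * t) r = fun x => w (N x) := by
      funext x
      simp only [polarDisc, N, c]
      congr 1
      push_cast
      ring
    have hNr : ∀ x ∈ Icc (0 : ℝ) 1 ×ˢ Icc (0 : ℝ) 1, N x ∈ Metric.closedBall (0 : ℂ) r := by
      rintro x ⟨hx, -⟩
      rw [mem_closedBall_zero_iff]
      simp only [N, c]
      rw [norm_mul, norm_mul, hexp, mul_one, Complex.norm_real, Complex.norm_real,
        Real.norm_of_nonneg hr.le, Real.norm_of_nonneg (by linarith [hx.2])]
      exact mul_le_of_le_one_left hr.le (by linarith [hx.1])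
    have e1 : rectArea Ω (polarDisc w (fun t => o + κ * t) r) 0 1 0 1 = planeArea W N 0 1 0 1 := by
      rw [hpolar, rectArea_comp Ω (fun x hx => (hwb _ (hrb (hNr x hx))).of_le (by norm_cast))
        (hN.of_le (by norm_num))]
      exact setIntegral_congr_fun (measurableSet_Icc.prod measurableSet_Icc) fun x hx => by
        simp only [hWD _ (hNr x hx)]
    have e2 := planeArea_eq (p := 0) (p' := 1) (t := 0) (t' := 1) hW.continuous hη zero_le_one
      zero_le_one (fun x _ => hN.contDiffAt)
    have e3 : pathInt η (fun b => N (1, b)) 0 1 = 0 := by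
      simp only [N, sub_self, Complex.ofReal_zero, zero_mul, pathInt_const]
    have e4 : pathInt η (fun b => N (0, b)) 0 1 = pathInt η c 0 (o + κ) - pathInt η c 0 o := by
      have := pathInt_comp_affine η (hc.differentiable (by norm_num)) κ o 0 1
      simp only [N, sub_zero, Complex.ofReal_one, one_mul]
      rw [this, mul_zero, add_zero, mul_one]
      exact (intervalIntegral.integral_interval_sub_left (hint _ _) (hint _ _)).symm
    have e5 : pathInt η (fun a => N (a, 0)) 0 1 = ray o := by simp only [N, ray, mul_zero, add_zero]
    have e6 : pathInt η (fun a => N (a, 1)) 0 1 = ray (o + κ) := by simp only [N, ray, mul_one]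
    rw [e1, e2, e3, e4, e5, e6]
    ring
  · have e1 : ray (t + 1) = ray t := by simp only [ray, hcper]
    have e2 := pathInt_periodic η hcper t
    have e3 : pathInt η c 0 t + pathInt η c t (t + 1) = pathInt η c 0 (t + 1) :=
      intervalIntegral.integral_add_adjacent_intervals (hint _ _) (hint _ _)
    simp only [e1]
    rw [← e3, e2, hcirc]
    ring

/-- The area density of a smooth disc is bounded. -/
theorem exists_mapDensity_le (Ω : SymplecticForm E M) {w : ℂ → M}
    (hw : ContMDiffOn 𝓘(ℝ, ℂ) 𝓘(ℝ, E) ∞ w (Metric.closedBall 0 1)) :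
    ∃ c, ∀ q ∈ Metric.ball (0 : ℂ) 1, |mapDensity Ω w q| ≤ c := by
  obtain ⟨c, hc⟩ := exists_forall_bound (ℓ := (pure () : Filter Unit)) (isCompact_closedBall (0 : ℂ) 1)
    (g := fun p : Unit × ℂ => (Metric.ball (0 : ℂ) 1).indicator (fun q => |mapDensity Ω w q|) p.2)
    (b := fun _ => 1) (fun _ => zero_le_one) (by
      intro q₀ hq₀
      let x₀ := w q₀
      have hx : w q₀ ∈ (chartAt E x₀).source := mem_chart_source E x₀
      obtain ⟨c, hc0, hc⟩ := exists_bound_disc hw hq₀ hx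
      have hB : ContinuousAt (fun x => formInChart Ω.form x₀ (chartAt E x₀ x)) (w q₀) :=
        ContinuousAt.comp (f := chartAt E x₀) ((Ω.smooth x₀).continuousOn.continuousAt
          ((chartAt E x₀).open_target.mem_nhds ((chartAt E x₀).map_source hx)))
          ((chartAt E x₀).continuousAt hx)
      obtain ⟨b, hb⟩ : ∃ b, ∀ᶠ x in 𝓝 (w q₀), ‖formInChart Ω.form x₀ (chartAt E x₀ x)‖ ≤ b :=
        ⟨_, (hB.norm.eventually_lt_const (lt_add_one _)).mono fun _ h => h.le⟩
      have hwc : Tendsto w (𝓝[Metric.ball 0 1] q₀) (𝓝 (w q₀)) :=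
        (hw q₀ hq₀).continuousWithinAt.mono Metric.ball_subset_closedBall
      refine ⟨max (b * c * c) 0, Eventually.prod_inr (p := fun q => (Metric.ball (0 : ℂ) 1).indicator
        (fun q => |mapDensity Ω w q|) q ≤ max (b * c * c) 0 * 1) ?_ _⟩
      -- The bound is needed only inside the open disc, so the indicator function is used to state
      -- it near boundary points.
      filter_upwards [eventually_nhdsWithin_iff.1 (hc.and (hwc.eventually hb))] with q hq
      rw [mul_one]
      by_cases hqb : q ∈ Metric.ball (0 : ℂ) 1
      · obtain ⟨⟨h1, h2, h3⟩, h4⟩ := hq hqb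
        rw [indicator_of_mem hqb, mapDensity, pullForm_eq Ω.form h1 (h2.mdifferentiableAt (by simp))]
        refine le_max_of_le_left ?_
        let B := formInChart Ω.form x₀ (chartAt E x₀ (w q))
        let T := fderiv ℝ (chartAt E x₀ ∘ w) q
        have h5 : ∀ a : ℂ, ‖a‖ = 1 → ‖T a‖ ≤ c := fun a ha => by
          have := T.le_opNorm a
          rw [ha, mul_one] at this
          exact this.trans h3
        have h6 : ‖B (T 1)‖ ≤ b * c := (B.le_opNorm _).trans
          (mul_le_mul h4 (h5 1 norm_one) (norm_nonneg _) ((norm_nonneg _).trans h4))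
        exact ((B (T 1)).le_opNorm _).trans
          (mul_le_mul h6 (h5 _ Complex.norm_I) (norm_nonneg _) ((norm_nonneg _).trans h6))
      · rw [indicator_of_notMem hqb]
        exact le_max_right _ _)
  refine ⟨c, fun q hq => ?_⟩
  have := hc q (Metric.ball_subset_closedBall hq)
  simpa only [indicator_of_mem hq, mul_one] using this

/-- The areas of concentric discs converge to the area of the disc. -/
theorem tendsto_discArea (Ω : SymplecticForm E M) {w : ℂ → M}
    (hw : ContMDiffOn 𝓘(ℝ, ℂ) 𝓘(ℝ, E) ∞ w (Metric.closedBall 0 1)) :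
    Tendsto (fun r => ∫ q in Metric.ball 0 r, mapDensity Ω w q) (𝓝[<] 1) (𝓝 (discArea Ω w)) := by
  obtain ⟨c, hc⟩ := exists_mapDensity_le Ω hw
  have hcont : ContinuousOn (mapDensity Ω w) (Metric.ball 0 1) := fun q hq =>
    (contDiffAt_mapDensity Ω (hw.contMDiffAt (Filter.mem_of_superset (Metric.isOpen_ball.mem_nhds hq)
      Metric.ball_subset_closedBall))).continuousAt.continuousWithinAt
  have hdisc : discArea Ω w = ∫ q in Metric.ball (0 : ℂ) 1, mapDensity Ω w q := rfl
  have hmeas : ∀ r : ℝ, MeasurableSet (Metric.ball (0 : ℂ) r) := fun r => Metric.isOpen_ball.measurableSet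
  rw [hdisc, ← integral_indicator (hmeas 1)]
  have hball : ∀ r : ℝ, ∫ q in Metric.ball (0 : ℂ) r, mapDensity Ω w q =
    ∫ q, (Metric.ball (0 : ℂ) r).indicator (mapDensity Ω w) q := fun r => (integral_indicator (hmeas r)).symm
  simp only [hball]
  refine tendsto_integral_filter_of_dominated_convergence
    ((Metric.ball (0 : ℂ) 1).indicator fun _ => c) ?_ ?_ ?_ ?_
  · filter_upwards [self_mem_nhdsWithin] with r hr
    rw [aestronglyMeasurable_indicator_iff (hmeas r)]
    exact (hcont.mono (Metric.ball_subset_ball (le_of_lt hr))).aestronglyMeasurable (hmeas r)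
  · filter_upwards [self_mem_nhdsWithin] with r hr
    refine Eventually.of_forall fun q => ?_
    by_cases hq : q ∈ Metric.ball (0 : ℂ) 1
    · rw [indicator_of_mem hq]
      exact (norm_indicator_le_norm_self _ _).trans (hc q hq)
    · rw [indicator_of_notMem hq, indicator_of_notMem fun h => hq (Metric.ball_subset_ball (le_of_lt hr) h),
        norm_zero]
  · rw [integrable_indicator_iff (hmeas 1)]
    exact integrableOn_const (measure_ball_lt_top.ne)
  · refine Eventually.of_forall fun q => ?_
    by_cases hq : q ∈ Metric.ball (0 : ℂ) 1
    · refine tendsto_const_nhds.congr' ?_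
      have : ‖q‖ < 1 := mem_ball_zero_iff.1 hq
      filter_upwards [eventually_nhdsWithin_of_eventually_nhds (eventually_gt_nhds this)] with r hr
      rw [indicator_of_mem hq, indicator_of_mem (mem_ball_zero_iff.2 hr)]
    · refine tendsto_const_nhds.congr' ?_
      filter_upwards [self_mem_nhdsWithin] with r hr
      rw [indicator_of_notMem hq, indicator_of_notMem fun h => hq (Metric.ball_subset_ball (le_of_lt hr) h)]

end Caps

/-! ### The action inequality -/

section ActionInequality

variable {E : Type*} [NormedAddCommGroup E] [NormedSpace ℝ E] [FiniteDimensional ℝ E]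
variable {M : Type} [TopologicalSpace M] [ChartedSpace E M] [IsManifold 𝓘(ℝ, E) ∞ M]
variable {Ω : SymplecticForm E M} {C : CylindricalEnds} {R₁ R₂ : Fin 3 → ℝ} {ρ : Fin 3 → ℝ → ℝ}
  {H : Fin 3 → ℝ → M → ℝ}
  {J₀ : ∀ x : M, TangentSpace 𝓘(ℝ, E) x →L[ℝ] TangentSpace 𝓘(ℝ, E) x}
  {J : Fin 3 → ℝ → ℝ → ∀ x : M, TangentSpace 𝓘(ℝ, E) x →L[ℝ] TangentSpace 𝓘(ℝ, E) x}
  {Jt : ℂ → ∀ x : M, (ℂ × TangentSpace 𝓘(ℝ, E) x) →L[ℝ] (ℂ × TangentSpace 𝓘(ℝ, E) x)}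
  {z : Fin 3 → ℝ → M} {w : Fin 3 → ℂ → M} {u : ℂ → M}
  {ι : Type*} {V : ι → Set M} {pot : ι → M → E →L[ℝ] ℝ} {f : M → M → M → ℝ} {I : ι → M → M → ℝ}

theorem polarDisc_zero (w : ℂ → M) (α : ℝ → ℝ) (r t : ℝ) :
    polarDisc w α r (0, t) = w (r * Complex.exp (2 * Real.pi * (α t) * Complex.I)) := by
  simp [polarDisc]

variable (C w u I z) in
/-- The boundary contribution of a neck at an angle. -/
def neckTerm (b : M → ι) (i : Fin 3) (x : ℝ × ℝ) (θ : ℝ) : ℝ :=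
  I (b (z i θ)) (u (C.point i x.1 θ)) (w i (x.2 * Complex.exp (2 * Real.pi * θ * Complex.I)))

theorem neckTerm_add_one (b : M → ι) (i : Fin 3) {x : ℝ × ℝ} (hx : 0 < x.1)
    (hz : ∀ t, z i (t + 1) = z i t) (θ : ℝ) :
    neckTerm C z w u I b i x (θ + 1) = neckTerm C z w u I b i x θ := by
  have := exp_two_pi_add_int θ 1
  rw [Int.cast_one] at this
  rw [neckTerm, neckTerm, this, C.point_eq_of_add_one i hx rfl, hz]

theorem sectorRate_mem (e : Fin 4) : 0 < sectorRate e ∧ sectorRate e ≤ 1 := by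
  fin_cases e <;> norm_num [sectorRate]

/-- The contributions of the necks converge. -/
theorem IsHolomorphicSection.tendsto_neck (hP : LocalPotentials Ω V pot f I)
    (hρ : ∀ i, IsCutOff (R₁ i) (R₂ i) (ρ i))
    (hH : ∀ i, IsPeriodicHamiltonian E (H i)) (hJ : ∀ i, IsACSPath Ω J₀ (J i))
    (hJt : IsHCompatible Ω C R₁ ρ H J₀ J Jt) (hu : IsHolomorphicSection Jt u)
    (hz : IsAsymptotic C z u) (hzw : ∀ i, IsCappedOrbit Ω (H i) (z i) (w i))
    {ℓ : Filter ℝ} (hℓ : ℓ ≤ atTop) (hlow : ∀ᶠ s in ℓ, IsLowEnergy Ω C ρ J u s)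
    (o : Fin 3 → ℝ) (e : Fin 4) {m : ℕ} (hm : m ≠ 0) {v : ℕ → ι}
    (hv : ∀ J < m, ∀ t ∈ Icc (unif m J) (unif m (J + 1)),
      z (sectorEnd e) (sectorAngle o e t) ∈ V (v J)) {b : M → ι} (hb : ∀ x, x ∈ V (b x)) :
    Tendsto (fun x : ℝ × ℝ => stripValue pot I v m
        (fun t => u (C.point (sectorEnd e) x.1 (sectorAngle o e t)))
        (fun t => polarDisc (w (sectorEnd e)) (sectorAngle o e) x.2 (0, t))
      - (neckTerm C z w u I b (sectorEnd e) x (sectorAngle o e 0)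
        - neckTerm C z w u I b (sectorEnd e) x (sectorAngle o e 1))) (ℓ ×ˢ 𝓝[<] 1) (𝓝 0) := by
  have hrate := sectorRate_mem e
  have hunif : ∀ J < m, 0 ≤ unif m J ∧ unif m (J + 1) ≤ 1 := fun J hJ => by
    have h := Icc_unif_subset hJ
    exact ⟨(h (left_mem_Icc.2 (unif_le m J))).1, (h (right_mem_Icc.2 (unif_le m J))).2⟩
  have hcap := hzw (sectorEnd e)
  have key := hP.tendsto_stripValue (ℓ := ℓ ×ˢ 𝓝[<] (1 : ℝ))
    (U := fun x t => u (C.point (sectorEnd e) x.1 (sectorAngle o e t)))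
    (W := fun x t => polarDisc (w (sectorEnd e)) (sectorAngle o e) x.2 (0, t))
    (z := fun t => z (sectorEnd e) (sectorAngle o e t)) hm hb hv
    (fun k hk => (hu.tendsto_lineInt hρ hH hJ hJt hz (sectorEnd e) hcap.smooth_orbit hℓ hlow
      (hP.potential (v k)) (hP.isOpen (v k)) (o := sectorOffset o e) hrate.1 hrate.2 (hunif k hk).1
      (unif_le m k) (hunif k hk).2 (hv k hk)).comp tendsto_fst)
    (fun k hk => (tendsto_lineInt_disc hcap.smooth_disc hcap.smooth_orbit hcap.boundary
      (hP.potential (v k)) (hP.isOpen (v k)) (o := sectorOffset o e) (κ := sectorRate e)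
      (unif_le m k) (hv k hk)).comp tendsto_snd)
    (fun t => (hz (sectorEnd e) (sectorAngle o e t)).comp
      ((tendsto_fst.mono_right hℓ).prodMk (tendsto_const_nhds (x := sectorAngle o e t)))) (fun t => by
        simp only [polarDisc_zero, ← hcap.boundary]
        have h1 : ContinuousWithinAt (w (sectorEnd e)) (Metric.closedBall 0 1)
            (Complex.exp (2 * Real.pi * (sectorAngle o e t) * Complex.I)) := by
          refine (hcap.smooth_disc _ ?_).continuousWithinAt
          have := Complex.norm_exp_ofReal_mul_I (2 * Real.pi * sectorAngle o e t)
          push_cast at this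
          rw [mem_closedBall_zero_iff, this]
        refine h1.tendsto.comp (tendsto_nhdsWithin_iff.2 ⟨?_, ?_⟩)
        · have h2 : Continuous fun r : ℝ =>
              (r : ℂ) * Complex.exp (2 * Real.pi * (sectorAngle o e t) * Complex.I) := by fun_prop
          have h3 := h2.tendsto 1
          rw [Complex.ofReal_one, one_mul] at h3
          exact h3.comp (tendsto_nhds_of_tendsto_nhdsWithin tendsto_snd)
        · have hr : ∀ᶠ r : ℝ in 𝓝[<] 1, 0 < r ∧ r < 1 :=
            (eventually_nhdsWithin_of_eventually_nhds (eventually_gt_nhds one_pos)).and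
              self_mem_nhdsWithin
          filter_upwards [tendsto_snd.eventually hr] with x hx
          have := Complex.norm_exp_ofReal_mul_I (2 * Real.pi * sectorAngle o e t)
          push_cast at this
          rw [mem_closedBall_zero_iff, norm_mul, this, mul_one, Complex.norm_real,
            Real.norm_of_nonneg hx.1.le]
          exact hx.2.le)
  simpa only [neckTerm, polarDisc_zero] using key

/-- The areas of the caps. -/
theorem sum_rectArea_polarDisc (Ω : SymplecticForm E M) (o : Fin 3 → ℝ)
    (hw : ∀ i, ContMDiffOn 𝓘(ℝ, ℂ) 𝓘(ℝ, E) ∞ (w i) (Metric.closedBall 0 1)) {r : ℝ} (hr : 0 < r)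
    (hr1 : r < 1) :
    -rectArea Ω (polarDisc (w (sectorEnd 0)) (sectorAngle o 0) r) 0 1 0 1
      - rectArea Ω (polarDisc (w (sectorEnd 1)) (sectorAngle o 1) r) 0 1 0 1
      + rectArea Ω (polarDisc (w (sectorEnd 2)) (sectorAngle o 2) r) 0 1 0 1
      + rectArea Ω (polarDisc (w (sectorEnd 3)) (sectorAngle o 3) r) 0 1 0 1 =
      (∫ q in Metric.ball 0 r, mapDensity Ω (w 0) q) + (∫ q in Metric.ball 0 r, mapDensity Ω (w 1) q)
        - ∫ q in Metric.ball 0 r, mapDensity Ω (w 2) q := by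
  choose Φ h1 h2 using fun i => exists_rectArea_polarDisc Ω (hw i) hr hr1
  have key : ∀ e, rectArea Ω (polarDisc (w (sectorEnd e)) (sectorAngle o e) r) 0 1 0 1 =
      Φ (sectorEnd e) (sectorOffset o e) - Φ (sectorEnd e) (sectorOffset o e + sectorRate e) :=
    fun e => h1 (sectorEnd e) (sectorOffset o e) (sectorRate e)
  rw [key, key, key, key]
  have e0 := h2 0 (o 0)
  have e1 := h2 1 (o 1)
  have e2 := h2 2 (o 2)
  have e3 : o 2 + 1 / 2 + 1 / 2 = o 2 + 1 := by ring
  change -(Φ 0 (o 0) - Φ 0 (o 0 + 1)) - (Φ 1 (o 1) - Φ 1 (o 1 + 1))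
    + (Φ 2 (o 2) - Φ 2 (o 2 + 1 / 2)) + (Φ 2 (o 2 + 1 / 2) - Φ 2 (o 2 + 1 / 2 + 1 / 2)) = _
  rw [e3]
  linarith

/-- The action inequality for a section over the pair of pants. -/
theorem IsPantsSection.action_inequality [CompactSpace M] [T2Space M]
    (hρ : ∀ i, IsCutOff (R₁ i) (R₂ i) (ρ i)) (hH : ∀ i, IsPeriodicHamiltonian E (H i))
    (hJ₀ : IsCompatible Ω J₀) (hJ : ∀ i, IsACSPath Ω J₀ (J i))
    (hJt : IsHCompatible Ω C R₁ ρ H J₀ J Jt) (hzw : ∀ i, IsCappedOrbit Ω (H i) (z i) (w i))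
    (hu : IsPantsSection Ω C ρ J Jt z w u) :
    action Ω (H 2) (z 2) (w 2) - (EPlus (H 0) + EPlus (H 1)) - EMinus (H 2) ≤
      action Ω (H 0) (z 0) (w 0) + action Ω (H 1) (z 1) (w 1) := by
  -- The arcs of the orbits, and the members of the cover that contain them, are fixed once; only
  -- the depth of the loops and the radius of the caps vary.
  obtain ⟨V, pot, f, I, hP⟩ := exists_localPotentials Ω
  choose b hb using hP.cover
  obtain ⟨S, hS, hS0⟩ := hu.null
  obtain ⟨o, hdeep, ho⟩ := C.exists_isDeep
  have hus := hu.toIsHolomorphicSection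
  have hzc : ∀ i, Continuous (z i) := fun i => (hzw i).smooth_orbit.continuous
  have harcs : ∀ e, ∀ᶠ m : ℕ in atTop, ∀ J < m, ∃ v, ∀ t ∈ Icc (unif m J) (unif m (J + 1)),
      z (sectorEnd e) (sectorAngle o e t) ∈ V v := fun e => by
    have := eventually_isSmallRect hP.isOpen hP.cover
      (G := fun x : ℝ × ℝ => z (sectorEnd e) (sectorAngle o e x.2))
      ((hzc _).comp ((continuous_sectorAngle o e).comp continuous_snd)).continuousOn
    filter_upwards [this, eventually_gt_atTop 0] with m hm hm0 J hJ
    obtain ⟨v, hv⟩ := hm 0 hm0 J hJ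
    exact ⟨v, fun t ht => hv _ (left_mem_Icc.2 (unif_le m 0)) t ht⟩
  obtain ⟨m, hm, hm0⟩ := ((eventually_all.2 harcs).and (eventually_ne_atTop 0)).exists
  have hx₀ : Nonempty M := ⟨u 0⟩
  choose! v hv using hm
  -- Depths go to infinity through levels of low energy, which form a nontrivial filter.
  let ℓ : Filter ℝ := atTop ⊓ 𝓟 {s | IsLowEnergy Ω C ρ J u s}
  have hne : ℓ.NeBot := frequently_mem_iff_neBot.1 hu.finite_energy.frequently
  have hℓ : ℓ ≤ atTop := inf_le_left
  have hlow : ∀ᶠ s in ℓ, IsLowEnergy Ω C ρ J u s := mem_inf_of_right (mem_principal_self _)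
  let N : Fin 4 → ℝ × ℝ → ℝ := fun e x => stripValue pot I (v e) m
    (fun t => u (C.point (sectorEnd e) x.1 (sectorAngle o e t)))
    (fun t => polarDisc (w (sectorEnd e)) (sectorAngle o e) x.2 (0, t))
  let T : Fin 4 → ℝ × ℝ → ℝ → ℝ := fun e x t =>
    neckTerm C z w u I b (sectorEnd e) x (sectorAngle o e t)
  have hN : ∀ e, Tendsto (fun x => N e x - (T e x 0 - T e x 1)) (ℓ ×ˢ 𝓝[<] 1) (𝓝 0) := fun e =>
    hus.tendsto_neck hP hρ hH hJ hJt hu.asymptotic hzw hℓ hlow o e hm0 (hv e) hb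
  have hneck : ∀ e, ∀ᶠ x : ℝ × ℝ in ℓ ×ˢ 𝓝[<] 1, ∀ J < m, ∀ p ∈ Icc (0 : ℝ) 1,
      ∀ t ∈ Icc (unif m J) (unif m (J + 1)),
        S (C.point (sectorEnd e) ((1 - p) * (2 - 1 / x.1) + p * (2 / x.2)) (sectorAngle o e t)) ∈
          V (v e J) := fun e => by
    refine (Set.finite_Iio m).eventually_all.2 fun J hJ => ?_
    exact (hS.eventually_neck_mem (sectorEnd e) (hzw _).boundary (hP.isOpen _)
      (continuous_sectorAngle o e) (hv e J hJ)).filter_mono (Filter.prod_mono_left _ hℓ)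
  have hham := fun i => ((hus.tendsto_integral_ham hH hu.asymptotic i (hzc i)).mono_left hℓ).comp
    (tendsto_fst (f := ℓ) (g := 𝓝[<] (1 : ℝ)))
  have hdisc := fun i => (tendsto_discArea Ω (hzw i).smooth_disc).comp
    (tendsto_snd (f := ℓ) (g := 𝓝[<] (1 : ℝ)))
  have hlhs := ((((hham 0).add (hham 1)).sub (hham 2)).sub_const
    (EPlus (H 0) + EPlus (H 1))).sub_const (EMinus (H 2))
  have hrhs := ((((hdisc 2).sub (hdisc 0)).sub (hdisc 1)).add
    ((((hN 0).add (hN 1)).sub (hN 2)).sub (hN 3)))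
  have hev : ∀ᶠ x : ℝ × ℝ in ℓ ×ˢ 𝓝[<] 1, C.IsDeep o x.1 ∧ (∀ i, R₂ i ≤ x.1) ∧ 0 < x.2 ∧ x.2 < 1 := by
    have h1 : ∀ᶠ s in ℓ, C.IsDeep o s ∧ ∀ i, R₂ i ≤ s :=
      hℓ (hdeep.and (eventually_all.2 fun i => eventually_ge_atTop (R₂ i)))
    have h2 : ∀ᶠ r : ℝ in 𝓝[<] 1, 0 < r ∧ r < 1 :=
      (eventually_nhdsWithin_of_eventually_nhds (eventually_gt_nhds one_pos)).and self_mem_nhdsWithin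
    filter_upwards [tendsto_fst.eventually h1, tendsto_snd.eventually h2] with x hx hx'
    exact ⟨hx.1, hx.2, hx'⟩
  -- For each depth and radius the energy inequality bounds the area of the annuli from below, and
  -- the vanishing on the torsion sphere expresses that area by caps and necks.
  have hle := le_of_tendsto_of_tendsto hlhs hrhs (by
    filter_upwards [hev, eventually_all.2 hneck] with x hx hxn
    obtain ⟨hd, hR, hr, hr1⟩ := hx
    have hx0 : 0 < x.1 := zero_lt_one.trans hd.one_lt
    have henergy := hus.energy_inequality hρ hH hJ₀ hJ hJt hd ho hR
    have hw := fun i => (hzw i).smooth_disc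
    have hsphere := hP.sectors_eq_zero hS hS0 (fun e => hd.sectorData hr e)
      (fun e => hd.isSmooth hr hr1 e hus.smooth hw) hm0 (v := v)
      (fun e J hJ p hp t ht => by
        have h01 := Icc_unif_subset hJ ht
        simp only [SectorData.sector, ContinuousMap.coe_mk, clamp_eq hp, clamp_eq h01]
        exact hxn e J hJ p hp t ht)
      (hd.meets_zero hr) (hd.meets_one hr) (hd.meets_two_three hr) (hd.meets_two_three_symm hr)
      (C.sectorHomotopy_zero_two o x.1) (C.sectorHomotopy_one_three o x.1)
    have hNe : ∀ e, (hd.sectorData hr e).neckValue pot I w u (v e) m = N e x := fun e => by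
      have : (fun t => (hd.sectorData hr e).annulus u (1, t)) =
          fun t => u (C.point (sectorEnd e) x.1 (sectorAngle o e t)) :=
        funext fun t => congrArg u (C.sectorHomotopy_one o x.1 e t)
      rw [SectorData.neckValue, this]
      rfl
    have hAe : ∀ e, (hd.sectorData hr e).area Ω w u =
        rectArea Ω (fun y => u (C.sectorHomotopy o x.1 e y)) 0 1 0 1
          + rectArea Ω (polarDisc (w (sectorEnd e)) (sectorAngle o e) x.2) 0 1 0 1 := fun e => rfl
    have hcaps := sum_rectArea_polarDisc Ω o hw hr hr1
    simp only [hNe, hAe] at hsphere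
    -- The boundary terms of the necks cancel around each end: sectors `0` and `1` close up after a
    -- full turn, while `2` and `3` pass into each other.
    have hper := fun i θ => neckTerm_add_one (C := C) (w := w) (u := u) (I := I) b i hx0 (hzw i).periodic θ
    have t0 : T 0 x 1 = T 0 x 0 := by
      simp only [T, sectorAngle, mul_one, mul_zero, add_zero]
      exact hper 0 (o 0)
    have t1 : T 1 x 1 = T 1 x 0 := by
      simp only [T, sectorAngle, mul_one, mul_zero, add_zero]
      exact hper 1 (o 1)
    have t2 : T 2 x 1 = T 3 x 0 := by
      simp only [T, sectorAngle, mul_one, mul_zero, add_zero]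
      rfl
    have t3 : T 3 x 1 = T 2 x 0 := by
      have e3 : o 2 + 1 / 2 + 1 / 2 = o 2 + 1 := by ring
      simp only [T, sectorAngle, mul_one, mul_zero, add_zero]
      change neckTerm C z w u I b 2 x (o 2 + 1 / 2 + 1 / 2) = neckTerm C z w u I b 2 x (o 2)
      rw [e3]
      exact hper 2 (o 2)
    simp only [Function.comp_apply]
    linarith)
  simp only [action]
  linarith

end ActionInequality

end PantsFloer

end

theorem corollary4p4
    {E : Type*} [NormedAddCommGroup E] [NormedSpace ℝ E] [FiniteDimensional ℝ E]
    {M : Type} [TopologicalSpace M] [ChartedSpace E M] [IsManifold 𝓘(ℝ, E) ∞ M]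
    [CompactSpace M] [T2Space M]
    (Ω : PantsFloer.SymplecticForm E M)
    (C : PantsFloer.CylindricalEnds)
    (R₁ R₂ : Fin 3 → ℝ) (ρ : Fin 3 → ℝ → ℝ)
    (hρ : ∀ i, PantsFloer.IsCutOff (R₁ i) (R₂ i) (ρ i))
    (H : Fin 3 → ℝ → M → ℝ)
    (hH : ∀ i, PantsFloer.IsPeriodicHamiltonian E (H i))
    (J₀ : ∀ x : M, TangentSpace 𝓘(ℝ, E) x →L[ℝ] TangentSpace 𝓘(ℝ, E) x)
    (hJ₀ : PantsFloer.IsCompatibleACS Ω J₀)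
    (J : Fin 3 → ℝ → ℝ → ∀ x : M, TangentSpace 𝓘(ℝ, E) x →L[ℝ] TangentSpace 𝓘(ℝ, E) x)
    (hJ : ∀ i, PantsFloer.IsACSPath Ω J₀ (J i))
    (Jt : ℂ → ∀ x : M, (ℂ × TangentSpace 𝓘(ℝ, E) x) →L[ℝ] (ℂ × TangentSpace 𝓘(ℝ, E) x))
    (hJt : PantsFloer.IsHCompatible Ω C R₁ ρ H J₀ J Jt)
    (z : Fin 3 → ℝ → M) (w : Fin 3 → ℂ → M)
    (hzw : ∀ i, PantsFloer.IsCappedOrbit Ω (H i) (z i) (w i))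
    (u : ℂ → M) (hu : PantsFloer.IsPantsSection Ω C ρ J Jt z w u)
    (c : ℝ) (hc : c ≤ PantsFloer.action Ω (H 2) (z 2) (w 2)) :
    PantsFloer.action Ω (H 0) (z 0) (w 0) + PantsFloer.action Ω (H 1) (z 1) (w 1) ≥
      c - (PantsFloer.EPlus (H 0) + PantsFloer.EPlus (H 1)) - PantsFloer.EMinus (H 2) := by
  have h := hu.action_inequality hρ hH hJ₀.toIsCompatible hJ hJt hzw
  linarith
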